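/- **Setting.** Let $X\subset \mathrm{Hilb}^2(\mathbb C^2)$ be the fiber over $0$ of $\mathrm{Hilb}^2(\mathbb C^2)\to\mathrm{Sym}^2(\mathbb C^2)\xrightarrow{\;+\;}\mathbb C^2$, with the tori $H=\mathbb C^\times_a$ acting by $(x,y)\mapsto(ax,a^{-1}y)$, $\mathbb S=\mathbb C^\times_v$ acting by $(x,y)\mapsto(v^{-1}x,v^{-1}y)$, and the Kähler torus $K=\mathbb C^\times_z$. The $H$-fixed points are $[2]$ and $[1,1]$, and classes are identified with their restrictions to these points, $\otimes$ being componentwise multiplication. For $r\in\mathbb Q$ put $\mathcal O(r)=\big((v^2a^{-1})^{r},(v^2a)^{r}\big)$ (restrictions to $[2]$, $[1,1]$), and $\sqrt{\mathcal L(-\kappa)}=a^{-3/2}\mathcal O(-\tfrac12)$. Multi-valued functions on $H\times K\times\mathbb S\times\mathfrak D^\circ$, $\mathfrak D^\circ=\{0<|q|<1\}$, are functions on the universal cover; $\widetilde{\mathfrak D^\circ}$ is the double cover of $\mathfrak D^\circ$. The operator $\delta_z^{t}$ ($t\in\mathbb R$, $\delta_z=\delta_z^1$) replaces $z$ by $q^{t}z$.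 Let $\vartheta(x)=(x^{1/2}-x^{-1/2})\prod_{m\ge1}(1-q^mx)(1-q^mx^{-1})$, $(q;q)_\infty=\prod_{m\ge1}(1-q^m)$, and $$\mathrm{Stab}^{ell}_{\mathfrak X}=\begin{pmatrix}\vartheta(a^{-2})\vartheta(v^{-2}z^{-2})&\dfrac{\vartheta(v^{-2})\left(\vartheta(a^{-2})\vartheta(vz^2a^{-1})\vartheta(v^{-1}z)+\vartheta(v^{-1}a^{-1})\vartheta(vza^{-2})\vartheta(z^{-2})\right)}{\vartheta(v^{-1}a)\vartheta(vz)}\\0&\vartheta(v^{-2}a^{-2})\vartheta(z^{-2})\end{pmatrix},$$ the matrix of the elliptic stable basis (rows: restriction to $[2]$, $[1,1]$; columns: $\mathrm{Stab}^{ell}_{\mathfrak X}([2])$, $\mathrm{Stab}^{ell}_{\mathfrak X}([1,1])$). The opposite basis $\mathrm{Stab}^{ell}_{-\mathfrak X}$ is obtained from it by exchanging the two fixed points in rows and columns and substituting $a\mapsto a^{-1}$. **$K$-theoretic canonical bases.** For a slope $s\in\mathbb R$ let $$\mathrm{Stab}^K_{\pm\mathfrak X,s}(p)=-v^{-1/2}\lim_{q\to0}\delta_z^{-s}\Big(\sqrt{\mathcal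 L(-\kappa)}\otimes \mathrm{Stab}^{ell}_{\pm\mathfrak X}(p)/\vartheta(n^{\pm}_p)\Big),$$ where $n^+_{[2]}=n^-_{[1,1]}=v^{-1}z^{-2}$ and $n^+_{[1,1]}=n^-_{[2]}=vz^{-2}$, and let $\beta^K_s$ be the map, semilinear for $v\mapsto v^{-1}$, with $\beta^K_s(\mathrm{Stab}^K_{\mathfrak X,s}(p))=-v\,\mathrm{Stab}^K_{-\mathfrak X,s}(p)$. For $s\notin\frac12\mathbb Z$ the canonical basis $\{\mathcal E^K_s(p)\}$ at slope $s$ is the $\mathbb Z[a^{\pm1},v^{\pm1}]$-basis of $K_{H\times\mathbb S}(X)$, consisting of $\beta^K_s$-invariant elements, such that the coefficients $f_{p,p'}(v,a)$ in $\mathcal E^K_s(p)=\sum_{p'}f_{p,p'}(v,a)\,\mathrm{Stab}^K_{\mathfrak X,s}(p')$ tend to $\delta_{p,p'}$ as $v\to\infty$. Here $K_{H\times\mathbb S}(X)$ is the set of pairs in $\mathbb Z[a^{\pm1},v^{\pm1}]^2$ congruent modulo $1-a^2$. Put $\mathbb B_s=\{a^i\mathcal E^K_s(p)\}$. For arbitrary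 $s$, write $s_\pm=s\pm\varepsilon$ with $\varepsilon>0$ small; $\mathcal E^K_s(p)$ is the $\beta_s^K$-invariant element of the form $\sum_{\beta=0}^{N}z^{-\beta}\mathcal F_\beta$ ($N\ge0$ depending on $p$) with $\mathcal F_0=\mathcal E^K_{s_+}(p)$, $\mathcal F_N=\pm\mathbf{wc}_s(\mathcal E^K_{s_+}(p))$, where $\mathbf{wc}_s:\mathbb B_{s_+}\to\mathbb B_{s_-}$ is a bijection commuting with multiplication by $a$; for $0<\beta<N$, $\mathcal F_\beta\in\big(\sum_{\mathcal E\in\mathbb B_{s_+}}v^{-1}\mathbb Z[v^{-1}]\mathcal E\big)\cap\big(\sum_{\mathcal E\in\mathbb B_{s_-}}v\mathbb Z[v]\mathcal E\big)$, and $\mathcal F_\beta=0$ unless $s\beta\in\mathbb Z$; and $\mathbf{wc}_s(\mathcal E^K_{s_+}(p))\in\sum_{\mathcal E\in\mathbb B_{s_+}}v^{-1}\mathbb Z[v^{-1}]\mathcal E$ if $N\ne0$. Let $\sim$ be the equivalence relation generated by $\mathcal E\sim\mathbf{wc}_s(\mathcal E)$ (all $s$) and $\mathcal E\sim a^i\mathcal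 E$. For $\mu\in\{[2],[1,1]\}$ let $[\mathcal E^K_s(\mu)]$ be the set of all $\pm a^iz^j\mathcal E^K_s(p)$, $i,j\in\mathbb Z$, with $p$ such that $\mathcal E^K_{s_+}(p)\sim\mathcal E^K_{\varepsilon}(\mu)$ for small $\varepsilon>0$. **Conditions.** Let $\mathcal E(\mu)=(\mathcal E(\mu)|_{[2]},\mathcal E(\mu)|_{[1,1]})$, $\mu\in\{[2],[1,1]\}$, be pairs of multi-valued functions of $(a,z,v;q)$, and let $\Upsilon(v;q)$ be a multi-valued function. Consider: 1. $\delta_z\mathcal E([2])=-q^{-3/2}z^{-3}\mathcal O(-1)\otimes\mathcal E([2])$ and $\delta_z\mathcal E([1,1])=-q^{-1/2}z^{-1}\mathcal O(-1)\otimes\mathcal E([1,1])$. 2. For each $q$, $z^{-1/2}\mathcal O(-\frac12)\otimes\mathcal E(\mu)$ is single-valued and holomorphic on $H\times K\times\mathbb S$. 3. For every $0<s<\frac12$ there are real $r_{[2]}(s),r_{[1,1]}(s)$ with $\lim_{q\to0}q^{-r_{[2]}(s)}\delta_z^{-s}\mathcal E([2])=vz^{1/2}\mathcal O(-\frac12)$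 and $\lim_{q\to0}q^{-r_{[1,1]}(s)}\delta_z^{-s}\mathcal E([1,1])=z^{1/2}\mathcal O(\frac12)$. 4. $\Upsilon$ is holomorphic and $\Upsilon\cdot\mathrm{Stab}^{ell}_{\mathfrak X}=\mathcal E\cdot{}^t\mathcal E^!$ as meromorphic functions, where $$\mathcal E=\begin{pmatrix}\mathcal E([2])|_{[2]}&\mathcal E([1,1])|_{[2]}\\ \mathcal E([2])|_{[1,1]}&\mathcal E([1,1])|_{[1,1]}\end{pmatrix},\qquad \mathcal E^!=\begin{pmatrix}\mathcal E([1,1])|_{[1,1]}&\mathcal E([2])|_{[1,1]}\\ \mathcal E([1,1])|_{[2]}&\mathcal E([2])|_{[2]}\end{pmatrix}\Bigg|_{a\leftrightarrow z}.$$ 5. (Property A) For each $\mu$ there are $\alpha,\beta,r\in\mathbb Q$ such that $q^{-r}a^{-\alpha}z^{-\beta}\sqrt{\mathcal L(-\kappa)}\otimes\mathcal E(\mu)$ is single-valued and holomorphic on $H\times K\times\mathbb S\times\widetilde{\mathfrak D^\circ}$, and for every $s\in\mathbb R$ there is $r(s)\in\mathbb R$ with $\lim_{q\to0}q^{-r(s)}a^{-\alpha}z^{-\beta}\sqrt{\mathcal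 L(-\kappa)}\otimes\delta_z^{-s}\mathcal E(\mu)\in[\mathcal E^K_s(\mu)]$. **Theorem 4.1.** Conditions 1–5 hold if and only if there exist (possibly multi-valued) holomorphic functions $f_0,f_1,f_2$ of $(v;q)$ and $c_0,c_1,c_2\in\mathbb Q$ with $c_2\ge c_1+\frac34$ and $c_2-c_1+\frac14\in\frac12\mathbb Z$, such that $q^{-c_i}f_i(v;q)$ is single-valued on $\mathbb S\times\widetilde{\mathfrak D^\circ}$, as $q\to0$ (for each $v$) $$f_0=q^{c_0}\big(1+O(q^{1/2})\big),\qquad f_1=q^{c_1}\big(1+O(q^{1/2})\big),\qquad f_2=q^{c_2}\cdot O(1),$$ and $$\begin{aligned}\mathcal E([2])={}&f_1\sum_{l,m\in\mathbb Z}(-1)^mq^{l^2+\frac12(m+\frac12)^2}v^{-2l+2m+1}z^{2l+m+\frac12}\mathcal O(2l-m-\tfrac12)\\&+f_2\sum_{l,m\in\mathbb Z}(-1)^mq^{(l+\frac12)^2+\frac12(m+\frac12)^2}v^{-2l+2m}z^{2l+m+\frac32}\mathcal O(2l-m+\tfrac12),\\ \mathcal E([1,1])={}&f_0\sum_{m\in\mathbb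 Z}(-1)^mq^{\frac12(m+\frac12)^2}z^{m+\frac12}\mathcal O(m+\tfrac12),\\ \Upsilon={}&q^{\frac14}(q;q)_\infty^2\,f_0\Big(f_1\sum_{m\in\mathbb Z}q^{m^2}v^{2m}+f_2\sum_{m\in\mathbb Z}q^{(m+\frac12)^2}v^{2m+1}\Big).\end{aligned}$$ -/

import Mathlib

open Filter Topology Complex

noncomputable section

namespace EllipticCanonical

/-! ## Coordinates

The two torus-fixed points `[2]`, `[1,1]` of `X` are `0, 1 : Fin 2`; the labels `μ` of the elliptic
canonical basis are written in the same way.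

A multi-valued function on `H × K × S × 𝔇°` is a function on the universal cover: a point of
`H × K × S` is given by logarithms `x = (log a, log z, log v)`, and a point of the punctured disk
`0 < |q| < 1` by `τ = log q` with `re τ < 0`.  Thus `q ^ r = exp (r * τ)` and so on. -/

/-- The universal cover of `H × K × S`; a point is `(log a, log z, log v)`. -/
abbrev Cover : Type := ℂ × ℂ × ℂ

/-- Multi-valued functions of `(a, z, v; q)`; only the values at `re τ < 0` are meaningful. -/
abbrev MultiFun : Type := Cover → ℂ → ℂ

/-- Fixed-point restrictions of an element of localized equivariant `K`-theory, as functions of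
`(log a, log z, log v)`. -/
abbrev Vec : Type := Fin 2 → Cover → ℂ

/-- `q → 0` on the universal cover of the punctured disk. -/
def qToZero : Filter ℂ := comap re atBot

/-- `z ↦ exp c * z`; with `c = t * τ` this is the shift `z ↦ q ^ t * z`. -/
def shiftZ (c : ℂ) (x : Cover) : Cover := (x.1, x.2.1 + c, x.2.2)

/-- `a ↔ z`. -/
def swapAZ (x : Cover) : Cover := (x.2.1, x.1, x.2.2)

/-- `a ↦ a⁻¹`. -/
def invA (x : Cover) : Cover := (-x.1, x.2.1, x.2.2)

/-- `v ↦ v⁻¹`. -/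
def invV (x : Cover) : Cover := (x.1, x.2.1, -x.2.2)

/-- The sign `ε_p`: `ε_[2] = 1`, `ε_[1,1] = -1`. -/
def eps : Fin 2 → ℂ := ![1, -1]

/-- The restriction of `𝒪(r)` to the fixed point `p`, where `𝒪(1)|_[2] = v² a⁻¹` and
`𝒪(1)|_[1,1] = v² a`. -/
def O (r : ℂ) (p : Fin 2) (x : Cover) : ℂ := exp (r * (2 * x.2.2 - eps p * x.1))

/-- The restriction to `p` of `√ℒ(-κ)`, where `κ = (1, 3)`, i.e. `ℒ(κ) = a³ 𝒪(1)`. -/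
def sqrtL (p : Fin 2) (x : Cover) : ℂ := exp (-(3 / 2) * x.1) * O (-1 / 2) p x

/-- The theta function `ϑ(y; q)` at `y = exp w`, `q = exp τ`:
`(y^{1/2} - y^{-1/2}) ∏_{m ≥ 1} (1 - q^m y) (1 - q^m y⁻¹)`. -/
def theta (τ w : ℂ) : ℂ :=
  (exp (w / 2) - exp (-w / 2)) *
    ∏' m : ℕ, ((1 - exp ((m + 1) * τ + w)) * (1 - exp ((m + 1) * τ - w)))

/-! ## Elliptic stable bases -/

/-- The matrix of the (renormalized) elliptic stable basis of `X`: the row is the fixed point to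
which one restricts, the column is the label. -/
def stabEll (x : Cover) (τ : ℂ) : Matrix (Fin 2) (Fin 2) ℂ :=
  let a := x.1
  let z := x.2.1
  let v := x.2.2
  let th := theta τ
  !![th (-2 * a) * th (-2 * v - 2 * z),
      th (-2 * v) * (th (-2 * a) * th (v + 2 * z - a) * th (-v + z)
        + th (-v - a) * th (v + z - 2 * a) * th (-2 * z)) / (th (-v + a) * th (v + z));
    0, th (-2 * v - 2 * a) * th (-2 * z)]

/-- The elliptic stable basis for the opposite chamber, obtained through the automorphism of `X`
that exchanges the two coordinates of the plane (it exchanges the fixed points and inverts `a`). -/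
def stabEllOp (x : Cover) (τ : ℂ) : Matrix (Fin 2) (Fin 2) ℂ :=
  Matrix.of fun p' p => stabEll (invA x) τ (Fin.rev p') (Fin.rev p)

/-! ## `K`-theoretic stable bases and canonical bases -/

/-- The logarithm of the character `v N_{p^!,-}`, where `[2]^! = [1,1]`, `[1,1]^! = [2]`: it is
`v⁻¹ z⁻²` for `p = [2]` and `v z⁻²` for `p = [1,1]`. -/
def vNDual (p : Fin 2) (x : Cover) : ℂ := ![-x.2.2 - 2 * x.2.1, x.2.2 - 2 * x.2.1] p

/-- The `K`-theoretic stable basis of `X` at slope `s`, as a `K`-theory limit: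
`(-v^{-1/2}) lim_{q → 0} δ_z^{-s} (√ℒ(-κ) ⊗ Stab^ell(p) / ϑ(v N_{p^!,-}))`. -/
def stabK (s : ℝ) (x : Cover) : Matrix (Fin 2) (Fin 2) ℂ :=
  Matrix.of fun p' p => limUnder qToZero fun τ =>
    -exp (-x.2.2 / 2) * (sqrtL p' x * stabEll (shiftZ (-s * τ) x) τ p' p
      / theta τ (vNDual p (shiftZ (-s * τ) x)))

/-- The `K`-theoretic stable basis for the opposite chamber at slope `s`.  The point dual to `p`
is now taken in the dual of `-X`, which exchanges the two characters `v N_{p^!,-}`. -/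
def stabKOp (s : ℝ) (x : Cover) : Matrix (Fin 2) (Fin 2) ℂ :=
  Matrix.of fun p' p => limUnder qToZero fun τ =>
    -exp (-x.2.2 / 2) * (sqrtL p' x * stabEllOp (shiftZ (-s * τ) x) τ p' p
      / theta τ (vNDual (Fin.rev p) (shiftZ (-s * τ) x)))

/-- The coefficients of `F` in the basis `Stab^K_{X,s}`. -/
def coeffK (s : ℝ) (F : Vec) (x : Cover) : Fin 2 → ℂ :=
  (stabK s x)⁻¹.mulVec fun p => F p x

/-- The `K`-theoretic bar involution at slope `s`: semilinear for `v ↦ v⁻¹` and sending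
`Stab^K_{X,s}(p)` to `-v Stab^K_{-X,s}(p)`. -/
def barK (s : ℝ) (F : Vec) : Vec := fun p x =>
  -exp x.2.2 * (stabKOp s x).mulVec (coeffK s F (invV x)) p

/-- Equality in localized `K`-theory: equality on a dense open set (away from the poles). -/
def AgreeGenerically (F G : Vec) : Prop :=
  ∃ U : Set Cover, IsOpen U ∧ Dense U ∧ ∀ x ∈ U, ∀ p, F p x = G p x

/-- The character `a^i z^j v^k`. -/
def ch (i j k : ℤ) : Cover → ℂ := fun x => exp (i * x.1 + j * x.2.1 + k * x.2.2)

/-- `K_{H × S}(pt) = ℤ[a^{±1}, v^{±1}]`. -/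
def KPt : Subring (Cover → ℂ) :=
  Subring.closure {ch 1 0 0, ch (-1) 0 0, ch 0 0 1, ch 0 0 (-1)}

/-- `K_{H × S}(X)`, through fixed-point restriction: pairs of elements of `K_{H × S}(pt)` that are
congruent modulo `1 - a²` (`a^{±2}` are the characters of the compact curve joining the two fixed
points of `X`, the cotangent bundle of the projective line). -/
def KX : Submodule KPt Vec where
  carrier := {F | (∀ p, F p ∈ KPt) ∧ ∃ h ∈ KPt, F 0 - F 1 = (1 - ch 2 0 0) * h}
  add_mem' := by
    rintro F G ⟨hF, h, hh, e⟩ ⟨hG, g, hg, e'⟩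
    refine ⟨fun p => KPt.add_mem (hF p) (hG p), h + g, KPt.add_mem hh hg, ?_⟩
    rw [mul_add, ← e, ← e']
    simp only [Pi.add_apply]
    abel
  zero_mem' := ⟨fun _ => KPt.zero_mem, 0, KPt.zero_mem, by simp⟩
  smul_mem' := by
    rintro ⟨c, hc⟩ F ⟨hF, h, hh, e⟩
    refine ⟨fun p => KPt.mul_mem hc (hF p), c * h, KPt.mul_mem hc hh, ?_⟩
    have : c * F 0 - c * F 1 = (1 - ch 2 0 0) * (c * h) := by
      rw [← mul_sub, e]
      ring
    exact this

/-- `B` is the `K`-theoretic canonical basis of `X` at the (generic) slope `s`: a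
`K_{H × S}(pt)`-basis of `K_{H × S}(X)`, invariant under the bar involution, whose coefficients
`f_{p,p'}(v, a)` in the stable basis tend to `δ_{p,p'}` as `v → ∞`. -/
structure IsKCanonical (s : ℝ) (B : Fin 2 → Vec) : Prop where
  basis : ∃ b : Module.Basis (Fin 2) KPt KX, ∀ p, (b p : Vec) = B p
  bar : ∀ p, AgreeGenerically (barK s (B p)) (B p)
  asymptotic : ∃ U : Set (ℂ × ℂ), IsOpen U ∧ Dense U ∧ ∀ y ∈ U, ∀ p p',
    Tendsto (fun ν => coeffK s (B p) (y.1, y.2, ν) p') (comap re atTop)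
      (𝓝 (if p = p' then 1 else 0))

/-- The product `a^i z^j v^k ⊗ F`. -/
def mono (i j k : ℤ) (F : Vec) : Vec := fun p x => ch i j k x * F p x

/-- The set `{a^i B(p)}` of character twists. -/
def twists (B : Fin 2 → Vec) : Set Vec := {F | ∃ (i : ℤ) (p : Fin 2), F = mono i 0 0 (B p)}

/-- `∑ v⁻¹ ℤ[v⁻¹] ℰ` over the twists `ℰ` of `B`. -/
def lowerSpan (B : Fin 2 → Vec) : AddSubgroup Vec :=
  AddSubgroup.closure {F | ∃ k : ℕ, 0 < k ∧ ∃ G ∈ twists B, F = mono 0 0 (-k) G}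

/-- `∑ v ℤ[v] ℰ` over the twists `ℰ` of `B`. -/
def upperSpan (B : Fin 2 → Vec) : AddSubgroup Vec :=
  AddSubgroup.closure {F | ∃ k : ℕ, 0 < k ∧ ∃ G ∈ twists B, F = mono 0 0 k G}

/-- `W` is the `K`-theoretic canonical basis at an arbitrary slope `s`, and `wc` is the
wall-crossing bijection; `B₊`, `B₋` are the canonical bases at the nearby generic slopes `s ± ε`.
Each `W p` has the form
`B₊ p + ∑_{0 < β < N} z^{-β} F_β ± z^{-N} wc (B₊ p)` (with `N = β_max`; for `N = 0` this
reads `W p = B₊ p = ± wc (B₊ p)`) and is bar invariant. -/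
structure IsWallCanonical (s : ℝ) (Bp Bm : Fin 2 → Vec) (wc : Vec → Vec)
    (W : Fin 2 → Vec) : Prop where
  plus : ∀ᶠ ε in 𝓝[>] (0 : ℝ), IsKCanonical (s + ε) Bp
  minus : ∀ᶠ ε in 𝓝[>] (0 : ℝ), IsKCanonical (s - ε) Bm
  bijOn : Set.BijOn wc (twists Bp) (twists Bm)
  equivariant : ∀ F ∈ twists Bp, ∀ i : ℤ, wc (mono i 0 0 F) = mono i 0 0 (wc F)
  form : ∀ p, ∃ (N : ℕ) (F : ℕ → Vec) (σ : ℤ), (σ = 1 ∨ σ = -1) ∧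
    F 0 = Bp p ∧ F N = σ • wc (Bp p) ∧
    (∀ β, 0 < β → β < N → F β ∈ lowerSpan Bp ∧ F β ∈ upperSpan Bm ∧
      ((∃ m : ℤ, s * β = m) ∨ F β = 0)) ∧
    (N ≠ 0 → wc (Bp p) ∈ lowerSpan Bp) ∧
    W p = ∑ β ∈ Finset.range (N + 1), mono 0 (-β) 0 (F β)
  bar : ∀ p, AgreeGenerically (barK s (W p)) (W p)

/-- The generators of the equivalence relation on canonical basis elements: wall crossing
`ℰ ∼ wc ℰ`, and twists by characters of `H`. -/
def Linked (F G : Vec) : Prop :=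
  (∃ s Bp Bm wc W, IsWallCanonical s Bp Bm wc W ∧ F ∈ twists Bp ∧ G = wc F) ∨
    ∃ i : ℤ, G = mono i 0 0 F

/-- The set `[ℰ^K_{X,s}(μ)]` of all `± a^i z^j ℰ^K_{X,s}(p)`, where `p` is such that
`ℰ^K_{X,s₊}(p)` lies in the class `μ`; the class `μ = [2]` or `[1,1]` is the one that contains the
element with that label in the canonical basis at small positive slope. -/
def kClass (s : ℝ) (μ : Fin 2) : Set Vec :=
  {V | ∃ B₀ Bp Bm wc W p, (∀ᶠ ε in 𝓝[>] (0 : ℝ), IsKCanonical ε B₀) ∧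
    IsWallCanonical s Bp Bm wc W ∧ Relation.EqvGen Linked (B₀ μ) (Bp p) ∧
    ∃ (σ i j : ℤ), (σ = 1 ∨ σ = -1) ∧ V = σ • mono i j 0 (W p)}

/-! ## The conditions on an elliptic canonical basis

`E μ p` is the restriction of `ℰ^ell_X(μ)` to the fixed point `p`. -/

/-- The `q`-difference equation
`δ_z ℰ([2]) = -q^{-3/2} z^{-3} 𝒪(-1) ⊗ ℰ([2])`. -/
def QDiffTwo (E : Fin 2 → Fin 2 → MultiFun) : Prop :=
  ∀ p x τ, τ.re < 0 →
    E 0 p (shiftZ τ x) τ = -exp (-(3 / 2) * τ) * exp (-3 * x.2.1) * O (-1) p x * E 0 p x τ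

/-- The `q`-difference equation
`δ_z ℰ([1,1]) = -q^{-1/2} z^{-1} 𝒪(-1) ⊗ ℰ([1,1])`. -/
def QDiffOneOne (E : Fin 2 → Fin 2 → MultiFun) : Prop :=
  ∀ p x τ, τ.re < 0 →
    E 1 p (shiftZ τ x) τ = -exp (-(1 / 2) * τ) * exp (-x.2.1) * O (-1) p x * E 1 p x τ

/-- A function of `(log a, log z, log v)` is single-valued on `H × K × S`. -/
def SingleValued (g : Cover → ℂ) : Prop :=
  ∀ x, g (x.1 + 2 * Real.pi * I, x.2.1, x.2.2) = g x ∧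
    g (x.1, x.2.1 + 2 * Real.pi * I, x.2.2) = g x ∧
    g (x.1, x.2.1, x.2.2 + 2 * Real.pi * I) = g x

/-- `z^{-1/2} 𝒪(-1/2) ⊗ ℰ(μ)` is single-valued and holomorphic on `H × K × S`, for each `q`. -/
def SingleValuedHolomorphic (E : Fin 2 → Fin 2 → MultiFun) : Prop :=
  ∀ μ p τ, τ.re < 0 →
    SingleValued (fun x => exp (-x.2.1 / 2) * O (-1 / 2) p x * E μ p x τ) ∧
    Differentiable ℂ (fun x : Cover => exp (-x.2.1 / 2) * O (-1 / 2) p x * E μ p x τ)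

/-- For `0 < s < 1/2`, `lim_{q → 0} q^{-r(s)} δ_z^{-s} ℰ([2]) = v z^{1/2} 𝒪(-1/2)`
for some real `r(s)`. -/
def KLimitTwo (E : Fin 2 → Fin 2 → MultiFun) : Prop :=
  ∀ s : ℝ, 0 < s → s < 1 / 2 → ∃ r : ℝ, ∀ p x,
    Tendsto (fun τ => exp (-r * τ) * E 0 p (shiftZ (-s * τ) x) τ) qToZero
      (𝓝 (exp x.2.2 * exp (x.2.1 / 2) * O (-1 / 2) p x))

/-- For `0 < s < 1/2`, `lim_{q → 0} q^{-r(s)} δ_z^{-s} ℰ([1,1]) = z^{1/2} 𝒪(1/2)`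
for some real `r(s)`. -/
def KLimitOneOne (E : Fin 2 → Fin 2 → MultiFun) : Prop :=
  ∀ s : ℝ, 0 < s → s < 1 / 2 → ∃ r : ℝ, ∀ p x,
    Tendsto (fun τ => exp (-r * τ) * E 1 p (shiftZ (-s * τ) x) τ) qToZero
      (𝓝 (exp (x.2.1 / 2) * O (1 / 2) p x))

/-- The matrix `ℰ^ell_X`: rows are restrictions to `[2], [1,1]`, columns are the labels
`[2], [1,1]`. -/
def matE (E : Fin 2 → Fin 2 → MultiFun) (x : Cover) (τ : ℂ) : Matrix (Fin 2) (Fin 2) ℂ :=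
  !![E 0 0 x τ, E 1 0 x τ;
    E 0 1 x τ, E 1 1 x τ]

/-- The elliptic canonical basis of the dual: `ℰ^ell_{X^!}(μ)|_p` is `ℰ^ell_X(μ)|_p` with `a` and
`z` exchanged, for a fixed point `p` of `X^! = X`. -/
def dualE (E : Fin 2 → Fin 2 → MultiFun) : Fin 2 → Fin 2 → MultiFun :=
  fun μ p x τ => E μ p (swapAZ x) τ

/-- The matrix `ℰ^ell_{X^!}`: rows are restrictions to `[2]^! = [1,1]`, `[1,1]^! = [2]`, columns
are the labels `[1,1], [2]`. -/
def matEDual (E : Fin 2 → Fin 2 → MultiFun) (x : Cover) (τ : ℂ) :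
    Matrix (Fin 2) (Fin 2) ℂ :=
  !![dualE E 1 1 x τ, dualE E 0 1 x τ;
    dualE E 1 0 x τ, dualE E 0 0 x τ]

/-- `Υ` is a (possibly multi-valued) holomorphic function of `(v; q)`. -/
def HolomorphicVQ (f : ℂ → ℂ → ℂ) : Prop :=
  DifferentiableOn ℂ (fun y : ℂ × ℂ => f y.1 y.2) {y | y.2.re < 0}

/-- The bilinear duality `Υ(v; q) Stab^ell_X = ℰ^ell_X · ᵗℰ^ell_{X^!}`, an identity of meromorphic
functions: it is required off the zeros of the denominators of `Stab^ell_X`. -/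
def BilinearDuality (E : Fin 2 → Fin 2 → MultiFun) (Υ : ℂ → ℂ → ℂ) : Prop :=
  ∀ (x : Cover) (τ : ℂ), τ.re < 0 → theta τ (-x.2.2 + x.1) * theta τ (x.2.2 + x.2.1) ≠ 0 →
    Υ x.2.2 τ • stabEll x τ = matE E x τ * (matEDual E x τ).transpose

/-- Property A: for each label `μ` there are rational `α`, `β`, `r` such that
`q^{-r} a^{-α} z^{-β} √ℒ(-κ) ⊗ ℰ(μ)` is single-valued and holomorphic on `H × K × S` times the
double cover of the punctured disk, and such that for every real `s` the limit of
`q^{-r(s)} a^{-α} z^{-β} √ℒ(-κ) ⊗ δ_z^{-s} ℰ(μ)` as `q → 0`, for some real `r(s)`, belongs to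
`[ℰ^K_{X,s}(μ)]`. -/
def PropertyA (E : Fin 2 → Fin 2 → MultiFun) : Prop :=
  ∀ μ, ∃ α β r : ℚ,
    (∀ p,
      let g : MultiFun := fun x τ =>
        exp (-r * τ) * exp (-α * x.1) * exp (-β * x.2.1) * sqrtL p x * E μ p x τ
      (∀ τ : ℂ, τ.re < 0 → SingleValued (fun x => g x τ)) ∧
      (∀ x (τ : ℂ), τ.re < 0 → g x (τ + 4 * Real.pi * I) = g x τ) ∧
      DifferentiableOn ℂ (fun y : Cover × ℂ => g y.1 y.2) {y | y.2.re < 0}) ∧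
    ∀ s : ℝ, ∃ rs : ℝ, ∃ V ∈ kClass s μ, ∀ p x,
      Tendsto (fun τ => exp (-rs * τ) * exp (-α * x.1) * exp (-β * x.2.1) * sqrtL p x *
        E μ p (shiftZ (-s * τ) x) τ) qToZero (𝓝 (V p x))

/-! ## The explicit series -/

/-- `q^{-c} f(v; q)` is single-valued on `S` times the double cover of the punctured disk. -/
def SingleValuedVQ (c : ℝ) (f : ℂ → ℂ → ℂ) : Prop :=
  ∀ ν τ : ℂ, τ.re < 0 →
    exp (-c * τ) * f (ν + 2 * Real.pi * I) τ = exp (-c * τ) * f ν τ ∧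
    exp (-c * (τ + 4 * Real.pi * I)) * f ν (τ + 4 * Real.pi * I) = exp (-c * τ) * f ν τ

/-- `∑_{l,m} (-1)^m q^{l² + (m+1/2)²/2} v^{-2l+2m+1} z^{2l+m+1/2} 𝒪(2l-m-1/2)`, restricted
to `p`. -/
def seriesTwoA (p : Fin 2) (x : Cover) (τ : ℂ) : ℂ :=
  ∑' n : ℤ × ℤ, (-1 : ℂ) ^ n.2 * exp (((n.1 : ℂ) ^ 2 + (n.2 + 1 / 2) ^ 2 / 2) * τ) *
    exp ((-2 * n.1 + 2 * n.2 + 1) * x.2.2) * exp ((2 * n.1 + n.2 + 1 / 2) * x.2.1) *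
    O (2 * n.1 - n.2 - 1 / 2) p x

/-- `∑_{l,m} (-1)^m q^{(l+1/2)² + (m+1/2)²/2} v^{-2l+2m} z^{2l+m+3/2} 𝒪(2l-m+1/2)`, restricted
to `p`. -/
def seriesTwoB (p : Fin 2) (x : Cover) (τ : ℂ) : ℂ :=
  ∑' n : ℤ × ℤ, (-1 : ℂ) ^ n.2 *
    exp ((((n.1 : ℂ) + 1 / 2) ^ 2 + (n.2 + 1 / 2) ^ 2 / 2) * τ) *
    exp ((-2 * n.1 + 2 * n.2) * x.2.2) * exp ((2 * n.1 + n.2 + 3 / 2) * x.2.1) *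
    O (2 * n.1 - n.2 + 1 / 2) p x

/-- `∑_m (-1)^m q^{(m+1/2)²/2} z^{m+1/2} 𝒪(m+1/2)`, restricted to `p`. -/
def seriesOneOne (p : Fin 2) (x : Cover) (τ : ℂ) : ℂ :=
  ∑' m : ℤ, (-1 : ℂ) ^ m * exp (((m : ℂ) + 1 / 2) ^ 2 / 2 * τ) *
    exp ((m + 1 / 2) * x.2.1) * O (m + 1 / 2) p x

/-- `ϑ₀(v) = ∑_m q^{m²} v^{2m}` at `v = exp ν`. -/
def thetaZero (ν τ : ℂ) : ℂ := ∑' m : ℤ, exp ((m : ℂ) ^ 2 * τ) * exp (2 * m * ν)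

/-- `ϑ₁(v) = ∑_m q^{(m+1/2)²} v^{2m+1}` at `v = exp ν`. -/
def thetaOne (ν τ : ℂ) : ℂ :=
  ∑' m : ℤ, exp (((m : ℂ) + 1 / 2) ^ 2 * τ) * exp ((2 * m + 1) * ν)

/-- `(q; q)_∞ = ∏_{m ≥ 1} (1 - q^m)`. -/
def qPochhammer (τ : ℂ) : ℂ := ∏' m : ℕ, (1 - exp ((m + 1) * τ))

end EllipticCanonical

end

open EllipticCanonical Asymptotics

/-! Every restriction of an elliptic canonical basis element is a theta function, and spaces of
theta functions with prescribed multipliers have small dimension. Collecting exponents, the series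
for `[1,1]` is the odd Jacobi series `thetaSer` at `z 𝒪(1)`, and the two series for `[2]` are
products of `ϑ₀` or `ϑ₁` at `z v a^{-ε}` with `thetaSer` at `z a^{ε}` (`seriesOneOne_eq`,
`seriesTwoA_eq`, `seriesTwoB_eq`). The triple product `thetaSer_eq` ties `thetaSer` to the product
`theta` of the stable envelopes. The addition formula `thetaSer_mul` writes a product of two values
of `thetaSer` as a 2×2 minor of vectors `(ϑ₀, ϑ₁)`, so all quadratic theta identities needed are
Plücker relations.

From the series to the conditions: the q-difference equations and single-valuedness are
quasi-periodicity, and the bilinear duality is `thetaMix_plucker` together with the four-term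
identity `thetaSer_fourTerm`. For the limits at a slope `s`, only the exponents nearest to `s`
survive, and `c₂ ≥ c₁ + 3/4` keeps `f₂` out of every limit. For Property A the `K`-theoretic
canonical bases are computed: they are pairs of adjacent twisted line bundles, they change only at
half-integral slopes, and each wall exchanges the two labels (`exists_isWallCanonical_int`,
`exists_isWallCanonical_half`). The limits of the series are then recognized as these classes.

From the conditions to the series: as a function of `z`, the element `[1,1]` is a theta function of
degree one, hence a constant multiple of `thetaSer`. The entries of the duality successively show
that its coefficients are elliptic in `a`, hence independent of `a`, and equal at the two fixed
points (`BilinearSystem.coef_one_const`, `BilinearSystem.coef_zero_const`,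
`BilinearSystem.coef_one_eq_zero`). The restriction of `[2]` to `[1,1]` is antisymmetric in `a` and
`z`; it is therefore `thetaSer (z - a)` times a degree-two theta function of `a z v`, and such
functions are combinations of `ϑ₀` and `ϑ₁`. The duality then yields the remaining restriction and
`Υ` (`BilinearSystem.solve`).

It remains to bound the coefficients as `q → 0`. The prescribed limits give `f₀ ∼ q^{c₀}`, `f₁ ∼
q^{c₁}` and `f₂ = o(q^{c₁})`. Single-valuedness on the double cover makes the `c_i` rational, and
since `ϑ₁` and `ϑ₀` have opposite monodromy, `f₂` is `q^{c₁ + 1/4} (u(v) + O(q^{1/2}))`. The term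
`u` would appear in the canonical class at the wall `s = 1/2`. There it is even by bar invariance
and decays as `v → ∞` by triangularity, so it vanishes (`half_limit_eq_zero`), and `f₂ = O(q^{c₁ +
3/4})`. -/

open Filter Topology Complex EllipticCanonical Asymptotics

namespace EllipticCanonical

/-! ## Holomorphic functions on `ℂ³ × {re τ < 0}` -/

/-- The universal cover of `H × K × S × 𝔇°`. -/
def fullCover : Set (Cover × ℂ) := {y | y.2.re < 0}

lemma isOpen_fullCover : IsOpen fullCover :=
  isOpen_lt (by fun_prop) continuous_const

/-- The identity theorem on `fullCover`, along complex lines. -/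
lemma eqOn_zero_of_open {f : Cover × ℂ → ℂ} (hf : DifferentiableOn ℂ f fullCover)
    {W : Set (Cover × ℂ)} (hW : IsOpen W) {y₀ : Cover × ℂ} (hy₀ : y₀ ∈ W) (hy₁ : y₀ ∈ fullCover)
    (h0 : ∀ y ∈ W, f y = 0) : ∀ y ∈ fullCover, f y = 0 := by
  intro y hy
  set L : ℂ → Cover × ℂ := fun t => y₀ + t • (y - y₀) with hL
  have hLc : Continuous L := by fun_prop
  have hLd : Differentiable ℂ L := by fun_prop
  set T : Set ℂ := L ⁻¹' fullCover with hT
  have hTo : IsOpen T := isOpen_fullCover.preimage hLc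
  -- The condition on `re τ` is real-affine in the parameter of the line, so its preimage is convex,
  -- hence connected, and the one-variable identity theorem reaches `y`.
  have hTc : Convex ℝ T := by
    intro s hs t ht a b ha hb hab
    simp only [hT, hL, fullCover, Set.mem_preimage, Set.mem_ofPred_eq, Prod.snd_add, Prod.smul_snd,
      Prod.snd_sub, add_re, smul_eq_mul, mul_re, real_smul, ofReal_re, ofReal_im, add_im, mul_im]
      at hs ht ⊢
    have : y₀.2.re = (a + b) * y₀.2.re := by rw [hab, one_mul]
    rcases ha.lt_or_eq with ha' | ha'
    · nlinarith [mul_lt_mul_of_pos_left hs ha', mul_le_mul_of_nonneg_left ht.le hb]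
    · have hb' : b = 1 := by linarith
      subst ha' hb'
      simp only [zero_mul, one_mul, zero_add, sub_zero]
      simpa using ht
  have hg : AnalyticOnNhd ℂ (f ∘ L) T :=
    (hf.comp hLd.differentiableOn fun t ht => ht).analyticOnNhd hTo
  have h0T : (0 : ℂ) ∈ T := by simpa [hT, hL] using hy₁
  have hev : f ∘ L =ᶠ[𝓝 0] 0 := by
    have : L ⁻¹' W ∈ 𝓝 (0 : ℂ) := (hW.preimage hLc).mem_nhds (by simpa [hL] using hy₀)
    filter_upwards [this] with t ht using h0 _ ht
  have := hg.eqOn_zero_of_preconnected_of_eventuallyEq_zero hTc.isPreconnected h0T hev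
    (show (1 : ℂ) ∈ T by simpa [hT, hL] using hy)
  simpa [hL] using this

/-- The ring of holomorphic functions on `fullCover` has no zero divisors. -/
lemma eq_zero_of_mul_eq_zero {f g : Cover × ℂ → ℂ} (hf : DifferentiableOn ℂ f fullCover)
    (hg : DifferentiableOn ℂ g fullCover) (hne : ∃ y ∈ fullCover, g y ≠ 0)
    (h : ∀ y ∈ fullCover, f y * g y = 0) : ∀ y ∈ fullCover, f y = 0 := by
  obtain ⟨y₀, hy₀, hgy⟩ := hne
  have hc : ContinuousOn g fullCover := hg.continuousOn
  have hW : IsOpen (fullCover ∩ g ⁻¹' {0}ᶜ) :=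
    hc.isOpen_inter_preimage isOpen_fullCover isOpen_compl_singleton
  refine eqOn_zero_of_open hf hW (y₀ := y₀) ⟨hy₀, by simpa using hgy⟩ hy₀ ?_
  rintro y ⟨hy, hy'⟩
  exact (mul_eq_zero.mp (h y hy)).resolve_right (by simpa using hy')

lemma exists_mul_ne_zero {f g : Cover × ℂ → ℂ} (hf : DifferentiableOn ℂ f fullCover)
    (hg : DifferentiableOn ℂ g fullCover) (hf' : ∃ y ∈ fullCover, f y ≠ 0)
    (hg' : ∃ y ∈ fullCover, g y ≠ 0) : ∃ y ∈ fullCover, f y * g y ≠ 0 := by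
  by_contra! hcon
  obtain ⟨y, hy, hfy⟩ := hf'
  exact hfy (eq_zero_of_mul_eq_zero hf hg hg' hcon y hy)

/-! ## Fourier coefficients of periodic entire functions -/

/-- The Fourier coefficient (times `2π`) of a `2πi`-periodic function on the imaginary axis. -/
noncomputable def fourierInt (h : ℂ → ℂ) (n : ℤ) : ℂ :=
  ∫ t in (0 : ℝ)..(2 * Real.pi), h (t * I) * exp (-n * (t * I))

/-- Cauchy's theorem on a rectangle of height `2π`: the horizontal sides cancel by periodicity,
which moves the contour by `w₀.re`. The imaginary part of `w₀` only moves the starting point along a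
full period. -/
lemma integral_shift {H : ℂ → ℂ} (hH : Differentiable ℂ H)
    (hp : ∀ w, H (w + 2 * Real.pi * I) = H w) (w₀ : ℂ) :
    ∫ t in (0 : ℝ)..(2 * Real.pi), H (w₀ + t * I) = ∫ t in (0 : ℝ)..(2 * Real.pi), H (t * I) := by
  have hrect := integral_boundary_rect_eq_zero_of_differentiableOn H 0
    (w₀.re + (2 * Real.pi : ℝ) * I) hH.differentiableOn
  have e1 : ∀ x : ℝ, H (x + (2 * Real.pi : ℝ) * I) = H x := fun x => by
    rw [← hp x]; push_cast; rfl
  simp only [zero_re, zero_im, add_re, add_im, ofReal_re, ofReal_im, mul_re, mul_im, I_re, I_im,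
    mul_zero, mul_one, sub_zero, zero_mul, add_zero, zero_add, ofReal_zero] at hrect
  simp only [e1, sub_self, zero_add, smul_eq_mul] at hrect
  rw [← mul_sub, mul_eq_zero, or_iff_right I_ne_zero, sub_eq_zero] at hrect
  rw [← hrect]
  have hper : Function.Periodic (fun t : ℝ => H (w₀.re + t * I)) (2 * Real.pi) := by
    intro t
    simp only
    rw [← hp (w₀.re + t * I)]
    push_cast; ring_nf
  have := hper.intervalIntegral_add_eq w₀.im 0
  rw [zero_add] at this
  rw [← this]
  have h2 := intervalIntegral.integral_comp_add_right (a := 0) (b := 2 * Real.pi)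
    (fun t : ℝ => H (w₀.re + t * I)) w₀.im
  rw [zero_add, add_comm (2 * Real.pi)] at h2
  rw [← h2]
  refine intervalIntegral.integral_congr fun t _ => ?_
  congr 1
  conv_lhs => rw [← re_add_im w₀]
  push_cast; ring

/-- Moving the contour through `w₀` is what turns quasi-periodicity, oddness and translation of a
function into relations between its Fourier coefficients. -/
lemma fourierInt_eq_shift {h : ℂ → ℂ} (hh : Differentiable ℂ h)
    (hp : ∀ w, h (w + 2 * Real.pi * I) = h w) (n : ℤ) (w₀ : ℂ) :
    fourierInt h n =
      exp (-n * w₀) * ∫ t in (0 : ℝ)..(2 * Real.pi), h (w₀ + t * I) * exp (-n * (t * I)) := by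
  have hd : Differentiable ℂ fun w => h w * exp (-n * w) := by fun_prop
  have hper : ∀ w, h (w + 2 * Real.pi * I) * exp (-n * (w + 2 * Real.pi * I)) =
      h w * exp (-n * w) := fun w => by
    rw [hp, show -(n : ℂ) * (w + 2 * Real.pi * I) = -n * w + (-n : ℤ) * (2 * Real.pi * I) by
      push_cast; ring, exp_add, exp_int_mul_two_pi_mul_I, mul_one]
  have := integral_shift hd hper w₀
  rw [fourierInt, ← this, ← intervalIntegral.integral_const_mul]
  refine intervalIntegral.integral_congr fun t _ => ?_
  simp only [mul_add, exp_add]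
  ring

lemma fourierInt_smul_sub {h₁ h₂ : ℂ → ℂ} (d₁ : Continuous h₁) (d₂ : Continuous h₂) (a b : ℂ)
    (n : ℤ) : fourierInt (fun w => a * h₁ w - b * h₂ w) n =
      a * fourierInt h₁ n - b * fourierInt h₂ n := by
  unfold fourierInt
  rw [← intervalIntegral.integral_const_mul, ← intervalIntegral.integral_const_mul,
    ← intervalIntegral.integral_sub]
  · refine intervalIntegral.integral_congr fun t _ => ?_
    ring
  · exact (by fun_prop : Continuous _).intervalIntegrable _ _
  · exact (by fun_prop : Continuous _).intervalIntegrable _ _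

/-- Continuous `2πi`-periodic functions on the imaginary axis with vanishing Fourier
coefficients vanish. -/
lemma eq_zero_on_imaginary {h : ℂ → ℂ} (hc : Continuous h)
    (hp : ∀ w, h (w + 2 * Real.pi * I) = h w) (h0 : ∀ n, fourierInt h n = 0) (t : ℝ) :
    h (t * I) = 0 := by
  have : Fact (0 < 2 * Real.pi) := ⟨Real.two_pi_pos⟩
  have hper : Function.Periodic (fun t : ℝ => h (t * I)) (2 * Real.pi) := by
    intro t
    simp only
    rw [← hp (t * I)]
    push_cast; ring_nf
  let f : C(AddCircle (2 * Real.pi), ℂ) :=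
    ⟨hper.lift, (by
      refine continuous_coinduced_dom.mpr ?_
      exact hc.comp (by fun_prop : Continuous fun t : ℝ => (t : ℂ) * I))⟩
  have hfc : ∀ n, fourierCoeff f n = 0 := by
    intro n
    rw [fourierCoeff_eq_intervalIntegral _ _ 0]
    have := h0 n
    rw [fourierInt] at this
    rw [zero_add]
    rw [show (∫ x in (0 : ℝ)..(2 * Real.pi), fourier (-n) (x : AddCircle (2 * Real.pi)) • f x) =
      ∫ t in (0 : ℝ)..(2 * Real.pi), h (t * I) * exp (-n * (t * I)) from ?_, this, smul_zero]
    refine intervalIntegral.integral_congr fun t _ => ?_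
    simp only [smul_eq_mul, fourier_coe_apply]
    rw [mul_comm]
    congr 2
    have : (Real.pi : ℂ) ≠ 0 := by exact_mod_cast Real.pi_ne_zero
    push_cast
    field_simp
  have hs := has_pointwise_sum_fourier_series_of_summable (f := f)
    (by simp only [funext hfc]; exact summable_zero) (t : AddCircle (2 * Real.pi))
  simp only [hfc, zero_smul] at hs
  exact hs.unique hasSum_zero

/-- The Fourier coefficients of a translate are nonzero multiples of the original ones, so the
vanishing criterion on the imaginary axis applies on a line through any point. -/
lemma eq_zero_of_fourierInt {h : ℂ → ℂ} (hh : Differentiable ℂ h)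
    (hp : ∀ w, h (w + 2 * Real.pi * I) = h w) (h0 : ∀ n, fourierInt h n = 0) (w : ℂ) : h w = 0 := by
  have := eq_zero_on_imaginary (h := fun u => h (w + u))
    (hh.continuous.comp (by fun_prop))
    (fun u => by simp only [← add_assoc, hp]) (fun n => by
      have := fourierInt_eq_shift hh hp n w
      rw [h0 n] at this
      have h2 := (mul_eq_zero.mp this.symm).resolve_left (exp_ne_zero _)
      exact h2) 0
  simpa using this

/-- The recursion for the Fourier coefficients of a theta function of degree `d`. -/
lemma fourierInt_add {h : ℂ → ℂ} (hh : Differentiable ℂ h)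
    (hp : ∀ w, h (w + 2 * Real.pi * I) = h w) {C τ : ℂ} {d : ℤ}
    (hq : ∀ w, h (w + τ) = C * exp (-d * w) * h w) (n : ℤ) :
    fourierInt h n = exp (-n * τ) * C * fourierInt h (n + d) := by
  rw [fourierInt_eq_shift hh hp n τ, mul_assoc]
  congr 1
  rw [fourierInt, ← intervalIntegral.integral_const_mul]
  refine intervalIntegral.integral_congr fun t _ => ?_
  rw [add_comm τ, hq]
  push_cast
  rw [show -((n : ℂ) + d) * (t * I) = -d * (t * I) + -n * (t * I) by ring, exp_add]
  ring

/-- A theta function of degree `d` with `d` consecutive vanishing Fourier coefficients vanishes. -/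
lemma theta_eq_zero {h : ℂ → ℂ} (hh : Differentiable ℂ h)
    (hp : ∀ w, h (w + 2 * Real.pi * I) = h w) {C τ : ℂ} {d : ℕ} (hd : 0 < d) (hC : C ≠ 0)
    (hq : ∀ w, h (w + τ) = C * exp (-d * w) * h w)
    (h0 : ∀ n : ℤ, 0 ≤ n → n < d → fourierInt h n = 0) (w : ℂ) : h w = 0 := by
  have hrec : ∀ n : ℤ, fourierInt h n = 0 ↔ fourierInt h (n + d) = 0 := by
    intro n
    rw [fourierInt_add hh hp (d := d) (by simpa using hq) n]
    simp [exp_ne_zero, hC]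
  have hk : ∀ k n : ℤ, fourierInt h n = 0 ↔ fourierInt h (n + d * k) = 0 := by
    intro k
    induction k using Int.induction_on with
    | zero => simp
    | succ k ih =>
      intro n
      rw [ih n, hrec]
      ring_nf
    | pred k ih =>
      intro n
      rw [ih n, hrec (n + d * (-k - 1))]
      ring_nf
  refine eq_zero_of_fourierInt hh hp (fun n => ?_) w
  have hd' : (0 : ℤ) < d := by exact_mod_cast hd
  have := (hk (n / d) (n % d)).mp
    (h0 _ (Int.emod_nonneg _ hd'.ne') (Int.emod_lt_of_pos _ hd'))
  rwa [Int.emod_add_mul_ediv] at this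

/-- Theta functions of degree one with the same multiplier are proportional. -/
lemma theta_one_unique {h₁ h₂ : ℂ → ℂ} (d₁ : Differentiable ℂ h₁) (d₂ : Differentiable ℂ h₂)
    (p₁ : ∀ w, h₁ (w + 2 * Real.pi * I) = h₁ w) (p₂ : ∀ w, h₂ (w + 2 * Real.pi * I) = h₂ w)
    {C τ : ℂ} (hC : C ≠ 0) (q₁ : ∀ w, h₁ (w + τ) = C * exp (-w) * h₁ w)
    (q₂ : ∀ w, h₂ (w + τ) = C * exp (-w) * h₂ w) (w w₀ : ℂ) : h₁ w * h₂ w₀ = h₂ w * h₁ w₀ := by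
  -- In degree one the recursion links all Fourier coefficients, so the one of index zero decides.
  -- This combination is built to have that coefficient equal to zero.
  have key : ∀ w, fourierInt h₂ 0 * h₁ w - fourierInt h₁ 0 * h₂ w = 0 := by
    refine theta_eq_zero (d := 1) (τ := τ) (by fun_prop) (fun w => by rw [p₁, p₂]) one_pos hC
      (fun w => ?_) (fun n hn hn' => ?_)
    · rw [q₁, q₂]; push_cast; ring_nf
    · obtain rfl : n = 0 := by push_cast at hn'; omega
      rw [fourierInt_smul_sub d₁.continuous d₂.continuous]
      ring
  have hz : ∀ {h : ℂ → ℂ}, Differentiable ℂ h → (∀ w, h (w + 2 * Real.pi * I) = h w) →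
      (∀ w, h (w + τ) = C * exp (-w) * h w) → fourierInt h 0 = 0 → ∀ w, h w = 0 := by
    intro h d p q h0
    refine theta_eq_zero (d := 1) (τ := τ) d p one_pos hC (fun w => by rw [q]; push_cast; ring_nf)
      (fun n hn hn' => ?_)
    obtain rfl : n = 0 := by push_cast at hn'; omega
    exact h0
  by_cases c : fourierInt h₂ 0 = 0
  · rw [hz d₂ p₂ q₂ c w₀, hz d₂ p₂ q₂ c w]; ring
  · refine mul_left_cancel₀ c ?_
    linear_combination h₂ w₀ * key w - h₂ w * key w₀

lemma fourierInt_odd {h : ℂ → ℂ} (hh : Differentiable ℂ h)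
    (hp : ∀ w, h (w + 2 * Real.pi * I) = h w) (ho : ∀ w, h (-w) = -h w) (n : ℤ) :
    fourierInt h (-n) = -fourierInt h n := by
  rw [fourierInt_eq_shift hh hp (-n) (-(2 * Real.pi * I)), fourierInt]
  have h2 := intervalIntegral.integral_comp_sub_left (a := 0) (b := 2 * Real.pi)
    (fun t : ℝ => h (t * I) * exp (-n * (t * I))) (2 * Real.pi)
  rw [sub_self, sub_zero] at h2
  rw [← h2, ← intervalIntegral.integral_neg, show -((-n : ℤ) : ℂ) * -(2 * Real.pi * I) =
    (-n : ℤ) * (2 * Real.pi * I) by push_cast; ring, exp_int_mul_two_pi_mul_I, one_mul]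
  refine intervalIntegral.integral_congr fun t _ => ?_
  rw [show -(2 * Real.pi * I) + t * I = -(((2 * Real.pi - t : ℝ) : ℂ) * I) by push_cast; ring, ho,
    show -((-n : ℤ) : ℂ) * (t * I) = -n * ((2 * Real.pi - t : ℝ) * I) + n * (2 * Real.pi * I) by
      push_cast; ring, exp_add, exp_int_mul_two_pi_mul_I]
  ring

/-- Odd theta functions of degree four with the multiplier of `ϑ(y²)` are proportional. -/
lemma theta_four_odd_unique {h₁ h₂ : ℂ → ℂ} (d₁ : Differentiable ℂ h₁) (d₂ : Differentiable ℂ h₂)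
    (p₁ : ∀ w, h₁ (w + 2 * Real.pi * I) = h₁ w) (p₂ : ∀ w, h₂ (w + 2 * Real.pi * I) = h₂ w)
    (o₁ : ∀ w, h₁ (-w) = -h₁ w) (o₂ : ∀ w, h₂ (-w) = -h₂ w)
    {τ : ℂ} (q₁ : ∀ w, h₁ (w + τ) = exp (-2 * τ) * exp (-4 * w) * h₁ w)
    (q₂ : ∀ w, h₂ (w + τ) = exp (-2 * τ) * exp (-4 * w) * h₂ w) (w w₀ : ℂ) :
    h₁ w * h₂ w₀ = h₂ w * h₁ w₀ := by
  have hz : ∀ {h : ℂ → ℂ}, Differentiable ℂ h → (∀ w, h (w + 2 * Real.pi * I) = h w) →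
      (∀ w, h (-w) = -h w) → (∀ w, h (w + τ) = exp (-2 * τ) * exp (-4 * w) * h w) →
      fourierInt h 1 = 0 → ∀ w, h w = 0 := by
    intro h d p o q h1
    have hrec := fun n => fourierInt_add d p (C := exp (-2 * τ)) (d := 4)
      (fun w => by rw [q]; push_cast; ring_nf) n
    refine theta_eq_zero (C := exp (-2 * τ)) (d := 4) (τ := τ) d p (by norm_num) (exp_ne_zero _)
      (fun w => by rw [q]; push_cast; ring_nf) (fun n hn hn' => ?_)
    push_cast at hn'
    have ho := fourierInt_odd d p o
    -- Of the four residues, oddness kills index 0. The recursion equates the coefficients at 2 and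
    -- -2, which are also opposite, and it ties index 3 to index -1. Only the coefficient at 1 is
    -- free.
    interval_cases n
    · have := ho 0
      rw [neg_zero] at this
      linear_combination this / 2
    · exact h1
    · have h2 := hrec (-2)
      rw [ho 2, ← exp_add] at h2
      push_cast at h2
      rw [show -(-2 : ℂ) * τ + -2 * τ = 0 by ring, exp_zero] at h2
      norm_num at h2
      linear_combination -h2 / 2
    · have h2 := hrec (-1)
      rw [ho 1, h1, neg_zero] at h2
      norm_num [exp_ne_zero] at h2
      exact h2
  have key : ∀ w, fourierInt h₂ 1 * h₁ w - fourierInt h₁ 1 * h₂ w = 0 := by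
    refine hz (by fun_prop) (fun w => by rw [p₁, p₂]) (fun w => by rw [o₁, o₂]; ring)
      (fun w => by rw [q₁, q₂]; ring) ?_
    rw [fourierInt_smul_sub d₁.continuous d₂.continuous]
    ring
  by_cases c : fourierInt h₂ 1 = 0
  · rw [hz d₂ p₂ o₂ q₂ c w₀, hz d₂ p₂ o₂ q₂ c w]; ring
  · refine mul_left_cancel₀ c ?_
    linear_combination h₂ w₀ * key w - h₂ w * key w₀

/-- Doubly periodic entire functions are constant. -/
lemma doublyPeriodic_const {h : ℂ → ℂ} (hh : Differentiable ℂ h)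
    (hp : ∀ w, h (w + 2 * Real.pi * I) = h w) {τ : ℂ} (hτ : τ.re < 0)
    (hq : ∀ w, h (w + τ) = h w) (w w₀ : ℂ) : h w = h w₀ := by
  -- Periodicity under `τ` multiplies the coefficient of index `n` by `exp (-n τ)`, whose absolute
  -- value differs from one because `re τ < 0`.
  have hn : ∀ n : ℤ, n ≠ 0 → fourierInt h n = 0 := by
    intro n hn
    have := fourierInt_add hh hp (C := 1) (d := 0) (fun w => by simpa using hq w) n
    rw [mul_one, add_zero] at this
    by_contra hne
    have h1 : exp (-n * τ) = 1 := by
      refine mul_right_cancel₀ hne ?_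
      rw [← this, one_mul]
    have h2 : ‖exp (-n * τ)‖ = 1 := by rw [h1, norm_one]
    rw [norm_exp, Real.exp_eq_one_iff] at h2
    have h3 : (-(n : ℂ) * τ).re = -n * τ.re := by simp [mul_re]
    rw [h3] at h2
    rcases mul_eq_zero.mp h2 with h | h
    · exact hn (by exact_mod_cast neg_eq_zero.mp h)
    · linarith
  -- A function and its translate have the same coefficient of index zero, and all others vanish.
  have hd0 : ∀ u, h (u + (w - w₀)) - h u = 0 := by
    refine eq_zero_of_fourierInt (by fun_prop) (fun u => ?_) (fun n => ?_)
    · rw [hp, add_right_comm, hp]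
    · have e := fourierInt_smul_sub (h₁ := fun u => h (u + (w - w₀))) (h₂ := h)
        (hh.continuous.comp (by fun_prop))
        hh.continuous 1 1 n
      simp only [one_mul] at e
      rw [e]
      have e2 := fourierInt_eq_shift hh hp n (w - w₀)
      have e3 : fourierInt (fun u => h (u + (w - w₀))) n =
          exp (n * (w - w₀)) * fourierInt h n := by
        rw [e2, ← mul_assoc, ← exp_add]
        simp only [fourierInt, add_comm (w - w₀)]
        simp
      rw [e3]
      rcases eq_or_ne n 0 with rfl | h
      · simp
      · simp [hn n h]
  have := hd0 w₀
  rw [add_sub_cancel] at this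
  exact sub_eq_zero.mp this

/-! ## Theta series -/

/-- `∑_m (-1)^m q^{(m+1/2)²/2} y^{m+1/2}` at `y = exp w`, `q = exp τ`. -/
noncomputable def thetaSer (w τ : ℂ) : ℂ :=
  ∑' m : ℤ, (-1 : ℂ) ^ m * exp (((m : ℂ) + 1 / 2) ^ 2 / 2 * τ) * exp ((m + 1 / 2) * w)

lemma neg_one_zpow_eq_exp (m : ℤ) : (-1 : ℂ) ^ m = exp (m * (Real.pi * I)) := by
  rw [exp_int_mul, exp_pi_mul_I]

/-- Identification with `jacobiTheta₂` provides summability and joint holomorphy in both variables.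
The sign is absorbed into the shift by `π i` and the half-integral index into the shift by `τ / 2`.
-/
lemma thetaSer_term (w τ : ℂ) (m : ℤ) :
    (-1 : ℂ) ^ m * exp (((m : ℂ) + 1 / 2) ^ 2 / 2 * τ) * exp ((m + 1 / 2) * w) =
      exp (τ / 8 + w / 2) *
        jacobiTheta₂_term m ((w + τ / 2 + Real.pi * I) / (2 * Real.pi * I))
          (τ / (2 * Real.pi * I)) := by
  have hπ : (Real.pi : ℂ) ≠ 0 := by exact_mod_cast Real.pi_ne_zero
  rw [neg_one_zpow_eq_exp, jacobiTheta₂_term, ← exp_add, ← exp_add, ← exp_add]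
  congr 1
  field_simp [I_ne_zero]
  ring

lemma thetaZero_term (w τ : ℂ) (m : ℤ) :
    exp ((m : ℂ) ^ 2 * τ) * exp (2 * m * w) =
      jacobiTheta₂_term m (w / (Real.pi * I)) (τ / (Real.pi * I)) := by
  have hπ : (Real.pi : ℂ) ≠ 0 := by exact_mod_cast Real.pi_ne_zero
  rw [jacobiTheta₂_term, ← exp_add]
  congr 1
  field_simp [I_ne_zero]
  ring

lemma thetaOne_term (w τ : ℂ) (m : ℤ) :
    exp (((m : ℂ) + 1 / 2) ^ 2 * τ) * exp ((2 * m + 1) * w) =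
      exp (τ / 4 + w) *
        jacobiTheta₂_term m ((2 * w + τ) / (2 * Real.pi * I)) (τ / (Real.pi * I)) := by
  have hπ : (Real.pi : ℂ) ≠ 0 := by exact_mod_cast Real.pi_ne_zero
  rw [jacobiTheta₂_term, ← exp_add, ← exp_add]
  congr 1
  field_simp [I_ne_zero]
  ring

lemma im_div_pi_I {τ : ℂ} (hτ : τ.re < 0) : 0 < (τ / (Real.pi * I)).im := by
  have : τ / (Real.pi * I) = -(τ / (Real.pi : ℝ)) * I := by
    have hπ : (Real.pi : ℂ) ≠ 0 := by exact_mod_cast Real.pi_ne_zero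
    field_simp [I_ne_zero]
    rw [I_sq]; ring
  rw [this]
  simp only [mul_im, neg_re, div_ofReal_re, I_im, mul_one, neg_im, I_re, mul_zero, add_zero]
  have := div_neg_of_neg_of_pos hτ Real.pi_pos
  linarith

lemma im_div_two_pi_I {τ : ℂ} (hτ : τ.re < 0) : 0 < (τ / (2 * Real.pi * I)).im := by
  have h := im_div_pi_I (τ := τ / 2) (by
    rw [show τ / 2 = τ / (2 : ℝ) by push_cast; ring, div_ofReal_re]; linarith)
  convert h using 2
  rw [mul_assoc, div_div]

lemma summable_thetaSer (w : ℂ) {τ : ℂ} (hτ : τ.re < 0) : Summable fun m : ℤ =>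
    (-1 : ℂ) ^ m * exp (((m : ℂ) + 1 / 2) ^ 2 / 2 * τ) * exp ((m + 1 / 2) * w) := by
  simp only [thetaSer_term]
  exact ((summable_jacobiTheta₂_term_iff _ _).mpr (im_div_two_pi_I hτ)).mul_left _

lemma summable_thetaZero (w : ℂ) {τ : ℂ} (hτ : τ.re < 0) : Summable fun m : ℤ =>
    exp ((m : ℂ) ^ 2 * τ) * exp (2 * m * w) := by
  simp only [thetaZero_term]
  exact (summable_jacobiTheta₂_term_iff _ _).mpr (im_div_pi_I hτ)

lemma summable_thetaOne (w : ℂ) {τ : ℂ} (hτ : τ.re < 0) : Summable fun m : ℤ =>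
    exp (((m : ℂ) + 1 / 2) ^ 2 * τ) * exp ((2 * m + 1) * w) := by
  simp only [thetaOne_term]
  exact ((summable_jacobiTheta₂_term_iff _ _).mpr (im_div_pi_I hτ)).mul_left _

section Differentiability

variable {V : Type*} [NormedAddCommGroup V] [NormedSpace ℂ V]

lemma differentiableAt_jacobiTheta₂_comp {f g : V → ℂ} {y : V} (hf : DifferentiableAt ℂ f y)
    (hg : DifferentiableAt ℂ g y) (h : 0 < (g y).im) :
    DifferentiableAt ℂ (fun y => jacobiTheta₂ (f y) (g y)) y :=
  DifferentiableAt.comp (g := fun p : ℂ × ℂ => jacobiTheta₂ p.1 p.2) y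
    (hasFDerivAt_jacobiTheta₂ (f y) h).differentiableAt (hf.prodMk hg)

lemma differentiableAt_thetaSer {f g : V → ℂ} {y : V} (hf : DifferentiableAt ℂ f y)
    (hg : DifferentiableAt ℂ g y) (h : (g y).re < 0) :
    DifferentiableAt ℂ (fun y => thetaSer (f y) (g y)) y := by
  have e : (fun y => thetaSer (f y) (g y)) = fun y => exp (g y / 8 + f y / 2) *
      jacobiTheta₂ ((f y + g y / 2 + Real.pi * I) / (2 * Real.pi * I))
        (g y / (2 * Real.pi * I)) := by
    funext y
    simp only [thetaSer, thetaSer_term, tsum_mul_left, jacobiTheta₂]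
  rw [e]
  refine DifferentiableAt.mul (by fun_prop) ?_
  exact differentiableAt_jacobiTheta₂_comp (by fun_prop) (by fun_prop) (im_div_two_pi_I h)

lemma differentiableAt_thetaZero {f g : V → ℂ} {y : V} (hf : DifferentiableAt ℂ f y)
    (hg : DifferentiableAt ℂ g y) (h : (g y).re < 0) :
    DifferentiableAt ℂ (fun y => thetaZero (f y) (g y)) y := by
  have e : (fun y => thetaZero (f y) (g y)) = fun y =>
      jacobiTheta₂ (f y / (Real.pi * I)) (g y / (Real.pi * I)) := by
    funext y
    simp only [thetaZero, thetaZero_term, jacobiTheta₂]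
  rw [e]
  exact differentiableAt_jacobiTheta₂_comp (by fun_prop) (by fun_prop) (im_div_pi_I h)

lemma differentiableAt_thetaOne {f g : V → ℂ} {y : V} (hf : DifferentiableAt ℂ f y)
    (hg : DifferentiableAt ℂ g y) (h : (g y).re < 0) :
    DifferentiableAt ℂ (fun y => thetaOne (f y) (g y)) y := by
  have e : (fun y => thetaOne (f y) (g y)) = fun y => exp (g y / 4 + f y) *
      jacobiTheta₂ ((2 * f y + g y) / (2 * Real.pi * I)) (g y / (Real.pi * I)) := by
    funext y
    simp only [thetaOne, thetaOne_term, tsum_mul_left, jacobiTheta₂]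
  rw [e]
  refine DifferentiableAt.mul (by fun_prop) ?_
  exact differentiableAt_jacobiTheta₂_comp (by fun_prop) (by fun_prop) (im_div_pi_I h)

end Differentiability

/-! ### Quasi-periodicity -/

lemma thetaSer_add_tau (w τ : ℂ) : thetaSer (w + τ) τ = -exp (-τ / 2 - w) * thetaSer w τ := by
  rw [thetaSer, thetaSer, ← tsum_mul_left, ← (Equiv.addRight (1 : ℤ)).tsum_eq
    fun m : ℤ => -exp (-τ / 2 - w) *
      ((-1 : ℂ) ^ m * exp (((m : ℂ) + 1 / 2) ^ 2 / 2 * τ) * exp ((m + 1 / 2) * w))]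
  refine tsum_congr fun m => ?_
  simp only [Equiv.coe_addRight]
  push_cast
  rw [zpow_add_one₀ (by norm_num : (-1 : ℂ) ≠ 0), mul_assoc, ← exp_add]
  rw [show -exp (-τ / 2 - w) * ((-1 : ℂ) ^ m * -1 *
    exp (((m : ℂ) + 1 + 1 / 2) ^ 2 / 2 * τ) * exp ((m + 1 + 1 / 2) * w)) =
    (-1 : ℂ) ^ m * (exp (-τ / 2 - w) *
    (exp (((m : ℂ) + 1 + 1 / 2) ^ 2 / 2 * τ) * exp ((m + 1 + 1 / 2) * w))) by ring,
    ← exp_add, ← exp_add]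
  ring_nf

lemma thetaZero_add_tau (w τ : ℂ) :
    thetaZero (w + τ) τ = exp (-τ - 2 * w) * thetaZero w τ := by
  rw [thetaZero, thetaZero, ← tsum_mul_left, ← (Equiv.addRight (1 : ℤ)).tsum_eq
    fun m : ℤ => exp (-τ - 2 * w) * (exp ((m : ℂ) ^ 2 * τ) * exp (2 * m * w))]
  refine tsum_congr fun m => ?_
  simp only [Equiv.coe_addRight]
  push_cast
  rw [← exp_add, ← exp_add, ← exp_add]
  ring_nf

lemma thetaOne_add_tau (w τ : ℂ) :
    thetaOne (w + τ) τ = exp (-τ - 2 * w) * thetaOne w τ := by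
  rw [thetaOne, thetaOne, ← tsum_mul_left, ← (Equiv.addRight (1 : ℤ)).tsum_eq
    fun m : ℤ => exp (-τ - 2 * w) * (exp (((m : ℂ) + 1 / 2) ^ 2 * τ) * exp ((2 * m + 1) * w))]
  refine tsum_congr fun m => ?_
  simp only [Equiv.coe_addRight]
  push_cast
  rw [← exp_add, ← exp_add, ← exp_add]
  ring_nf

/-- The reflection `m ↦ -1 - m` negates `m + 1/2` and changes the parity of `m`. -/
lemma thetaSer_neg (w τ : ℂ) : thetaSer (-w) τ = -thetaSer w τ := by
  rw [thetaSer, thetaSer, ← tsum_neg, ← (Equiv.subLeft (-1 : ℤ)).tsum_eq]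
  refine tsum_congr fun m => ?_
  simp only [Equiv.subLeft_apply]
  have : (-1 : ℂ) ^ (-1 - m) = -(-1) ^ m := by
    rw [zpow_sub₀ (by norm_num), zpow_neg_one]
    rcases Int.even_or_odd m with h | h
    · rw [h.neg_one_zpow]; norm_num
    · rw [h.neg_one_zpow]; norm_num
  rw [this]
  push_cast
  rw [neg_mul, neg_mul]
  ring_nf

lemma thetaZero_neg (w τ : ℂ) : thetaZero (-w) τ = thetaZero w τ := by
  rw [thetaZero, thetaZero, ← (Equiv.neg ℤ).tsum_eq]
  refine tsum_congr fun m => ?_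
  simp only [Equiv.neg_apply]
  push_cast
  ring_nf

lemma thetaOne_neg (w τ : ℂ) : thetaOne (-w) τ = thetaOne w τ := by
  rw [thetaOne, thetaOne, ← (Equiv.subLeft (-1 : ℤ)).tsum_eq]
  refine tsum_congr fun m => ?_
  simp only [Equiv.subLeft_apply]
  push_cast
  ring_nf

lemma thetaSer_add_two_pi (w τ : ℂ) : thetaSer (w + 2 * Real.pi * I) τ = -thetaSer w τ := by
  rw [thetaSer, thetaSer, ← tsum_neg]
  refine tsum_congr fun m => ?_
  rw [show ((m : ℂ) + 1 / 2) * (w + 2 * Real.pi * I) =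
    (m + 1 / 2) * w + m * (2 * Real.pi * I) + Real.pi * I by ring, exp_add, exp_add,
    exp_int_mul_two_pi_mul_I, exp_pi_mul_I]
  ring

lemma thetaZero_add_pi (w τ : ℂ) : thetaZero (w + Real.pi * I) τ = thetaZero w τ := by
  refine tsum_congr fun m => ?_
  rw [show 2 * (m : ℂ) * (w + Real.pi * I) = 2 * m * w + m * (2 * Real.pi * I) by ring, exp_add,
    exp_int_mul_two_pi_mul_I, mul_one]

lemma thetaOne_add_pi (w τ : ℂ) : thetaOne (w + Real.pi * I) τ = -thetaOne w τ := by
  rw [thetaOne, thetaOne, ← tsum_neg]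
  refine tsum_congr fun m => ?_
  rw [show (2 * (m : ℂ) + 1) * (w + Real.pi * I) =
    (2 * m + 1) * w + m * (2 * Real.pi * I) + Real.pi * I by ring, exp_add, exp_add,
    exp_int_mul_two_pi_mul_I, exp_pi_mul_I]
  ring

/-- Since `(m + 1/2)²/2 = m(m+1)/2 + 1/8`, turning twice around `q = 0` produces `exp (4πi/8)`. The
corresponding factors are `1` for `thetaZero` and `-1` for `thetaOne`. This contrast governs the
exponents allowed for `f₂` relative to `f₁`. -/
lemma thetaSer_tau_add (w τ : ℂ) : thetaSer w (τ + 4 * Real.pi * I) = I * thetaSer w τ := by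
  rw [thetaSer, thetaSer, ← tsum_mul_left]
  refine tsum_congr fun m => ?_
  rw [show ((m : ℂ) + 1 / 2) ^ 2 / 2 * (τ + 4 * Real.pi * I) =
    (m + 1 / 2) ^ 2 / 2 * τ + (m ^ 2 + m : ℤ) * (2 * Real.pi * I) + Real.pi / 2 * I by
      push_cast; ring, exp_add, exp_add, exp_int_mul_two_pi_mul_I, exp_pi_div_two_mul_I]
  ring

lemma thetaZero_tau_add (w τ : ℂ) : thetaZero w (τ + 4 * Real.pi * I) = thetaZero w τ := by
  refine tsum_congr fun m => ?_
  rw [show (m : ℂ) ^ 2 * (τ + 4 * Real.pi * I) =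
    m ^ 2 * τ + (2 * m ^ 2 : ℤ) * (2 * Real.pi * I) by push_cast; ring, exp_add,
    exp_int_mul_two_pi_mul_I]
  ring

lemma thetaOne_tau_add (w τ : ℂ) : thetaOne w (τ + 4 * Real.pi * I) = -thetaOne w τ := by
  rw [thetaOne, thetaOne, ← tsum_neg]
  refine tsum_congr fun m => ?_
  rw [show ((m : ℂ) + 1 / 2) ^ 2 * (τ + 4 * Real.pi * I) =
    (m + 1 / 2) ^ 2 * τ + (2 * (m ^ 2 + m) : ℤ) * (2 * Real.pi * I) + Real.pi * I by
      push_cast; ring, exp_add, exp_add, exp_int_mul_two_pi_mul_I, exp_pi_mul_I]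
  ring

/-! ### The product formula -/

/-- `(k, j) ↦ (k + j, k - 1 - j)` and `(j, k) ↦ (j + k, j - k)` enumerate the pairs of integers
with odd, respectively even, sum. -/
def parityEquiv : (ℤ × ℤ) ⊕ (ℤ × ℤ) ≃ ℤ × ℤ where
  toFun := Sum.elim (fun p => (p.1 + p.2, p.1 - 1 - p.2)) fun p => (p.1 + p.2, p.1 - p.2)
  invFun p := if (p.1 + p.2) % 2 = 0 then Sum.inr ((p.1 + p.2) / 2, (p.1 - p.2) / 2)
    else Sum.inl ((p.1 + p.2 + 1) / 2, (p.1 - p.2 - 1) / 2)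
  left_inv := by
    rintro (⟨k, j⟩ | ⟨j, k⟩)
    · have h : ¬ (k + j + (k - 1 - j)) % 2 = 0 := by omega
      refine (if_neg h).trans ?_
      simp only [Sum.elim_inl, Sum.inl.injEq, Prod.mk.injEq]
      constructor <;> omega
    · have h : (j + k + (j - k)) % 2 = 0 := by omega
      refine (if_pos h).trans ?_
      simp only [Sum.elim_inr, Sum.inr.injEq, Prod.mk.injEq]
      constructor <;> omega
  right_inv := by
    rintro ⟨m, n⟩
    dsimp only
    split_ifs with h
    · simp only [Sum.elim_inr, Prod.mk.injEq]
      constructor <;> omega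
    · simp only [Sum.elim_inl, Prod.mk.injEq]
      constructor <;> omega

/-- In the double sum, `x` carries the sum of the two half-integral indices and `y` their
difference. Splitting by parity along `parityEquiv` leaves products of single series: an even sum of
`m` and `n` gives `ϑ₁(x) ϑ₀(y)`, an odd one gives `-ϑ₀(x) ϑ₁(y)`. The result is a 2×2 minor, the
source of the quadratic identities used later. -/
lemma thetaSer_mul (x y : ℂ) {τ : ℂ} (hτ : τ.re < 0) :
    thetaSer (x + y) τ * thetaSer (x - y) τ =
      thetaOne x τ * thetaZero y τ - thetaZero x τ * thetaOne y τ := by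
  have s1 := summable_thetaSer (x + y) hτ
  have s2 := summable_thetaSer (x - y) hτ
  have hs := summable_mul_of_summable_norm s1.norm s2.norm
  have hs' := hs.comp_injective parityEquiv.injective
  rw [thetaSer, thetaSer, tsum_mul_tsum_of_summable_norm s1.norm s2.norm, ← parityEquiv.tsum_eq,
    Summable.tsum_sum (by exact hs'.comp_injective Sum.inl_injective)
      (by exact hs'.comp_injective Sum.inr_injective), thetaOne, thetaZero, thetaZero, thetaOne,
    tsum_mul_tsum_of_summable_norm (summable_thetaOne x hτ).norm (summable_thetaZero y hτ).norm,
    tsum_mul_tsum_of_summable_norm (summable_thetaZero x hτ).norm (summable_thetaOne y hτ).norm,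
    add_comm, sub_eq_add_neg (∑' _ : ℤ × ℤ, _), ← tsum_neg]
  congr 1
  · refine tsum_congr fun ⟨j, k⟩ => ?_
    simp only [parityEquiv, Equiv.coe_fn_mk, Sum.elim_inr]
    have : (-1 : ℂ) ^ (j + k) * (-1 : ℂ) ^ (j - k) = 1 := by
      rw [← zpow_add₀ (by norm_num), show j + k + (j - k) = 2 * j by ring, zpow_mul]
      norm_num
    rw [show ∀ a b c d e f : ℂ, a * b * c * (d * e * f) = a * d * (b * c * (e * f)) by
      intros; ring, this, one_mul, ← exp_add, ← exp_add, ← exp_add, ← exp_add, ← exp_add,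
      ← exp_add]
    push_cast
    ring_nf
  · refine tsum_congr fun ⟨k, j⟩ => ?_
    simp only [parityEquiv, Equiv.coe_fn_mk, Sum.elim_inl]
    have : (-1 : ℂ) ^ (k + j) * (-1 : ℂ) ^ (k - 1 - j) = -1 := by
      rw [← zpow_add₀ (by norm_num), show k + j + (k - 1 - j) = 2 * k - 1 by ring,
        zpow_sub₀ (by norm_num), zpow_mul]
      norm_num
    rw [show ∀ a b c d e f : ℂ, a * b * c * (d * e * f) = a * d * (b * c * (e * f)) by
      intros; ring, this, ← exp_add, ← exp_add, ← exp_add, ← exp_add, ← exp_add, ← exp_add]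
    push_cast
    ring_nf

/-! ## The Jacobi triple product -/

/-- `(q; q)_n = ∏_{m=1}^n (1 - q^m)`. -/
noncomputable def qFactorial (q : ℂ) (n : ℕ) : ℂ := ∏ m ∈ Finset.range n, (1 - q ^ (m + 1))

/-- `1 / (q; q)_n`, extended by zero to negative `n`. -/
noncomputable def invQFactorial (q : ℂ) : ℤ → ℂ
  | Int.ofNat n => (qFactorial q n)⁻¹
  | Int.negSucc _ => 0

lemma one_sub_pow_ne_zero {q : ℂ} (hq : ‖q‖ < 1) (n : ℕ) : 1 - q ^ (n + 1) ≠ 0 := by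
  intro h
  have h1 : ‖q ^ (n + 1)‖ = 1 := by rw [← sub_eq_zero.mp h, norm_one]
  rw [norm_pow] at h1
  exact (pow_lt_one₀ (norm_nonneg q) hq n.succ_ne_zero).ne h1

lemma qFactorial_ne_zero {q : ℂ} (hq : ‖q‖ < 1) (n : ℕ) : qFactorial q n ≠ 0 :=
  Finset.prod_ne_zero_iff.mpr fun m _ => one_sub_pow_ne_zero hq m

/-- Extension by zero is consistent with the recursion because the factor `1 - q^0` vanishes at `m =
0`. The recurrence thus needs no boundary cases. -/
lemma invQFactorial_sub_one {q : ℂ} (hq : ‖q‖ < 1) (m : ℤ) :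
    invQFactorial q (m - 1) = (1 - q ^ m) * invQFactorial q m := by
  match m with
  | Int.ofNat 0 => 
    rw [show (Int.ofNat 0 - 1 : ℤ) = Int.negSucc 0 by rfl]
    simp [invQFactorial]
  | Int.ofNat (n + 1) =>
    rw [show (Int.ofNat (n + 1) - 1 : ℤ) = Int.ofNat n by simp]
    simp only [invQFactorial, qFactorial, Finset.prod_range_succ, mul_inv]
    have h := one_sub_pow_ne_zero hq n
    rw [show q ^ (Int.ofNat (n + 1)) = q ^ (n + 1) from zpow_natCast q (n + 1)]
    field_simp
  | Int.negSucc n =>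
    rw [show (Int.negSucc n - 1 : ℤ) = Int.negSucc (n + 1) by rfl]
    simp [invQFactorial]

/-- The coefficients of the finite triple product. -/
noncomputable def tripleCoeff (q : ℂ) (N : ℕ) (j : ℤ) : ℂ :=
  qFactorial q (2 * N + 1) * invQFactorial q (N - j) * invQFactorial q (N + 1 + j)

/-- This is the effect on coefficients of multiplication by `(1 - q^{N+1} y)(1 - q^{N+1} y⁻¹)`.
Expressing all inverse factorials through the two with largest argument reduces it to a polynomial
identity in `A` and `B`. -/
lemma tripleCoeff_succ {q : ℂ} (hq : ‖q‖ < 1) (hq0 : q ≠ 0) (N : ℕ) (j : ℤ) :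
    tripleCoeff q (N + 1) j = (1 + q ^ (2 * N + 2)) * tripleCoeff q N j +
      q ^ ((N : ℤ) + 1 - j) * tripleCoeff q N (j - 1) +
      q ^ ((N : ℤ) + 2 + j) * tripleCoeff q N (j + 1) := by
  set A := q ^ ((N : ℤ) + 1 - j) with hA
  set B := q ^ ((N : ℤ) + 2 + j) with hB
  have hAB : A * B = q ^ (2 * N + 3) := by
    rw [hA, hB, ← zpow_add₀ hq0, ← zpow_natCast]
    congr 1
    push_cast; ring
  have a1 : q ^ ((N : ℤ) - j) = A / q := by
    rw [hA, div_eq_mul_inv, ← zpow_neg_one, ← zpow_add₀ hq0]; congr 1; ring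
  have b1 : q ^ ((N : ℤ) + 1 + j) = B / q := by
    rw [hB, div_eq_mul_inv, ← zpow_neg_one, ← zpow_add₀ hq0]; congr 1; ring
  have r1 : invQFactorial q (N - j) = (1 - A) * invQFactorial q (N + 1 - j) := by
    rw [← invQFactorial_sub_one hq]; congr 1; ring
  have r2 : invQFactorial q (N + 1 + j) = (1 - B) * invQFactorial q (N + 2 + j) := by
    rw [← invQFactorial_sub_one hq]; congr 1; ring
  have r3 : invQFactorial q (N - j - 1) = (1 - A / q) * ((1 - A) * invQFactorial q (N + 1 - j)) := by
    rw [invQFactorial_sub_one hq, r1, a1]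
  have r4 : invQFactorial q (N + j) = (1 - B / q) * ((1 - B) * invQFactorial q (N + 2 + j)) := by
    rw [← r2, ← b1, ← invQFactorial_sub_one hq]; congr 1; ring
  have f1 : qFactorial q (2 * (N + 1) + 1) =
      qFactorial q (2 * N + 1) * (1 - q ^ (2 * N + 2)) * (1 - q ^ (2 * N + 3)) := by
    simp only [qFactorial]
    rw [show 2 * (N + 1) + 1 = 2 * N + 1 + 1 + 1 by ring, Finset.prod_range_succ,
      Finset.prod_range_succ]
  have p2 : q ^ (2 * N + 2) = A * B / q := by
    rw [hAB]; field_simp; ring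
  simp only [tripleCoeff]
  push_cast
  rw [f1, p2, ← hAB, show (N : ℤ) + 1 + 1 + j = N + 2 + j by ring,
    show (N : ℤ) - (j - 1) = N + 1 - j by ring, show (N : ℤ) + 1 + (j - 1) = N + j by ring,
    show (N : ℤ) - (j + 1) = N - j - 1 by ring, show (N : ℤ) + 1 + (j + 1) = N + 2 + j by ring,
    r1, r2, r3, r4]
  field_simp
  ring

lemma norm_exp_lt_one {τ : ℂ} (hτ : τ.re < 0) : ‖exp τ‖ < 1 := by
  rw [norm_exp]
  simpa using hτ

/-- The finite form of the triple product identity. -/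
lemma hasSum_tripleCoeff (w : ℂ) {τ : ℂ} (hτ : τ.re < 0) (N : ℕ) :
    HasSum (fun j : ℤ => tripleCoeff (exp τ) N j *
        ((-1 : ℂ) ^ j * exp ((j : ℂ) * (j + 1) / 2 * τ) * exp ((j + 1 / 2) * w)))
      ((exp (w / 2) - exp (-w / 2)) * ∏ m ∈ Finset.range N,
        ((1 - exp ((m + 1) * τ + w)) * (1 - exp ((m + 1) * τ - w)))) := by
  have hq := norm_exp_lt_one hτ
  induction N with
  | zero =>
    -- For `N = 0` only `j = 0` and `j = -1` survive, giving `y^{1/2} - y^{-1/2}`.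
    have h : ∀ j ∉ ({0, -1} : Finset ℤ), tripleCoeff (exp τ) 0 j *
        ((-1 : ℂ) ^ j * exp ((j : ℂ) * (j + 1) / 2 * τ) * exp ((j + 1 / 2) * w)) = 0 := by
      intro j hj
      simp only [Finset.mem_insert, Finset.mem_singleton, not_or] at hj
      have : tripleCoeff (exp τ) 0 j = 0 := by
        rw [tripleCoeff]
        rcases lt_or_ge j 0 with h | h
        · obtain ⟨n, hn⟩ := Int.eq_negSucc_of_lt_zero (show ((0 : ℕ) : ℤ) + 1 + j < 0 by
            push_cast; omega)
          rw [hn]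
          simp [invQFactorial]
        · obtain ⟨n, hn⟩ := Int.eq_negSucc_of_lt_zero (show ((0 : ℕ) : ℤ) - j < 0 by
            push_cast; omega)
          rw [hn]
          simp [invQFactorial]
      rw [this, zero_mul]
    have : HasSum _ _ := hasSum_sum_of_ne_finset_zero h
    rw [Finset.sum_pair (by norm_num)] at this
    convert! this using 1
    have e1 : invQFactorial (exp τ) 0 = 1 := by
      change (qFactorial _ 0)⁻¹ = 1
      simp [qFactorial]
    have e2 : qFactorial (exp τ) 1 * invQFactorial (exp τ) 1 = 1 := by
      change _ * (qFactorial _ 1)⁻¹ = 1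
      exact mul_inv_cancel₀ (qFactorial_ne_zero hq 1)
    have c0 : tripleCoeff (exp τ) 0 0 = 1 := by
      simp [tripleCoeff, e1, e2]
    have c1 : tripleCoeff (exp τ) 0 (-1) = 1 := by
      simp [tripleCoeff, e1, e2]
    rw [c0, c1]
    norm_num
    ring_nf
  | succ N ih =>
    rw [Finset.prod_range_succ, ← mul_assoc]
    have i1 := (Equiv.addRight (-1 : ℤ)).hasSum_iff.mpr ih
    have i2 := (Equiv.addRight (1 : ℤ)).hasSum_iff.mpr ih
    have i3 := ((ih.mul_left (1 + exp τ ^ (2 * N + 2))).add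
      (i1.mul_left (-exp ((N + 1) * τ + w)))).add (i2.mul_left (-exp ((N + 1) * τ - w)))
    convert! i3 using 1
    · funext j
      rw [tripleCoeff_succ hq (exp_ne_zero _)]
      simp only [Function.comp, Equiv.coe_addRight, ← sub_eq_add_neg]
      have z1 : (-1 : ℂ) ^ (j - 1) = -(-1) ^ j := by
        rw [zpow_sub_one₀ (by norm_num)]; norm_num
      have z2 : (-1 : ℂ) ^ (j + 1) = -(-1) ^ j := by
        rw [zpow_add_one₀ (by norm_num)]; norm_num
      rw [z1, z2, add_mul, add_mul, ← exp_int_mul, ← exp_int_mul]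
      congr 1
      · congr 1
        · ring
        · rw [show ∀ a b c d e : ℂ, -a * (b * (-c * d * e)) = b * c * (a * d * e) by
            intros; ring, ← exp_add, ← exp_add]
          rw [show ∀ a b c d e : ℂ, a * b * (c * d * e) = b * c * (a * d * e) by
            intros; ring, ← exp_add, ← exp_add]
          push_cast
          ring_nf
      · rw [show ∀ a b c d e : ℂ, -a * (b * (-c * d * e)) = b * c * (a * d * e) by
            intros; ring, ← exp_add, ← exp_add]
        rw [show ∀ a b c d e : ℂ, a * b * (c * d * e) = b * c * (a * d * e) by
            intros; ring, ← exp_add, ← exp_add]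
        push_cast
        ring_nf
    · have : exp τ ^ (2 * N + 2) = exp ((N + 1) * τ + w) * exp ((N + 1) * τ - w) := by
        rw [← exp_nat_mul, ← exp_add]; push_cast; ring_nf
      rw [this]
      ring

lemma multipliable_one_sub_exp (w : ℂ) {τ : ℂ} (hτ : τ.re < 0) :
    Multipliable fun m : ℕ => 1 - exp ((m + 1) * τ + w) := by
  have hq := norm_exp_lt_one hτ
  have e : ∀ m : ℕ, 1 - exp ((m + 1) * τ + w) = 1 + (-(exp w * exp τ ^ (m + 1))) := by
    intro m
    rw [← exp_nat_mul, ← exp_add]; push_cast; ring_nf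
  simp only [e]
  refine multipliable_one_add_of_summable ?_
  simp only [norm_neg, norm_mul, norm_pow]
  exact ((summable_nat_add_iff 1).mpr
    (summable_geometric_of_lt_one (norm_nonneg _) hq)).mul_left _

lemma tprod_one_sub_exp_ne_zero {w τ : ℂ} (hτ : τ.re < 0)
    (h : ∀ m : ℕ, exp ((m + 1) * τ + w) ≠ 1) : ∏' m : ℕ, (1 - exp ((m + 1) * τ + w)) ≠ 0 := by
  have hq := norm_exp_lt_one hτ
  simp only [sub_eq_add_neg (1 : ℂ)]
  refine tprod_one_add_ne_zero_of_summable (fun m => ?_) ?_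
  · rw [← sub_eq_add_neg, sub_ne_zero]
    exact (h m).symm
  · have e : ∀ m : ℕ, ‖-exp ((m + 1) * τ + w)‖ = ‖exp w‖ * ‖exp τ‖ ^ (m + 1) := by
      intro m
      rw [norm_neg, ← norm_pow, ← norm_mul, ← exp_nat_mul, ← exp_add]; push_cast; ring_nf
    simp only [e]
    exact ((summable_nat_add_iff 1).mpr
      (summable_geometric_of_lt_one (norm_nonneg _) hq)).mul_left _

lemma qPochhammer_ne_zero {τ : ℂ} (hτ : τ.re < 0) : qPochhammer τ ≠ 0 := by
  have := tprod_one_sub_exp_ne_zero (w := 0) hτ fun m h => by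
    have h1 : ‖exp ((m + 1) * τ + 0)‖ = 1 := by rw [h, norm_one]
    rw [add_zero, norm_exp, Real.exp_eq_one_iff] at h1
    have h2 : (((m : ℂ) + 1) * τ).re = (m + 1) * τ.re := by simp
    rw [h2] at h1
    rcases mul_eq_zero.mp h1 with h | h
    · have : (0 : ℝ) < m + 1 := by positivity
      linarith
    · linarith
  simpa [qPochhammer] using this

lemma tendsto_qFactorial {τ : ℂ} (hτ : τ.re < 0) :
    Tendsto (qFactorial (exp τ)) atTop (𝓝 (qPochhammer τ)) := by
  have h := (multipliable_one_sub_exp 0 hτ).hasProd.tendsto_prod_nat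
  convert! h using 2 with n
  · rw [qFactorial]
    refine Finset.prod_congr rfl fun m _ => ?_
    rw [← exp_nat_mul, add_zero]; push_cast; ring_nf
  · simp [qPochhammer]

lemma tendsto_invQFactorial {τ : ℂ} (hτ : τ.re < 0) :
    Tendsto (invQFactorial (exp τ)) atTop (𝓝 (qPochhammer τ)⁻¹) := by
  have h := (tendsto_qFactorial hτ).inv₀ (qPochhammer_ne_zero hτ)
  have h2 : Tendsto (fun m : ℤ => (qFactorial (exp τ) m.toNat)⁻¹) atTop (𝓝 (qPochhammer τ)⁻¹) :=
    h.comp (tendsto_atTop_atTop.mpr fun b => ⟨b, fun a ha => by omega⟩)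
  refine h2.congr' ?_
  filter_upwards [eventually_ge_atTop 0] with m hm
  obtain ⟨n, rfl⟩ := Int.eq_ofNat_of_zero_le hm
  rfl

lemma exists_bound_invQFactorial {τ : ℂ} (hτ : τ.re < 0) :
    ∃ C, ∀ m, ‖invQFactorial (exp τ) m‖ ≤ C := by
  obtain ⟨C, hC⟩ :=
    ((tendsto_qFactorial hτ).inv₀ (qPochhammer_ne_zero hτ)).norm.bddAbove_range
  refine ⟨C, fun m => ?_⟩
  match m with
  | Int.ofNat n => exact hC ⟨n, rfl⟩
  | Int.negSucc n =>
    refine le_trans ?_ (hC ⟨0, rfl⟩)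
    simp [invQFactorial]

/-- The Jacobi triple product identity. -/
theorem thetaSer_eq (w : ℂ) {τ : ℂ} (hτ : τ.re < 0) :
    thetaSer w τ = exp (τ / 8) * qPochhammer τ * theta τ w := by
  have hlim : Tendsto (fun N : ℕ => (exp (w / 2) - exp (-w / 2)) * ∏ m ∈ Finset.range N,
        ((1 - exp ((m + 1) * τ + w)) * (1 - exp ((m + 1) * τ - w)))) atTop
      (𝓝 (theta τ w)) := by
    have := (multipliable_one_sub_exp w hτ).mul (multipliable_one_sub_exp (-w) hτ)
    simp only [← sub_eq_add_neg] at this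
    exact this.hasProd.tendsto_prod_nat.const_mul _
  obtain ⟨C, hC⟩ := exists_bound_invQFactorial hτ
  obtain ⟨D, hD⟩ := (tendsto_qFactorial hτ).norm.bddAbove_range
  have hC0 : 0 ≤ C := (norm_nonneg _).trans (hC 0)
  have hD0 : 0 ≤ D := (norm_nonneg _).trans (hD ⟨0, rfl⟩)
  have hterm : ∀ j : ℤ, (-1 : ℂ) ^ j * exp ((j : ℂ) * (j + 1) / 2 * τ) * exp ((j + 1 / 2) * w) =
      exp (-τ / 8) * ((-1 : ℂ) ^ j * exp (((j : ℂ) + 1 / 2) ^ 2 / 2 * τ) *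
        exp ((j + 1 / 2) * w)) := by
    intro j
    rw [show (j : ℂ) * (j + 1) / 2 * τ = -τ / 8 + (j + 1 / 2) ^ 2 / 2 * τ by ring, exp_add]
    ring
  have hcoef : ∀ j : ℤ, Tendsto (fun N => tripleCoeff (exp τ) N j) atTop
      (𝓝 (qPochhammer τ)⁻¹) := by
    intro j
    have t0 : Tendsto (fun N : ℕ => 2 * N + 1) atTop atTop :=
      tendsto_atTop_mono (fun N => by simp only [id]; omega) tendsto_id
    have t1 : Tendsto (fun N : ℕ => (N : ℤ) - j) atTop atTop :=
      tendsto_atTop_add_const_right _ _ tendsto_natCast_atTop_atTop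
    have t2 : Tendsto (fun N : ℕ => (N : ℤ) + 1 + j) atTop atTop :=
      tendsto_atTop_add_const_right _ _
        (tendsto_atTop_add_const_right _ _ tendsto_natCast_atTop_atTop)
    have := (((tendsto_qFactorial hτ).comp t0).mul ((tendsto_invQFactorial hτ).comp t1)).mul
      ((tendsto_invQFactorial hτ).comp t2)
    convert! this using 2
    have := qPochhammer_ne_zero hτ
    field_simp
  -- Each coefficient tends to `1/(q;q)_∞`. They are uniformly bounded by `D * C * C`, so the theta
  -- series dominates and the limit in `N` passes inside the sum.
  have hlim2 := tendsto_tsum_of_dominated_convergence (𝓕 := atTop)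
    (f := fun (N : ℕ) (j : ℤ) => tripleCoeff (exp τ) N j *
        ((-1 : ℂ) ^ j * exp ((j : ℂ) * (j + 1) / 2 * τ) * exp ((j + 1 / 2) * w)))
    (g := fun j : ℤ => (qPochhammer τ)⁻¹ *
        ((-1 : ℂ) ^ j * exp ((j : ℂ) * (j + 1) / 2 * τ) * exp ((j + 1 / 2) * w)))
    (bound := fun j : ℤ => D * C * C * ‖(-1 : ℂ) ^ j * exp ((j : ℂ) * (j + 1) / 2 * τ) *
      exp ((j + 1 / 2) * w)‖)
    (by
      simp only [hterm]
      exact (((summable_thetaSer w hτ).mul_left _).norm).mul_left _)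
    (fun j => (hcoef j).mul_const _)
    (Eventually.of_forall fun N j => by
      rw [norm_mul]
      refine mul_le_mul_of_nonneg_right ?_ (norm_nonneg _)
      rw [tripleCoeff, norm_mul, norm_mul]
      exact mul_le_mul (mul_le_mul (hD ⟨_, rfl⟩) (hC _) (norm_nonneg _) hD0) (hC _)
        (norm_nonneg _) (mul_nonneg hD0 hC0))
  simp only [(hasSum_tripleCoeff w hτ _).tsum_eq] at hlim2
  have := tendsto_nhds_unique hlim hlim2
  rw [this, tsum_mul_left]
  simp only [hterm]
  rw [tsum_mul_left, ← thetaSer]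
  have h0 := qPochhammer_ne_zero hτ
  rw [show -τ / 8 = -(τ / 8) by ring, exp_neg]
  field_simp

/-- `q^{1/8} (q; q)_∞`. -/
noncomputable def thetaScale (τ : ℂ) : ℂ := exp (τ / 8) * qPochhammer τ

lemma thetaScale_ne_zero {τ : ℂ} (hτ : τ.re < 0) : thetaScale τ ≠ 0 :=
  mul_ne_zero (exp_ne_zero _) (qPochhammer_ne_zero hτ)

lemma theta_eq (w : ℂ) {τ : ℂ} (hτ : τ.re < 0) : theta τ w = thetaSer w τ / thetaScale τ := by
  rw [thetaSer_eq w hτ, ← thetaScale, mul_div_cancel_left₀ _ (thetaScale_ne_zero hτ)]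

lemma thetaSer_ne_zero {w τ : ℂ} (hτ : τ.re < 0) (h0 : exp w ≠ 1)
    (h₁ : ∀ m : ℕ, exp ((m + 1) * τ + w) ≠ 1) (h₂ : ∀ m : ℕ, exp ((m + 1) * τ - w) ≠ 1) :
    thetaSer w τ ≠ 0 := by
  rw [thetaSer_eq w hτ, theta]
  refine mul_ne_zero (thetaScale_ne_zero hτ) (mul_ne_zero ?_ ?_)
  · intro h
    apply h0
    rw [sub_eq_zero] at h
    rw [show w = w / 2 + w / 2 by ring, exp_add]
    nth_rewrite 1 [h]
    rw [← exp_add]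
    ring_nf
    exact exp_zero
  · simp only [sub_eq_add_neg ((_ : ℂ) * τ)] at h₂ ⊢
    rw [(multipliable_one_sub_exp w hτ).tprod_mul (multipliable_one_sub_exp (-w) hτ)]
    exact mul_ne_zero (tprod_one_sub_exp_ne_zero hτ h₁) (tprod_one_sub_exp_ne_zero hτ h₂)

lemma exp_ne_one_of_re {u : ℂ} (h : u.re ≠ 0) : exp u ≠ 1 := by
  intro he
  have : ‖exp u‖ = 1 := by rw [he, norm_one]
  rw [norm_exp, Real.exp_eq_one_iff] at this
  exact h this

lemma thetaSer_pi_ne_zero {τ : ℂ} (hτ : τ.re < 0) : thetaSer (Real.pi * I) τ ≠ 0 := by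
  have hm : ∀ m : ℕ, ((m : ℝ) + 1) * τ.re ≠ 0 := fun m =>
    mul_ne_zero (by positivity) hτ.ne
  refine thetaSer_ne_zero hτ ?_ (fun m => exp_ne_one_of_re ?_) fun m => exp_ne_one_of_re ?_
  · rw [exp_pi_mul_I]; norm_num
  · simpa using hm m
  · simpa using hm m

/-- Up to an exponential, this theta constant is a value of `thetaSer` for `q²`, at a point that the
product formula shows not to be a zero. Nonvanishing here and in `thetaOne_zero_ne_zero` allows `f₁`
and `f₂` to be isolated by division. -/
lemma thetaZero_zero_ne_zero {τ : ℂ} (hτ : τ.re < 0) : thetaZero 0 τ ≠ 0 := by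
  have h2 : (2 * τ).re < 0 := by simp; linarith
  have hne : thetaSer (-τ + Real.pi * I) (2 * τ) ≠ 0 := by
    refine thetaSer_ne_zero h2 (exp_ne_one_of_re ?_) (fun m => exp_ne_one_of_re ?_) fun m =>
      exp_ne_one_of_re ?_
    · simpa using hτ.ne
    · have : ((2 : ℝ) * m + 1) * τ.re ≠ 0 := mul_ne_zero (by positivity) hτ.ne
      intro h; apply this; simp at h; linarith
    · have : ((2 : ℝ) * m + 3) * τ.re ≠ 0 := mul_ne_zero (by positivity) hτ.ne
      intro h; apply this; simp at h; linarith
  intro h0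
  apply hne
  have : thetaSer (-τ + Real.pi * I) (2 * τ) = exp (-τ / 4 + Real.pi / 2 * I) * thetaZero 0 τ := by
    rw [thetaSer, thetaZero, ← tsum_mul_left]
    refine tsum_congr fun m => ?_
    rw [neg_one_zpow_eq_exp, ← exp_add, ← exp_add, ← exp_add, ← exp_add]
    rw [show (m : ℂ) * (Real.pi * I) + ((m : ℂ) + 1 / 2) ^ 2 / 2 * (2 * τ) +
      (m + 1 / 2) * (-τ + Real.pi * I) = -τ / 4 + Real.pi / 2 * I + (m ^ 2 * τ + 2 * m * 0) +
      m * (2 * Real.pi * I) by ring, exp_add _ (m * (2 * Real.pi * I)), exp_int_mul_two_pi_mul_I,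
      mul_one]
  rw [this, h0, mul_zero]

lemma thetaOne_zero_ne_zero {τ : ℂ} (hτ : τ.re < 0) : thetaOne 0 τ ≠ 0 := by
  have h2 : (2 * τ).re < 0 := by simp; linarith
  intro h0
  apply thetaSer_pi_ne_zero h2
  have : thetaSer (Real.pi * I) (2 * τ) = exp (Real.pi / 2 * I) * thetaOne 0 τ := by
    rw [thetaSer, thetaOne, ← tsum_mul_left]
    refine tsum_congr fun m => ?_
    rw [neg_one_zpow_eq_exp, ← exp_add, ← exp_add, ← exp_add, ← exp_add]
    rw [show (m : ℂ) * (Real.pi * I) + ((m : ℂ) + 1 / 2) ^ 2 / 2 * (2 * τ) +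
      (m + 1 / 2) * (Real.pi * I) = Real.pi / 2 * I + ((m + 1 / 2) ^ 2 * τ + (2 * m + 1) * 0) +
      m * (2 * Real.pi * I) by ring, exp_add _ (m * (2 * Real.pi * I)), exp_int_mul_two_pi_mul_I,
      mul_one]
  rw [this, h0, mul_zero]

lemma differentiableOn_thetaScale : DifferentiableOn ℂ thetaScale {τ | τ.re < 0} := by
  have h := ModularForm.differentiableOn_tprod_one_sub_pow
  have e : Set.EqOn thetaScale (fun τ => exp (τ / 8) * ∏' n : ℕ, (1 - exp τ ^ (n + 1)))
      {τ | τ.re < 0} := fun τ _ => by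
    simp only [thetaScale, qPochhammer, ← exp_nat_mul]
    push_cast
    rfl
  refine DifferentiableOn.congr ?_ e
  refine DifferentiableOn.mul (by fun_prop) ?_
  exact h.comp (by fun_prop) fun τ hτ => by simpa using norm_exp_lt_one hτ

lemma tendsto_exp_qToZero : Tendsto exp qToZero (𝓝 0) := by
  rw [tendsto_zero_iff_norm_tendsto_zero]
  simp only [norm_exp]
  exact Real.tendsto_exp_atBot.comp tendsto_comap

lemma tendsto_qPochhammer : Tendsto qPochhammer qToZero (𝓝 1) := by
  have h := ModularForm.differentiableOn_tprod_one_sub_pow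
  have hc := (h.differentiableAt (Metric.ball_mem_nhds (0 : ℂ) one_pos)).continuousAt.tendsto
  simp only [ne_eq, Nat.add_eq_zero_iff, one_ne_zero, and_false, not_false_eq_true, zero_pow,
    sub_zero, tprod_one] at hc
  have := hc.comp tendsto_exp_qToZero
  refine this.congr fun τ => ?_
  simp only [Function.comp, qPochhammer, ← exp_nat_mul]
  push_cast
  rfl

/-! ## Theta function identities -/

/-- Weierstrass' three-term identity. -/
lemma thetaSer_weierstrass (x y u w : ℂ) {τ : ℂ} (hτ : τ.re < 0) :
    thetaSer (x + y) τ * thetaSer (x - y) τ * (thetaSer (u + w) τ * thetaSer (u - w) τ) +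
      thetaSer (x + u) τ * thetaSer (x - u) τ * (thetaSer (w + y) τ * thetaSer (w - y) τ) +
      thetaSer (x + w) τ * thetaSer (x - w) τ * (thetaSer (y + u) τ * thetaSer (y - u) τ) = 0 := by
  -- Each product becomes a minor of a 2×4 matrix, and the claim is its three-term Plücker relation.
  simp only [thetaSer_mul _ _ hτ]
  ring

/-- The three vectors `(ϑ₀, ϑ₁)` at `v`, `z - a - v` and `z + a + v` lie in a plane. Cramer's linear
relation among them has the minors of `thetaSer_mul` as coefficients; this is its first coordinate,
and `thetaOne_plucker` is the second. -/
lemma thetaZero_plucker (a z v : ℂ) {τ : ℂ} (hτ : τ.re < 0) :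
    thetaSer (z - a) τ * thetaSer (2 * v + a - z) τ * thetaZero (z + a + v) τ +
      thetaSer (z + a + 2 * v) τ * thetaSer (z + a) τ * thetaZero (v + a - z) τ =
      thetaZero v τ * (thetaSer (2 * v + 2 * a) τ * thetaSer (2 * z) τ) := by
  have e1 := thetaSer_mul v (z - a - v) hτ
  have e2 := thetaSer_mul (z + a + v) v hτ
  have e3 := thetaSer_mul (z + a + v) (v + a - z) hτ
  have n0 := thetaZero_neg (z - a - v) τ
  have n1 := thetaOne_neg (z - a - v) τ
  rw [show -(z - a - v) = v + a - z by ring] at n0 n1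
  rw [← n0, ← n1] at e1
  ring_nf at e1 e2 e3 ⊢
  linear_combination thetaZero (v + z + a) τ * e1 + thetaZero (v - z + a) τ * e2 -
    thetaZero v τ * e3

lemma thetaOne_plucker (a z v : ℂ) {τ : ℂ} (hτ : τ.re < 0) :
    thetaSer (z - a) τ * thetaSer (2 * v + a - z) τ * thetaOne (z + a + v) τ +
      thetaSer (z + a + 2 * v) τ * thetaSer (z + a) τ * thetaOne (v + a - z) τ =
      thetaOne v τ * (thetaSer (2 * v + 2 * a) τ * thetaSer (2 * z) τ) := by
  have e1 := thetaSer_mul v (z - a - v) hτ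
  have e2 := thetaSer_mul (z + a + v) v hτ
  have e3 := thetaSer_mul (z + a + v) (v + a - z) hτ
  have n0 := thetaZero_neg (z - a - v) τ
  have n1 := thetaOne_neg (z - a - v) τ
  rw [show -(z - a - v) = v + a - z by ring] at n0 n1
  rw [← n0, ← n1] at e1
  ring_nf at e1 e2 e3 ⊢
  linear_combination thetaOne (v + z + a) τ * e1 + thetaOne (v - z + a) τ * e2 -
    thetaOne v τ * e3

/-- The four-term identity behind the holomorphy of the off-diagonal stable envelope. -/
lemma thetaSer_fourTerm (a z v : ℂ) {τ : ℂ} (hτ : τ.re < 0) :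
    thetaSer (-2 * v) τ * (thetaSer (-2 * a) τ * thetaSer (v + 2 * z - a) τ *
        thetaSer (-v + z) τ + thetaSer (-v - a) τ * thetaSer (v + z - 2 * a) τ *
        thetaSer (-2 * z) τ) * thetaSer (z + a + 2 * v) τ =
      thetaSer (-v + a) τ * thetaSer (v + z) τ *
        (thetaSer (2 * v + a - z) τ * thetaSer (2 * v + 2 * z) τ * thetaSer (2 * a) τ +
          thetaSer (2 * v + z - a) τ * thetaSer (2 * v + 2 * a) τ * thetaSer (2 * z) τ) := by
  -- Two instances of Weierstrass' identity share a product containing the auxiliary factor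
  -- `thetaSer (3 * v + z)`. The factors `thetaSer (2 * a)` and `thetaSer (2 * z)` in the final
  -- combination make it cancel.
  have W1 := thetaSer_weierstrass ((4 * v + z + a) / 2) ((-z - a) / 2) ((3 * z - a) / 2)
    ((2 * v + z - a) / 2) hτ
  have W2 := thetaSer_weierstrass ((4 * v + z + a) / 2) ((-z - a) / 2) ((2 * v + z - a) / 2)
    ((z - 3 * a) / 2) hτ
  rw [show (4 * v + z + a) / 2 + (-z - a) / 2 = 2 * v by ring,
    show (4 * v + z + a) / 2 - (-z - a) / 2 = z + a + 2 * v by ring,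
    show (3 * z - a) / 2 + (2 * v + z - a) / 2 = v + 2 * z - a by ring,
    show (3 * z - a) / 2 - (2 * v + z - a) / 2 = -v + z by ring,
    show (4 * v + z + a) / 2 + (3 * z - a) / 2 = 2 * v + 2 * z by ring,
    show (4 * v + z + a) / 2 - (3 * z - a) / 2 = 2 * v + a - z by ring,
    show (2 * v + z - a) / 2 + (-z - a) / 2 = -(-v + a) by ring,
    show (2 * v + z - a) / 2 - (-z - a) / 2 = v + z by ring,
    show (4 * v + z + a) / 2 + (2 * v + z - a) / 2 = 3 * v + z by ring,
    show (4 * v + z + a) / 2 - (2 * v + z - a) / 2 = -(-v - a) by ring,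
    show (-z - a) / 2 + (3 * z - a) / 2 = z - a by ring,
    show (-z - a) / 2 - (3 * z - a) / 2 = -(2 * z) by ring] at W1
  rw [show (4 * v + z + a) / 2 + (-z - a) / 2 = 2 * v by ring,
    show (4 * v + z + a) / 2 - (-z - a) / 2 = z + a + 2 * v by ring,
    show (2 * v + z - a) / 2 + (z - 3 * a) / 2 = v + z - 2 * a by ring,
    show (2 * v + z - a) / 2 - (z - 3 * a) / 2 = -(-v - a) by ring,
    show (4 * v + z + a) / 2 + (2 * v + z - a) / 2 = 3 * v + z by ring,
    show (4 * v + z + a) / 2 - (2 * v + z - a) / 2 = -(-v - a) by ring,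
    show (z - 3 * a) / 2 + (-z - a) / 2 = -(2 * a) by ring,
    show (z - 3 * a) / 2 - (-z - a) / 2 = z - a by ring,
    show (4 * v + z + a) / 2 + (z - 3 * a) / 2 = 2 * v + z - a by ring,
    show (4 * v + z + a) / 2 - (z - 3 * a) / 2 = 2 * v + 2 * a by ring,
    show (-z - a) / 2 + (2 * v + z - a) / 2 = -(-v + a) by ring,
    show (-z - a) / 2 - (2 * v + z - a) / 2 = -(v + z) by ring] at W2
  simp only [neg_mul (2 : ℂ), thetaSer_neg] at W1 W2 ⊢
  linear_combination thetaSer (2 * a) τ * W1 - thetaSer (2 * z) τ * W2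

/-! ## Factorization of the series -/

lemma seriesOneOne_eq (p : Fin 2) (x : Cover) (τ : ℂ) :
    seriesOneOne p x τ = thetaSer (x.2.1 + 2 * x.2.2 - eps p * x.1) τ := by
  refine tsum_congr fun m => ?_
  rw [O, mul_assoc, mul_assoc, mul_assoc, ← exp_add]
  ring_nf

/-- After `𝒪` is expanded, the monomial is `(z a^{-ε} v)^{2l} (z a^{ε})^{m+1/2}`, so the double sum
separates. -/
lemma seriesTwoA_eq (p : Fin 2) (x : Cover) {τ : ℂ} (hτ : τ.re < 0) :
    seriesTwoA p x τ = thetaZero (x.2.1 - eps p * x.1 + x.2.2) τ *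
      thetaSer (x.2.1 + eps p * x.1) τ := by
  rw [thetaZero, thetaSer, tsum_mul_tsum_of_summable_norm (summable_thetaZero _ hτ).norm
    (summable_thetaSer _ hτ).norm]
  refine tsum_congr fun n => ?_
  rw [O, show ∀ a b c d e : ℂ, a * b * (c * d * e) = c * (a * b * d * e) by intros; ring,
    mul_assoc, mul_assoc, mul_assoc, ← exp_add, ← exp_add, ← exp_add, ← exp_add, ← exp_add,
    ← exp_add]
  ring_nf

lemma seriesTwoB_eq (p : Fin 2) (x : Cover) {τ : ℂ} (hτ : τ.re < 0) :
    seriesTwoB p x τ = thetaOne (x.2.1 - eps p * x.1 + x.2.2) τ *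
      thetaSer (x.2.1 + eps p * x.1) τ := by
  rw [thetaOne, thetaSer, tsum_mul_tsum_of_summable_norm (summable_thetaOne _ hτ).norm
    (summable_thetaSer _ hτ).norm]
  refine tsum_congr fun n => ?_
  rw [O, show ∀ a b c d e : ℂ, a * b * (c * d * e) = c * (a * b * d * e) by intros; ring,
    mul_assoc, mul_assoc, mul_assoc, ← exp_add, ← exp_add, ← exp_add, ← exp_add, ← exp_add,
    ← exp_add]
  ring_nf

/-! ## The elliptic stable basis in terms of theta series -/

lemma stabEll_zero_zero (x : Cover) {τ : ℂ} (hτ : τ.re < 0) :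
    stabEll x τ 0 0 = thetaSer (2 * x.1) τ * thetaSer (2 * x.2.2 + 2 * x.2.1) τ /
      thetaScale τ ^ 2 := by
  simp only [stabEll, Matrix.of_apply, Matrix.cons_val', Matrix.cons_val_zero,
    theta_eq _ hτ]
  rw [show -2 * x.1 = -(2 * x.1) by ring,
    show -2 * x.2.2 - 2 * x.2.1 = -(2 * x.2.2 + 2 * x.2.1) by ring, thetaSer_neg, thetaSer_neg]
  ring

lemma stabEll_one_zero (x : Cover) (τ : ℂ) : stabEll x τ 1 0 = 0 := by
  simp [stabEll]

lemma stabEll_one_one (x : Cover) {τ : ℂ} (hτ : τ.re < 0) :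
    stabEll x τ 1 1 = thetaSer (2 * x.2.2 + 2 * x.1) τ * thetaSer (2 * x.2.1) τ /
      thetaScale τ ^ 2 := by
  simp only [stabEll, Matrix.of_apply, Matrix.cons_val', Matrix.cons_val_one,
    Matrix.cons_val_fin_one, theta_eq _ hτ]
  rw [show -2 * x.2.1 = -(2 * x.2.1) by ring,
    show -2 * x.2.2 - 2 * x.1 = -(2 * x.2.2 + 2 * x.1) by ring, thetaSer_neg, thetaSer_neg]
  ring

/-- The numerator of the off-diagonal entry of the elliptic stable basis. -/
noncomputable def stabNum (a z v τ : ℂ) : ℂ :=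
  thetaSer (-2 * v) τ * (thetaSer (-2 * a) τ * thetaSer (v + 2 * z - a) τ *
        thetaSer (-v + z) τ + thetaSer (-v - a) τ * thetaSer (v + z - 2 * a) τ *
        thetaSer (-2 * z) τ)

lemma stabEll_zero_one (x : Cover) {τ : ℂ} (hτ : τ.re < 0) :
    stabEll x τ 0 1 = stabNum x.1 x.2.1 x.2.2 τ / (thetaSer (-x.2.2 + x.1) τ *
      thetaSer (x.2.2 + x.2.1) τ * thetaScale τ ^ 2) := by
  have h := thetaScale_ne_zero hτ
  simp only [stabEll, stabNum, Matrix.of_apply, Matrix.cons_val', Matrix.cons_val_one,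
    Matrix.cons_val_fin_one, Matrix.cons_val_zero, theta_eq _ hτ]
  field_simp

lemma theta_den_ne_zero_iff (x : Cover) {τ : ℂ} (hτ : τ.re < 0) :
    theta τ (-x.2.2 + x.1) * theta τ (x.2.2 + x.2.1) ≠ 0 ↔
      thetaSer (-x.2.2 + x.1) τ * thetaSer (x.2.2 + x.2.1) τ ≠ 0 := by
  have h := thetaScale_ne_zero hτ
  rw [theta_eq _ hτ, theta_eq _ hτ]
  simp [h]

/-- One extra theta factor trades both denominators for an expression symmetric under `a ↔ z`. In
this form the off-diagonal entry can be compared with the duality and its slope limits can be read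
off. -/
lemma stabEll_zero_one_mul (x : Cover) {τ : ℂ} (hτ : τ.re < 0)
    (hd : thetaSer (-x.2.2 + x.1) τ * thetaSer (x.2.2 + x.2.1) τ ≠ 0) :
    stabEll x τ 0 1 * thetaSer (x.2.1 + x.1 + 2 * x.2.2) τ =
      (thetaSer (2 * x.2.2 + x.1 - x.2.1) τ * thetaSer (2 * x.2.2 + 2 * x.2.1) τ *
          thetaSer (2 * x.1) τ +
        thetaSer (2 * x.2.2 + x.2.1 - x.1) τ * thetaSer (2 * x.2.2 + 2 * x.1) τ *
          thetaSer (2 * x.2.1) τ) / thetaScale τ ^ 2 := by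
  have h := thetaScale_ne_zero hτ
  rw [stabEll_zero_one x hτ, div_mul_eq_mul_div, stabNum, thetaSer_fourTerm _ _ _ hτ]
  obtain ⟨d1, d2⟩ := mul_ne_zero_iff.mp hd
  field_simp

/-! ## The bilinear identity for the explicit series -/

/-- `f₁ ϑ₀(w) + f₂ ϑ₁(w)`. -/
noncomputable def thetaMix (f₁ f₂ : ℂ → ℂ → ℂ) (ν w τ : ℂ) : ℂ :=
  f₁ ν τ * thetaZero w τ + f₂ ν τ * thetaOne w τ

lemma thetaMix_plucker (f₁ f₂ : ℂ → ℂ → ℂ) (ν a z v : ℂ) {τ : ℂ} (hτ : τ.re < 0) :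
    thetaSer (z - a) τ * thetaSer (2 * v + a - z) τ * thetaMix f₁ f₂ ν (z + a + v) τ +
      thetaSer (z + a + 2 * v) τ * thetaSer (z + a) τ * thetaMix f₁ f₂ ν (v + a - z) τ =
      thetaMix f₁ f₂ ν v τ * (thetaSer (2 * v + 2 * a) τ * thetaSer (2 * z) τ) := by
  simp only [thetaMix]
  linear_combination f₁ ν τ * thetaZero_plucker a z v hτ + f₂ ν τ * thetaOne_plucker a z v hτ

/-- `E` is given by the explicit series with coefficients `f₀, f₁, f₂`. -/
def IsSeries (f₀ f₁ f₂ : ℂ → ℂ → ℂ) (E : Fin 2 → Fin 2 → MultiFun) : Prop :=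
  ∀ τ : ℂ, τ.re < 0 →
    (∀ p x, E 0 p x τ = f₁ x.2.2 τ * seriesTwoA p x τ + f₂ x.2.2 τ * seriesTwoB p x τ) ∧
    ∀ p x, E 1 p x τ = f₀ x.2.2 τ * seriesOneOne p x τ

lemma isSeries_iff {f₀ f₁ f₂ : ℂ → ℂ → ℂ} {E : Fin 2 → Fin 2 → MultiFun} :
    IsSeries f₀ f₁ f₂ E ↔ ∀ τ : ℂ, τ.re < 0 →
      (∀ p x, E 0 p x τ = thetaMix f₁ f₂ x.2.2 (x.2.1 - eps p * x.1 + x.2.2) τ *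
        thetaSer (x.2.1 + eps p * x.1) τ) ∧
      ∀ p x, E 1 p x τ = f₀ x.2.2 τ * thetaSer (x.2.1 + 2 * x.2.2 - eps p * x.1) τ := by
  refine forall_congr' fun τ => forall_congr' fun hτ => and_congr ?_ ?_
  · refine forall_congr' fun p => forall_congr' fun x => ?_
    rw [seriesTwoA_eq _ _ hτ, seriesTwoB_eq _ _ hτ, thetaMix, add_mul, mul_assoc, mul_assoc]
  · refine forall_congr' fun p => forall_congr' fun x => ?_
    rw [seriesOneOne_eq]

section Bilinear

variable {f₀ f₁ f₂ : ℂ → ℂ → ℂ} {E : Fin 2 → Fin 2 → MultiFun}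

lemma matE_mul_one_one (hE : IsSeries f₀ f₁ f₂ E) (x : Cover) {τ : ℂ} (hτ : τ.re < 0) :
    (matE E x τ * (matEDual E x τ).transpose) 1 1 = f₀ x.2.2 τ * thetaMix f₁ f₂ x.2.2 x.2.2 τ *
      (thetaSer (2 * x.2.2 + 2 * x.1) τ * thetaSer (2 * x.2.1) τ) := by
  obtain ⟨h0, h1⟩ := isSeries_iff.mp hE τ hτ
  have e := thetaMix_plucker f₁ f₂ x.2.2 x.1 x.2.1 x.2.2 hτ
  simp only [matE, matEDual, dualE, swapAZ, Matrix.mul_apply, Fin.sum_univ_two,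
    Matrix.transpose_apply, Matrix.of_apply, Matrix.cons_val', Matrix.cons_val_zero,
    Matrix.cons_val_one, Matrix.cons_val_fin_one, h0, h1, eps]
  ring_nf at e ⊢
  linear_combination f₀ x.2.2 τ * e

lemma matE_mul_zero_zero (hE : IsSeries f₀ f₁ f₂ E) (x : Cover) {τ : ℂ} (hτ : τ.re < 0) :
    (matE E x τ * (matEDual E x τ).transpose) 0 0 = f₀ x.2.2 τ * thetaMix f₁ f₂ x.2.2 x.2.2 τ *
      (thetaSer (2 * x.1) τ * thetaSer (2 * x.2.2 + 2 * x.2.1) τ) := by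
  obtain ⟨h0, h1⟩ := isSeries_iff.mp hE τ hτ
  have e := thetaMix_plucker f₁ f₂ x.2.2 x.2.1 x.1 x.2.2 hτ
  simp only [matE, matEDual, dualE, swapAZ, Matrix.mul_apply, Fin.sum_univ_two,
    Matrix.transpose_apply, Matrix.of_apply, Matrix.cons_val', Matrix.cons_val_zero,
    Matrix.cons_val_one, Matrix.cons_val_fin_one, h0, h1, eps]
  ring_nf at e ⊢
  linear_combination f₀ x.2.2 τ * e

/-- The two summands differ only by the sign of the argument `z - a`, so they cancel by oddness. -/
lemma matE_mul_one_zero (hE : IsSeries f₀ f₁ f₂ E) (x : Cover) {τ : ℂ} (hτ : τ.re < 0) :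
    (matE E x τ * (matEDual E x τ).transpose) 1 0 = 0 := by
  obtain ⟨h0, h1⟩ := isSeries_iff.mp hE τ hτ
  simp only [matE, matEDual, dualE, swapAZ, Matrix.mul_apply, Fin.sum_univ_two,
    Matrix.transpose_apply, Matrix.of_apply, Matrix.cons_val', Matrix.cons_val_zero,
    Matrix.cons_val_one, Matrix.cons_val_fin_one, h0, h1, eps]
  have := thetaSer_neg (x.2.1 - x.1) τ
  ring_nf at this ⊢
  linear_combination f₀ x.2.2 τ * thetaMix f₁ f₂ x.2.2 (x.2.1 + x.1 + x.2.2) τ *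
    thetaSer (x.2.1 + x.1 + x.2.2 * 2) τ * this

/-- Weight the three-term relation and its mirror under `a ↔ z` by the two factors `thetaSer (2v ±
(a - z))` and add. The surplus terms cancel because `thetaSer (z - a)` is odd. -/
lemma matE_mul_zero_one (hE : IsSeries f₀ f₁ f₂ E) (x : Cover) {τ : ℂ} (hτ : τ.re < 0) :
    (matE E x τ * (matEDual E x τ).transpose) 0 1 * thetaSer (x.2.1 + x.1 + 2 * x.2.2) τ =
      f₀ x.2.2 τ * thetaMix f₁ f₂ x.2.2 x.2.2 τ *
      (thetaSer (2 * x.2.2 + x.1 - x.2.1) τ * thetaSer (2 * x.2.2 + 2 * x.2.1) τ *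
          thetaSer (2 * x.1) τ +
        thetaSer (2 * x.2.2 + x.2.1 - x.1) τ * thetaSer (2 * x.2.2 + 2 * x.1) τ *
          thetaSer (2 * x.2.1) τ) := by
  obtain ⟨h0, h1⟩ := isSeries_iff.mp hE τ hτ
  have e := thetaMix_plucker f₁ f₂ x.2.2 x.2.1 x.1 x.2.2 hτ
  have e' := thetaMix_plucker f₁ f₂ x.2.2 x.1 x.2.1 x.2.2 hτ
  have := thetaSer_neg (x.2.1 - x.1) τ
  simp only [matE, matEDual, dualE, swapAZ, Matrix.mul_apply, Fin.sum_univ_two,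
    Matrix.transpose_apply, Matrix.of_apply, Matrix.cons_val', Matrix.cons_val_zero,
    Matrix.cons_val_one, Matrix.cons_val_fin_one, h0, h1, eps]
  ring_nf at e e' this ⊢
  linear_combination f₀ x.2.2 τ * thetaSer (x.1 - x.2.1 + x.2.2 * 2) τ * e +
    f₀ x.2.2 τ * thetaSer (-x.1 + x.2.1 + x.2.2 * 2) τ * e' -
    f₀ x.2.2 τ * thetaSer (x.1 - x.2.1 + x.2.2 * 2) τ *
      thetaSer (-x.1 + x.2.1 + x.2.2 * 2) τ *
      thetaMix f₁ f₂ x.2.2 (x.1 + x.2.1 + x.2.2) τ * this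

end Bilinear

/-! ## Limits as `q → 0` -/

instance : qToZero.NeBot := by
  refine comap_neBot fun t ht => ?_
  obtain ⟨b, hb⟩ := mem_atBot_sets.mp ht
  exact ⟨(b : ℂ), hb _ (by simp)⟩

lemma eventually_re_lt (b : ℝ) : ∀ᶠ τ in qToZero, τ.re < b :=
  tendsto_comap.eventually (eventually_lt_atBot b)

lemma tendsto_exp_mul_qToZero {r : ℝ} (hr : 0 < r) :
    Tendsto (fun τ => exp (r * τ)) qToZero (𝓝 0) := by
  rw [tendsto_zero_iff_norm_tendsto_zero]
  have h : ∀ τ : ℂ, ‖exp (r * τ)‖ = Real.exp (r * τ.re) := fun τ => by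
    rw [norm_exp, re_ofReal_mul]
  simp only [h]
  exact Real.tendsto_exp_atBot.comp ((tendsto_comap (f := re)).const_mul_atBot hr)

lemma tendsto_add_qToZero (t : ℝ) : Tendsto (fun τ => τ + t * I) qToZero qToZero := by
  refine tendsto_comap_iff.mpr ?_
  have : re ∘ (fun τ : ℂ => τ + t * I) = re := by
    funext τ; simp
  rw [this]
  exact tendsto_comap

/-- A dominated convergence theorem for series in real powers of `q`. -/
lemma tendsto_expSeries {g : ℤ → ℂ} {lam : ℤ → ℝ} (hl : ∀ n, 0 ≤ lam n)
    (hs : Summable fun n => ‖g n * exp (lam n * (-1))‖) :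
    Tendsto (fun τ => ∑' n, g n * exp (lam n * τ)) qToZero
      (𝓝 (∑' n, if lam n = 0 then g n else 0)) := by
  refine tendsto_tsum_of_dominated_convergence hs (fun n => ?_) ?_
  · split_ifs with h
    · simp [h]
    · have := (tendsto_exp_mul_qToZero (lt_of_le_of_ne (hl n) (Ne.symm h))).const_mul (g n)
      rwa [mul_zero] at this
  · filter_upwards [eventually_re_lt (-1)] with τ hτ n
    rw [norm_mul, norm_mul, norm_exp, norm_exp]
    refine mul_le_mul_of_nonneg_left ?_ (norm_nonneg _)
    rw [Real.exp_le_exp, re_ofReal_mul, re_ofReal_mul]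
    exact mul_le_mul_of_nonneg_left (by simpa using hτ.le) (hl n)

/-- The squared distance from `s` to `1/2 + ℤ`. -/
noncomputable def distHalf (s : ℝ) : ℝ := (⌊s⌋ + 1 / 2 - s) ^ 2

lemma distHalf_nonneg (s : ℝ) : 0 ≤ distHalf s := sq_nonneg _

lemma distHalf_le (s : ℝ) : distHalf s ≤ 1 / 4 := by
  have h1 := Int.floor_le s
  have h2 := Int.lt_floor_add_one s
  rw [distHalf]
  nlinarith

lemma distHalf_le_sq (s : ℝ) (m : ℤ) : distHalf s ≤ (m + 1 / 2 - s) ^ 2 := by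
  have h1 := Int.floor_le s
  have h2 := Int.lt_floor_add_one s
  rw [distHalf]
  rcases lt_or_ge m ⌊s⌋ with h | h
  · have : (m : ℝ) + 1 ≤ ⌊s⌋ := by exact_mod_cast h
    nlinarith
  · rcases h.lt_or_eq with h | h
    · have : (⌊s⌋ : ℝ) + 1 ≤ m := by exact_mod_cast h
      nlinarith
    · rw [h]

/-- The difference of squares factors. Its second factor has a zero at an integer different from
`⌊s⌋` only when `s` is itself an integer, equidistant from two half-integers. -/
lemma distHalf_eq_sq_iff (s : ℝ) (m : ℤ) :
    (m + 1 / 2 - s) ^ 2 - distHalf s = 0 ↔ m = ⌊s⌋ ∨ (s = ⌊s⌋ ∧ m = ⌊s⌋ - 1) := by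
  have h1 := Int.floor_le s
  have h2 := Int.lt_floor_add_one s
  rw [distHalf]
  constructor
  · intro h
    have hf : ((m : ℝ) - ⌊s⌋) * (m + 1 + ⌊s⌋ - 2 * s) = 0 := by linear_combination h
    rcases mul_eq_zero.mp hf with h | h
    · left; exact_mod_cast sub_eq_zero.mp h
    · rcases lt_trichotomy m ⌊s⌋ with hm | hm | hm
      · right
        have hm' : (m : ℝ) + 1 ≤ ⌊s⌋ := by exact_mod_cast hm
        have e : s = ⌊s⌋ := by linarith
        refine ⟨e, ?_⟩
        have : (m : ℝ) = ⌊s⌋ - 1 := by linarith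
        exact_mod_cast this
      · exact Or.inl hm
      · have hm' : (⌊s⌋ : ℝ) + 1 ≤ m := by exact_mod_cast hm
        linarith
  · rintro (h | ⟨e, h⟩)
    · rw [h]; ring
    · rw [h]
      push_cast
      linear_combination 2 * e

open scoped Classical in
/-- A sum over the indices `m` for which `m + 1/2` is nearest to `s`. -/
lemma tsum_nearest (s : ℝ) (g : ℤ → ℂ) (c : ℝ) (hc : c ≠ 0) :
    (∑' m : ℤ, if c * (((m : ℝ) + 1 / 2 - s) ^ 2 - distHalf s) = 0 then g m else 0) =
      if s = ⌊s⌋ then g ⌊s⌋ + g (⌊s⌋ - 1) else g ⌊s⌋ := by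
  have h0 : ∀ m : ℤ, c * (((m : ℝ) + 1 / 2 - s) ^ 2 - distHalf s) = 0 ↔
      m = ⌊s⌋ ∨ (s = ⌊s⌋ ∧ m = ⌊s⌋ - 1) := fun m => by
    rw [mul_eq_zero, or_iff_right hc, distHalf_eq_sq_iff]
  simp only [h0]
  split_ifs with h
  · rw [tsum_eq_sum (s := {⌊s⌋, ⌊s⌋ - 1}) (fun b hb => ?_), Finset.sum_pair (by omega)]
    · rw [if_pos (Or.inl rfl), if_pos (Or.inr ⟨h, rfl⟩)]
    · simp only [Finset.mem_insert, Finset.mem_singleton, not_or] at hb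
      rw [if_neg]
      rintro (h' | ⟨-, h'⟩)
      · exact hb.1 h'
      · exact hb.2 h'
  · rw [tsum_eq_single ⌊s⌋ (fun b hb => ?_)]
    · rw [if_pos (Or.inl rfl)]
    · rw [if_neg]
      rintro (h' | ⟨h', -⟩)
      · exact hb h'
      · exact h h'

open scoped Classical in
/-- The leading coefficient of `ϑ(q^{-s} y)`, up to sign, at `y = exp w`. -/
noncomputable def leadTerm (s : ℝ) (w : ℂ) : ℂ :=
  if s = ⌊s⌋ then exp (⌊s⌋ * w) * (exp (w / 2) - exp (-w / 2)) else exp ((⌊s⌋ + 1 / 2) * w)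

open scoped Classical in
/-- The leading coefficient of `ϑ₀(q^{-s} y)` at `y = exp w`. -/
noncomputable def leadZero (s : ℝ) (w : ℂ) : ℂ :=
  if s + 1 / 2 = ⌊s + 1 / 2⌋ then exp (2 * ⌊s + 1 / 2⌋ * w) + exp (2 * (⌊s + 1 / 2⌋ - 1) * w)
  else exp (2 * ⌊s + 1 / 2⌋ * w)

open scoped Classical in
/-- The leading coefficient of `ϑ₁(q^{-s} y)` at `y = exp w`. -/
noncomputable def leadOne (s : ℝ) (w : ℂ) : ℂ :=
  if s = ⌊s⌋ then exp ((2 * ⌊s⌋ + 1) * w) + exp ((2 * ⌊s⌋ - 1) * w)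
  else exp ((2 * ⌊s⌋ + 1) * w)

/-- Completing the square turns the exponent of `q` into `((m + 1/2 - s)² - s²)/2`. After
normalization by the minimum, only the indices nearest to `s` keep exponent zero: one of them in
general, two when `s` is an integer. -/
lemma tendsto_thetaSer (s : ℝ) (w : ℂ) :
    Tendsto (fun τ => exp (((s ^ 2 - distHalf s) / 2 : ℝ) * τ) * thetaSer (w - s * τ) τ) qToZero
      (𝓝 ((-1) ^ ⌊s⌋ * leadTerm s w)) := by
  have key : ∀ τ : ℂ, exp (((s ^ 2 - distHalf s) / 2 : ℝ) * τ) * thetaSer (w - s * τ) τ =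
      ∑' m : ℤ, (-1 : ℂ) ^ m * exp ((m + 1 / 2) * w) *
        exp (((1 / 2 : ℝ) * (((m : ℝ) + 1 / 2 - s) ^ 2 - distHalf s) : ℝ) * τ) := by
    intro τ
    rw [thetaSer, ← tsum_mul_left]
    refine tsum_congr fun m => ?_
    rw [show ∀ a b c d : ℂ, a * (b * c * d) = b * (a * c * d) by intros; ring, mul_assoc,
      mul_assoc, ← exp_add, ← exp_add, ← exp_add]
    push_cast
    ring_nf
  simp only [key]
  have hl := tendsto_expSeries (g := fun m : ℤ => (-1 : ℂ) ^ m * exp ((m + 1 / 2) * w))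
    (lam := fun m : ℤ => (1 / 2 : ℝ) * (((m : ℝ) + 1 / 2 - s) ^ 2 - distHalf s))
    (fun m => mul_nonneg (by norm_num) (sub_nonneg.mpr (distHalf_le_sq s m))) (by
      have := ((summable_thetaSer (w - s * (-1)) (τ := -1) (by simp)).mul_left
        (exp (((s ^ 2 - distHalf s) / 2 : ℝ) * (-1)))).norm
      refine this.congr fun m => ?_
      congr 1
      rw [show ∀ a b c d : ℂ, a * (b * c * d) = b * (a * c * d) by intros; ring, mul_assoc,
        mul_assoc, ← exp_add, ← exp_add, ← exp_add]
      push_cast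
      ring_nf)
  convert! hl using 2
  rw [tsum_nearest s _ _ (by norm_num), leadTerm]
  split_ifs with h
  · have : (-1 : ℂ) ^ (⌊s⌋ - 1) = -(-1) ^ ⌊s⌋ := by
      rw [zpow_sub_one₀ (by norm_num)]; norm_num
    rw [this, mul_sub, ← exp_add, ← exp_add]
    push_cast
    ring_nf
  · rfl

lemma tendsto_thetaOne (s : ℝ) (w : ℂ) :
    Tendsto (fun τ => exp ((s ^ 2 - distHalf s : ℝ) * τ) * thetaOne (w - s * τ) τ) qToZero
      (𝓝 (leadOne s w)) := by
  have key : ∀ τ : ℂ, exp ((s ^ 2 - distHalf s : ℝ) * τ) * thetaOne (w - s * τ) τ =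
      ∑' m : ℤ, exp ((2 * m + 1) * w) *
        exp (((1 : ℝ) * (((m : ℝ) + 1 / 2 - s) ^ 2 - distHalf s) : ℝ) * τ) := by
    intro τ
    rw [thetaOne, ← tsum_mul_left]
    refine tsum_congr fun m => ?_
    rw [← exp_add, ← exp_add, ← exp_add]
    push_cast
    ring_nf
  simp only [key]
  have hl := tendsto_expSeries (g := fun m : ℤ => exp ((2 * m + 1) * w))
    (lam := fun m : ℤ => (1 : ℝ) * (((m : ℝ) + 1 / 2 - s) ^ 2 - distHalf s))
    (fun m => mul_nonneg (by norm_num) (sub_nonneg.mpr (distHalf_le_sq s m))) (by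
      have := ((summable_thetaOne (w - s * (-1)) (τ := -1) (by simp)).mul_left
        (exp ((s ^ 2 - distHalf s : ℝ) * (-1)))).norm
      refine this.congr fun m => ?_
      congr 1
      rw [← exp_add, ← exp_add, ← exp_add]
      push_cast
      ring_nf)
  convert! hl using 2
  rw [tsum_nearest s _ _ (by norm_num), leadOne]
  split_ifs with h
  · push_cast
    ring_nf
  · rfl

/-- The integers are the half-integers seen from `s + 1/2`, so the same estimate applies with `s`
moved by one half; the ties now occur at half-integral slopes. -/
lemma tendsto_thetaZero (s : ℝ) (w : ℂ) :
    Tendsto (fun τ => exp ((s ^ 2 - distHalf (s + 1 / 2) : ℝ) * τ) * thetaZero (w - s * τ) τ)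
      qToZero (𝓝 (leadZero s w)) := by
  have key : ∀ τ : ℂ, exp ((s ^ 2 - distHalf (s + 1 / 2) : ℝ) * τ) * thetaZero (w - s * τ) τ =
      ∑' m : ℤ, exp (2 * m * w) *
        exp (((1 : ℝ) * (((m : ℝ) + 1 / 2 - (s + 1 / 2)) ^ 2 - distHalf (s + 1 / 2)) : ℝ) * τ) := by
    intro τ
    rw [thetaZero, ← tsum_mul_left]
    refine tsum_congr fun m => ?_
    rw [← exp_add, ← exp_add, ← exp_add]
    push_cast
    ring_nf
  simp only [key]
  have hl := tendsto_expSeries (g := fun m : ℤ => exp (2 * m * w))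
    (lam := fun m : ℤ =>
      (1 : ℝ) * (((m : ℝ) + 1 / 2 - (s + 1 / 2)) ^ 2 - distHalf (s + 1 / 2)))
    (fun m => mul_nonneg (by norm_num) (sub_nonneg.mpr (distHalf_le_sq _ m))) (by
      have := ((summable_thetaZero (w - s * (-1)) (τ := -1) (by simp)).mul_left
        (exp ((s ^ 2 - distHalf (s + 1 / 2) : ℝ) * (-1)))).norm
      refine this.congr fun m => ?_
      congr 1
      rw [← exp_add, ← exp_add, ← exp_add]
      push_cast
      ring_nf)
  convert! hl using 2
  rw [tsum_nearest _ _ _ (by norm_num), leadZero]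
  push_cast
  rfl

lemma tendsto_thetaScale : Tendsto (fun τ => exp (-(1 / 8 : ℝ) * τ) * thetaScale τ) qToZero
    (𝓝 1) := by
  refine tendsto_qPochhammer.congr fun τ => ?_
  rw [thetaScale, ← mul_assoc, ← exp_add]
  push_cast
  rw [show -(1 / 8) * τ + τ / 8 = 0 by ring, exp_zero, one_mul]

/-- `ϑ(y) → y^{1/2} - y^{-1/2}` as `q → 0`. -/
lemma tendsto_theta (w : ℂ) :
    Tendsto (fun τ => theta τ w) qToZero (𝓝 (exp (w / 2) - exp (-w / 2))) := by
  have h := (tendsto_thetaSer 0 w).div tendsto_thetaScale one_ne_zero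
  have e : (-1 : ℂ) ^ ⌊(0 : ℝ)⌋ * leadTerm 0 w / 1 = exp (w / 2) - exp (-w / 2) := by
    simp [leadTerm]
  rw [e] at h
  refine h.congr' ?_
  filter_upwards [eventually_re_lt 0] with τ hτ
  have h0 := thetaScale_ne_zero hτ
  have hd : ((0 ^ 2 - distHalf 0) / 2 : ℝ) = -(1 / 8 : ℝ) := by norm_num [distHalf]
  simp only [Pi.div_apply]
  rw [theta_eq _ hτ, hd]
  push_cast
  rw [zero_mul, sub_zero, mul_div_mul_left _ _ (exp_ne_zero _)]

/-- Ratios of theta functions shifted by the same power of `q`. -/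
lemma tendsto_theta_ratio (s : ℝ) (w₁ w₂ : ℂ) (h : leadTerm s w₂ ≠ 0) :
    Tendsto (fun τ => thetaSer (w₁ - s * τ) τ / thetaSer (w₂ - s * τ) τ) qToZero
      (𝓝 (leadTerm s w₁ / leadTerm s w₂)) := by
  have h1 : ((-1 : ℂ) ^ ⌊s⌋) ≠ 0 := zpow_ne_zero _ (by norm_num)
  have := (tendsto_thetaSer s w₁).div (tendsto_thetaSer s w₂) (mul_ne_zero h1 h)
  rw [mul_div_mul_left _ _ h1] at this
  refine this.congr fun τ => ?_
  simp only [Pi.div_apply]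
  rw [mul_div_mul_left _ _ (exp_ne_zero _)]

lemma eventually_thetaSer_ne_zero (s : ℝ) (w : ℂ) (h : leadTerm s w ≠ 0) :
    ∀ᶠ τ in qToZero, thetaSer (w - s * τ) τ ≠ 0 := by
  have h1 : ((-1 : ℂ) ^ ⌊s⌋) ≠ 0 := zpow_ne_zero _ (by norm_num)
  filter_upwards [(tendsto_thetaSer s w).eventually_ne (mul_ne_zero h1 h)] with τ hτ
  exact right_ne_zero_of_mul hτ

/-! ### Properties of the leading terms -/

lemma leadTerm_add_int (s : ℝ) (n : ℤ) (w : ℂ) :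
    leadTerm (s + n) w = exp (n * w) * leadTerm s w := by
  have h : s + n = ⌊s + n⌋ ↔ s = ⌊s⌋ := by
    rw [Int.floor_add_intCast]; push_cast; rw [add_left_inj]
  simp only [leadTerm, h]
  split_ifs
  · rw [← mul_assoc, ← exp_add, Int.floor_add_intCast]; push_cast; ring_nf
  · rw [← exp_add, Int.floor_add_intCast]; push_cast; ring_nf

lemma leadTerm_of_mem {s : ℝ} (h0 : 0 < s) (h1 : s < 1) (w : ℂ) : leadTerm s w = exp (w / 2) := by
  have hf : ⌊s⌋ = 0 := Int.floor_eq_zero_iff.mpr ⟨h0.le, h1⟩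
  rw [leadTerm, hf, if_neg]
  · push_cast; ring_nf
  · push_cast; exact h0.ne'

lemma leadTerm_int (n : ℤ) (w : ℂ) :
    leadTerm n w = exp (n * w) * (exp (w / 2) - exp (-w / 2)) := by
  rw [leadTerm, Int.floor_intCast, if_pos rfl]

lemma leadTerm_of_mem_int {s : ℝ} {n : ℤ} (h0 : n < s) (h1 : s < n + 1) (w : ℂ) :
    leadTerm s w = exp ((n + 1 / 2) * w) := by
  have := leadTerm_add_int (s - n) n w
  rw [sub_add_cancel, leadTerm_of_mem (s := s - n) (by linarith) (by linarith),
    ← exp_add] at this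
  rw [this]; ring_nf

lemma leadZero_of_mem {s : ℝ} {n : ℤ} (h0 : n - 1 / 2 < s) (h1 : s < n + 1 / 2) (w : ℂ) :
    leadZero s w = exp (2 * n * w) := by
  have hf : ⌊s + 1 / 2⌋ = n := by
    rw [Int.floor_eq_iff]; constructor <;> linarith
  rw [leadZero, hf, if_neg]
  intro h; linarith

lemma leadZero_half (n : ℤ) (w : ℂ) :
    leadZero (n + 1 / 2) w = exp (2 * (n + 1) * w) + exp (2 * n * w) := by
  have hf : ⌊(n + 1 / 2 + 1 / 2 : ℝ)⌋ = n + 1 := by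
    rw [Int.floor_eq_iff]; push_cast; constructor <;> linarith
  rw [leadZero, hf, if_pos]
  · push_cast; ring_nf
  · push_cast; ring

lemma leadOne_of_mem {s : ℝ} {n : ℤ} (h0 : n < s) (h1 : s < n + 1) (w : ℂ) :
    leadOne s w = exp ((2 * n + 1) * w) := by
  have hf : ⌊s⌋ = n := by
    rw [Int.floor_eq_iff]; constructor <;> linarith
  rw [leadOne, hf, if_neg]
  intro h; linarith

/-! ## Characters and the coefficient ring -/

lemma ch_add (i j k i' j' k' : ℤ) (x : Cover) :
    ch (i + i') (j + j') (k + k') x = ch i j k x * ch i' j' k' x := by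
  rw [ch, ch, ch, ← exp_add]
  push_cast
  ring_nf

lemma ch_ne_zero (i j k : ℤ) (x : Cover) : ch i j k x ≠ 0 := exp_ne_zero _

lemma ch_zero (x : Cover) : ch 0 0 0 x = 1 := by simp [ch]

lemma continuous_ch (i j k : ℤ) : Continuous (ch i j k) := by
  unfold ch; fun_prop

/-- Off a nowhere dense closed set, finitely many nontrivial characters are different from `1`. -/
def genericSet (l : List (ℤ × ℤ × ℤ)) : Set Cover := {x | ∀ t ∈ l, ch t.1 t.2.1 t.2.2 x ≠ 1}

lemma genericSet_isOpen_dense (l : List (ℤ × ℤ × ℤ)) (hl : ∀ t ∈ l, t ≠ 0) :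
    IsOpen (genericSet l) ∧ Dense (genericSet l) := by
  induction l with
  | nil =>
    have : genericSet [] = Set.univ := by ext; simp [genericSet]
    rw [this]
    exact ⟨isOpen_univ, dense_univ⟩
  | cons t l ih =>
    obtain ⟨h1, h2⟩ := ih fun t ht => hl t (List.mem_cons_of_mem _ ht)
    have he : genericSet (t :: l) = {x | ch t.1 t.2.1 t.2.2 x ≠ 1} ∩ genericSet l := by
      ext x; simp [genericSet]
    have ho : IsOpen {x | ch t.1 t.2.1 t.2.2 x ≠ 1} :=
      isOpen_ne_fun (continuous_ch _ _ _) continuous_const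
    have hd : Dense {x | ch t.1 t.2.1 t.2.2 x ≠ 1} := by
      have ht := hl t List.mem_cons_self
      obtain ⟨i, j, k⟩ := t
      rw [dense_iff_closure_eq, Set.eq_univ_iff_forall]
      intro x
      by_contra hx
      -- Along the real direction `(i, j, k)` the character is multiplied by `exp (r (i² + j² +
      -- k²))`, so it cannot be identically `1` on an open set.
      set d : Cover := (((i : ℝ) : ℂ), ((j : ℝ) : ℂ), ((k : ℝ) : ℂ)) with hd
      have hev : ∀ᶠ r : ℝ in 𝓝[>] 0, x + (r : ℂ) • d ∈ (closure {x | ch i j k x ≠ 1})ᶜ := by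
        have hc : Tendsto (fun r : ℝ => x + (r : ℂ) • d) (𝓝[>] 0) (𝓝 x) := by
          have : Continuous fun r : ℝ => x + (r : ℂ) • d := by fun_prop
          have := this.tendsto 0
          rw [ofReal_zero, zero_smul, add_zero] at this
          exact this.mono_left nhdsWithin_le_nhds
        exact hc (isClosed_closure.isOpen_compl.mem_nhds hx)
      obtain ⟨r, hr, hr0⟩ := (hev.and self_mem_nhdsWithin).exists
      have e0 : ch i j k x = 1 := by
        by_contra hne
        exact hx (subset_closure hne)
      have e1 : ch i j k (x + (r : ℂ) • d) = 1 := by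
        by_contra hne
        exact hr (subset_closure hne)
      have e2 : ch i j k (x + (r : ℂ) • d) = ch i j k x * exp ((r * (i ^ 2 + j ^ 2 + k ^ 2) : ℝ)) := by
        rw [ch, ch, ← exp_add]
        simp only [hd, Prod.fst_add, Prod.snd_add, Prod.smul_fst, Prod.smul_snd, smul_eq_mul]
        push_cast
        ring_nf
      rw [e0, e1, one_mul, ← ofReal_exp] at e2
      have e3 : Real.exp (r * (i ^ 2 + j ^ 2 + k ^ 2)) = 1 := by exact_mod_cast e2.symm
      rw [Real.exp_eq_one_iff] at e3
      rcases mul_eq_zero.mp e3 with h | h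
      · have hr1 : 0 < r := hr0
        linarith
      · have hi : (i : ℝ) ^ 2 = 0 := by nlinarith [sq_nonneg (i : ℝ), sq_nonneg (j : ℝ), sq_nonneg (k : ℝ)]
        have hj : (j : ℝ) ^ 2 = 0 := by nlinarith [sq_nonneg (i : ℝ), sq_nonneg (j : ℝ), sq_nonneg (k : ℝ)]
        have hk : (k : ℝ) ^ 2 = 0 := by nlinarith [sq_nonneg (i : ℝ), sq_nonneg (j : ℝ), sq_nonneg (k : ℝ)]
        simp only [ne_eq, OfNat.ofNat_ne_zero, not_false_eq_true, pow_eq_zero_iff, Int.cast_eq_zero]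
          at hi hj hk
        exact ht (by simp [hi, hj, hk])
    rw [he]
    exact ⟨ho.inter h1, hd.inter_of_isOpen_left h2 ho⟩

lemma ch_mem_KPt (i k : ℤ) : ch i 0 k ∈ KPt := by
  have hmul : ∀ i k i' k' : ℤ, ch i 0 k ∈ KPt → ch i' 0 k' ∈ KPt → ch (i + i') 0 (k + k') ∈ KPt := by
    intro i k i' k' h h'
    have := KPt.mul_mem h h'
    convert this using 1
    funext x
    rw [Pi.mul_apply, ← ch_add, add_zero]
  have hz : ch 0 0 0 ∈ KPt := by
    convert KPt.one_mem using 1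
    funext x
    exact ch_zero x
  have hi : ∀ i : ℤ, ch i 0 0 ∈ KPt := by
    intro i
    induction i using Int.induction_on with
    | zero => exact hz
    | succ i ih => exact hmul i 0 1 0 ih (Subring.subset_closure (by simp))
    | pred i ih => exact hmul (-i) 0 (-1) 0 ih (Subring.subset_closure (by simp))
  have hk : ∀ k : ℤ, ch 0 0 k ∈ KPt := by
    intro k
    induction k using Int.induction_on with
    | zero => exact hz
    | succ k ih => exact hmul 0 k 0 1 ih (Subring.subset_closure (by simp))
    | pred k ih => exact hmul 0 (-k) 0 (-1) ih (Subring.subset_closure (by simp))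
  simpa using hmul i 0 0 k (hi i) (hk k)

/-- Properties of Laurent polynomials in `a` and `v`, proved on the generators. -/
lemma KPt_induction {P : (Cover → ℂ) → Prop} (hch : ∀ i k : ℤ, P (ch i 0 k))
    (hadd : ∀ f g, P f → P g → P (f + g)) (hmul : ∀ f g, P f → P g → P (f * g))
    (hneg : ∀ f, P f → P (-f)) {f : Cover → ℂ} (hf : f ∈ KPt) : P f := by
  have h1 : P 1 := by
    convert hch 0 0 using 1
    funext x
    exact (ch_zero x).symm
  refine Subring.closure_induction ?_ ?_ h1 (fun f g _ _ => hadd f g) (fun f _ => hneg f)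
    (fun f g _ _ => hmul f g) hf
  · rintro g (rfl | rfl | rfl | rfl)
    · exact hch 1 0
    · exact hch (-1) 0
    · exact hch 0 1
    · exact hch 0 (-1)
  · convert hadd _ _ h1 (hneg _ h1) using 1
    simp

lemma differentiable_of_mem_KPt {f : Cover → ℂ} (hf : f ∈ KPt) : Differentiable ℂ f := by
  refine KPt_induction (P := Differentiable ℂ) (fun i k => ?_) (fun f g hf hg => hf.add hg)
    (fun f g hf hg => hf.mul hg) (fun f hf => hf.neg) hf
  unfold ch; fun_prop

/-- Independence of `z` is what makes the powers of `z` in a wall-crossing sum comparable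
coefficient by coefficient. -/
lemma indep_z_of_mem_KPt {f : Cover → ℂ} (hf : f ∈ KPt) (a z z' v : ℂ) :
    f (a, z, v) = f (a, z', v) := by
  refine KPt_induction (P := fun f => f (a, z, v) = f (a, z', v)) (fun i k => ?_)
    (fun f g hf hg => by rw [Pi.add_apply, Pi.add_apply, hf, hg])
    (fun f g hf hg => by rw [Pi.mul_apply, Pi.mul_apply, hf, hg])
    (fun f hf => by rw [Pi.neg_apply, Pi.neg_apply, hf]) hf
  simp [ch]

lemma periodic_v_of_mem_KPt {f : Cover → ℂ} (hf : f ∈ KPt) (a z v : ℂ) :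
    f (a, z, v + 2 * Real.pi * I) = f (a, z, v) := by
  refine KPt_induction (P := fun f => f (a, z, v + 2 * Real.pi * I) = f (a, z, v)) (fun i k => ?_)
    (fun f g hf hg => by rw [Pi.add_apply, Pi.add_apply, hf, hg])
    (fun f g hf hg => by rw [Pi.mul_apply, Pi.mul_apply, hf, hg])
    (fun f hf => by rw [Pi.neg_apply, Pi.neg_apply, hf]) hf
  simp only [ch]
  rw [show (i : ℂ) * a + (0 : ℤ) * z + k * (v + 2 * Real.pi * I) =
    i * a + (0 : ℤ) * z + k * v + k * (2 * Real.pi * I) by ring, exp_add _ (k * _),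
    exp_int_mul_two_pi_mul_I, mul_one]

/-- Geometric sums divide `1 - a^{2j}` by `1 - a²`, for either sign of `j`. This is the congruence
satisfied by the restrictions of `𝒪(j)`. -/
lemma one_sub_ch_two_mul (j : ℤ) : ∃ g ∈ KPt, (1 : Cover → ℂ) - ch (2 * j) 0 0 = (1 - ch 2 0 0) * g := by
  have hstep : ∀ j : ℤ, ch (2 * (j + 1)) 0 0 = ch (2 * j) 0 0 * ch 2 0 0 := by
    intro j; funext x
    rw [Pi.mul_apply, ← ch_add, mul_add, mul_one, add_zero]
  induction j using Int.induction_on with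
  | zero => exact ⟨0, KPt.zero_mem, by funext x; simp [ch]⟩
  | succ j ih =>
    obtain ⟨g, hg, e⟩ := ih
    refine ⟨g + ch (2 * j) 0 0, KPt.add_mem hg (ch_mem_KPt _ _), ?_⟩
    rw [hstep]
    linear_combination e
  | pred j ih =>
    obtain ⟨g, hg, e⟩ := ih
    refine ⟨g - ch (2 * (-j - 1)) 0 0, KPt.sub_mem hg (ch_mem_KPt _ _), ?_⟩
    have := hstep (-j - 1)
    rw [sub_add_cancel] at this
    rw [this] at e
    linear_combination e

/-! ## Monomial classes and bases of `K_{H × S}(X)` -/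

/-- The class `a^i z^j v^k 𝒪(n)`. -/
noncomputable def lineClass (i j k n : ℤ) : Vec := mono i j k fun p x => O n p x

lemma lineClass_eq_exp (i j k n : ℤ) (p : Fin 2) (x : Cover) : lineClass i j k n p x =
    exp (i * x.1 + j * x.2.1 + k * x.2.2 + n * (2 * x.2.2 - eps p * x.1)) := by
  rw [lineClass, mono, ch, O, ← exp_add]

lemma mono_lineClass (i j k i' j' k' n : ℤ) :
    mono i j k (lineClass i' j' k' n) = lineClass (i + i') (j + j') (k + k') n := by
  funext p x
  simp only [lineClass, mono, ch_add, mul_assoc]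

lemma lineClass_zero (i j k n : ℤ) : lineClass i j k n 0 = ch (i - n) j (k + 2 * n) := by
  funext x
  rw [lineClass_eq_exp, ch]
  simp [eps]
  ring_nf

lemma lineClass_one (i j k n : ℤ) : lineClass i j k n 1 = ch (i + n) j (k + 2 * n) := by
  funext x
  rw [lineClass_eq_exp, ch]
  simp [eps]
  ring_nf

lemma lineClass_mem_KX (i k n : ℤ) : lineClass i 0 k n ∈ KX := by
  refine ⟨fun p => ?_, ?_⟩
  · fin_cases p
    · change lineClass i 0 k n 0 ∈ KPt
      rw [lineClass_zero]; exact ch_mem_KPt _ _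
    · change lineClass i 0 k n 1 ∈ KPt
      rw [lineClass_one]; exact ch_mem_KPt _ _
  · obtain ⟨g, hg, e⟩ := one_sub_ch_two_mul n
    refine ⟨ch (i - n) 0 (k + 2 * n) * g, KPt.mul_mem (ch_mem_KPt _ _) hg, ?_⟩
    rw [lineClass_zero, lineClass_one]
    have : ch (i + n) 0 (k + 2 * n) = ch (i - n) 0 (k + 2 * n) * ch (2 * n) 0 0 := by
      funext x
      rw [Pi.mul_apply, ← ch_add]
      ring_nf
    rw [this]
    linear_combination ch (i - n) 0 (k + 2 * n) * e

lemma eq_zero_of_generic {f : Cover → ℂ} (hf : Continuous f)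
    (h : ∀ x, ch 2 0 0 x ≠ 1 → f x = 0) : f = 0 := by
  have hd := (genericSet_isOpen_dense [(2, 0, 0)] (by simp)).2
  refine Continuous.ext_on hd hf continuous_const fun x hx => ?_
  exact h x (hx (2, 0, 0) (by simp))

/-- Adjacent line bundles, twisted by characters, form a basis. -/
lemma exists_basis_lineClass (i k i' k' n : ℤ) : ∃ b : Module.Basis (Fin 2) KPt KX,
    (b 0 : Vec) = lineClass i 0 k n ∧ (b 1 : Vec) = lineClass i' 0 k' (n + 1) := by
  set B₀ : KX := ⟨lineClass i 0 k n, lineClass_mem_KX i k n⟩ with hB₀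
  set B₁ : KX := ⟨lineClass i' 0 k' (n + 1), lineClass_mem_KX i' k' (n + 1)⟩ with hB₁
  have hli : LinearIndependent KPt ![B₀, B₁] := by
    rw [LinearIndependent.pair_iff]
    rintro ⟨s, hs⟩ ⟨t, ht⟩ h
    have h' : ∀ p x, s x * lineClass i 0 k n p x + t x * lineClass i' 0 k' (n + 1) p x = 0 := by
      intro p x
      have := congrArg (fun F : KX => (F : Vec) p x) h
      exact this
    -- The determinant of two adjacent line bundles is a unit times `a² - 1`, so the relation is
    -- trivial wherever `a² ≠ 1`, and then everywhere by density.
    have hdet : ∀ x, ch 2 0 0 x ≠ 1 → s x = 0 ∧ t x = 0 := by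
      intro x hx
      have e0 := h' 0 x
      have e1 := h' 1 x
      rw [lineClass_zero, lineClass_zero] at e0
      rw [lineClass_one, lineClass_one] at e1
      have c1 : ch (i + n) 0 (k + 2 * n) x = ch (i - n) 0 (k + 2 * n) x * ch (2 * n) 0 0 x := by
        rw [← ch_add]; ring_nf
      have c2 : ch (i' + (n + 1)) 0 (k' + 2 * (n + 1)) x =
          ch (i' - (n + 1)) 0 (k' + 2 * (n + 1)) x * (ch (2 * n) 0 0 x * ch 2 0 0 x) := by
        rw [← ch_add, ← ch_add]; ring_nf
      rw [c1, c2] at e1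
      have n1 := ch_ne_zero (2 * n) 0 0 x
      have n2 := ch_ne_zero (i - n) 0 (k + 2 * n) x
      have n3 := ch_ne_zero (i' - (n + 1)) 0 (k' + 2 * (n + 1)) x
      have ht0 : t x = 0 := by
        have : t x * (ch (i' - (n + 1)) 0 (k' + 2 * (n + 1)) x * ch (2 * n) 0 0 x *
          (ch 2 0 0 x - 1)) = 0 := by linear_combination e1 - ch (2 * n) 0 0 x * e0
        exact (mul_eq_zero.mp this).resolve_right
          (mul_ne_zero (mul_ne_zero n3 n1) (sub_ne_zero.mpr hx))
      refine ⟨?_, ht0⟩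
      rw [ht0, zero_mul, add_zero] at e0
      exact (mul_eq_zero.mp e0).resolve_right n2
    constructor
    · ext1
      exact eq_zero_of_generic (differentiable_of_mem_KPt hs).continuous fun x hx => (hdet x hx).1
    · ext1
      exact eq_zero_of_generic (differentiable_of_mem_KPt ht).continuous fun x hx => (hdet x hx).2
  have hsp : ⊤ ≤ Submodule.span KPt (Set.range ![B₀, B₁]) := by
    rintro ⟨F, hF, h, hh, e⟩ -
    obtain ⟨g, hg, eg⟩ := one_sub_ch_two_mul n
    -- Cramer's rule: `F 1 - a^{2n} F 0 = (1 - a²)(g F 0 - h)` is divisible by the determinant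
    -- exactly because of the congruence defining `KX`.
    have hβ : -(ch (-i' - n + 1) 0 (-k' - 2 * (n + 1)) * (g * F 0 - h)) ∈ KPt :=
      KPt.neg_mem (KPt.mul_mem (ch_mem_KPt _ _) (KPt.sub_mem (KPt.mul_mem hg (hF 0)) hh))
    set β : Cover → ℂ := -(ch (-i' - n + 1) 0 (-k' - 2 * (n + 1)) * (g * F 0 - h)) with hβd
    have hα : ch (n - i) 0 (-k - 2 * n) * (F 0 - β * ch (i' - (n + 1)) 0 (k' + 2 * (n + 1))) ∈ KPt :=
      KPt.mul_mem (ch_mem_KPt _ _) (KPt.sub_mem (hF 0) (KPt.mul_mem hβ (ch_mem_KPt _ _)))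
    rw [Matrix.range_cons, Matrix.range_cons, Matrix.range_empty, Set.union_empty,
      Set.singleton_union, Submodule.mem_span_pair]
    refine ⟨⟨_, hα⟩, ⟨_, hβ⟩, ?_⟩
    refine Subtype.ext (funext fun p => funext fun x => ?_)
    change (ch (n - i) 0 (-k - 2 * n) x *
      (F 0 x - β x * ch (i' - (n + 1)) 0 (k' + 2 * (n + 1)) x)) *
        lineClass i 0 k n p x + β x * lineClass i' 0 k' (n + 1) p x = F p x
    have u1 : ch (n - i) 0 (-k - 2 * n) x * ch (i - n) 0 (k + 2 * n) x = 1 := by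
      rw [← ch_add]; ring_nf; exact ch_zero x
    fin_cases p
    · change _ * lineClass i 0 k n 0 x + β x * lineClass i' 0 k' (n + 1) 0 x = F 0 x
      rw [lineClass_zero, lineClass_zero]
      linear_combination (F 0 x - β x * ch (i' - (n + 1)) 0 (k' + 2 * (n + 1)) x) * u1
    · change _ * lineClass i 0 k n 1 x + β x * lineClass i' 0 k' (n + 1) 1 x = F 1 x
      rw [lineClass_one, lineClass_one]
      have c1 : ch (i + n) 0 (k + 2 * n) x = ch (i - n) 0 (k + 2 * n) x * ch (2 * n) 0 0 x := by
        rw [← ch_add]; ring_nf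
      have c2 : ch (i' + (n + 1)) 0 (k' + 2 * (n + 1)) x =
          ch (i' - (n + 1)) 0 (k' + 2 * (n + 1)) x * (ch (2 * n) 0 0 x * ch 2 0 0 x) := by
        rw [← ch_add, ← ch_add]; ring_nf
      rw [c1, c2]
      have eF : F 0 x - F 1 x = (1 - ch 2 0 0 x) * h x := congrFun e x
      have eG : 1 - ch (2 * n) 0 0 x = (1 - ch 2 0 0 x) * g x := congrFun eg x
      have u2 : ch (-i' - n + 1) 0 (-k' - 2 * (n + 1)) x *
          (ch (i' - (n + 1)) 0 (k' + 2 * (n + 1)) x * ch (2 * n) 0 0 x) = 1 := by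
        rw [← ch_add, ← ch_add]; ring_nf; exact ch_zero x
      have hβx : β x = -(ch (-i' - n + 1) 0 (-k' - 2 * (n + 1)) x * (g x * F 0 x - h x)) := rfl
      rw [hβx]
      linear_combination ch (2 * n) 0 0 x * (F 0 x + (ch (-i' - n + 1) 0 (-k' - 2 * (n + 1)) x * (g x * F 0 x - h x)) * ch (i' - (n + 1)) 0 (k' + 2 * (n + 1)) x) * u1 +
        (1 - ch 2 0 0 x) * (g x * F 0 x - h x) * u2 + eF - F 0 x * eG
  refine ⟨Module.Basis.mk hli hsp, ?_, ?_⟩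
  · rw [Module.Basis.mk_apply]; rfl
  · rw [Module.Basis.mk_apply]; rfl

/-! ## The `K`-theoretic stable basis -/

/-- A point at which no small character is trivial. -/
def Generic (x : Cover) : Prop :=
  ∀ i j k : ℤ, |i| ≤ 2 → |j| ≤ 2 → |k| ≤ 2 → (i, j, k) ≠ 0 → ch i j k x ≠ 1

lemma isOpen_dense_generic : IsOpen {x | Generic x} ∧ Dense {x | Generic x} := by
  have he : {x | Generic x} = genericSet
      (((Finset.Icc (-2 : ℤ) 2 ×ˢ (Finset.Icc (-2 : ℤ) 2 ×ˢ Finset.Icc (-2 : ℤ) 2)).erase 0).toList) := by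
    ext x
    simp only [Generic, genericSet, Set.mem_ofPred_eq, Finset.mem_toList, Finset.mem_erase,
      Finset.mem_product, Finset.mem_Icc, abs_le]
    constructor
    · rintro h ⟨i, j, k⟩ ⟨h0, hi, hj, hk⟩
      exact h i j k hi hj hk h0
    · intro h i j k hi hj hk h0
      exact h (i, j, k) ⟨h0, hi, hj, hk⟩
  rw [he]
  refine genericSet_isOpen_dense _ fun t ht => ?_
  rw [Finset.mem_toList, Finset.mem_erase] at ht
  exact ht.1

lemma Generic.invA {x : Cover} (hx : Generic x) : Generic (invA x) := by
  intro i j k hi hj hk h0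
  have := hx (-i) j k (by rwa [abs_neg]) hj hk (by
    intro h; apply h0
    simp only [Prod.mk_eq_zero, neg_eq_zero] at h ⊢
    exact h)
  rwa [show ch i j k (EllipticCanonical.invA x) = ch (-i) j k x by
    simp [ch, EllipticCanonical.invA]]

lemma Generic.invV {x : Cover} (hx : Generic x) : Generic (invV x) := by
  intro i j k hi hj hk h0
  have := hx i j (-k) hi hj (by rwa [abs_neg]) (by
    intro h; apply h0
    simp only [Prod.mk_eq_zero, neg_eq_zero] at h ⊢
    exact h)
  rwa [show ch i j k (EllipticCanonical.invV x) = ch i j (-k) x by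
    simp [ch, EllipticCanonical.invV]]

lemma exp_half_sub_ne_zero {w : ℂ} (h : exp w ≠ 1) : exp (w / 2) - exp (-w / 2) ≠ 0 := by
  intro h0
  apply h
  have h1 : exp w = exp (w / 2) * exp (w / 2) := by rw [← exp_add, add_halves]
  have h2 : exp (-w / 2) * exp (w / 2) = 1 := by
    rw [← exp_add]; ring_nf; exact exp_zero
  rw [h1]
  linear_combination exp (w / 2) * h0 + h2

lemma leadTerm_ne_zero (s : ℝ) {w : ℂ} (h : exp w ≠ 1) : leadTerm s w ≠ 0 := by
  rw [leadTerm]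
  split_ifs
  · exact mul_ne_zero (exp_ne_zero _) (exp_half_sub_ne_zero h)
  · exact exp_ne_zero _

lemma Generic.leadTerm_ne_zero {x : Cover} (hx : Generic x) (s : ℝ) {w : ℂ} (i j k : ℤ)
    (hw : w = i * x.1 + j * x.2.1 + k * x.2.2) (hi : |i| ≤ 2 := by decide)
    (hj : |j| ≤ 2 := by decide) (hk : |k| ≤ 2 := by decide) (h0 : (i, j, k) ≠ 0 := by decide) :
    leadTerm s w ≠ 0 := by
  apply EllipticCanonical.leadTerm_ne_zero
  rw [hw]
  exact hx i j k hi hj hk h0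

/-- The `K`-theory limit of the elliptic stable basis at slope `s`. -/
noncomputable def stabLim (s : ℝ) (x : Cover) : Matrix (Fin 2) (Fin 2) ℂ :=
  !![exp (-x.2.2 / 2) * sqrtL 0 x * leadTerm 0 (2 * x.1) *
      (leadTerm (2 * s) (2 * x.2.2 + 2 * x.2.1) / leadTerm (2 * s) (x.2.2 + 2 * x.2.1)),
    exp (-x.2.2 / 2) * sqrtL 0 x *
      (leadTerm 0 (2 * x.2.2 + 2 * x.1) * (leadTerm s (2 * x.2.2 + x.2.1 - x.1) /
          leadTerm s (x.2.1 + x.1 + 2 * x.2.2)) *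
          (leadTerm (2 * s) (2 * x.2.1) / leadTerm (2 * s) (2 * x.2.1 - x.2.2)) -
        leadTerm 0 (2 * x.1) * (leadTerm s (x.2.1 - x.1 - 2 * x.2.2) /
          leadTerm s (x.2.1 + x.1 + 2 * x.2.2)) *
          (leadTerm (2 * s) (2 * x.2.2 + 2 * x.2.1) / leadTerm (2 * s) (2 * x.2.1 - x.2.2)));
    0, exp (-x.2.2 / 2) * sqrtL 1 x * leadTerm 0 (2 * x.2.2 + 2 * x.1) *
      (leadTerm (2 * s) (2 * x.2.1) / leadTerm (2 * s) (2 * x.2.1 - x.2.2))]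

lemma tendsto_theta_zero (w : ℂ) : Tendsto (fun τ => theta τ w) qToZero (𝓝 (leadTerm 0 w)) := by
  have : leadTerm 0 w = exp (w / 2) - exp (-w / 2) := by simp [leadTerm]
  rw [this]
  exact tendsto_theta w

lemma theta_vNDual_zero (s : ℝ) (x : Cover) {τ : ℂ} (hτ : τ.re < 0) :
    theta τ (vNDual 0 (shiftZ (-s * τ) x)) =
      -(thetaSer (x.2.2 + 2 * x.2.1 - (2 * s : ℝ) * τ) τ / thetaScale τ) := by
  rw [theta_eq _ hτ, show vNDual 0 (shiftZ (-s * τ) x) =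
    -(x.2.2 + 2 * x.2.1 - (2 * s : ℝ) * τ) by simp [vNDual, shiftZ]; ring, thetaSer_neg, neg_div]

lemma theta_vNDual_one (s : ℝ) (x : Cover) {τ : ℂ} (hτ : τ.re < 0) :
    theta τ (vNDual 1 (shiftZ (-s * τ) x)) =
      -(thetaSer (2 * x.2.1 - x.2.2 - (2 * s : ℝ) * τ) τ / thetaScale τ) := by
  rw [theta_eq _ hτ, show vNDual 1 (shiftZ (-s * τ) x) =
    -(2 * x.2.1 - x.2.2 - (2 * s : ℝ) * τ) by simp [vNDual, shiftZ]; ring, thetaSer_neg, neg_div]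

/-- The constant `c` is left free so that the same limit serves the opposite chamber, where the
polarization factor is taken at `x` while the stable matrix is taken at `invA x`. -/
lemma tendsto_stabEll (s : ℝ) (x : Cover) (hx : Generic x) (p' p : Fin 2) (c : ℂ) :
    Tendsto (fun τ => -exp (-x.2.2 / 2) * (c * stabEll (shiftZ (-s * τ) x) τ p' p
      / theta τ (vNDual p (shiftZ (-s * τ) x)))) qToZero
      (𝓝 (c / sqrtL p' x * stabLim s x p' p)) := by
  obtain ⟨a, z, v⟩ := x
  have hs0 : sqrtL 0 (a, z, v) ≠ 0 := mul_ne_zero (exp_ne_zero _) (exp_ne_zero _)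
  have hs1 : sqrtL 1 (a, z, v) ≠ 0 := mul_ne_zero (exp_ne_zero _) (exp_ne_zero _)
  have n1 : leadTerm (2 * s) (v + 2 * z) ≠ 0 := hx.leadTerm_ne_zero _ 0 2 1 (by push_cast; ring)
  have n2 : leadTerm (2 * s) (2 * z - v) ≠ 0 := hx.leadTerm_ne_zero _ 0 2 (-1) (by push_cast; ring)
  have n3 : leadTerm s (z + a + 2 * v) ≠ 0 := hx.leadTerm_ne_zero _ 1 1 2 (by push_cast; ring)
  have n4 : leadTerm s (v + z) ≠ 0 := hx.leadTerm_ne_zero _ 0 1 1 (by push_cast; ring)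
  have n5 : leadTerm 0 (-v + a) ≠ 0 := hx.leadTerm_ne_zero _ 1 0 (-1) (by push_cast; ring)
  have ev := eventually_re_lt 0
  have e1 := eventually_thetaSer_ne_zero _ _ n1
  have e2 := eventually_thetaSer_ne_zero _ _ n2
  have e3 := eventually_thetaSer_ne_zero _ _ n3
  have e4 := eventually_thetaSer_ne_zero _ _ n4
  have e5 := eventually_thetaSer_ne_zero _ _ n5
  fin_cases p' <;> fin_cases p
  · have key := ((tendsto_theta_zero (2 * a)).mul
      (tendsto_theta_ratio (2 * s) (2 * v + 2 * z) (v + 2 * z) n1)).const_mul (exp (-v / 2) * c)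
    refine (key.congr' ?_).trans_eq ?_
    · filter_upwards [ev, e1] with τ hτ h1
      change _ = -exp (-v / 2) * (c * stabEll (shiftZ (-s * τ) (a, z, v)) τ 0 0
        / theta τ (vNDual 0 (shiftZ (-s * τ) (a, z, v))))
      rw [stabEll_zero_zero _ hτ, theta_vNDual_zero s _ hτ, theta_eq _ hτ]
      simp only [shiftZ]
      have hsc := thetaScale_ne_zero hτ
      rw [show 2 * v + 2 * (z + -s * τ) = 2 * v + 2 * z - (2 * s : ℝ) * τ by push_cast; ring]
      field_simp
    · simp only [stabLim, Matrix.of_apply, Matrix.cons_val', Matrix.cons_val_zero, Fin.zero_eta]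
      congr 1
      field_simp
  · have key := (((tendsto_theta_zero (2 * v + 2 * a)).mul
      (tendsto_theta_ratio s (2 * v + z - a) (z + a + 2 * v) n3)).mul
      (tendsto_theta_ratio (2 * s) (2 * z) (2 * z - v) n2)).sub (((tendsto_theta_zero (2 * a)).mul
      (tendsto_theta_ratio s (z - a - 2 * v) (z + a + 2 * v) n3)).mul
      (tendsto_theta_ratio (2 * s) (2 * v + 2 * z) (2 * z - v) n2)) |>.const_mul (exp (-v / 2) * c)
    refine (key.congr' ?_).trans_eq ?_
    · filter_upwards [ev, e2, e3, e4, e5] with τ hτ h2 h3 h4 h5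
      change _ = -exp (-v / 2) * (c * stabEll (shiftZ (-s * τ) (a, z, v)) τ 0 1
        / theta τ (vNDual 1 (shiftZ (-s * τ) (a, z, v))))
      have hm := stabEll_zero_one_mul (shiftZ (-s * τ) (a, z, v)) hτ (by
        simp only [shiftZ]
        refine mul_ne_zero ?_ ?_
        · convert h5 using 2
          push_cast; ring
        · convert h4 using 2
          ring)
      rw [theta_vNDual_one s _ hτ, theta_eq _ hτ, theta_eq _ hτ]
      have hsc := thetaScale_ne_zero hτ
      simp only [shiftZ] at hm ⊢
      rw [show 2 * v + 2 * (z + -s * τ) = 2 * v + 2 * z - (2 * s : ℝ) * τ by push_cast; ring,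
        show 2 * (z + -s * τ) = 2 * z - (2 * s : ℝ) * τ by push_cast; ring,
        show z + -s * τ + a + 2 * v = z + a + 2 * v - s * τ by ring,
        show 2 * v + a - (z + -s * τ) = -(z - a - 2 * v - s * τ) by ring, thetaSer_neg,
        show 2 * v + (z + -s * τ) - a = 2 * v + z - a - s * τ by ring] at hm
      rw [← eq_div_iff h3] at hm
      rw [hm]
      field_simp
      ring
    · simp only [stabLim, Matrix.of_apply, Matrix.cons_val', Matrix.cons_val_zero,
        Matrix.cons_val_one, Fin.mk_one, Fin.zero_eta, Matrix.cons_val_fin_one]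
      congr 1
      field_simp
  · change Tendsto (fun τ => -exp (-v / 2) * (c * stabEll (shiftZ (-s * τ) (a, z, v)) τ 1 0
        / theta τ (vNDual 0 (shiftZ (-s * τ) (a, z, v))))) _ _
    simp only [stabEll_one_zero, mul_zero, zero_div]
    simp [stabLim]
  · have key := ((tendsto_theta_zero (2 * v + 2 * a)).mul
      (tendsto_theta_ratio (2 * s) (2 * z) (2 * z - v) n2)).const_mul (exp (-v / 2) * c)
    refine (key.congr' ?_).trans_eq ?_
    · filter_upwards [ev, e2] with τ hτ h1
      change _ = -exp (-v / 2) * (c * stabEll (shiftZ (-s * τ) (a, z, v)) τ 1 1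
        / theta τ (vNDual 1 (shiftZ (-s * τ) (a, z, v))))
      rw [stabEll_one_one _ hτ, theta_vNDual_one s _ hτ, theta_eq _ hτ]
      simp only [shiftZ]
      have hsc := thetaScale_ne_zero hτ
      rw [show 2 * (z + -s * τ) = 2 * z - (2 * s : ℝ) * τ by push_cast; ring]
      field_simp
    · simp only [stabLim, Matrix.of_apply, Matrix.cons_val', Matrix.cons_val_one, Fin.mk_one,
        Matrix.cons_val_fin_one]
      congr 1
      field_simp

lemma stabK_eq (s : ℝ) (x : Cover) (hx : Generic x) : stabK s x = stabLim s x := by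
  ext p' p
  have hs : sqrtL p' x ≠ 0 := mul_ne_zero (exp_ne_zero _) (exp_ne_zero _)
  have := (tendsto_stabEll s x hx p' p (sqrtL p' x)).limUnder_eq
  rw [div_self hs, one_mul] at this
  exact this

/-- The polarization is not symmetric under the exchange of the fixed points; the defect `a⁻³` is
the source of the factor `exp (-3 a)` in the bar involution. -/
lemma sqrtL_rev_invA (p : Fin 2) (x : Cover) :
    sqrtL p x / sqrtL (Fin.rev p) (invA x) = exp (-3 * x.1) := by
  rw [sqrtL, sqrtL, O, O, ← exp_add, ← exp_add, ← exp_sub]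
  congr 1
  fin_cases p <;> simp [eps, invA] <;> ring

lemma stabKOp_eq (s : ℝ) (x : Cover) (hx : Generic x) (p' p : Fin 2) :
    stabKOp s x p' p = exp (-3 * x.1) * stabLim s (invA x) (Fin.rev p') (Fin.rev p) := by
  have := (tendsto_stabEll s (invA x) hx.invA (Fin.rev p') (Fin.rev p) (sqrtL p' x)).limUnder_eq
  rw [sqrtL_rev_invA] at this
  rw [← this]
  rfl

/-- Each leading term changes by an exponential under an integral shift, and the ratios leave only
`𝒪(n)` on rows and a power of `a` on columns. Explicit computation is thus reduced to slopes in `[0,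
1)`. -/
lemma stabLim_add_int (s : ℝ) (n : ℤ) (x : Cover) (p' p : Fin 2) :
    stabLim (s + n) x p' p = O n p' x * stabLim s x p' p * exp (n * (eps p * x.1)) := by
  obtain ⟨a, z, v⟩ := x
  have h2 : (2 * (s + n) : ℝ) = 2 * s + (2 * n : ℤ) := by push_cast; ring
  have hr : ∀ (t : ℝ) (m : ℤ) (w w' : ℂ), leadTerm (t + m) w / leadTerm (t + m) w' =
      exp (m * (w - w')) * (leadTerm t w / leadTerm t w') := by
    intro t m w w'
    rw [leadTerm_add_int, leadTerm_add_int, mul_div_mul_comm, ← exp_sub, mul_sub]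
  fin_cases p' <;> fin_cases p
  · simp only [stabLim, Matrix.of_apply, Matrix.cons_val', Matrix.cons_val_zero, Fin.zero_eta]
    have : exp ((2 * n : ℤ) * (2 * v + 2 * z - (v + 2 * z))) =
        exp (n * (2 * v - a)) * exp (n * a) := by
      rw [← exp_add]; push_cast; ring_nf
    rw [h2, hr, O, this]
    simp only [eps, Matrix.cons_val_zero, one_mul]
    ring
  · simp only [stabLim, Matrix.of_apply, Matrix.cons_val', Matrix.cons_val_zero,
        Matrix.cons_val_one, Fin.mk_one, Fin.zero_eta, Matrix.cons_val_fin_one]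
    have e1 : exp (n * (2 * v + z - a - (z + a + 2 * v))) *
        exp ((2 * n : ℤ) * (2 * z - (2 * z - v))) = exp (n * (2 * v - a)) * exp (n * (-1 * a)) := by
      rw [← exp_add, ← exp_add]; push_cast; ring_nf
    have e2 : exp (n * (z - a - 2 * v - (z + a + 2 * v))) *
        exp ((2 * n : ℤ) * (2 * v + 2 * z - (2 * z - v))) =
        exp (n * (2 * v - a)) * exp (n * (-1 * a)) := by
      rw [← exp_add, ← exp_add]; push_cast; ring_nf
    rw [h2, hr, hr, hr, hr, O]
    simp only [eps, Matrix.cons_val_zero, Matrix.cons_val_one, one_mul, Matrix.cons_val_fin_one]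
    generalize leadTerm s (2 * v + z - a) / leadTerm s (z + a + 2 * v) = X1
    generalize leadTerm s (z - a - 2 * v) / leadTerm s (z + a + 2 * v) = X2
    generalize leadTerm (2 * s) (2 * z) / leadTerm (2 * s) (2 * z - v) = X3
    generalize leadTerm (2 * s) (2 * v + 2 * z) / leadTerm (2 * s) (2 * z - v) = X4
    linear_combination exp (-v / 2) * sqrtL 0 (a, z, v) * (leadTerm 0 (2 * v + 2 * a) * X1 * X3 * e1 -
      leadTerm 0 (2 * a) * X2 * X4 * e2)
  · simp [stabLim]
  · simp only [stabLim, Matrix.of_apply, Matrix.cons_val', Matrix.cons_val_one, Fin.mk_one,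
        Matrix.cons_val_fin_one]
    have : exp ((2 * n : ℤ) * (2 * z - (2 * z - v))) =
        exp (n * (2 * v - -1 * a)) * exp (n * (-1 * a)) := by
      rw [← exp_add]; push_cast; ring_nf
    rw [h2, hr, O, this]
    simp only [eps, Matrix.cons_val_one, Matrix.cons_val_fin_one]
    ring

lemma stabLim_one_zero (s : ℝ) (x : Cover) : stabLim s x 1 0 = 0 := by simp [stabLim]

lemma stabLim_zero_zero_ne_zero (s : ℝ) {x : Cover} (hx : Generic x) : stabLim s x 0 0 ≠ 0 := by
  simp only [stabLim, Matrix.of_apply, Matrix.cons_val', Matrix.cons_val_zero]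
  refine mul_ne_zero (mul_ne_zero (mul_ne_zero (exp_ne_zero _)
    (mul_ne_zero (exp_ne_zero _) (exp_ne_zero _))) ?_) (div_ne_zero ?_ ?_)
  · exact hx.leadTerm_ne_zero _ 2 0 0 (by push_cast; ring)
  · exact hx.leadTerm_ne_zero _ 0 2 2 (by push_cast; ring)
  · exact hx.leadTerm_ne_zero _ 0 2 1 (by push_cast; ring)

lemma stabLim_one_one_ne_zero (s : ℝ) {x : Cover} (hx : Generic x) : stabLim s x 1 1 ≠ 0 := by
  simp only [stabLim, Matrix.of_apply, Matrix.cons_val', Matrix.cons_val_one,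
    Matrix.cons_val_fin_one]
  refine mul_ne_zero (mul_ne_zero (mul_ne_zero (exp_ne_zero _)
    (mul_ne_zero (exp_ne_zero _) (exp_ne_zero _))) ?_) (div_ne_zero ?_ ?_)
  · exact hx.leadTerm_ne_zero _ 2 0 2 (by push_cast; ring)
  · exact hx.leadTerm_ne_zero _ 0 2 0 (by push_cast; ring)
  · exact hx.leadTerm_ne_zero _ 0 2 (-1) (by push_cast; ring)

/-- Coefficients in the stable basis, for a class expanded in the stable basis at an integer
translate of the slope. -/
lemma coeffK_eq (s : ℝ) (n : ℤ) (F : Vec) {x : Cover} (hx : Generic x) (f : Fin 2 → ℂ)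
    (hf : ∀ p, F p x = O n p x * ((stabLim s x).mulVec f) p) (p : Fin 2) :
    coeffK (s + n) F x p = exp (-n * (eps p * x.1)) * f p := by
  have hF : (fun p => F p x) = (stabLim (s + n) x).mulVec
      fun p => exp (-n * (eps p * x.1)) * f p := by
    funext q
    have hc : ∀ p, exp (n * (eps p * x.1)) * exp (-n * (eps p * x.1)) = 1 := fun p => by
      rw [← exp_add]; ring_nf; exact exp_zero
    rw [hf q, Matrix.mulVec, Matrix.mulVec, dotProduct, dotProduct, Finset.mul_sum]
    refine Finset.sum_congr rfl fun j _ => ?_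
    rw [stabLim_add_int]
    linear_combination -O n q x * stabLim s x q j * f j * hc j
  have hdet : IsUnit (stabLim (s + n) x).det := by
    rw [Matrix.det_fin_two, stabLim_one_zero, mul_zero, sub_zero]
    exact (mul_ne_zero (stabLim_zero_zero_ne_zero _ hx) (stabLim_one_one_ne_zero _ hx)).isUnit
  rw [coeffK, stabK_eq _ _ hx, hF, Matrix.mulVec_mulVec, Matrix.nonsing_inv_mul _ hdet,
    Matrix.one_mulVec]

/-- The column factors of the two chambers at an integral translate are inverse to each other, so
the bar involution at `s + n` is the one at `s` conjugated by `𝒪(n)`. -/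
lemma barK_eq (s : ℝ) (n : ℤ) (F : Vec) {x : Cover} (hx : Generic x) (f : Fin 2 → ℂ)
    (hf : ∀ p, F p (invV x) = O n p (invV x) * ((stabLim s (invV x)).mulVec f) p) (p : Fin 2) :
    barK (s + n) F p x = O n p x * (-exp (x.2.2 - 3 * x.1) *
      ∑ j, stabLim s (invA x) (Fin.rev p) (Fin.rev j) * f j) := by
  have hc := coeffK_eq s n F hx.invV f hf
  rw [barK, Matrix.mulVec, dotProduct]
  simp only [Finset.mul_sum]
  refine Finset.sum_congr rfl fun j _ => ?_
  rw [hc, stabKOp_eq _ _ hx, stabLim_add_int, show x.2.2 - 3 * x.1 = x.2.2 + -3 * x.1 by ring,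
    exp_add]
  have e1 : O n (Fin.rev p) (invA x) = O n p x := by
    rw [O, O]; fin_cases p <;> simp [eps, invA]
  have e2 : exp (n * (eps (Fin.rev j) * (invA x).1)) * exp (-n * (eps j * (invV x).1)) = 1 := by
    rw [← exp_add, ← exp_zero]; fin_cases j <;> simp [eps, invA, invV]
  rw [e1]
  linear_combination -exp x.2.2 * exp (-3 * x.1) * O n p x *
    stabLim s (invA x) (Fin.rev p) (Fin.rev j) * f j * e2

/-! ## Bar invariance at the slopes `(0, 1/2)`, `(1/2, 1)`, `0` and `1/2` -/

lemma ch_eq_zpow (i j k : ℤ) (x : Cover) :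
    ch i j k x = exp x.1 ^ i * exp x.2.1 ^ j * exp x.2.2 ^ k := by
  rw [ch, exp_add, exp_add, exp_int_mul, exp_int_mul, exp_int_mul]

/-- The twist `a^i 𝒪(n) ⊗ F`. -/
noncomputable def twistO (i n : ℤ) (F : Vec) : Vec := fun p x => ch i 0 0 x * (O n p x * F p x)

lemma twistO_lineClass (i n i' j k m : ℤ) :
    twistO i n (lineClass i' j k m) = lineClass (i + i') j k (n + m) := by
  funext p x
  rw [twistO, lineClass_eq_exp, lineClass_eq_exp, ch, O, ← exp_add, ← exp_add]
  push_cast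
  ring_nf

/-- Generic bar invariance of `F` and of all its twists, at the integer translates of `s`. -/
def BarFixed (s : ℝ) (F : Vec) : Prop := ∀ x, Generic x → ∃ f : Fin 2 → ℂ,
  (∀ p, F p (invV x) = ((stabLim s (invV x)).mulVec f) p) ∧
  ∀ p, -exp (x.2.2 - 3 * x.1) * ∑ j, stabLim s (invA x) (Fin.rev p) (Fin.rev j) * f j = F p x

lemma BarFixed.barK_eq {s : ℝ} {F : Vec} (h : BarFixed s F) (i n : ℤ) {x : Cover}
    (hx : Generic x) (p : Fin 2) : barK (s + n) (twistO i n F) p x = twistO i n F p x := by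
  obtain ⟨f, h1, h2⟩ := h x hx
  rw [EllipticCanonical.barK_eq s n _ hx (ch i 0 0 x • f) fun p => by
    rw [Matrix.mulVec_smul, Pi.smul_apply, ← h1, twistO, smul_eq_mul,
      show ch i 0 0 (invV x) = ch i 0 0 x by simp [ch, invV]]
    ring]
  rw [twistO, ← h2]
  simp only [Pi.smul_apply, smul_eq_mul, Finset.mul_sum]
  refine Finset.sum_congr rfl fun j _ => ?_
  ring

lemma BarFixed.agree {s : ℝ} {F : Vec} (h : BarFixed s F) (i n : ℤ) :
    AgreeGenerically (barK (s + n) (twistO i n F)) (twistO i n F) :=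
  ⟨{x | Generic x}, isOpen_dense_generic.1, isOpen_dense_generic.2,
    fun _ hx p => h.barK_eq i n hx p⟩

/-- The stable matrix is upper triangular, so the coefficients of `F` at `v⁻¹` are given by back
substitution. Bar invariance becomes two explicit identities of rational functions. -/
lemma barFixed_of {s : ℝ} {F : Vec} (h : ∀ x, Generic x →
    -exp (x.2.2 - 3 * x.1) * (stabLim s (invA x) 1 1 * ((F 0 (invV x) - stabLim s (invV x) 0 1 *
      (F 1 (invV x) / stabLim s (invV x) 1 1)) / stabLim s (invV x) 0 0)) = F 0 x ∧
    -exp (x.2.2 - 3 * x.1) * (stabLim s (invA x) 0 1 * ((F 0 (invV x) - stabLim s (invV x) 0 1 *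
      (F 1 (invV x) / stabLim s (invV x) 1 1)) / stabLim s (invV x) 0 0) +
      stabLim s (invA x) 0 0 * (F 1 (invV x) / stabLim s (invV x) 1 1)) = F 1 x) :
    BarFixed s F := by
  intro x hx
  obtain ⟨h0, h1⟩ := h x hx
  have n0 := stabLim_zero_zero_ne_zero s hx.invV
  have n1 := stabLim_one_one_ne_zero s hx.invV
  refine ⟨![(F 0 (invV x) - stabLim s (invV x) 0 1 * (F 1 (invV x) / stabLim s (invV x) 1 1)) /
    stabLim s (invV x) 0 0, F 1 (invV x) / stabLim s (invV x) 1 1], fun p => ?_, fun p => ?_⟩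
  · fin_cases p
    · simp only [Matrix.mulVec, dotProduct, Fin.sum_univ_two, Fin.zero_eta, Matrix.cons_val_zero,
        Matrix.cons_val_one, Matrix.cons_val_fin_one]
      rw [mul_div_cancel₀ _ n0, sub_add_cancel]
    · simp only [Matrix.mulVec, dotProduct, Fin.sum_univ_two, Fin.mk_one, Matrix.cons_val_zero,
        Matrix.cons_val_one, Matrix.cons_val_fin_one, stabLim_one_zero]
      rw [mul_div_cancel₀ _ n1, zero_mul]
      exact (zero_add _).symm
  · fin_cases p
    · simp only [Fin.sum_univ_two, Fin.zero_eta, Matrix.cons_val_zero,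
        Matrix.cons_val_one, Matrix.cons_val_fin_one, Fin.rev_zero, Fin.reduceLast]
      rw [show (Fin.rev 1 : Fin 2) = 0 from rfl, stabLim_one_zero, zero_mul, add_zero]
      exact h0
    · simp only [Fin.sum_univ_two, Fin.mk_one, Matrix.cons_val_zero,
        Matrix.cons_val_one, Matrix.cons_val_fin_one, Fin.rev_zero, Fin.reduceLast]
      rw [show (Fin.rev 1 : Fin 2) = 0 from rfl]
      exact h1

section Slopes

variable {s : ℝ} (x : Cover)

lemma sqrtL_zero : sqrtL 0 x = exp (-x.1 - x.2.2) := by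
  rw [sqrtL, O, ← exp_add]; congr 1; simp [eps]; ring

lemma sqrtL_one : sqrtL 1 x = exp (-2 * x.1 - x.2.2) := by
  rw [sqrtL, O, ← exp_add]; congr 1; simp [eps]; ring

lemma stabLim_entries : stabLim s x 0 0 = exp (-x.2.2 / 2) * exp (-x.1 - x.2.2) *
      (exp x.1 - exp (-x.1)) *
      (leadTerm (2 * s) (2 * x.2.2 + 2 * x.2.1) / leadTerm (2 * s) (x.2.2 + 2 * x.2.1)) ∧
    stabLim s x 0 1 = exp (-x.2.2 / 2) * exp (-x.1 - x.2.2) *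
      ((exp (x.2.2 + x.1) - exp (-x.2.2 - x.1)) * (leadTerm s (2 * x.2.2 + x.2.1 - x.1) /
          leadTerm s (x.2.1 + x.1 + 2 * x.2.2)) *
          (leadTerm (2 * s) (2 * x.2.1) / leadTerm (2 * s) (2 * x.2.1 - x.2.2)) -
        (exp x.1 - exp (-x.1)) * (leadTerm s (x.2.1 - x.1 - 2 * x.2.2) /
          leadTerm s (x.2.1 + x.1 + 2 * x.2.2)) *
          (leadTerm (2 * s) (2 * x.2.2 + 2 * x.2.1) / leadTerm (2 * s) (2 * x.2.1 - x.2.2))) ∧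
    stabLim s x 1 1 = exp (-x.2.2 / 2) * exp (-2 * x.1 - x.2.2) *
      (exp (x.2.2 + x.1) - exp (-x.2.2 - x.1)) *
      (leadTerm (2 * s) (2 * x.2.1) / leadTerm (2 * s) (2 * x.2.1 - x.2.2)) := by
  have h1 : leadTerm 0 (2 * x.1) = exp x.1 - exp (-x.1) := by
    simp [leadTerm, neg_div]
  have h2 : leadTerm 0 (2 * x.2.2 + 2 * x.1) = exp (x.2.2 + x.1) - exp (-x.2.2 - x.1) := by
    simp only [leadTerm, Int.floor_zero, Int.cast_zero, if_true, zero_mul, exp_zero, one_mul]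
    ring_nf
  simp only [stabLim, Matrix.of_apply, Matrix.cons_val', Matrix.cons_val_zero, Matrix.cons_val_one,
    Matrix.cons_val_fin_one, h1, h2, sqrtL_zero, sqrtL_one, and_self]

/-- Here both `s` and `2s` lie in `(0, 1)`, so every leading term is the pure exponential `exp (w /
2)` and `z` drops out. The theta functions of `z²` bring in `2s`, which is why chambers have length
one half. -/
lemma stabLim_of_mem_first (h0 : 0 < s) (h1 : s < 1 / 2) :
    stabLim s x 0 0 = (exp x.1 ^ 2 - 1) / (exp x.2.2 * exp x.1 ^ 2) ∧
    stabLim s x 0 1 = (exp x.2.2 ^ 2 - 1) / (exp x.1 * exp x.2.2 ^ 2) ∧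
    stabLim s x 1 1 = (exp x.2.2 ^ 2 * exp x.1 ^ 2 - 1) / (exp x.2.2 ^ 2 * exp x.1 ^ 3) := by
  obtain ⟨e0, e1, e2⟩ := stabLim_entries (s := s) x
  have l1 := fun w => leadTerm_of_mem (s := s) h0 (by linarith) w
  have l2 := fun w => leadTerm_of_mem (s := 2 * s) (by linarith) (by linarith) w
  simp only [e0, e1, e2, l1, l2, ← exp_nat_mul, ← exp_sub, ← exp_add, sub_div _ _ (exp _), ← exp_sub, mul_sub, sub_mul,
    ← exp_add, one_div, ← exp_neg]
  refine ⟨?_, ?_, ?_⟩ <;> push_cast <;> ring_nf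

lemma stabLim_of_mem_second (h0 : 1 / 2 < s) (h1 : s < 1) :
    stabLim s x 0 0 = (exp x.1 ^ 2 - 1) / (exp x.1 ^ 2) ∧
    stabLim s x 0 1 = (exp x.2.2 ^ 2 - 1) / (exp x.1 ^ 3 * exp x.2.2) ∧
    stabLim s x 1 1 = (exp x.2.2 ^ 2 * exp x.1 ^ 2 - 1) / (exp x.2.2 * exp x.1 ^ 3) := by
  obtain ⟨e0, e1, e2⟩ := stabLim_entries (s := s) x
  have l1 := fun w => leadTerm_of_mem (s := s) (by linarith) (by linarith) w
  have l2 := fun w => leadTerm_of_mem_int (s := 2 * s) (n := 1) (by push_cast; linarith)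
    (by push_cast; linarith) w
  simp only [e0, e1, e2, l1, l2, ← exp_nat_mul, ← exp_sub, ← exp_add, sub_div _ _ (exp _), ← exp_sub, mul_sub, sub_mul,
    ← exp_add, one_div, ← exp_neg]
  refine ⟨?_, ?_, ?_⟩ <;> push_cast <;> ring_nf

lemma leadTerm_int_ratio (n : ℤ) (w w' : ℂ) : leadTerm n w / leadTerm n w' =
    exp ((n - 1 / 2) * (w - w')) * ((exp w - 1) / (exp w' - 1)) := by
  have h : ∀ w, leadTerm n w = exp ((n - 1 / 2) * w) * (exp w - 1) := fun w => by
    rw [leadTerm_int]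
    simp only [mul_sub, ← exp_add, mul_one]
    ring_nf
  rw [h, h, mul_div_mul_comm, ← exp_sub, mul_sub]

lemma Generic.sub_ne_zero {x : Cover} (hx : Generic x) {u v : ℂ} (i j k : ℤ)
    (h : u = v * (exp x.1 ^ i * exp x.2.1 ^ j * exp x.2.2 ^ k)) (hv : v ≠ 0) (hi : |i| ≤ 2 := by decide)
    (hj : |j| ≤ 2 := by decide) (hk : |k| ≤ 2 := by decide) (h0 : (i, j, k) ≠ 0 := by decide) :
    u - v ≠ 0 := by
  rw [h, ← ch_eq_zpow]
  intro h1
  apply hx i j k hi hj hk h0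
  have : v * (ch i j k x - 1) = 0 := by linear_combination h1
  exact _root_.sub_eq_zero.mp ((mul_eq_zero.mp this).resolve_left hv)

lemma stabLim_zero (hx : Generic x) :
    stabLim 0 x 0 0 = (exp x.1 ^ 2 - 1) * (exp x.2.2 ^ 2 * exp x.2.1 ^ 2 - 1) /
      (exp x.2.2 ^ 2 * exp x.1 ^ 2 * (exp x.2.2 * exp x.2.1 ^ 2 - 1)) ∧
    stabLim 0 x 0 1 = (exp x.2.2 ^ 2 - 1) * (exp x.2.1 + exp x.1) * (exp x.1 * exp x.2.1 - 1) /
      (exp x.1 ^ 2 * exp x.2.2 ^ 2 * (exp x.2.1 ^ 2 - exp x.2.2)) ∧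
    stabLim 0 x 1 1 = (exp x.2.2 ^ 2 * exp x.1 ^ 2 - 1) * (exp x.2.1 ^ 2 - 1) /
      (exp x.1 ^ 3 * exp x.2.2 ^ 2 * (exp x.2.1 ^ 2 - exp x.2.2)) := by
  obtain ⟨e0, e1, e2⟩ := stabLim_entries (s := 0) x
  rw [mul_zero] at e0 e1 e2
  have l := leadTerm_int_ratio 0
  simp only [Int.cast_zero] at l
  simp only [l] at e0 e1 e2
  obtain ⟨a, z, v⟩ := x
  simp only at e0 e1 e2 ⊢
  set A := exp a with hA
  set Z := exp z with hZ
  set V := exp v with hV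
  -- A square root of `v` is needed because the leading-term ratios contain half-integral powers.
  set g := exp (v / 2) with hg
  have gV : V = g ^ 2 := by rw [hg, ← exp_nat_mul, hV]; push_cast; ring_nf
  have q1 : exp (-v / 2) = g⁻¹ := by rw [hg, ← exp_neg, neg_div]
  have q2 : exp (-a - v) = (A * V)⁻¹ := by rw [hA, hV, ← exp_add, ← exp_neg]; ring_nf
  have q3 : exp (-2 * a - v) = (A ^ 2 * V)⁻¹ := by
    rw [hA, hV, ← exp_nat_mul, ← exp_add, ← exp_neg]; push_cast; ring_nf
  have q4 : exp (v + a) = V * A := exp_add _ _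
  have q5 : exp (-v - a) = (V * A)⁻¹ := by rw [hA, hV, ← exp_add, ← exp_neg]; ring_nf
  have q6 : exp (2 * v + 2 * z) = V ^ 2 * Z ^ 2 := by
    rw [hV, hZ, ← exp_nat_mul, ← exp_nat_mul, ← exp_add]; push_cast; ring_nf
  have q7 : exp (v + 2 * z) = V * Z ^ 2 := by
    rw [hV, hZ, ← exp_nat_mul, ← exp_add]; push_cast; ring_nf
  have q8 : exp (2 * z) = Z ^ 2 := by
    rw [hZ, ← exp_nat_mul]; push_cast; ring_nf
  have q9 : exp (2 * z - v) = Z ^ 2 / V := by rw [exp_sub, q8]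
  have q10 : exp (2 * v + z - a) = V ^ 2 * Z / A := by
    rw [exp_sub, exp_add, hV, hZ, hA, ← exp_nat_mul]; push_cast; ring_nf
  have q11 : exp (z + a + 2 * v) = V ^ 2 * Z * A := by
    rw [exp_add, exp_add, hV, hZ, hA, ← exp_nat_mul]; push_cast; ring_nf
  have q12 : exp (z - a - 2 * v) = Z / (V ^ 2 * A) := by
    rw [exp_sub, exp_sub, hV, hZ, hA, ← exp_nat_mul]; push_cast; field_simp
  have q13 : exp (-a) = A⁻¹ := exp_neg _
  have r0 : exp ((0 - 1 / 2) * (2 * v + 2 * z - (v + 2 * z))) = g⁻¹ := by rw [← q1]; ring_nf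
  have r1 : exp ((0 - 1 / 2) * (2 * v + z - a - (z + a + 2 * v))) = A := by rw [hA]; ring_nf
  have r2 : exp ((0 - 1 / 2) * (2 * z - (2 * z - v))) = g⁻¹ := by rw [← q1]; ring_nf
  have r3 : exp ((0 - 1 / 2) * (z - a - 2 * v - (z + a + 2 * v))) = A * V ^ 2 := by
    rw [hA, hV, ← exp_nat_mul, ← exp_add]; push_cast; ring_nf
  have r4 : exp ((0 - 1 / 2) * (2 * v + 2 * z - (2 * z - v))) = (g ^ 3)⁻¹ := by
    rw [hg, ← exp_nat_mul, ← exp_neg]; push_cast; ring_nf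
  have hA0 : A ≠ 0 := exp_ne_zero _
  have hV0 : V ≠ 0 := exp_ne_zero _
  have hZ0 : Z ≠ 0 := exp_ne_zero _
  have hg0 : g ≠ 0 := exp_ne_zero _
  have d1 : V * Z ^ 2 - 1 ≠ 0 := hx.sub_ne_zero 0 2 1 (by
    change _ = 1 * (A ^ (0 : ℤ) * Z ^ (2 : ℤ) * V ^ (1 : ℤ)); simp [mul_comm]) one_ne_zero
  have d2 : Z ^ 2 - V ≠ 0 := hx.sub_ne_zero 0 2 (-1) (by
    change _ = V * (A ^ (0 : ℤ) * Z ^ (2 : ℤ) * V ^ (-1 : ℤ)); simp; field_simp) hV0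
  have d3 : V ^ 2 * Z * A - 1 ≠ 0 := hx.sub_ne_zero 1 1 2 (by
    change _ = 1 * (A ^ (1 : ℤ) * Z ^ (1 : ℤ) * V ^ (2 : ℤ)); simp; ring) one_ne_zero
  rw [q1, q2, r0, q6, q7, q13] at e0
  rw [q1, q2, q4, q5, r1, q10, q11, r2, q8, q9, q13, r3, q12, r4, q6] at e1
  rw [q1, q3, q4, q5, r2, q8, q9] at e2
  clear_value g A Z
  clear_value V
  subst gV
  have d2' : Z ^ 2 / g ^ 2 - 1 ≠ 0 := by
    rw [div_sub_one hV0]; exact div_ne_zero d2 hV0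
  have E2 : (Z ^ 2 / g ^ 2 - 1) = (Z ^ 2 - g ^ 2) / g ^ 2 := by field_simp
  rw [E2] at e1 e2
  have d3' : g ^ 4 * A * Z - 1 ≠ 0 := by
    rwa [show g ^ 4 * A * Z = (g ^ 2) ^ 2 * Z * A by ring]
  refine ⟨?_, ?_, ?_⟩
  · rw [e0]; field_simp
  · rw [e1]; field_simp; ring
  · rw [e2]; field_simp

lemma stabLim_half (hx : Generic x) :
    stabLim (1 / 2) x 0 0 = (exp x.1 ^ 2 - 1) * (exp x.2.2 ^ 2 * exp x.2.1 ^ 2 - 1) /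
      (exp x.2.2 * exp x.1 ^ 2 * (exp x.2.2 * exp x.2.1 ^ 2 - 1)) ∧
    stabLim (1 / 2) x 0 1 = (exp x.2.2 ^ 2 - 1) * (exp x.2.1 ^ 2 - exp x.1 ^ 2) /
      (exp x.1 ^ 3 * exp x.2.2 * (exp x.2.1 ^ 2 - exp x.2.2)) ∧
    stabLim (1 / 2) x 1 1 = (exp x.2.2 ^ 2 * exp x.1 ^ 2 - 1) * (exp x.2.1 ^ 2 - 1) /
      (exp x.1 ^ 3 * exp x.2.2 * (exp x.2.1 ^ 2 - exp x.2.2)) := by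
  obtain ⟨e0, e1, e2⟩ := stabLim_entries (s := 1 / 2) x
  rw [show (2 * (1 / 2) : ℝ) = (1 : ℤ) by norm_num] at e0 e1 e2
  have l := leadTerm_int_ratio 1
  simp only [Int.cast_one] at l
  have l' := fun w => leadTerm_of_mem (s := 1 / 2) (by norm_num) (by norm_num) w
  simp only [Int.cast_one] at e0 e1 e2
  simp only [l, l', ← exp_sub] at e0 e1 e2
  obtain ⟨a, z, v⟩ := x
  simp only at e0 e1 e2 ⊢
  set A := exp a with hA
  set Z := exp z with hZ
  set V := exp v with hV
  set g := exp (v / 2) with hg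
  have gV : V = g ^ 2 := by rw [hg, ← exp_nat_mul, hV]; push_cast; ring_nf
  have q1 : exp (-v / 2) = g⁻¹ := by rw [hg, ← exp_neg, neg_div]
  have q2 : exp (-a - v) = (A * V)⁻¹ := by rw [hA, hV, ← exp_add, ← exp_neg]; ring_nf
  have q3 : exp (-2 * a - v) = (A ^ 2 * V)⁻¹ := by
    rw [hA, hV, ← exp_nat_mul, ← exp_add, ← exp_neg]; push_cast; ring_nf
  have q4 : exp (v + a) = V * A := exp_add _ _
  have q5 : exp (-v - a) = (V * A)⁻¹ := by rw [hA, hV, ← exp_add, ← exp_neg]; ring_nf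
  have q6 : exp (2 * v + 2 * z) = V ^ 2 * Z ^ 2 := by
    rw [hV, hZ, ← exp_nat_mul, ← exp_nat_mul, ← exp_add]; push_cast; ring_nf
  have q7 : exp (v + 2 * z) = V * Z ^ 2 := by
    rw [hV, hZ, ← exp_nat_mul, ← exp_add]; push_cast; ring_nf
  have q8 : exp (2 * z) = Z ^ 2 := by
    rw [hZ, ← exp_nat_mul]; push_cast; ring_nf
  have q9 : exp (2 * z - v) = Z ^ 2 / V := by rw [exp_sub, q8]
  have q10 : exp (2 * v + z - a) = V ^ 2 * Z / A := by
    rw [exp_sub, exp_add, hV, hZ, hA, ← exp_nat_mul]; push_cast; ring_nf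
  have q11 : exp (z + a + 2 * v) = V ^ 2 * Z * A := by
    rw [exp_add, exp_add, hV, hZ, hA, ← exp_nat_mul]; push_cast; ring_nf
  have q12 : exp (z - a - 2 * v) = Z / (V ^ 2 * A) := by
    rw [exp_sub, exp_sub, hV, hZ, hA, ← exp_nat_mul]; push_cast; field_simp
  have q13 : exp (-a) = A⁻¹ := exp_neg _
  have r0 : exp ((1 - 1 / 2) * (2 * v + 2 * z - (v + 2 * z))) = g := by rw [hg]; ring_nf
  have r1 : exp ((2 * v + z - a) / 2 - (z + a + 2 * v) / 2) = A⁻¹ := by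
    rw [hA, ← exp_neg]; ring_nf
  have r2 : exp ((1 - 1 / 2) * (2 * z - (2 * z - v))) = g := by rw [hg]; ring_nf
  have r3 : exp ((z - a - 2 * v) / 2 - (z + a + 2 * v) / 2) = (A * V ^ 2)⁻¹ := by
    rw [hA, hV, ← exp_nat_mul, ← exp_add, ← exp_neg]; push_cast; ring_nf
  have r4 : exp ((1 - 1 / 2) * (2 * v + 2 * z - (2 * z - v))) = g ^ 3 := by
    rw [hg, ← exp_nat_mul]; push_cast; ring_nf
  have hA0 : A ≠ 0 := exp_ne_zero _
  have hV0 : V ≠ 0 := exp_ne_zero _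
  have hZ0 : Z ≠ 0 := exp_ne_zero _
  have hg0 : g ≠ 0 := exp_ne_zero _
  have d1 : V * Z ^ 2 - 1 ≠ 0 := hx.sub_ne_zero 0 2 1 (by
    change _ = 1 * (A ^ (0 : ℤ) * Z ^ (2 : ℤ) * V ^ (1 : ℤ)); simp [mul_comm]) one_ne_zero
  have d2 : Z ^ 2 - V ≠ 0 := hx.sub_ne_zero 0 2 (-1) (by
    change _ = V * (A ^ (0 : ℤ) * Z ^ (2 : ℤ) * V ^ (-1 : ℤ)); simp; field_simp) hV0
  rw [q1, q2, r0, q6, q7, q13] at e0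
  rw [q1, q2, q4, q5, r1, r2, q8, q9, q13, r3, r4, q6] at e1
  rw [q1, q3, q4, q5, r2, q8, q9] at e2
  clear_value g A Z
  clear_value V
  subst gV
  have d2' : Z ^ 2 / g ^ 2 - 1 ≠ 0 := by
    rw [div_sub_one hV0]; exact div_ne_zero d2 hV0
  have E2 : (Z ^ 2 / g ^ 2 - 1) = (Z ^ 2 - g ^ 2) / g ^ 2 := by field_simp
  rw [E2] at e1 e2
  refine ⟨?_, ?_, ?_⟩
  · rw [e0]; field_simp
  · rw [e1]; field_simp; ring
  · rw [e2]; field_simp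

end Slopes


lemma Generic.coords {x : Cover} (hx : Generic x) :
    exp x.2.1 ^ 2 - 1 ≠ 0 ∧ exp x.1 ^ 2 - 1 ≠ 0 ∧ exp x.1 ^ 2 - exp x.2.2 ^ 2 ≠ 0 ∧
      exp x.2.2 * exp x.2.1 ^ 2 - 1 ≠ 0 ∧ exp x.2.1 ^ 2 - exp x.2.2 ≠ 0 ∧
      exp x.2.1 ^ 2 - exp x.2.2 ^ 2 ≠ 0 := by
  have hV := exp_ne_zero x.2.2
  refine ⟨hx.sub_ne_zero 0 2 0 (by simp) one_ne_zero,
    hx.sub_ne_zero 2 0 0 (by simp) one_ne_zero,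
    hx.sub_ne_zero 2 0 (-2) (by simp; field_simp) (pow_ne_zero _ hV),
    hx.sub_ne_zero 0 2 1 (by simp [mul_comm]) one_ne_zero,
    hx.sub_ne_zero 0 2 (-1) (by simp; field_simp) hV,
    hx.sub_ne_zero 0 2 (-2) (by simp; field_simp) (pow_ne_zero _ hV)⟩

lemma exp_coords (x : Cover) : exp (x.2.2 - 3 * x.1) = exp x.2.2 / exp x.1 ^ 3 ∧
    exp (invA x).1 = (exp x.1)⁻¹ ∧ exp (invV x).2.2 = (exp x.2.2)⁻¹ := by
  refine ⟨?_, exp_neg _, exp_neg _⟩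
  rw [exp_sub, ← exp_nat_mul]; push_cast; ring_nf

lemma lineClass_zpow (i j k n : ℤ) (x : Cover) :
    lineClass i j k n 0 x = exp x.1 ^ (i - n) * exp x.2.1 ^ j * exp x.2.2 ^ (k + 2 * n) ∧
    lineClass i j k n 1 x = exp x.1 ^ (i + n) * exp x.2.1 ^ j * exp x.2.2 ^ (k + 2 * n) := by
  rw [lineClass_zero, lineClass_one, ch_eq_zpow, ch_eq_zpow]
  exact ⟨rfl, rfl⟩

lemma barFixed_first {s : ℝ} (h0 : 0 < s) (h1 : s < 1 / 2) :
    BarFixed s (lineClass 0 0 1 (-1)) ∧ BarFixed s (lineClass 0 0 0 0) := by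
  constructor <;> refine barFixed_of fun x hx => ?_
  all_goals
    obtain ⟨d1, d2, d3, d4, d5, d6⟩ := hx.coords
    obtain ⟨e1, e2, e3⟩ := stabLim_of_mem_first (s := s) (invV x) h0 h1
    obtain ⟨e4, e5, e6⟩ := stabLim_of_mem_first (s := s) (invA x) h0 h1
    obtain ⟨q1, q2, q3⟩ := exp_coords x
    rw [e1, e2, e3, e4, e5, e6, (lineClass_zpow _ _ _ _ _).1, (lineClass_zpow _ _ _ _ _).1,
      (lineClass_zpow _ _ _ _ _).2, (lineClass_zpow _ _ _ _ _).2, q1, q2, q3]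
    have hA := exp_ne_zero x.1
    have hV := exp_ne_zero x.2.2
    change _ * (_ * ((_ - ((exp x.2.2)⁻¹ ^ 2 - 1) / (exp x.1 * _) * _) / _)) = _ ∧ _
    simp only [invA, invV] at *
    generalize exp x.1 = A at *
    generalize exp x.2.2 = V at *
    norm_num
    constructor <;> field_simp <;> ring


lemma barFixed_second {s : ℝ} (h0 : 1 / 2 < s) (h1 : s < 1) :
    BarFixed s (lineClass 0 0 0 0) ∧ BarFixed s (lineClass 0 0 (-1) 1) := by
  constructor <;> refine barFixed_of fun x hx => ?_
  all_goals
    obtain ⟨d1, d2, d3, d4, d5, d6⟩ := hx.coords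
    obtain ⟨e1, e2, e3⟩ := stabLim_of_mem_second (s := s) (invV x) h0 h1
    obtain ⟨e4, e5, e6⟩ := stabLim_of_mem_second (s := s) (invA x) h0 h1
    obtain ⟨q1, q2, q3⟩ := exp_coords x
    rw [e1, e2, e3, e4, e5, e6]
    simp only [(lineClass_zpow _ _ _ _ _).1,
      (lineClass_zpow _ _ _ _ _).2, q1, q2, q3]
    have hA := exp_ne_zero x.1
    have hZ := exp_ne_zero x.2.1
    have hV := exp_ne_zero x.2.2
    simp only [invA, invV] at *
    generalize exp x.1 = A at *
    generalize exp x.2.1 = Z at *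
    generalize exp x.2.2 = V at *
    norm_num
    constructor <;> field_simp <;> ring

/-- On a wall the stable matrix depends on `z`. The invariant elements join canonical classes of the
two adjacent chambers by a power of `z`: here `z⁻¹` with a minus sign. -/
lemma barFixed_zero :
    BarFixed 0 (lineClass 0 0 1 (-1) - lineClass 0 (-1) (-1) 0) ∧ BarFixed 0 (lineClass 0 0 0 0 - lineClass 0 (-1) 0 (-1)) := by
  constructor <;> refine barFixed_of fun x hx => ?_
  all_goals
    obtain ⟨d1, d2, d3, d4, d5, d6⟩ := hx.coords
    obtain ⟨e1, e2, e3⟩ := stabLim_zero (invV x) hx.invV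
    obtain ⟨e4, e5, e6⟩ := stabLim_zero (invA x) hx.invA
    obtain ⟨q1, q2, q3⟩ := exp_coords x
    rw [e1, e2, e3, e4, e5, e6]
    simp only [Pi.sub_apply, (lineClass_zpow _ _ _ _ _).1,
      (lineClass_zpow _ _ _ _ _).2, q1, q2, q3]
    have hA := exp_ne_zero x.1
    have hZ := exp_ne_zero x.2.1
    have hV := exp_ne_zero x.2.2
    simp only [invA, invV] at *
    generalize exp x.1 = A at *
    generalize exp x.2.1 = Z at *
    generalize exp x.2.2 = V at *
    have d7 : V⁻¹ * Z ^ 2 - 1 ≠ 0 := by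
      rw [show V⁻¹ * Z ^ 2 - 1 = (Z ^ 2 - V) / V by field_simp]; exact div_ne_zero d5 hV
    have d8 : Z ^ 2 - V⁻¹ ≠ 0 := by
      rw [show Z ^ 2 - V⁻¹ = (V * Z ^ 2 - 1) / V by field_simp]; exact div_ne_zero d4 hV
    norm_num
    constructor <;> field_simp <;> ring

/-- The trivial bundle is unaffected by this wall. The other invariant element joins two classes by
`z⁻²`, without a `z⁻¹` term; this pair is also used to show that a `z⁻¹` coefficient must be even in
`log v`. -/
lemma barFixed_half :
    BarFixed (1 / 2) (lineClass 0 0 0 0) ∧ BarFixed (1 / 2) (lineClass 0 0 (-1) 1 + lineClass 0 (-2) 1 (-1)) := by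
  constructor <;> refine barFixed_of fun x hx => ?_
  all_goals
    obtain ⟨d1, d2, d3, d4, d5, d6⟩ := hx.coords
    obtain ⟨e1, e2, e3⟩ := stabLim_half (invV x) hx.invV
    obtain ⟨e4, e5, e6⟩ := stabLim_half (invA x) hx.invA
    obtain ⟨q1, q2, q3⟩ := exp_coords x
    rw [e1, e2, e3, e4, e5, e6]
    simp only [Pi.add_apply, (lineClass_zpow _ _ _ _ _).1,
      (lineClass_zpow _ _ _ _ _).2, q1, q2, q3]
    have hA := exp_ne_zero x.1
    have hZ := exp_ne_zero x.2.1
    have hV := exp_ne_zero x.2.2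
    simp only [invA, invV] at *
    generalize exp x.1 = A at *
    generalize exp x.2.1 = Z at *
    generalize exp x.2.2 = V at *
    have d7 : V⁻¹ * Z ^ 2 - 1 ≠ 0 := by
      rw [show V⁻¹ * Z ^ 2 - 1 = (Z ^ 2 - V) / V by field_simp]; exact div_ne_zero d5 hV
    have d8 : Z ^ 2 - V⁻¹ ≠ 0 := by
      rw [show Z ^ 2 - V⁻¹ = (V * Z ^ 2 - 1) / V by field_simp]; exact div_ne_zero d4 hV
    norm_num
    constructor <;> field_simp <;> ring

/-! ## Canonical bases at generic slopes -/

/-- The hypothesis displays the coefficients as `a^γ v^{-k} / (1 - v^{-2} a^{-2})`. As `v → ∞` those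
with `k > 0` vanish and those with `k = 0` tend to a power of `a`. -/
lemma tendsto_coeffK (s : ℝ) (i n : ℤ) (B : Vec) (γ : Fin 2 → ℤ) (k : Fin 2 → ℕ)
    (h : ∀ x, Generic x → ∀ p, B p x = ((stabLim s x).mulVec fun j =>
      exp (γ j * x.1 - k j * x.2.2) / (1 - exp (-2 * x.2.2 - 2 * x.1))) p) {a z : ℂ}
    (hU : ∀ i j : ℤ, |i| ≤ 2 → |j| ≤ 2 → (i, j) ≠ 0 → exp (i * a + j * z) ≠ 1) (p : Fin 2) :
    Tendsto (fun ν => coeffK (s + n) (twistO i n B) (a, z, ν) p) (comap re atTop)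
      (𝓝 (if k p = 0 then exp ((i + γ p) * a - n * (eps p * a)) else 0)) := by
  -- When `re ν` is large, a character involving `v` cannot be trivial, its absolute value being far
  -- from one. Only characters in `a` and `z` need a genericity hypothesis.
  have hgen : ∀ᶠ ν in comap re atTop, Generic (a, z, ν) := by
    have h1 := tendsto_comap.eventually (eventually_gt_atTop
      (2 * ‖a‖ + 2 * ‖z‖) : ∀ᶠ t : ℝ in atTop, 2 * ‖a‖ + 2 * ‖z‖ < t) (f := re)
    filter_upwards [h1] with ν hν i j k hi hj hk h0
    rcases eq_or_ne k 0 with rfl | hk0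
    · have := hU i j hi hj (by simpa using h0)
      simpa [ch] using this
    · intro h1
      have h2 : Real.exp (i * a.re + j * z.re + k * ν.re) = 1 := by
        have := congrArg norm h1
        rw [ch, norm_exp, norm_one] at this
        simpa using this
      rw [Real.exp_eq_one_iff] at h2
      have b1 : |(i : ℝ) * a.re| ≤ 2 * ‖a‖ := by
        rw [abs_mul]
        exact mul_le_mul (by exact_mod_cast hi) (abs_re_le_norm a) (abs_nonneg _) (by norm_num)
      have b2 : |(j : ℝ) * z.re| ≤ 2 * ‖z‖ := by
        rw [abs_mul]
        exact mul_le_mul (by exact_mod_cast hj) (abs_re_le_norm z) (abs_nonneg _) (by norm_num)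
      have b3 : |(k : ℝ) * ν.re| ≤ 2 * ‖a‖ + 2 * ‖z‖ := by
        rw [show (k : ℝ) * ν.re = -(i * a.re + j * z.re) by linarith, abs_neg]
        exact (abs_add_le _ _).trans (add_le_add b1 b2)
      rw [abs_mul] at b3
      have b4 : (1 : ℝ) ≤ |(k : ℝ)| := by exact_mod_cast Int.one_le_abs hk0
      have b5 := le_abs_self ν.re
      nlinarith [abs_nonneg ν.re]
  have hval : ∀ᶠ ν in comap re atTop, coeffK (s + n) (twistO i n B) (a, z, ν) p =
      exp ((i + γ p) * a - n * (eps p * a)) * (exp (-(k p * ν)) / (1 - exp (-2 * ν - 2 * a))) := by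
    filter_upwards [hgen] with ν hν
    rw [coeffK_eq s n _ hν (ch i 0 0 (a, z, ν) • fun j =>
      exp (γ j * a - k j * ν) / (1 - exp (-2 * ν - 2 * a))) fun q => by
        rw [Matrix.mulVec_smul, Pi.smul_apply, ← h _ hν, twistO, smul_eq_mul]; ring]
    rw [Pi.smul_apply, smul_eq_mul, ch, ← mul_assoc, ← exp_add, mul_div_assoc', mul_div_assoc',
      ← exp_add, ← exp_add]
    congr 2
    push_cast
    ring
  have hz : ∀ r : ℝ, 0 < r → ∀ c : ℂ, Tendsto (fun ν => exp (-(r * ν) - c)) (comap re atTop) (𝓝 0) := by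
    intro r hr c
    rw [tendsto_zero_iff_norm_tendsto_zero]
    have e : ∀ ν : ℂ, ‖exp (-(r * ν) - c)‖ = Real.exp (-(r * ν.re + c.re)) := fun ν => by
      rw [norm_exp]; simp; ring
    simp only [e]
    refine Real.tendsto_exp_neg_atTop_nhds_zero.comp ?_
    exact tendsto_atTop_add_const_right _ _ (tendsto_comap.const_mul_atTop hr)
  have hD : Tendsto (fun ν => 1 - exp (-2 * ν - 2 * a)) (comap re atTop) (𝓝 1) := by
    have := (hz 2 (by norm_num) (2 * a)).const_sub 1
    rw [sub_zero] at this
    refine this.congr fun ν => ?_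
    push_cast; ring_nf
  refine Tendsto.congr' (hval.mono fun ν h => h.symm) ?_
  split_ifs with hk
  · have := (hD.inv₀ one_ne_zero).const_mul (exp ((i + γ p) * a - n * (eps p * a)))
    rw [inv_one, mul_one] at this
    refine this.congr fun ν => ?_
    simp [hk]
  · have h1 := hz (k p) (by positivity) 0
    have := (h1.div hD one_ne_zero).const_mul (exp ((i + γ p) * a - n * (eps p * a)))
    rw [zero_div, mul_zero] at this
    refine this.congr fun ν => ?_
    simp

lemma dense_generic_az : ∃ U : Set (ℂ × ℂ), IsOpen U ∧ Dense U ∧ ∀ y ∈ U,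
    ∀ i j : ℤ, |i| ≤ 2 → |j| ≤ 2 → (i, j) ≠ 0 → exp (i * y.1 + j * y.2) ≠ 1 := by
  refine ⟨(fun x : Cover => (x.1, x.2.1)) '' {x | Generic x}, ?_, ?_, ?_⟩
  · have : IsOpenMap (fun x : Cover => (x.1, x.2.1)) :=
      IsOpenMap.prodMap IsOpenMap.id isOpenMap_fst
    exact this _ isOpen_dense_generic.1
  · refine DenseRange.dense_image ?_ (by fun_prop) isOpen_dense_generic.2
    exact (Function.Surjective.denseRange fun y => ⟨(y.1, y.2, 0), rfl⟩)
  · rintro y ⟨x, hx, rfl⟩ i j hi hj h0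
    have := hx i j 0 hi hj (by simp) (by simpa using h0)
    simpa [ch] using this

/-- The canonical basis at slopes in `(n, n + 1/2)`. -/
noncomputable def canonEven (n : ℤ) : Fin 2 → Vec :=
  ![lineClass (n - 1) 0 1 (n - 1), lineClass (-n - 1) 0 0 n]

/-- The canonical basis at slopes in `(n + 1/2, n + 1)`. -/
noncomputable def canonOdd (n : ℤ) : Fin 2 → Vec :=
  ![lineClass n 0 0 n, lineClass (-n - 2) 0 (-1) (n + 1)]

lemma canonEven_zero (n : ℤ) : canonEven n 0 = twistO (n - 1) n (lineClass 0 0 1 (-1)) := by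
  rw [twistO_lineClass]; simp [canonEven, sub_eq_add_neg]

lemma canonEven_one (n : ℤ) : canonEven n 1 = twistO (-n - 1) n (lineClass 0 0 0 0) := by
  rw [twistO_lineClass]; simp [canonEven]

lemma canonOdd_zero (n : ℤ) : canonOdd n 0 = twistO n n (lineClass 0 0 0 0) := by
  rw [twistO_lineClass]; simp [canonOdd]

lemma canonOdd_one (n : ℤ) : canonOdd n 1 = twistO (-n - 2) n (lineClass 0 0 (-1) 1) := by
  rw [twistO_lineClass]; simp [canonOdd]

lemma exp_stab_coeff (γ : ℤ) (k : ℕ) (x : Cover) :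
    exp (γ * x.1 - k * x.2.2) / (1 - exp (-2 * x.2.2 - 2 * x.1)) =
      exp x.1 ^ γ * (exp x.2.2 ^ k)⁻¹ / (1 - (exp x.2.2 ^ 2 * exp x.1 ^ 2)⁻¹) := by
  rw [exp_sub, exp_int_mul, exp_nat_mul, show -2 * x.2.2 - 2 * x.1 = -((2 : ℕ) * x.2.2 + (2 : ℕ) * x.1) by
    push_cast; ring, exp_neg (_ + _), exp_add, exp_nat_mul, exp_nat_mul]
  rfl

lemma Generic.one_sub_inv_ne_zero {x : Cover} (hx : Generic x) :
    exp x.2.2 ^ 2 * exp x.1 ^ 2 - 1 ≠ 0 :=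
  hx.sub_ne_zero 2 0 2 (by simp [mul_comm]) one_ne_zero

lemma stabCoeff_first {s : ℝ} (h0 : 0 < s) (h1 : s < 1 / 2) (x : Cover) (hx : Generic x)
    (p : Fin 2) :
    lineClass 0 0 1 (-1) p x = ((stabLim s x).mulVec fun j =>
      exp ((![1, 0] j : ℤ) * x.1 - (![0, 1] j : ℕ) * x.2.2) /
        (1 - exp (-2 * x.2.2 - 2 * x.1))) p ∧
    lineClass 0 0 0 0 p x = ((stabLim s x).mulVec fun j =>
      exp ((![0, 1] j : ℤ) * x.1 - (![1, 0] j : ℕ) * x.2.2) /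
        (1 - exp (-2 * x.2.2 - 2 * x.1))) p := by
  obtain ⟨e1, e2, e3⟩ := stabLim_of_mem_first (s := s) x h0 h1
  have d := hx.one_sub_inv_ne_zero
  have hA := exp_ne_zero x.1
  have hV := exp_ne_zero x.2.2
  have e4 := stabLim_one_zero s x
  simp only [exp_stab_coeff, Matrix.mulVec, dotProduct, Fin.sum_univ_two, Matrix.cons_val_zero,
    Matrix.cons_val_one, Matrix.cons_val_fin_one]
  fin_cases p
  all_goals
    simp only [Fin.zero_eta, Fin.mk_one, e1, e2, e3, e4, (lineClass_zpow _ _ _ _ _).1,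
      (lineClass_zpow _ _ _ _ _).2]
    generalize exp x.1 = A at *
    generalize exp x.2.2 = V at *
    have d' : 1 - (V ^ 2 * A ^ 2)⁻¹ = (V ^ 2 * A ^ 2 - 1) / (V ^ 2 * A ^ 2) := by field_simp
    have d'' : A ^ 2 * V ^ 2 - 1 ≠ 0 := by rwa [mul_comm]
    rw [d']
    norm_num
    constructor <;> field_simp <;> ring

lemma stabCoeff_second {s : ℝ} (h0 : 1 / 2 < s) (h1 : s < 1) (x : Cover) (hx : Generic x)
    (p : Fin 2) :
    lineClass 0 0 0 0 p x = ((stabLim s x).mulVec fun j =>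
      exp ((![0, 1] j : ℤ) * x.1 - (![0, 1] j : ℕ) * x.2.2) /
        (1 - exp (-2 * x.2.2 - 2 * x.1))) p ∧
    lineClass 0 0 (-1) 1 p x = ((stabLim s x).mulVec fun j =>
      exp ((![-1, 2] j : ℤ) * x.1 - (![1, 0] j : ℕ) * x.2.2) /
        (1 - exp (-2 * x.2.2 - 2 * x.1))) p := by
  obtain ⟨e1, e2, e3⟩ := stabLim_of_mem_second (s := s) x h0 h1
  have d := hx.one_sub_inv_ne_zero
  have hA := exp_ne_zero x.1
  have hV := exp_ne_zero x.2.2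
  have e4 := stabLim_one_zero s x
  simp only [exp_stab_coeff, Matrix.mulVec, dotProduct, Fin.sum_univ_two, Matrix.cons_val_zero,
    Matrix.cons_val_one, Matrix.cons_val_fin_one]
  fin_cases p
  all_goals
    simp only [Fin.zero_eta, Fin.mk_one, e1, e2, e3, e4, (lineClass_zpow _ _ _ _ _).1,
      (lineClass_zpow _ _ _ _ _).2]
    generalize exp x.1 = A at *
    generalize exp x.2.2 = V at *
    have d' : 1 - (V ^ 2 * A ^ 2)⁻¹ = (V ^ 2 * A ^ 2 - 1) / (V ^ 2 * A ^ 2) := by field_simp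
    have d'' : A ^ 2 * V ^ 2 - 1 ≠ 0 := by rwa [mul_comm]
    rw [d']
    norm_num
    constructor <;> field_simp <;> ring

/-- The twists `a^{n-1}` and `a^{-n-1}` in `canonEven` are exactly those that make the diagonal
limits equal to `1`, compensating both `γ` and the column factor of `stabLim_add_int`. -/
lemma isKCanonical_even {s : ℝ} (n : ℤ) (h0 : 0 < s) (h1 : s < 1 / 2) :
    IsKCanonical (s + n) (canonEven n) := by
  refine ⟨?_, fun p => ?_, ?_⟩
  · obtain ⟨b, e0, e1⟩ := exists_basis_lineClass (n - 1) 1 (-n - 1) 0 (n - 1)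
    refine ⟨b, fun p => ?_⟩
    fin_cases p
    · exact e0
    · rw [sub_add_cancel] at e1; exact e1
  · fin_cases p
    · change AgreeGenerically (barK _ (canonEven n 0)) (canonEven n 0)
      rw [canonEven_zero]; exact (barFixed_first h0 h1).1.agree _ _
    · change AgreeGenerically (barK _ (canonEven n 1)) (canonEven n 1)
      rw [canonEven_one]; exact (barFixed_first h0 h1).2.agree _ _
  · obtain ⟨U, hU, hU', h⟩ := dense_generic_az
    refine ⟨U, hU, hU', fun y hy p p' => ?_⟩
    fin_cases p
    · have := tendsto_coeffK s (n - 1) n _ ![1, 0] ![0, 1]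
        (fun x hx p => (stabCoeff_first h0 h1 x hx p).1) (h y hy) p'
      change Tendsto (fun ν => coeffK _ (canonEven n 0) _ p') _ _
      rw [canonEven_zero]
      convert this using 2
      fin_cases p' <;> simp [eps]
    · have := tendsto_coeffK s (-n - 1) n _ ![0, 1] ![1, 0]
        (fun x hx p => (stabCoeff_first h0 h1 x hx p).2) (h y hy) p'
      change Tendsto (fun ν => coeffK _ (canonEven n 1) _ p') _ _
      rw [canonEven_one]
      convert this using 2
      fin_cases p' <;> simp [eps]

lemma isKCanonical_odd {s : ℝ} (n : ℤ) (h0 : 1 / 2 < s) (h1 : s < 1) :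
    IsKCanonical (s + n) (canonOdd n) := by
  refine ⟨?_, fun p => ?_, ?_⟩
  · obtain ⟨b, e0, e1⟩ := exists_basis_lineClass n 0 (-n - 2) (-1) n
    refine ⟨b, fun p => ?_⟩
    fin_cases p
    · exact e0
    · exact e1
  · fin_cases p
    · change AgreeGenerically (barK _ (canonOdd n 0)) (canonOdd n 0)
      rw [canonOdd_zero]; exact (barFixed_second h0 h1).1.agree _ _
    · change AgreeGenerically (barK _ (canonOdd n 1)) (canonOdd n 1)
      rw [canonOdd_one]; exact (barFixed_second h0 h1).2.agree _ _
  · obtain ⟨U, hU, hU', h⟩ := dense_generic_az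
    refine ⟨U, hU, hU', fun y hy p p' => ?_⟩
    fin_cases p
    · have := tendsto_coeffK s n n _ ![0, 1] ![0, 1]
        (fun x hx p => (stabCoeff_second h0 h1 x hx p).1) (h y hy) p'
      change Tendsto (fun ν => coeffK _ (canonOdd n 0) _ p') _ _
      rw [canonOdd_zero]
      convert this using 2
      fin_cases p' <;> simp [eps]
    · have := tendsto_coeffK s (-n - 2) n _ ![-1, 2] ![1, 0]
        (fun x hx p => (stabCoeff_second h0 h1 x hx p).2) (h y hy) p'
      change Tendsto (fun ν => coeffK _ (canonOdd n 1) _ p') _ _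
      rw [canonOdd_one]
      convert this using 2
      fin_cases p' <;> simp [eps]

/-! ## Wall crossing -/

lemma mono_zero (F : Vec) : mono 0 0 0 F = F := by
  funext p x; rw [mono, ch_zero, one_mul]

lemma mono_mono (i j k i' j' k' : ℤ) (F : Vec) :
    mono i j k (mono i' j' k' F) = mono (i + i') (j + j') (k + k') F := by
  funext p x; simp only [mono, ch_add, mul_assoc]

lemma ch_injective {i j k i' j' k' : ℤ} (h : ch i j k = ch i' j' k') :
    i = i' ∧ j = j' ∧ k = k' := by
  have key : ∀ u v : ℤ, exp (u : ℂ) = exp (v : ℂ) → u = v := by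
    intro u v h
    have h1 := congrArg norm h
    rw [norm_exp, norm_exp, Real.exp_eq_exp] at h1
    simpa using h1
  refine ⟨key _ _ ?_, key _ _ ?_, key _ _ ?_⟩
  · have := congrFun h (1, 0, 0); simpa [ch] using this
  · have := congrFun h (0, 1, 0); simpa [ch] using this
  · have := congrFun h (0, 0, 1); simpa [ch] using this

/-- The two restrictions are distinct monomials whose exponents determine all four indices. This
makes a map prescribed on the twists of a canonical basis well defined. -/
lemma lineClass_injective {i j k n i' j' k' n' : ℤ}
    (h : lineClass i j k n = lineClass i' j' k' n') : i = i' ∧ j = j' ∧ k = k' ∧ n = n' := by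
  have h0 := congrFun h 0
  have h1 := congrFun h 1
  rw [lineClass_zero, lineClass_zero] at h0
  rw [lineClass_one, lineClass_one] at h1
  obtain ⟨a1, a2, a3⟩ := ch_injective h0
  obtain ⟨b1, b2, b3⟩ := ch_injective h1
  omega

/-- The twists of the members of `B` are pairwise distinct. -/
def TwistInjective (B : Fin 2 → Vec) : Prop :=
  ∀ i i' p p', mono i 0 0 (B p) = mono i' 0 0 (B p') → i = i' ∧ p = p'

lemma twistInjective_even (n : ℤ) : TwistInjective (canonEven n) := by
  intro i i' p p' h
  fin_cases p <;> fin_cases p' <;>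
  · simp only [canonEven, Fin.zero_eta, Fin.mk_one, Matrix.cons_val_zero, Matrix.cons_val_one,
      Matrix.cons_val_fin_one, mono_lineClass] at h
    have := lineClass_injective h
    simp only [Fin.zero_eta, Fin.mk_one, zero_ne_one, one_ne_zero, and_true, and_false]
    omega

lemma twistInjective_odd (n : ℤ) : TwistInjective (canonOdd n) := by
  intro i i' p p' h
  fin_cases p <;> fin_cases p' <;>
  · simp only [canonOdd, Fin.zero_eta, Fin.mk_one, Matrix.cons_val_zero, Matrix.cons_val_one,
      Matrix.cons_val_fin_one, mono_lineClass] at h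
    have := lineClass_injective h
    simp only [Fin.zero_eta, Fin.mk_one, zero_ne_one, one_ne_zero, and_true, and_false]
    omega

/-- An equivariant bijection is determined by the images of the two basis elements. It always
exchanges the labels here, and the exponents `c` remain to be chosen for each wall. Off the twists
the value of `wc` is immaterial. -/
lemma exists_wallCrossing {B B' : Fin 2 → Vec} (hB : TwistInjective B) (hB' : TwistInjective B')
    (c : Fin 2 → ℤ) : ∃ wc : Vec → Vec,
      (∀ i p, wc (mono i 0 0 (B p)) = mono (i + c p) 0 0 (B' (Fin.rev p))) ∧
      (∀ p, wc (B p) = mono (c p) 0 0 (B' (Fin.rev p))) ∧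
      Set.BijOn wc (twists B) (twists B') ∧
      ∀ F ∈ twists B, ∀ i : ℤ, wc (mono i 0 0 F) = mono i 0 0 (wc F) := by
  classical
  set wc : Vec → Vec := fun F => if h : ∃ ip : ℤ × Fin 2, F = mono ip.1 0 0 (B ip.2) then
    mono (h.choose.1 + c h.choose.2) 0 0 (B' (Fin.rev h.choose.2)) else F with hwc
  have h1 : ∀ i p, wc (mono i 0 0 (B p)) = mono (i + c p) 0 0 (B' (Fin.rev p)) := by
    intro i p
    have h : ∃ ip : ℤ × Fin 2, mono i 0 0 (B p) = mono ip.1 0 0 (B ip.2) := ⟨(i, p), rfl⟩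
    obtain ⟨e1, e2⟩ := hB _ _ _ _ h.choose_spec
    have : wc (mono i 0 0 (B p)) =
        mono (h.choose.1 + c h.choose.2) 0 0 (B' (Fin.rev h.choose.2)) := dif_pos h
    rw [this, ← e1, ← e2]
  refine ⟨wc, h1, fun p => ?_, ⟨?_, ?_, ?_⟩, ?_⟩
  · have := h1 0 p
    rwa [mono_zero, zero_add] at this
  · rintro _ ⟨i, p, rfl⟩
    exact ⟨i + c p, Fin.rev p, h1 i p⟩
  · rintro _ ⟨i, p, rfl⟩ _ ⟨i', p', rfl⟩ h
    rw [h1, h1] at h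
    obtain ⟨e1, e2⟩ := hB' _ _ _ _ h
    have e3 : p = p' := Fin.rev_injective e2
    subst e3
    rw [add_right_cancel e1]
  · rintro _ ⟨i, p, rfl⟩
    refine ⟨_, ⟨i - c (Fin.rev p), Fin.rev p, rfl⟩, ?_⟩
    rw [h1, Fin.rev_rev, sub_add_cancel]
  · rintro _ ⟨i, p, rfl⟩ i'
    rw [mono_mono, add_zero, h1, h1, mono_mono, add_zero, add_assoc]

lemma eventually_small {P : ℝ → Prop} {b : ℝ} (hb : 0 < b) (h : ∀ ε, 0 < ε → ε < b → P ε) :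
    ∀ᶠ ε in 𝓝[>] (0 : ℝ), P ε := by
  filter_upwards [Ioo_mem_nhdsGT hb] with ε hε
  exact h ε hε.1 hε.2

/-- At a slope off the walls the canonical basis does not change. -/
lemma isWallCanonical_of_generic {s : ℝ} {B : Fin 2 → Vec} {b : ℝ} (hb : 0 < b)
    (h : ∀ ε, |ε| < b → IsKCanonical (s + ε) B) : IsWallCanonical s B B id B := by
  refine ⟨eventually_small hb fun ε h0 h1 => h ε (by rwa [abs_of_pos h0]),
    eventually_small hb fun ε h0 h1 => ?_, Set.bijOn_id _, fun F _ i => rfl, fun p => ?_, fun p => ?_⟩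
  · rw [sub_eq_add_neg]; exact h _ (by rwa [abs_neg, abs_of_pos h0])
  · refine ⟨0, fun _ => B p, 1, Or.inl rfl, rfl, (one_smul _ _).symm, fun β h0 h1 => by omega,
      fun h => absurd rfl h, ?_⟩
    simp [mono_zero]
  · have := (h 0 (by rwa [abs_zero])).bar p
    rwa [add_zero] at this

/-- The canonical basis at an integral slope. -/
noncomputable def wallInt (n : ℤ) : Fin 2 → Vec :=
  ![twistO (n - 1) n (lineClass 0 0 1 (-1) - lineClass 0 (-1) (-1) 0),
    twistO (-n - 1) n (lineClass 0 0 0 0 - lineClass 0 (-1) 0 (-1))]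

/-- The canonical basis at a half-integral slope. -/
noncomputable def wallHalf (n : ℤ) : Fin 2 → Vec :=
  ![twistO n n (lineClass 0 0 0 0),
    twistO (-n - 2) n (lineClass 0 0 (-1) 1 + lineClass 0 (-2) 1 (-1))]

lemma twistO_sub (i n : ℤ) (F G : Vec) : twistO i n (F - G) = twistO i n F - twistO i n G := by
  funext p x; simp only [twistO, Pi.sub_apply]; ring

lemma twistO_add (i n : ℤ) (F G : Vec) : twistO i n (F + G) = twistO i n F + twistO i n G := by
  funext p x; simp only [twistO, Pi.add_apply]; ring

/-- With the shifts `±2n`, the image of each element is `v⁻¹` times a twist of the other element of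
the same basis. The required triangularity is then immediate, and `N = 1` leaves no intermediate
terms. -/
lemma exists_isWallCanonical_int (n : ℤ) : ∃ wc,
    IsWallCanonical n (canonEven n) (canonOdd (n - 1)) wc (wallInt n) ∧
      ∀ p, ∃ c, wc (canonEven n p) = mono c 0 0 (canonOdd (n - 1) (Fin.rev p)) := by
  obtain ⟨wc, h1, h2, h3, h4⟩ := exists_wallCrossing (twistInjective_even n)
    (twistInjective_odd (n - 1)) ![2 * n, -2 * n]
  have w0 : wc (canonEven n 0) = lineClass (n - 1) 0 (-1) n := by
    rw [h2]; simp [canonOdd, mono_lineClass]; ring_nf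
  have w1 : wc (canonEven n 1) = lineClass (-n - 1) 0 0 (n - 1) := by
    rw [h2]; simp [canonOdd, mono_lineClass]; ring_nf
  refine ⟨wc, ⟨eventually_small one_half_pos fun ε e0 e1 => ?_,
    eventually_small one_half_pos fun ε e0 e1 => ?_, h3, h4, fun p => ?_, fun p => ?_⟩,
    fun p => ⟨_, h2 p⟩⟩
  · rw [add_comm]; exact isKCanonical_even n e0 e1
  · have := isKCanonical_odd (s := 1 - ε) (n - 1) (by linarith) (by linarith)
    push_cast at this
    convert this using 1; ring
  · refine ⟨1, fun β => if β = 0 then canonEven n p else (-1 : ℤ) • wc (canonEven n p), -1,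
      Or.inr rfl, by simp, by simp, fun β b0 b1 => by omega, fun _ => ?_, ?_⟩
    · refine AddSubgroup.subset_closure ⟨1, one_pos, ?_⟩
      fin_cases p
      · refine ⟨_, ⟨2 * n, 1, rfl⟩, ?_⟩
        simp only [Fin.zero_eta, w0]
        simp only [canonEven, Matrix.cons_val_one, Matrix.cons_val_fin_one,
          mono_lineClass]
        push_cast; ring_nf
      · refine ⟨_, ⟨-2 * n, 0, rfl⟩, ?_⟩
        simp only [Fin.mk_one, w1]
        simp only [canonEven, Matrix.cons_val_zero, mono_lineClass]
        push_cast; ring_nf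
    · have hm : ∀ F : Vec, mono 0 (-1) 0 ((-1 : ℤ) • F) = -mono 0 (-1) 0 F := fun F => by
        funext p x; simp [mono]
      rw [Finset.sum_range_succ, Finset.sum_range_one]
      simp only [if_true, one_ne_zero, if_false, Nat.cast_zero, neg_zero, mono_zero, Nat.cast_one, hm]
      fin_cases p
      · simp only [Fin.zero_eta, w0]
        simp only [wallInt, Matrix.cons_val_zero, twistO_sub, twistO_lineClass,
          canonEven, mono_lineClass]
        ring_nf
      · simp only [Fin.mk_one, w1]
        simp only [wallInt, Matrix.cons_val_one, Matrix.cons_val_fin_one, twistO_sub,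
          twistO_lineClass, canonEven, mono_lineClass]
        ring_nf
  · have := barFixed_zero
    rw [← zero_add (n : ℝ)]
    fin_cases p
    · exact this.1.agree _ _
    · exact this.2.agree _ _

/-- The class `a^n 𝒪(n)` belongs to the bases on both sides, so it crosses unchanged with `N = 0`.
The other class passes from `𝒪(n+1)` to `𝒪(n-1)` and needs `N = 2`. -/
lemma exists_isWallCanonical_half (n : ℤ) : ∃ wc,
    IsWallCanonical (1 / 2 + n) (canonOdd n) (canonEven n) wc (wallHalf n) ∧
      ∀ p, ∃ c, wc (canonOdd n p) = mono c 0 0 (canonEven n (Fin.rev p)) := by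
  obtain ⟨wc, h1, h2, h3, h4⟩ := exists_wallCrossing (twistInjective_odd n)
    (twistInjective_even n) ![2 * n + 1, -2 * n - 1]
  have w0 : wc (canonOdd n 0) = canonOdd n 0 := by
    rw [h2]; simp [canonOdd, canonEven, mono_lineClass]; ring_nf
  have w1 : wc (canonOdd n 1) = lineClass (-n - 2) 0 1 (n - 1) := by
    rw [h2]; simp [canonEven, mono_lineClass]; ring_nf
  refine ⟨wc, ⟨eventually_small one_half_pos fun ε e0 e1 => ?_,
    eventually_small one_half_pos fun ε e0 e1 => ?_, h3, h4, fun p => ?_, fun p => ?_⟩,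
    fun p => ⟨_, h2 p⟩⟩
  · have := isKCanonical_odd (s := 1 / 2 + ε) n (by linarith) (by linarith)
    convert this using 1; ring
  · have := isKCanonical_even (s := 1 / 2 - ε) n (by linarith) (by linarith)
    convert this using 1; ring
  · fin_cases p
    · refine ⟨0, fun _ => canonOdd n 0, 1, Or.inl rfl, rfl, ?_, fun β b0 b1 => by omega,
        fun h => absurd rfl h, ?_⟩
      · simp [w0]
      · simp only [zero_add, Finset.sum_range_one, Nat.cast_zero, neg_zero, mono_zero, Fin.zero_eta]
        simp only [wallHalf, Matrix.cons_val_zero, canonOdd_zero]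
    -- The term at `β = 1` has to vanish, since the slope times one is not an integer.
    · refine ⟨2, fun β => if β = 0 then canonOdd n 1 else if β = 1 then 0 else
        wc (canonOdd n 1), 1, Or.inl rfl, by simp, by simp, fun β b0 b1 => ?_, fun _ => ?_, ?_⟩
      · obtain rfl : β = 1 := by omega
        simp
      -- For `L = 𝒪(1)` the two restrictions are the roots of `L² - v² (a + a⁻¹) L + v⁴`. Divided by
      -- `v³ L`, this expresses `v L⁻¹` through `v⁻¹ a^{±1}` and `v⁻² (v⁻¹ L)`, all with negative
      -- powers of `v` in front of basis elements.
      · have e : wc (canonOdd n 1) = mono 0 0 (-(1 : ℕ)) (mono (-2 * n - 1) 0 0 (canonOdd n 0)) +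
            mono 0 0 (-(1 : ℕ)) (mono (-2 * n - 3) 0 0 (canonOdd n 0)) -
            mono 0 0 (-(2 : ℕ)) (mono 0 0 0 (canonOdd n 1)) := by
          rw [w1]
          simp only [canonOdd, Matrix.cons_val_zero, Matrix.cons_val_one, Matrix.cons_val_fin_one,
            mono_lineClass]
          funext p x
          fin_cases p
          · simp only [Fin.zero_eta, Pi.sub_apply, Pi.add_apply, lineClass_zero]
            simp only [ch]
            push_cast; ring_nf
          · simp only [Fin.mk_one, Pi.sub_apply, Pi.add_apply, lineClass_one]
            simp only [ch]
            push_cast; ring_nf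
        rw [Fin.mk_one, e]
        refine AddSubgroup.sub_mem _ (AddSubgroup.add_mem _ ?_ ?_) ?_
        · exact AddSubgroup.subset_closure ⟨1, one_pos, _, ⟨_, 0, rfl⟩, rfl⟩
        · exact AddSubgroup.subset_closure ⟨1, one_pos, _, ⟨_, 0, rfl⟩, rfl⟩
        · exact AddSubgroup.subset_closure ⟨2, two_pos, _, ⟨_, 1, rfl⟩, rfl⟩
      · have hm : mono 0 (-((1 : ℕ) : ℤ)) 0 (0 : Vec) = 0 := by funext p x; simp [mono]
        rw [Finset.sum_range_succ, Finset.sum_range_succ, Finset.sum_range_one]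
        simp only [if_true, one_ne_zero, if_false, hm, add_zero, two_ne_zero, OfNat.ofNat_ne_one,
          Nat.cast_zero, neg_zero, mono_zero, Fin.mk_one, w1]
        simp only [wallHalf, Matrix.cons_val_one, Matrix.cons_val_fin_one, twistO_add,
          twistO_lineClass, canonOdd, mono_lineClass]
        push_cast; ring_nf
  · have := barFixed_half
    fin_cases p
    · exact this.1.agree _ _
    · exact this.2.agree _ _

/-! ## The classes of canonical basis elements -/

lemma eqvGen_of_wall {s : ℝ} {Bp Bm : Fin 2 → Vec} {wc : Vec → Vec} {W : Fin 2 → Vec}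
    (h : IsWallCanonical s Bp Bm wc W) {p p' : Fin 2} {c : ℤ}
    (hc : wc (Bp p) = mono c 0 0 (Bm p')) : Relation.EqvGen Linked (Bp p) (Bm p') := by
  refine .trans _ _ _ (.rel _ _ (Or.inl ⟨s, Bp, Bm, wc, W, h, ⟨0, p, (mono_zero _).symm⟩, rfl⟩)) ?_
  rw [hc]
  exact .symm _ _ (.rel _ _ (Or.inr ⟨c, rfl⟩))

/-- A step from `n + 1` to `n` crosses an integral and a half-integral wall. Each exchanges the
labels, so the label returns. -/
lemma eqvGen_even (n : ℤ) (p : Fin 2) :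
    Relation.EqvGen Linked (canonEven 0 p) (canonEven n p) := by
  have hstep : ∀ n : ℤ, Relation.EqvGen Linked (canonEven (n + 1) p) (canonEven n p) := by
    intro n
    obtain ⟨wc, h, hw⟩ := exists_isWallCanonical_int (n + 1)
    obtain ⟨wc', h', hw'⟩ := exists_isWallCanonical_half n
    obtain ⟨c, hc⟩ := hw p
    obtain ⟨c', hc'⟩ := hw' (Fin.rev p)
    rw [Fin.rev_rev] at hc'
    have := eqvGen_of_wall h hc
    rw [add_sub_cancel_right] at this
    exact .trans _ _ _ this (eqvGen_of_wall h' hc')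
  induction n using Int.induction_on with
  | zero => exact .refl _
  | succ n ih => exact .trans _ _ _ ih (.symm _ _ (hstep n))
  | pred n ih =>
    have := hstep (-n - 1)
    rw [sub_add_cancel] at this
    exact .trans _ _ _ ih this

lemma eqvGen_odd (n : ℤ) (p : Fin 2) :
    Relation.EqvGen Linked (canonEven 0 p) (canonOdd n (Fin.rev p)) := by
  obtain ⟨wc', h', hw'⟩ := exists_isWallCanonical_half n
  obtain ⟨c', hc'⟩ := hw' (Fin.rev p)
  rw [Fin.rev_rev] at hc'
  exact .trans _ _ _ (eqvGen_even n p) (.symm _ _ (eqvGen_of_wall h' hc'))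

lemma eventually_isKCanonical_zero : ∀ᶠ ε in 𝓝[>] (0 : ℝ), IsKCanonical ε (canonEven 0) :=
  eventually_small one_half_pos fun ε h0 h1 => by
    have := isKCanonical_even 0 h0 h1
    rwa [Int.cast_zero, add_zero] at this

lemma mem_kClass_int (n : ℤ) (μ : Fin 2) (σ i j : ℤ) (hσ : σ = 1 ∨ σ = -1) :
    σ • mono i j 0 (wallInt n μ) ∈ kClass n μ := by
  obtain ⟨wc, h, -⟩ := exists_isWallCanonical_int n
  exact ⟨_, _, _, _, _, μ, eventually_isKCanonical_zero, h, eqvGen_even n μ, σ, i, j, hσ, rfl⟩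

/-- Just above a half-integral slope lies a chamber separated from the even ones by one label
exchange; hence the class `μ` is represented there by the other label. -/
lemma mem_kClass_half (n : ℤ) (μ : Fin 2) (σ i j : ℤ) (hσ : σ = 1 ∨ σ = -1) :
    σ • mono i j 0 (wallHalf n (Fin.rev μ)) ∈ kClass (1 / 2 + n) μ := by
  obtain ⟨wc, h, -⟩ := exists_isWallCanonical_half n
  exact ⟨_, _, _, _, _, _, eventually_isKCanonical_zero, h, eqvGen_odd n μ, σ, i, j, hσ, rfl⟩

lemma mem_kClass_even {s : ℝ} {n : ℤ} (h0 : n < s) (h1 : s < n + 1 / 2) (μ : Fin 2) (σ i j : ℤ)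
    (hσ : σ = 1 ∨ σ = -1) : σ • mono i j 0 (canonEven n μ) ∈ kClass s μ := by
  have h : IsWallCanonical s (canonEven n) (canonEven n) id (canonEven n) := by
    refine isWallCanonical_of_generic (b := min (s - n) (n + 1 / 2 - s))
      (lt_min (by linarith) (by linarith)) fun ε hε => ?_
    rw [lt_min_iff] at hε
    have h2 := neg_abs_le ε
    have h3 := le_abs_self ε
    have := isKCanonical_even (s := s - n + ε) n (by linarith) (by linarith)
    convert this using 1; ring
  exact ⟨_, _, _, _, _, _, eventually_isKCanonical_zero, h, eqvGen_even n μ, σ, i, j, hσ, rfl⟩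

lemma mem_kClass_odd {s : ℝ} {n : ℤ} (h0 : n + 1 / 2 < s) (h1 : s < n + 1) (μ : Fin 2)
    (σ i j : ℤ) (hσ : σ = 1 ∨ σ = -1) :
    σ • mono i j 0 (canonOdd n (Fin.rev μ)) ∈ kClass s μ := by
  have h : IsWallCanonical s (canonOdd n) (canonOdd n) id (canonOdd n) := by
    refine isWallCanonical_of_generic (b := min (s - n - 1 / 2) (n + 1 - s))
      (lt_min (by linarith) (by linarith)) fun ε hε => ?_
    rw [lt_min_iff] at hε
    have h2 := neg_abs_le ε
    have h3 := le_abs_self ε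
    have := isKCanonical_odd (s := s - n + ε) n (by linarith) (by linarith)
    convert this using 1; ring
  exact ⟨_, _, _, _, _, _, eventually_isKCanonical_zero, h, eqvGen_odd n μ, σ, i, j, hσ, rfl⟩

/-! ## The explicit series satisfy the conditions -/

lemma thetaSer_sub_two_pi (w τ : ℂ) : thetaSer (w - 2 * Real.pi * I) τ = -thetaSer w τ := by
  have := thetaSer_add_two_pi (w - 2 * Real.pi * I) τ
  rw [sub_add_cancel] at this
  rw [this, neg_neg]

lemma thetaMix_add_pi (f₁ f₂ : ℂ → ℂ → ℂ) (ν w τ : ℂ) :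
    thetaMix f₁ f₂ ν (w + 2 * Real.pi * I) τ = thetaMix f₁ f₂ ν w τ := by
  rw [thetaMix, show w + 2 * Real.pi * I = w + Real.pi * I + Real.pi * I by ring, thetaZero_add_pi,
    thetaZero_add_pi, thetaOne_add_pi, thetaOne_add_pi, neg_neg, thetaMix]

lemma thetaMix_sub_pi (f₁ f₂ : ℂ → ℂ → ℂ) (ν w τ : ℂ) :
    thetaMix f₁ f₂ ν (w - 2 * Real.pi * I) τ = thetaMix f₁ f₂ ν w τ := by
  have := thetaMix_add_pi f₁ f₂ ν (w - 2 * Real.pi * I) τ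
  rw [sub_add_cancel] at this
  exact this.symm

lemma thetaMix_add_tau (f₁ f₂ : ℂ → ℂ → ℂ) (ν w τ : ℂ) :
    thetaMix f₁ f₂ ν (w + τ) τ = exp (-τ - 2 * w) * thetaMix f₁ f₂ ν w τ := by
  rw [thetaMix, thetaMix, thetaZero_add_tau, thetaOne_add_tau]; ring

lemma SingleValuedVQ.add_two_pi {c : ℝ} {f : ℂ → ℂ → ℂ} (h : SingleValuedVQ c f) (ν : ℂ) {τ : ℂ}
    (hτ : τ.re < 0) : f (ν + 2 * Real.pi * I) τ = f ν τ :=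
  mul_left_cancel₀ (exp_ne_zero _) (h ν τ hτ).1

lemma SingleValuedVQ.add_four_pi {c : ℝ} {f : ℂ → ℂ → ℂ} (h : SingleValuedVQ c f) (ν : ℂ) {τ : ℂ}
    (hτ : τ.re < 0) : f ν (τ + 4 * Real.pi * I) = exp (c * (4 * Real.pi * I)) * f ν τ := by
  have := (h ν τ hτ).2
  rw [show -(c : ℂ) * (τ + 4 * Real.pi * I) = -c * τ + -(c * (4 * Real.pi * I)) by ring, exp_add,
    mul_assoc] at this
  have h1 := mul_left_cancel₀ (exp_ne_zero _) this
  rw [← h1, ← mul_assoc, ← exp_add, add_neg_cancel, exp_zero, one_mul]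

lemma HolomorphicVQ.comp {f : ℂ → ℂ → ℂ} (hf : HolomorphicVQ f) {V : Type*}
    [NormedAddCommGroup V] [NormedSpace ℂ V] {g h : V → ℂ} {y : V} (hg : DifferentiableAt ℂ g y)
    (hh : DifferentiableAt ℂ h y) (hy : (h y).re < 0) :
    DifferentiableAt ℂ (fun y => f (g y) (h y)) y := by
  have ho : IsOpen {y : ℂ × ℂ | y.2.re < 0} := isOpen_lt (by fun_prop) continuous_const
  have h1 : DifferentiableAt ℂ (fun y : ℂ × ℂ => f y.1 y.2) (g y, h y) :=
    hf.differentiableAt (ho.mem_nhds hy)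
  exact DifferentiableAt.comp (g := fun y : ℂ × ℂ => f y.1 y.2) y h1 (hg.prodMk hh)

lemma differentiableAt_thetaMix {f₁ f₂ : ℂ → ℂ → ℂ} (h₁ : HolomorphicVQ f₁) (h₂ : HolomorphicVQ f₂)
    {V : Type*} [NormedAddCommGroup V] [NormedSpace ℂ V] {g w h : V → ℂ} {y : V}
    (hg : DifferentiableAt ℂ g y) (hw : DifferentiableAt ℂ w y)
    (hh : DifferentiableAt ℂ h y) (hy : (h y).re < 0) :
    DifferentiableAt ℂ (fun y => thetaMix f₁ f₂ (g y) (w y) (h y)) y := by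
  unfold thetaMix
  exact ((h₁.comp hg hh hy).mul (differentiableAt_thetaZero hw hh hy)).add
    ((h₂.comp hg hh hy).mul (differentiableAt_thetaOne hw hh hy))

section Backward

variable {f₀ f₁ f₂ : ℂ → ℂ → ℂ} {E : Fin 2 → Fin 2 → MultiFun} {c₀ c₁ c₂ : ℝ}

lemma IsSeries.two (hE : IsSeries f₀ f₁ f₂ E) (p : Fin 2) (x : Cover) {τ : ℂ} (hτ : τ.re < 0) :
    E 0 p x τ = thetaMix f₁ f₂ x.2.2 (x.2.1 - eps p * x.1 + x.2.2) τ *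
      thetaSer (x.2.1 + eps p * x.1) τ := (isSeries_iff.mp hE τ hτ).1 p x

lemma IsSeries.oneOne (hE : IsSeries f₀ f₁ f₂ E) (p : Fin 2) (x : Cover) {τ : ℂ} (hτ : τ.re < 0) :
    E 1 p x τ = f₀ x.2.2 τ * thetaSer (x.2.1 + 2 * x.2.2 - eps p * x.1) τ :=
  (isSeries_iff.mp hE τ hτ).2 p x

lemma IsSeries.qDiffTwo (hE : IsSeries f₀ f₁ f₂ E) : QDiffTwo E := by
  intro p x τ hτ
  rw [hE.two p _ hτ, hE.two p _ hτ]
  simp only [shiftZ]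
  rw [show x.2.1 + τ - eps p * x.1 + x.2.2 = x.2.1 - eps p * x.1 + x.2.2 + τ by ring,
    show x.2.1 + τ + eps p * x.1 = x.2.1 + eps p * x.1 + τ by ring, thetaMix_add_tau,
    thetaSer_add_tau, O]
  have : exp (-τ - 2 * (x.2.1 - eps p * x.1 + x.2.2)) * exp (-τ / 2 - (x.2.1 + eps p * x.1)) =
      exp (-(3 / 2) * τ) * exp (-3 * x.2.1) * exp (-1 * (2 * x.2.2 - eps p * x.1)) := by
    simp only [← exp_add]; ring_nf
  linear_combination -thetaMix f₁ f₂ x.2.2 (x.2.1 - eps p * x.1 + x.2.2) τ *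
      thetaSer (x.2.1 + eps p * x.1) τ * this

lemma IsSeries.qDiffOneOne (hE : IsSeries f₀ f₁ f₂ E) : QDiffOneOne E := by
  intro p x τ hτ
  rw [hE.oneOne p _ hτ, hE.oneOne p _ hτ]
  simp only [shiftZ]
  rw [show x.2.1 + τ + 2 * x.2.2 - eps p * x.1 = x.2.1 + 2 * x.2.2 - eps p * x.1 + τ by ring,
    thetaSer_add_tau, O]
  have : exp (-τ / 2 - (x.2.1 + 2 * x.2.2 - eps p * x.1)) =
      exp (-(1 / 2) * τ) * exp (-x.2.1) * exp (-1 * (2 * x.2.2 - eps p * x.1)) := by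
    simp only [← exp_add]; ring_nf
  linear_combination -f₀ x.2.2 τ * thetaSer (x.2.1 + 2 * x.2.2 - eps p * x.1) τ * this

lemma IsSeries.differentiableOn (hE : IsSeries f₀ f₁ f₂ E) (h₀ : HolomorphicVQ f₀)
    (h₁ : HolomorphicVQ f₁) (h₂ : HolomorphicVQ f₂) (μ p : Fin 2) :
    DifferentiableOn ℂ (fun y : Cover × ℂ => E μ p y.1 y.2) fullCover := by
  fin_cases μ
  · refine DifferentiableOn.congr (f := fun y : Cover × ℂ => thetaMix f₁ f₂ y.1.2.2
      (y.1.2.1 - eps p * y.1.1 + y.1.2.2) y.2 * thetaSer (y.1.2.1 + eps p * y.1.1) y.2)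
      (fun y hy => ?_) fun y hy => hE.two p _ hy
    exact ((differentiableAt_thetaMix h₁ h₂ (by fun_prop) (by fun_prop) (by fun_prop) hy).mul
      (differentiableAt_thetaSer (by fun_prop) (by fun_prop) hy)).differentiableWithinAt
  · refine DifferentiableOn.congr (f := fun y : Cover × ℂ => f₀ y.1.2.2 y.2 *
      thetaSer (y.1.2.1 + 2 * y.1.2.2 - eps p * y.1.1) y.2)
      (fun y hy => ?_) fun y hy => hE.oneOne p _ hy
    exact ((h₀.comp (by fun_prop) (by fun_prop) hy).mul
      (differentiableAt_thetaSer (by fun_prop) (by fun_prop) hy)).differentiableWithinAt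

lemma IsSeries.singleValued (hE : IsSeries f₀ f₁ f₂ E) (s₀ : SingleValuedVQ c₀ f₀)
    (s₁ : SingleValuedVQ c₁ f₁) (s₂ : SingleValuedVQ c₂ f₂) (μ p : Fin 2) {τ : ℂ}
    (hτ : τ.re < 0) :
    SingleValued (fun x => exp (-x.2.1 / 2) * O (-1 / 2) p x * E μ p x τ) := by
  have hmix : ∀ ν w, thetaMix f₁ f₂ (ν + 2 * Real.pi * I) w τ = thetaMix f₁ f₂ ν w τ := by
    intro ν w
    rw [thetaMix, thetaMix, s₁.add_two_pi _ hτ, s₂.add_two_pi _ hτ]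
  have ex : ∀ w, exp (w + Real.pi * I) = -exp w := fun w => by
    rw [exp_add, exp_pi_mul_I]; ring
  have ex' : ∀ w, exp (w - Real.pi * I) = -exp w := fun w => by
    rw [exp_sub, exp_pi_mul_I]; ring
  intro x
  fin_cases μ
  · simp only [Fin.zero_eta, hE.two _ _ hτ, O, ← exp_add]
    refine ⟨?_, ?_, ?_⟩
    · fin_cases p
      · simp only [eps, Fin.zero_eta, Matrix.cons_val_zero, one_mul]
        rw [show -x.2.1 / 2 + -1 / 2 * (2 * x.2.2 - (x.1 + 2 * Real.pi * I)) =
            -x.2.1 / 2 + -1 / 2 * (2 * x.2.2 - x.1) + Real.pi * I by ring,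
          show x.2.1 - (x.1 + 2 * Real.pi * I) + x.2.2 = x.2.1 - x.1 + x.2.2 - 2 * Real.pi * I by
            ring, ← add_assoc, ex, thetaMix_sub_pi, thetaSer_add_two_pi]
        ring
      · simp only [eps, Fin.mk_one, Matrix.cons_val_one, Matrix.cons_val_fin_one]
        rw [show -x.2.1 / 2 + -1 / 2 * (2 * x.2.2 - -1 * (x.1 + 2 * Real.pi * I)) =
            -x.2.1 / 2 + -1 / 2 * (2 * x.2.2 - -1 * x.1) - Real.pi * I by ring,
          show x.2.1 - -1 * (x.1 + 2 * Real.pi * I) + x.2.2 =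
            x.2.1 - -1 * x.1 + x.2.2 + 2 * Real.pi * I by ring,
          show x.2.1 + -1 * (x.1 + 2 * Real.pi * I) = x.2.1 + -1 * x.1 - 2 * Real.pi * I by ring,
          ex', thetaMix_add_pi, thetaSer_sub_two_pi]
        ring
    · rw [show -(x.2.1 + 2 * Real.pi * I) / 2 + -1 / 2 * (2 * x.2.2 - eps p * x.1) =
          -x.2.1 / 2 + -1 / 2 * (2 * x.2.2 - eps p * x.1) - Real.pi * I by ring,
        show x.2.1 + 2 * Real.pi * I - eps p * x.1 + x.2.2 =
          x.2.1 - eps p * x.1 + x.2.2 + 2 * Real.pi * I by ring,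
        show x.2.1 + 2 * Real.pi * I + eps p * x.1 = x.2.1 + eps p * x.1 + 2 * Real.pi * I by ring,
        ex', thetaMix_add_pi, thetaSer_add_two_pi]
      ring
    · rw [show -x.2.1 / 2 + -1 / 2 * (2 * (x.2.2 + 2 * Real.pi * I) - eps p * x.1) =
          -x.2.1 / 2 + -1 / 2 * (2 * x.2.2 - eps p * x.1) - Real.pi * I - Real.pi * I by ring,
        ← add_assoc, ex', ex', thetaMix_add_pi, hmix, neg_neg]
  · simp only [Fin.mk_one, hE.oneOne _ _ hτ, O, ← exp_add]
    refine ⟨?_, ?_, ?_⟩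
    · fin_cases p
      · simp only [eps, Fin.zero_eta, Matrix.cons_val_zero, one_mul]
        rw [show -x.2.1 / 2 + -1 / 2 * (2 * x.2.2 - (x.1 + 2 * Real.pi * I)) =
            -x.2.1 / 2 + -1 / 2 * (2 * x.2.2 - x.1) + Real.pi * I by ring,
          ← sub_sub, ex, thetaSer_sub_two_pi]
        ring
      · simp only [eps, Fin.mk_one, Matrix.cons_val_one, Matrix.cons_val_fin_one]
        rw [show -x.2.1 / 2 + -1 / 2 * (2 * x.2.2 - -1 * (x.1 + 2 * Real.pi * I)) =
            -x.2.1 / 2 + -1 / 2 * (2 * x.2.2 - -1 * x.1) - Real.pi * I by ring,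
          show x.2.1 + 2 * x.2.2 - -1 * (x.1 + 2 * Real.pi * I) =
            x.2.1 + 2 * x.2.2 - -1 * x.1 + 2 * Real.pi * I by ring, ex', thetaSer_add_two_pi]
        ring
    · rw [show -(x.2.1 + 2 * Real.pi * I) / 2 + -1 / 2 * (2 * x.2.2 - eps p * x.1) =
          -x.2.1 / 2 + -1 / 2 * (2 * x.2.2 - eps p * x.1) - Real.pi * I by ring,
        show x.2.1 + 2 * Real.pi * I + 2 * x.2.2 - eps p * x.1 =
          x.2.1 + 2 * x.2.2 - eps p * x.1 + 2 * Real.pi * I by ring, ex', thetaSer_add_two_pi]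
      ring
    · rw [show -x.2.1 / 2 + -1 / 2 * (2 * (x.2.2 + 2 * Real.pi * I) - eps p * x.1) =
          -x.2.1 / 2 + -1 / 2 * (2 * x.2.2 - eps p * x.1) - Real.pi * I - Real.pi * I by ring,
        show x.2.1 + 2 * (x.2.2 + 2 * Real.pi * I) - eps p * x.1 =
          x.2.1 + 2 * x.2.2 - eps p * x.1 + 2 * Real.pi * I + 2 * Real.pi * I by ring,
        ex', ex', thetaSer_add_two_pi, thetaSer_add_two_pi, s₀.add_two_pi _ hτ, neg_neg, neg_neg]

lemma differentiable_slice {f : MultiFun}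
    (hf : DifferentiableOn ℂ (fun y : Cover × ℂ => f y.1 y.2) fullCover) {τ : ℂ} (hτ : τ.re < 0) :
    Differentiable ℂ fun x => f x τ := fun x =>
  DifferentiableAt.comp (g := fun y : Cover × ℂ => f y.1 y.2) (f := fun x => (x, τ)) x
    (hf.differentiableAt (isOpen_fullCover.mem_nhds hτ)) (by fun_prop)

lemma IsSeries.singleValuedHolomorphic (hE : IsSeries f₀ f₁ f₂ E) (h₀ : HolomorphicVQ f₀)
    (h₁ : HolomorphicVQ f₁) (h₂ : HolomorphicVQ f₂) (s₀ : SingleValuedVQ c₀ f₀)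
    (s₁ : SingleValuedVQ c₁ f₁) (s₂ : SingleValuedVQ c₂ f₂) : SingleValuedHolomorphic E := by
  intro μ p τ hτ
  refine ⟨hE.singleValued s₀ s₁ s₂ μ p hτ, ?_⟩
  have := differentiable_slice (hE.differentiableOn h₀ h₁ h₂ μ p) hτ
  unfold O
  fun_prop

lemma tendsto_one_of_isBigO {f : ℂ → ℂ → ℂ} {c : ℝ} {ν : ℂ}
    (h : (fun τ => exp (-c * τ) * f ν τ - 1) =O[qToZero] fun τ => exp (τ / 2)) :
    Tendsto (fun τ => exp (-c * τ) * f ν τ) qToZero (𝓝 1) := by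
  have h1 := tendsto_exp_mul_qToZero (r := 1 / 2) (by norm_num)
  have h2 := h.trans_tendsto (h1.congr fun τ => by push_cast; ring_nf)
  have := h2.add_const 1
  rw [zero_add] at this
  exact this.congr fun τ => by ring

lemma IsSeries.tendsto_oneOne (hE : IsSeries f₀ f₁ f₂ E)
    (a₀ : ∀ ν, Tendsto (fun τ => exp (-c₀ * τ) * f₀ ν τ) qToZero (𝓝 1))
    (s : ℝ) (p : Fin 2) (x : Cover) :
    Tendsto (fun τ => exp (((s ^ 2 - distHalf s) / 2 - c₀ : ℝ) * τ) *
        E 1 p (shiftZ (-s * τ) x) τ) qToZero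
      (𝓝 ((-1) ^ ⌊s⌋ * leadTerm s (x.2.1 + 2 * x.2.2 - eps p * x.1))) := by
  have := (a₀ x.2.2).mul (tendsto_thetaSer s (x.2.1 + 2 * x.2.2 - eps p * x.1))
  rw [one_mul] at this
  refine this.congr' ?_
  filter_upwards [eventually_re_lt 0] with τ hτ
  rw [hE.oneOne p _ hτ]
  simp only [shiftZ]
  rw [show x.2.1 + -s * τ + 2 * x.2.2 - eps p * x.1 =
    x.2.1 + 2 * x.2.2 - eps p * x.1 - s * τ by ring,
    show (((s ^ 2 - distHalf s) / 2 - c₀ : ℝ) : ℂ) * τ =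
      -c₀ * τ + ((s ^ 2 - distHalf s) / 2 : ℝ) * τ by push_cast; ring, exp_add]
  ring

/-- Relative to `f₁ ϑ₀`, the term `f₂ ϑ₁` has order at least `c₂ - c₁ + distHalf s - distHalf (s +
1/2)`. The last term is at most `1/4`, so `c₂ ≥ c₁ + 3/4` makes this positive at every slope and the
limit sees only `f₁`. -/
lemma IsSeries.tendsto_two (hE : IsSeries f₀ f₁ f₂ E)
    (a₁ : ∀ ν, Tendsto (fun τ => exp (-c₁ * τ) * f₁ ν τ) qToZero (𝓝 1))
    (a₂ : ∀ ν, (fun τ => exp (-c₂ * τ) * f₂ ν τ) =O[qToZero] fun _ => (1 : ℂ))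
    (hc : c₁ + 3 / 4 ≤ c₂) (s : ℝ) (p : Fin 2) (x : Cover) :
    Tendsto (fun τ => exp ((s ^ 2 - distHalf (s + 1 / 2) + (s ^ 2 - distHalf s) / 2 - c₁ : ℝ) * τ) *
        E 0 p (shiftZ (-s * τ) x) τ) qToZero
      (𝓝 (leadZero s (x.2.1 - eps p * x.1 + x.2.2) *
        ((-1) ^ ⌊s⌋ * leadTerm s (x.2.1 + eps p * x.1)))) := by
  have hr : 0 < c₂ - c₁ + distHalf s - distHalf (s + 1 / 2) := by
    have := distHalf_nonneg s
    have := distHalf_le (s + 1 / 2)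
    linarith
  have h1 := (a₁ x.2.2).mul (tendsto_thetaZero s (x.2.1 - eps p * x.1 + x.2.2))
  have h2 : Tendsto (fun τ => (exp (-c₂ * τ) * f₂ x.2.2 τ) *
      (exp ((c₂ - c₁ + distHalf s - distHalf (s + 1 / 2) : ℝ) * τ) *
      (exp ((s ^ 2 - distHalf s : ℝ) * τ) *
        thetaOne (x.2.1 - eps p * x.1 + x.2.2 - s * τ) τ))) qToZero (𝓝 0) := by
    have h3 := (tendsto_exp_mul_qToZero hr).mul
      (tendsto_thetaOne s (x.2.1 - eps p * x.1 + x.2.2))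
    rw [zero_mul] at h3
    refine IsBigO.trans_tendsto (g'' := fun τ => (1 : ℂ) *
      (exp ((c₂ - c₁ + distHalf s - distHalf (s + 1 / 2) : ℝ) * τ) *
      (exp ((s ^ 2 - distHalf s : ℝ) * τ) *
        thetaOne (x.2.1 - eps p * x.1 + x.2.2 - s * τ) τ))) ((a₂ x.2.2).mul (isBigO_refl _ _)) ?_
    simpa only [one_mul] using h3
  have := (h1.add h2).mul (tendsto_thetaSer s (x.2.1 + eps p * x.1))
  rw [one_mul, add_zero] at this
  refine this.congr' ?_
  filter_upwards [eventually_re_lt 0] with τ hτ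
  rw [hE.two p _ hτ]
  simp only [shiftZ, thetaMix]
  rw [show x.2.1 + -s * τ - eps p * x.1 + x.2.2 = x.2.1 - eps p * x.1 + x.2.2 - s * τ by ring,
    show x.2.1 + -s * τ + eps p * x.1 = x.2.1 + eps p * x.1 - s * τ by ring]
  have e1 : exp ((s ^ 2 - distHalf (s + 1 / 2) + (s ^ 2 - distHalf s) / 2 - c₁ : ℝ) * τ) =
      exp (-c₁ * τ) * exp ((s ^ 2 - distHalf (s + 1 / 2) : ℝ) * τ) *
        exp (((s ^ 2 - distHalf s) / 2 : ℝ) * τ) := by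
    rw [← exp_add, ← exp_add]; push_cast; ring_nf
  have e2 : exp ((s ^ 2 - distHalf (s + 1 / 2) + (s ^ 2 - distHalf s) / 2 - c₁ : ℝ) * τ) =
      exp (-c₂ * τ) * exp ((c₂ - c₁ + distHalf s - distHalf (s + 1 / 2) : ℝ) * τ) *
        exp ((s ^ 2 - distHalf s : ℝ) * τ) * exp (((s ^ 2 - distHalf s) / 2 : ℝ) * τ) := by
    rw [← exp_add, ← exp_add, ← exp_add]; push_cast; ring_nf
  rw [add_mul, add_mul, mul_add]
  congr 1
  · rw [e1]; ring
  · rw [e2]; ring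

lemma IsSeries.kLimitTwo (hE : IsSeries f₀ f₁ f₂ E)
    (a₁ : ∀ ν, Tendsto (fun τ => exp (-c₁ * τ) * f₁ ν τ) qToZero (𝓝 1))
    (a₂ : ∀ ν, (fun τ => exp (-c₂ * τ) * f₂ ν τ) =O[qToZero] fun _ => (1 : ℂ))
    (hc : c₁ + 3 / 4 ≤ c₂) : KLimitTwo E := by
  intro s h0 h1
  refine ⟨-(s ^ 2 - distHalf (s + 1 / 2) + (s ^ 2 - distHalf s) / 2 - c₁), fun p x => ?_⟩
  have := hE.tendsto_two a₁ a₂ hc s p x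
  rw [leadZero_of_mem (n := 0) (by push_cast; linarith) (by push_cast; linarith),
    leadTerm_of_mem h0 (by linarith), Int.floor_eq_zero_iff.mpr ⟨h0.le, by linarith⟩] at this
  convert this using 2
  · push_cast; ring_nf
  · rw [O, zpow_zero, one_mul, ← exp_add, ← exp_add, ← exp_add]; push_cast; ring_nf

lemma IsSeries.kLimitOneOne (hE : IsSeries f₀ f₁ f₂ E)
    (a₀ : ∀ ν, Tendsto (fun τ => exp (-c₀ * τ) * f₀ ν τ) qToZero (𝓝 1)) : KLimitOneOne E := by
  intro s h0 h1
  refine ⟨-((s ^ 2 - distHalf s) / 2 - c₀), fun p x => ?_⟩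
  have := hE.tendsto_oneOne a₀ s p x
  rw [leadTerm_of_mem h0 (by linarith), Int.floor_eq_zero_iff.mpr ⟨h0.le, by linarith⟩] at this
  convert this using 2
  · push_cast; ring_nf
  · rw [O, zpow_zero, one_mul, ← exp_add]; ring_nf

/-- `Υ` as given by the explicit series. -/
def IsUpsilon (f₀ f₁ f₂ Υ : ℂ → ℂ → ℂ) : Prop :=
  ∀ ν τ : ℂ, τ.re < 0 → Υ ν τ = thetaScale τ ^ 2 * (f₀ ν τ * thetaMix f₁ f₂ ν ν τ)

lemma upsilon_eq (ν τ : ℂ) :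
    exp (τ / 4) * qPochhammer τ ^ 2 *
      (f₀ ν τ * (f₁ ν τ * thetaZero ν τ + f₂ ν τ * thetaOne ν τ)) =
      thetaScale τ ^ 2 * (f₀ ν τ * thetaMix f₁ f₂ ν ν τ) := by
  rw [thetaMix, thetaScale, mul_pow, ← exp_nat_mul]
  push_cast; ring_nf

lemma IsUpsilon.holomorphic {Υ : ℂ → ℂ → ℂ} (hΥ : IsUpsilon f₀ f₁ f₂ Υ) (h₀ : HolomorphicVQ f₀)
    (h₁ : HolomorphicVQ f₁) (h₂ : HolomorphicVQ f₂) : HolomorphicVQ Υ := by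
  refine DifferentiableOn.congr (f := fun y : ℂ × ℂ => thetaScale y.2 ^ 2 *
    (f₀ y.1 y.2 * thetaMix f₁ f₂ y.1 y.1 y.2)) (fun y hy => ?_) fun y hy => hΥ _ _ hy
  have ho : IsOpen {τ : ℂ | τ.re < 0} := isOpen_lt (by fun_prop) continuous_const
  have h3 : DifferentiableAt ℂ thetaScale y.2 :=
    differentiableOn_thetaScale.differentiableAt (ho.mem_nhds hy)
  have h4 : DifferentiableAt ℂ (fun y : ℂ × ℂ => thetaScale y.2) y :=
    DifferentiableAt.comp (g := thetaScale) y h3 (by fun_prop)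
  exact ((h4.pow 2).mul ((h₀.comp (by fun_prop) (by fun_prop) hy).mul
    (differentiableAt_thetaMix h₁ h₂ (by fun_prop) (by fun_prop) (by fun_prop)
      hy))).differentiableWithinAt

end Backward

lemma differentiableOn_thetaSer_cover {w : Cover × ℂ → ℂ} (hw : Differentiable ℂ w) :
    DifferentiableOn ℂ (fun y : Cover × ℂ => thetaSer (w y) y.2) fullCover := fun y hy =>
  (differentiableAt_thetaSer hw.differentiableAt (by fun_prop) hy).differentiableWithinAt

/-- A nonconstant linear argument makes the theta series nonzero somewhere. -/
lemma exists_thetaSer_ne_zero {w : Cover × ℂ → ℂ} (h : ∃ x, w (x, -1) = Real.pi * I) :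
    ∃ y ∈ fullCover, thetaSer (w y) y.2 ≠ 0 := by
  obtain ⟨x, hx⟩ := h
  have h1 : (-1 : ℂ).re < 0 := by simp
  refine ⟨(x, -1), h1, ?_⟩
  rw [hx]
  exact thetaSer_pi_ne_zero h1

/-! ### Bilinear duality and monodromy of the explicit series. -/

section Backward

variable {f₀ f₁ f₂ : ℂ → ℂ → ℂ} {E : Fin 2 → Fin 2 → MultiFun} {c₀ c₁ c₂ : ℝ}
  {Υ : ℂ → ℂ → ℂ}

/-- The identity is known after multiplication by `thetaSer (z + a + 2v)`, and off the zeros of the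
denominators. Both restrictions are removed by cancelling a factor that is not identically zero
among holomorphic functions. -/
lemma IsSeries.bilinear_zero_one (hE : IsSeries f₀ f₁ f₂ E) (h₀ : HolomorphicVQ f₀)
    (h₁ : HolomorphicVQ f₁) (h₂ : HolomorphicVQ f₂) (x : Cover) {τ : ℂ} (hτ : τ.re < 0) :
    f₀ x.2.2 τ * thetaMix f₁ f₂ x.2.2 x.2.2 τ * stabNum x.1 x.2.1 x.2.2 τ =
      (matE E x τ * (matEDual E x τ).transpose) 0 1 *
        (thetaSer (-x.2.2 + x.1) τ * thetaSer (x.2.2 + x.2.1) τ) := by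
  have dE := hE.differentiableOn h₀ h₁ h₂
  have dE' : ∀ μ p, DifferentiableOn ℂ (fun y : Cover × ℂ => E μ p (swapAZ y.1) y.2) fullCover := by
    intro μ p
    refine (dE μ p).comp (f := fun y : Cover × ℂ => (swapAZ y.1, y.2)) ?_ fun y hy => hy
    unfold swapAZ
    exact Differentiable.differentiableOn (by fun_prop)
  have key := eq_zero_of_mul_eq_zero
    (f := fun y : Cover × ℂ => f₀ y.1.2.2 y.2 * thetaMix f₁ f₂ y.1.2.2 y.1.2.2 y.2 *
      stabNum y.1.1 y.1.2.1 y.1.2.2 y.2 - (matE E y.1 y.2 * (matEDual E y.1 y.2).transpose) 0 1 *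
        (thetaSer (-y.1.2.2 + y.1.1) y.2 * thetaSer (y.1.2.2 + y.1.2.1) y.2))
    (g := fun y : Cover × ℂ => thetaSer (y.1.2.1 + y.1.1 + 2 * y.1.2.2) y.2 *
      (thetaSer (-y.1.2.2 + y.1.1) y.2 * thetaSer (y.1.2.2 + y.1.2.1) y.2)) ?_ ?_ ?_ ?_ (x, τ) hτ
  · exact sub_eq_zero.mp key
  · have d1 : DifferentiableOn ℂ (fun y : Cover × ℂ => stabNum y.1.1 y.1.2.1 y.1.2.2 y.2)
        fullCover := by
      unfold stabNum
      refine (differentiableOn_thetaSer_cover (by fun_prop)).mul (DifferentiableOn.add ?_ ?_) <;>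
      exact ((differentiableOn_thetaSer_cover (by fun_prop)).mul
        (differentiableOn_thetaSer_cover (by fun_prop))).mul
        (differentiableOn_thetaSer_cover (by fun_prop))
    have d2 : DifferentiableOn ℂ (fun y : Cover × ℂ =>
        (matE E y.1 y.2 * (matEDual E y.1 y.2).transpose) 0 1) fullCover := by
      simp only [matE, matEDual, dualE, Matrix.mul_apply, Fin.sum_univ_two,
        Matrix.transpose_apply, Matrix.of_apply, Matrix.cons_val', Matrix.cons_val_zero,
        Matrix.cons_val_one, Matrix.cons_val_fin_one]
      exact ((dE 0 0).mul (dE' 1 0)).add ((dE 1 0).mul (dE' 0 0))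
    refine DifferentiableOn.sub (DifferentiableOn.mul (DifferentiableOn.mul ?_ ?_) d1) (d2.mul
      ((differentiableOn_thetaSer_cover (by fun_prop)).mul
        (differentiableOn_thetaSer_cover (by fun_prop))))
    · exact fun y hy => (h₀.comp (by fun_prop) (by fun_prop) hy).differentiableWithinAt
    · exact fun y hy => (differentiableAt_thetaMix h₁ h₂ (by fun_prop) (by fun_prop) (by fun_prop)
        hy).differentiableWithinAt
  · exact (differentiableOn_thetaSer_cover (by fun_prop)).mul
      ((differentiableOn_thetaSer_cover (by fun_prop)).mul
        (differentiableOn_thetaSer_cover (by fun_prop)))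
  · refine exists_mul_ne_zero (differentiableOn_thetaSer_cover (by fun_prop))
      ((differentiableOn_thetaSer_cover (by fun_prop)).mul
        (differentiableOn_thetaSer_cover (by fun_prop)))
      (exists_thetaSer_ne_zero ⟨(Real.pi * I, 0, 0), by simp⟩)
      (exists_mul_ne_zero (differentiableOn_thetaSer_cover (by fun_prop))
        (differentiableOn_thetaSer_cover (by fun_prop))
        (exists_thetaSer_ne_zero ⟨(Real.pi * I, 0, 0), by simp⟩)
        (exists_thetaSer_ne_zero ⟨(0, Real.pi * I, 0), by simp⟩))
  · rintro ⟨x, τ⟩ (hτ : τ.re < 0)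
    simp only
    by_cases hd : thetaSer (-x.2.2 + x.1) τ * thetaSer (x.2.2 + x.2.1) τ = 0
    · rw [hd]; ring
    · have e1 := stabEll_zero_one_mul x hτ hd
      have e2 := matE_mul_zero_one hE x hτ
      have hs := thetaScale_ne_zero hτ
      have hd1 := left_ne_zero_of_mul hd
      have hd2 := right_ne_zero_of_mul hd
      rw [stabEll_zero_one x hτ, div_mul_eq_mul_div,
        div_eq_div_iff (by positivity) (by positivity)] at e1
      have e3 : stabNum x.1 x.2.1 x.2.2 τ * thetaSer (x.2.1 + x.1 + 2 * x.2.2) τ =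
          (thetaSer (2 * x.2.2 + x.1 - x.2.1) τ * thetaSer (2 * x.2.2 + 2 * x.2.1) τ *
              thetaSer (2 * x.1) τ +
            thetaSer (2 * x.2.2 + x.2.1 - x.1) τ * thetaSer (2 * x.2.2 + 2 * x.1) τ *
              thetaSer (2 * x.2.1) τ) *
          (thetaSer (-x.2.2 + x.1) τ * thetaSer (x.2.2 + x.2.1) τ) := by
        refine mul_right_cancel₀ (pow_ne_zero 2 hs) ?_
        linear_combination e1
      linear_combination (thetaSer (-x.2.2 + x.1) τ * thetaSer (x.2.2 + x.2.1) τ) *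
        (f₀ x.2.2 τ * thetaMix f₁ f₂ x.2.2 x.2.2 τ * e3 -
          (thetaSer (-x.2.2 + x.1) τ * thetaSer (x.2.2 + x.2.1) τ) * e2)

lemma IsSeries.bilinearDuality (hE : IsSeries f₀ f₁ f₂ E) (hΥ : IsUpsilon f₀ f₁ f₂ Υ)
    (h₀ : HolomorphicVQ f₀) (h₁ : HolomorphicVQ f₁) (h₂ : HolomorphicVQ f₂) :
    BilinearDuality E Υ := by
  intro x τ hτ hd
  rw [theta_den_ne_zero_iff x hτ] at hd
  have hs := thetaScale_ne_zero hτ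
  rw [hΥ _ _ hτ]
  ext i j
  rw [Matrix.smul_apply, smul_eq_mul]
  fin_cases i <;> fin_cases j
  · simp only [Fin.zero_eta]
    rw [matE_mul_zero_zero hE x hτ, stabEll_zero_zero x hτ]
    field_simp
  · simp only [Fin.zero_eta, Fin.mk_one]
    have := hE.bilinear_zero_one h₀ h₁ h₂ x hτ
    rw [stabEll_zero_one x hτ, mul_div_assoc', div_eq_iff (mul_ne_zero hd (pow_ne_zero 2 hs))]
    linear_combination thetaScale τ ^ 2 * this
  · simp only [Fin.zero_eta, Fin.mk_one]
    rw [matE_mul_one_zero hE x hτ, stabEll_one_zero, mul_zero]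
  · simp only [Fin.mk_one]
    rw [matE_mul_one_one hE x hτ, stabEll_one_one x hτ]
    field_simp

/-- The condition on `c₂ - c₁ + 1/4` compensates the sign `-1` of `ϑ₁`, so that `f₁ ϑ₀` and `f₂ ϑ₁`
have the same monodromy. The additional `1/8` comes from `thetaSer`. -/
lemma IsSeries.add_four_pi (hE : IsSeries f₀ f₁ f₂ E) (s₀ : SingleValuedVQ c₀ f₀)
    (s₁ : SingleValuedVQ c₁ f₁) (s₂ : SingleValuedVQ c₂ f₂)
    (hk : ∃ k : ℤ, c₂ - c₁ + 1 / 4 = k / 2) (μ p : Fin 2) (x : Cover) {τ : ℂ} (hτ : τ.re < 0) :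
    E μ p x (τ + 4 * Real.pi * I) =
      exp (((![c₁, c₀] μ : ℝ) + 1 / 8) * (4 * Real.pi * I)) * E μ p x τ := by
  have hτ' : (τ + 4 * Real.pi * I).re < 0 := by simpa using hτ
  obtain ⟨k, hk⟩ := hk
  have eI : ∀ c : ℝ, exp ((c + 1 / 8) * (4 * Real.pi * I)) = exp (c * (4 * Real.pi * I)) * I := by
    intro c
    rw [add_mul, exp_add, show 1 / 8 * (4 * Real.pi * I) = Real.pi / 2 * I by ring,
      exp_pi_div_two_mul_I]
  fin_cases μ
  · have e2 : exp (c₂ * (4 * Real.pi * I)) = -exp (c₁ * (4 * Real.pi * I)) := by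
      have : (c₂ : ℂ) = c₁ + k / 2 - 1 / 4 := by
        have : c₂ = c₁ + k / 2 - 1 / 4 := by linarith
        rw [this]; push_cast; ring
      rw [this, show ((c₁ : ℂ) + k / 2 - 1 / 4) * (4 * Real.pi * I) =
        c₁ * (4 * Real.pi * I) + k * (2 * Real.pi * I) - Real.pi * I by ring, exp_sub, exp_add,
        exp_int_mul_two_pi_mul_I, exp_pi_mul_I]
      ring
    simp only [Fin.zero_eta, Matrix.cons_val_zero]
    rw [hE.two p _ hτ', hE.two p _ hτ, thetaMix, thetaMix, s₁.add_four_pi _ hτ,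
      s₂.add_four_pi _ hτ, thetaZero_tau_add, thetaOne_tau_add, thetaSer_tau_add, eI, e2]
    ring
  · simp only [Fin.mk_one, Matrix.cons_val_one, Matrix.cons_val_fin_one]
    rw [hE.oneOne p _ hτ', hE.oneOne p _ hτ, s₀.add_four_pi _ hτ, thetaSer_tau_add, eI]
    ring

end Backward

/-- The prefactor `a^{-1/2} z^{-1/2} √ℒ(-κ)`. -/
lemma prefactor_eq (p : Fin 2) (x : Cover) :
    exp (-(1 / 2 : ℚ) * x.1) * exp (-(1 / 2 : ℚ) * x.2.1) * sqrtL p x =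
      exp (-2 * x.1) * (exp (-x.2.1 / 2) * O (-1 / 2) p x) := by
  simp only [sqrtL, O, ← exp_add]
  push_cast; ring_nf

lemma singleValued_prefactor {g : Cover → ℂ} (h : SingleValued g) :
    SingleValued fun x => exp (-2 * x.1) * g x := by
  intro x
  obtain ⟨h1, h2, h3⟩ := h x
  refine ⟨?_, ?_, ?_⟩ <;> beta_reduce
  · rw [h1, show -2 * (x.1 + 2 * Real.pi * I) = -2 * x.1 + (-2 : ℤ) * (2 * Real.pi * I) by
      push_cast; ring, exp_add, exp_int_mul_two_pi_mul_I, mul_one]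
  · rw [h2]
  · rw [h3]

lemma intCast_sign_smul (n : ℤ) (F : Vec) (p : Fin 2) (x : Cover) :
    ((if Even n then (1 : ℤ) else -1) • F) p x = (-1 : ℂ) ^ n * F p x := by
  split_ifs with h
  · rw [h.neg_one_zpow, one_smul, one_mul]
  · rw [(Int.not_even_iff_odd.mp h).neg_one_zpow]
    simp

lemma sign_cases (n : ℤ) : (if Even n then (1 : ℤ) else -1) = 1 ∨
    (if Even n then (1 : ℤ) else -1) = -1 := by
  split_ifs <;> simp

/-- Position of a slope relative to the walls. -/
lemma slope_cases (s : ℝ) : ∃ n : ℤ, s = n ∨ (n < s ∧ s < n + 1 / 2) ∨ s = 1 / 2 + n ∨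
    (n + 1 / 2 < s ∧ s < n + 1) := by
  refine ⟨⌊s⌋, ?_⟩
  have h1 := Int.floor_le s
  have h2 := Int.lt_floor_add_one s
  rcases h1.eq_or_lt with h | h
  · exact Or.inl h.symm
  rcases lt_trichotomy s (⌊s⌋ + 1 / 2) with h3 | h3 | h3
  · exact Or.inr (Or.inl ⟨h, h3⟩)
  · exact Or.inr (Or.inr (Or.inl (by linarith)))
  · exact Or.inr (Or.inr (Or.inr ⟨h3, h2⟩))

lemma floor_of_mem {s : ℝ} {n : ℤ} (h0 : n ≤ s) (h1 : s < n + 1) : ⌊s⌋ = n :=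
  Int.floor_eq_iff.mpr ⟨h0, h1⟩

/-- The limit of the elliptic canonical basis element labelled by `[1,1]`, up to the prefactor. -/
lemma lead_oneOne_mem_kClass (s : ℝ) : ∃ V ∈ kClass s 1, ∀ p x,
    exp (-2 * x.1) * (exp (-x.2.1 / 2) * O (-1 / 2) p x) *
      ((-1) ^ ⌊s⌋ * leadTerm s (x.2.1 + 2 * x.2.2 - eps p * x.1)) = V p x := by
  have r1 : (Fin.rev 1 : Fin 2) = 0 := rfl
  obtain ⟨n, rfl | ⟨h0, h1⟩ | rfl | ⟨h0, h1⟩⟩ := slope_cases s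
  · refine ⟨_, mem_kClass_int n 1 _ (n - 1) n (sign_cases n), fun p x => ?_⟩
    rw [intCast_sign_smul, Int.floor_intCast, leadTerm_int, mul_left_comm]
    simp only [wallInt, mono, Matrix.cons_val_one, Matrix.cons_val_fin_one, twistO_sub,
      twistO_lineClass, Pi.sub_apply, lineClass_eq_exp, ch, O, mul_sub, ← exp_add]
    push_cast; ring_nf
  · refine ⟨_, mem_kClass_even h0 h1 1 _ (n - 1) n (sign_cases n), fun p x => ?_⟩
    rw [intCast_sign_smul, floor_of_mem h0.le (by linarith),
      leadTerm_of_mem_int h0 (by linarith), mul_left_comm]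
    simp only [canonEven, mono, Matrix.cons_val_one, Matrix.cons_val_fin_one, lineClass_eq_exp, ch,
      O, ← exp_add]
    push_cast; ring_nf
  · refine ⟨_, mem_kClass_half n 1 _ (-n - 2) n (sign_cases n), fun p x => ?_⟩
    rw [intCast_sign_smul, floor_of_mem (n := n) (by linarith) (by linarith),
      leadTerm_of_mem_int (n := n) (by linarith) (by linarith), mul_left_comm, r1]
    simp only [wallHalf, mono, Matrix.cons_val_zero, twistO_lineClass, lineClass_eq_exp, ch, O,
      ← exp_add]
    push_cast; ring_nf
  · refine ⟨_, mem_kClass_odd h0 h1 1 _ (-n - 2) n (sign_cases n), fun p x => ?_⟩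
    rw [intCast_sign_smul, floor_of_mem (n := n) (by linarith) (by linarith),
      leadTerm_of_mem_int (n := n) (by linarith) (by linarith), mul_left_comm, r1]
    simp only [canonOdd, mono, Matrix.cons_val_zero, lineClass_eq_exp, ch, O, ← exp_add]
    push_cast; ring_nf

/-- The limit of the elliptic canonical basis element labelled by `[2]`, up to the prefactor. -/
lemma lead_two_mem_kClass (s : ℝ) : ∃ V ∈ kClass s 0, ∀ p x,
    exp (-2 * x.1) * (exp (-x.2.1 / 2) * O (-1 / 2) p x) *
      (leadZero s (x.2.1 - eps p * x.1 + x.2.2) *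
        ((-1) ^ ⌊s⌋ * leadTerm s (x.2.1 + eps p * x.1))) = V p x := by
  have r0 : (Fin.rev 0 : Fin 2) = 1 := rfl
  obtain ⟨n, rfl | ⟨h0, h1⟩ | rfl | ⟨h0, h1⟩⟩ := slope_cases s
  · refine ⟨_, mem_kClass_int n 0 _ (-n - 1) (3 * n) (sign_cases n), fun p x => ?_⟩
    rw [intCast_sign_smul, Int.floor_intCast, leadTerm_int,
      leadZero_of_mem (n := n) (by linarith) (by linarith), mul_left_comm, mul_left_comm _ (_ ^ _),
      mul_left_comm _ (_ ^ _), mul_left_comm (exp (2 * n * _))]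
    simp only [wallInt, mono, Matrix.cons_val_zero, twistO_sub,
      twistO_lineClass, Pi.sub_apply, lineClass_eq_exp, ch, O, mul_sub, ← exp_add]
    push_cast; ring_nf
  · refine ⟨_, mem_kClass_even h0 h1 0 _ (-n - 1) (3 * n) (sign_cases n), fun p x => ?_⟩
    rw [intCast_sign_smul, floor_of_mem h0.le (by linarith),
      leadTerm_of_mem_int h0 (by linarith), leadZero_of_mem (n := n) (by linarith) (by linarith),
      mul_left_comm (exp (2 * n * _)), mul_left_comm]
    simp only [canonEven, mono, Matrix.cons_val_zero, lineClass_eq_exp, ch, O, ← exp_add]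
    push_cast; ring_nf
  · refine ⟨_, mem_kClass_half n 0 _ n (3 * n + 2) (sign_cases n), fun p x => ?_⟩
    rw [intCast_sign_smul, floor_of_mem (n := n) (by linarith) (by linarith),
      leadTerm_of_mem_int (n := n) (by linarith) (by linarith), add_comm (1 / 2 : ℝ), leadZero_half,
      mul_left_comm (_ + _), mul_left_comm, r0]
    simp only [wallHalf, mono, Matrix.cons_val_one, Matrix.cons_val_fin_one, twistO_add,
      twistO_lineClass, Pi.add_apply, lineClass_eq_exp, ch, O, mul_add, add_mul, ← exp_add]
    push_cast; ring_nf
  · refine ⟨_, mem_kClass_odd h0 h1 0 _ n (3 * n + 2) (sign_cases n), fun p x => ?_⟩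
    rw [intCast_sign_smul, floor_of_mem (n := n) (by linarith) (by linarith),
      leadTerm_of_mem_int (n := n) (by linarith) (by linarith),
      leadZero_of_mem (n := n + 1) (by push_cast; linarith) (by push_cast; linarith),
      mul_left_comm (exp (2 * (n + 1 : ℤ) * _)), mul_left_comm, r0]
    simp only [canonOdd, mono, Matrix.cons_val_one, Matrix.cons_val_fin_one, lineClass_eq_exp, ch,
      O, ← exp_add]
    push_cast; ring_nf

/-! ### Property A for the explicit series. -/

section PropertyA

variable {f₀ f₁ f₂ : ℂ → ℂ → ℂ} {E : Fin 2 → Fin 2 → MultiFun} {c₀ c₁ c₂ : ℚ}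

lemma IsSeries.propertyA (hE : IsSeries f₀ f₁ f₂ E) (h₀ : HolomorphicVQ f₀)
    (h₁ : HolomorphicVQ f₁) (h₂ : HolomorphicVQ f₂) (s₀ : SingleValuedVQ c₀ f₀)
    (s₁ : SingleValuedVQ c₁ f₁) (s₂ : SingleValuedVQ c₂ f₂)
    (hk : ∃ k : ℤ, (c₂ : ℝ) - c₁ + 1 / 4 = k / 2)
    (a₀ : ∀ ν, Tendsto (fun τ => exp (-(c₀ : ℝ) * τ) * f₀ ν τ) qToZero (𝓝 1))
    (a₁ : ∀ ν, Tendsto (fun τ => exp (-(c₁ : ℝ) * τ) * f₁ ν τ) qToZero (𝓝 1))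
    (a₂ : ∀ ν, (fun τ => exp (-(c₂ : ℝ) * τ) * f₂ ν τ) =O[qToZero] fun _ => (1 : ℂ))
    (hc : (c₁ : ℝ) + 3 / 4 ≤ c₂) : PropertyA E := by
  intro μ
  -- With `α = β = 1/2` the prefactor is `a⁻²` times the one of the single-valuedness condition, and
  -- `r` is the exponent whose monodromy was found in `IsSeries.add_four_pi`.
  refine ⟨1 / 2, 1 / 2, ![c₁, c₀] μ + 1 / 8, fun p => ⟨fun τ hτ => ?_, fun x τ hτ => ?_, ?_⟩,
    fun s => ?_⟩
  · have := singleValued_prefactor (hE.singleValued s₀ s₁ s₂ μ p hτ)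
    have e : ∀ x : Cover, exp (-(![c₁, c₀] μ + 1 / 8 : ℚ) * τ) * exp (-(1 / 2 : ℚ) * x.1) *
        exp (-(1 / 2 : ℚ) * x.2.1) * sqrtL p x * E μ p x τ = exp (-(![c₁, c₀] μ + 1 / 8 : ℚ) * τ) *
        (exp (-2 * x.1) * (exp (-x.2.1 / 2) * O (-1 / 2) p x * E μ p x τ)) := fun x => by
      linear_combination exp (-(![c₁, c₀] μ + 1 / 8 : ℚ) * τ) * E μ p x τ * prefactor_eq p x
    intro x
    obtain ⟨t1, t2, t3⟩ := this x
    exact ⟨(e _).trans ((congrArg _ t1).trans (e x).symm),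
      (e _).trans ((congrArg _ t2).trans (e x).symm),
      (e _).trans ((congrArg _ t3).trans (e x).symm)⟩
  · beta_reduce
    have hcast : ((![(c₁ : ℝ), (c₀ : ℝ)] μ : ℝ) : ℂ) = ((![c₁, c₀] μ : ℚ) : ℂ) := by
      fin_cases μ <;> simp
    rw [hE.add_four_pi s₀ s₁ s₂ hk μ p x hτ, hcast]
    have : exp (-(![c₁, c₀] μ + 1 / 8 : ℚ) * (τ + 4 * Real.pi * I)) *
        exp ((((![c₁, c₀] μ : ℚ) : ℂ) + 1 / 8) * (4 * Real.pi * I)) =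
        exp (-(![c₁, c₀] μ + 1 / 8 : ℚ) * τ) := by
      rw [← exp_add]; push_cast; ring_nf
    linear_combination exp (-(1 / 2 : ℚ) * x.1) * exp (-(1 / 2 : ℚ) * x.2.1) * sqrtL p x *
      E μ p x τ * this
  · have := hE.differentiableOn h₀ h₁ h₂ μ p
    refine DifferentiableOn.mul (Differentiable.differentiableOn ?_) this
    unfold sqrtL O
    fun_prop
  · fin_cases μ
    · obtain ⟨V, hV, hlim⟩ := lead_two_mem_kClass s
      refine ⟨-(s ^ 2 - distHalf (s + 1 / 2) + (s ^ 2 - distHalf s) / 2 - c₁), V, hV, fun p x => ?_⟩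
      rw [← hlim]
      refine ((hE.tendsto_two a₁ a₂ hc s p x).const_mul _).congr fun τ => ?_
      rw [← prefactor_eq]
      push_cast; ring_nf
    · obtain ⟨V, hV, hlim⟩ := lead_oneOne_mem_kClass s
      refine ⟨-((s ^ 2 - distHalf s) / 2 - c₀), V, hV, fun p x => ?_⟩
      rw [← hlim]
      refine ((hE.tendsto_oneOne a₀ s p x).const_mul _).congr fun τ => ?_
      rw [← prefactor_eq]
      push_cast; ring_nf

end PropertyA

/-! ## Solving the bilinear equations -/

/-- Holomorphic functions of `(log a, log z, log v, log q)`, in curried form. -/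
def Hol (f : ℂ → ℂ → ℂ → ℂ → ℂ) : Prop :=
  DifferentiableOn ℂ (fun y : Cover × ℂ => f y.1.1 y.1.2.1 y.1.2.2 y.2) fullCover

/-- Functions that do not vanish identically. -/
def NonZero (f : ℂ → ℂ → ℂ → ℂ → ℂ) : Prop := ∃ a z v τ, τ.re < 0 ∧ f a z v τ ≠ 0

section Hol

variable {f g : ℂ → ℂ → ℂ → ℂ → ℂ}

lemma Hol.mul (hf : Hol f) (hg : Hol g) : Hol fun a z v τ => f a z v τ * g a z v τ :=
  DifferentiableOn.mul hf hg

lemma Hol.add (hf : Hol f) (hg : Hol g) : Hol fun a z v τ => f a z v τ + g a z v τ :=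
  DifferentiableOn.add hf hg

lemma Hol.sub (hf : Hol f) (hg : Hol g) : Hol fun a z v τ => f a z v τ - g a z v τ :=
  DifferentiableOn.sub hf hg

lemma Hol.const_mul (c : ℂ) (hf : Hol f) : Hol fun a z v τ => c * f a z v τ :=
  DifferentiableOn.const_mul hf c

lemma Hol.div (hf : Hol f) (hg : Hol g) (h : ∀ a z v τ, τ.re < 0 → g a z v τ ≠ 0) :
    Hol fun a z v τ => f a z v τ / g a z v τ :=
  (DifferentiableOn.mul hf (DifferentiableOn.inv hg fun _ hy => h _ _ _ _ hy)).congr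
    fun _ _ => div_eq_mul_inv _ _

/-- Substitution in the first three variables. -/
lemma Hol.comp (hf : Hol f) (α ζ ν : ℂ → ℂ → ℂ → ℂ → ℂ)
    (hα : Differentiable ℂ fun y : Cover × ℂ => α y.1.1 y.1.2.1 y.1.2.2 y.2 := by fun_prop)
    (hζ : Differentiable ℂ fun y : Cover × ℂ => ζ y.1.1 y.1.2.1 y.1.2.2 y.2 := by fun_prop)
    (hν : Differentiable ℂ fun y : Cover × ℂ => ν y.1.1 y.1.2.1 y.1.2.2 y.2 := by fun_prop) :
    Hol fun a z v τ => f (α a z v τ) (ζ a z v τ) (ν a z v τ) τ := by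
  refine DifferentiableOn.comp (f := fun y : Cover × ℂ =>
    (((α y.1.1 y.1.2.1 y.1.2.2 y.2, ζ y.1.1 y.1.2.1 y.1.2.2 y.2, ν y.1.1 y.1.2.1 y.1.2.2 y.2), y.2) :
      Cover × ℂ)) hf ?_ fun y hy => hy
  exact ((hα.prodMk (hζ.prodMk hν)).prodMk differentiable_snd).differentiableOn

lemma hol_thetaSer (w : ℂ → ℂ → ℂ → ℂ → ℂ)
    (hw : Differentiable ℂ fun y : Cover × ℂ => w y.1.1 y.1.2.1 y.1.2.2 y.2 := by fun_prop) :
    Hol fun a z v τ => thetaSer (w a z v τ) τ :=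
  differentiableOn_thetaSer_cover hw

lemma nonZero_thetaSer (w : ℂ → ℂ → ℂ → ℂ → ℂ) (h : ∃ a z v, w a z v (-1) = Real.pi * I) :
    NonZero fun a z v τ => thetaSer (w a z v τ) τ := by
  obtain ⟨a, z, v, h⟩ := h
  have h1 : (-1 : ℂ).re < 0 := by simp
  refine ⟨a, z, v, -1, h1, ?_⟩
  simp only [h]
  exact thetaSer_pi_ne_zero h1

lemma Hol.cancel (hf : Hol f) (hg : Hol g) (hne : NonZero g)
    (h : ∀ a z v τ, τ.re < 0 → f a z v τ * g a z v τ = 0) :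
    ∀ a z v τ, τ.re < 0 → f a z v τ = 0 := by
  obtain ⟨a, z, v, τ, hτ, h0⟩ := hne
  intro a' z' v' τ' hτ'
  exact eq_zero_of_mul_eq_zero hf hg ⟨((a, z, v), τ), hτ, h0⟩ (fun y hy => h _ _ _ _ hy)
    ((a', z', v'), τ') hτ'

lemma NonZero.mul (hf : Hol f) (hg : Hol g) (hf' : NonZero f) (hg' : NonZero g) :
    NonZero fun a z v τ => f a z v τ * g a z v τ := by
  by_contra hcon
  have h0 : ∀ a z v τ, τ.re < 0 → f a z v τ * g a z v τ = 0 := by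
    intro a z v τ hτ
    by_contra h
    exact hcon ⟨a, z, v, τ, hτ, h⟩
  obtain ⟨a, z, v, τ, hτ, h1⟩ := hf'
  exact h1 (Hol.cancel hf hg hg' h0 a z v τ hτ)

/-- Cancellation of a common factor. -/
lemma Hol.eq_of_mul_eq (hf : Hol f) (hg : Hol g) {k : ℂ → ℂ → ℂ → ℂ → ℂ} (hk : Hol k)
    (hne : NonZero k) (h : ∀ a z v τ, τ.re < 0 → f a z v τ * k a z v τ = g a z v τ * k a z v τ)
    (a z v : ℂ) {τ : ℂ} (hτ : τ.re < 0) : f a z v τ = g a z v τ :=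
  sub_eq_zero.mp (Hol.cancel (hf.sub hg) hk hne
    (fun a z v τ hτ => by rw [sub_mul, h a z v τ hτ, sub_self]) a z v τ hτ)

end Hol

/-- The quasi-periodicity and bilinear relations for the restrictions `e μ p` of an elliptic
canonical basis, with the normalized factor `U`. -/
structure BilinearSystem (e : Fin 2 → Fin 2 → ℂ → ℂ → ℂ → ℂ → ℂ) (U : ℂ → ℂ → ℂ) : Prop where
  hol : ∀ μ p, Hol (e μ p)
  holU : Hol fun _ _ v τ => U v τ
  two_add_tau : ∀ p a z v τ, τ.re < 0 → e 0 p a (z + τ) v τ =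
    -exp (-(3 / 2) * τ - 3 * z - (2 * v - eps p * a)) * e 0 p a z v τ
  one_add_tau : ∀ p a z v τ, τ.re < 0 → e 1 p a (z + τ) v τ =
    -exp (-τ / 2 - z - (2 * v - eps p * a)) * e 1 p a z v τ
  add_a : ∀ μ p a z v τ, τ.re < 0 → e μ p (a + 2 * Real.pi * I) z v τ = -e μ p a z v τ
  add_z : ∀ μ p a z v τ, τ.re < 0 → e μ p a (z + 2 * Real.pi * I) v τ = -e μ p a z v τ
  one_zero : ∀ a z v τ, τ.re < 0 →
    e 0 1 a z v τ * e 1 1 z a v τ + e 1 1 a z v τ * e 0 1 z a v τ = 0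
  one_one : ∀ a z v τ, τ.re < 0 →
    e 0 1 a z v τ * e 1 0 z a v τ + e 1 1 a z v τ * e 0 0 z a v τ =
      U v τ * (thetaSer (2 * v + 2 * a) τ * thetaSer (2 * z) τ)
  zero_one : ∀ a z v τ, τ.re < 0 →
    (e 0 0 a z v τ * e 1 0 z a v τ + e 1 0 a z v τ * e 0 0 z a v τ) *
        thetaSer (z + a + 2 * v) τ =
      U v τ * (thetaSer (2 * v + a - z) τ * thetaSer (2 * v + 2 * z) τ * thetaSer (2 * a) τ +
        thetaSer (2 * v + z - a) τ * thetaSer (2 * v + 2 * a) τ * thetaSer (2 * z) τ)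
  one_ne : ∀ p, NonZero (e 1 p)
  U_ne : NonZero fun _ _ v τ => U v τ

namespace BilinearSystem

variable {e : Fin 2 → Fin 2 → ℂ → ℂ → ℂ → ℂ → ℂ} {U : ℂ → ℂ → ℂ}

/-- The factor of `e 1 p` that does not depend on `z`. -/
noncomputable def coef (e : Fin 2 → Fin 2 → ℂ → ℂ → ℂ → ℂ → ℂ) (p : Fin 2) (a v τ : ℂ) : ℂ :=
  e 1 p a (Real.pi * I - 2 * v + eps p * a) v τ / thetaSer (Real.pi * I) τ

lemma hol_coef (h : BilinearSystem e U) (p : Fin 2) : Hol fun a _ v τ => coef e p a v τ :=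
  ((h.hol 1 p).comp (fun a _ _ _ => a) (fun a _ v _ => Real.pi * I - 2 * v + eps p * a)
    (fun _ _ v _ => v)).div (hol_thetaSer fun _ _ _ _ => Real.pi * I)
    fun _ _ _ _ hτ => thetaSer_pi_ne_zero hτ

lemma Hol.differentiable_z {f : ℂ → ℂ → ℂ → ℂ → ℂ} (hf : Hol f) (a v : ℂ) {τ : ℂ} (hτ : τ.re < 0) :
    Differentiable ℂ fun z => f a z v τ := by
  intro z
  have h1 : DifferentiableAt ℂ (fun y : Cover × ℂ => f y.1.1 y.1.2.1 y.1.2.2 y.2)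
    (((a, z, v), τ) : Cover × ℂ) := hf.differentiableAt (isOpen_fullCover.mem_nhds hτ)
  exact DifferentiableAt.comp (f := fun z => (((a, z, v), τ) : Cover × ℂ)) z h1 (by fun_prop)

lemma Hol.differentiable_a {f : ℂ → ℂ → ℂ → ℂ → ℂ} (hf : Hol f) (z v : ℂ) {τ : ℂ} (hτ : τ.re < 0) :
    Differentiable ℂ fun a => f a z v τ := by
  intro a
  have h1 : DifferentiableAt ℂ (fun y : Cover × ℂ => f y.1.1 y.1.2.1 y.1.2.2 y.2)
    (((a, z, v), τ) : Cover × ℂ) := hf.differentiableAt (isOpen_fullCover.mem_nhds hτ)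
  exact DifferentiableAt.comp (f := fun a => (((a, z, v), τ) : Cover × ℂ)) a h1 (by fun_prop)

lemma differentiable_thetaSer {w : ℂ → ℂ} (hw : Differentiable ℂ w) {τ : ℂ} (hτ : τ.re < 0) :
    Differentiable ℂ fun y => thetaSer (w y) τ := fun _ =>
  differentiableAt_thetaSer hw.differentiableAt (by fun_prop) hτ

lemma exp_neg_half_add (z : ℂ) : exp (-(z + 2 * Real.pi * I) / 2) = -exp (-z / 2) := by
  rw [show -(z + 2 * Real.pi * I) / 2 = -z / 2 - Real.pi * I by ring, exp_sub, exp_pi_mul_I]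
  ring

/-- After multiplication by `z^{-1/2}`, both sides are single-valued theta functions of degree one
in `z` with the same multiplier, hence proportional. The base point makes the argument of `thetaSer`
equal to `π i`, where it does not vanish. -/
lemma one_eq (h : BilinearSystem e U) (p : Fin 2) (a z v : ℂ) {τ : ℂ} (hτ : τ.re < 0) :
    e 1 p a z v τ = coef e p a v τ * thetaSer (z + 2 * v - eps p * a) τ := by
  have key := theta_one_unique (h₁ := fun z => exp (-z / 2) * e 1 p a z v τ)
    (h₂ := fun z => exp (-z / 2) * thetaSer (z + 2 * v - eps p * a) τ)
    (C := -exp (-τ - (2 * v - eps p * a))) (τ := τ)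
    (by have := Hol.differentiable_z (h.hol 1 p) a v hτ; fun_prop)
    (by have := differentiable_thetaSer (w := fun z => z + 2 * v - eps p * a) (by fun_prop) hτ
        fun_prop)
    (fun z => by rw [exp_neg_half_add, h.add_z _ _ _ _ _ _ hτ]; ring)
    (fun z => by
      rw [exp_neg_half_add, show z + 2 * Real.pi * I + 2 * v - eps p * a =
        z + 2 * v - eps p * a + 2 * Real.pi * I by ring, thetaSer_add_two_pi]; ring)
    (neg_ne_zero.mpr (exp_ne_zero _))
    (fun z => by
      rw [h.one_add_tau _ _ _ _ _ hτ]
      have : exp (-(z + τ) / 2) * exp (-τ / 2 - z - (2 * v - eps p * a)) =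
        exp (-τ - (2 * v - eps p * a)) * exp (-z) * exp (-z / 2) := by
        simp only [← exp_add]; ring_nf
      linear_combination -e 1 p a z v τ * this)
    (fun z => by
      rw [show z + τ + 2 * v - eps p * a = z + 2 * v - eps p * a + τ by ring, thetaSer_add_tau]
      have : exp (-(z + τ) / 2) * exp (-τ / 2 - (z + 2 * v - eps p * a)) =
        exp (-τ - (2 * v - eps p * a)) * exp (-z) * exp (-z / 2) := by
        simp only [← exp_add]; ring_nf
      linear_combination -thetaSer (z + 2 * v - eps p * a) τ * this)
    z (Real.pi * I - 2 * v + eps p * a)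
  beta_reduce at key
  rw [show Real.pi * I - 2 * v + eps p * a + 2 * v - eps p * a = Real.pi * I by ring] at key
  have h1 := thetaSer_pi_ne_zero hτ
  rw [coef, div_mul_eq_mul_div, eq_div_iff h1]
  refine mul_left_cancel₀ (mul_ne_zero (exp_ne_zero (-z / 2))
    (exp_ne_zero (-(Real.pi * I - 2 * v + eps p * a) / 2))) ?_
  linear_combination key

lemma coef_ne (h : BilinearSystem e U) (p : Fin 2) : NonZero fun a _ v τ => coef e p a v τ := by
  obtain ⟨a, z, v, τ, hτ, h0⟩ := h.one_ne p
  refine ⟨a, z, v, τ, hτ, ?_⟩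
  rw [h.one_eq p a z v hτ] at h0
  exact left_ne_zero_of_mul h0

lemma coef_add_a (h : BilinearSystem e U) (p : Fin 2) (a v : ℂ) {τ : ℂ} (hτ : τ.re < 0) :
    coef e p (a + 2 * Real.pi * I) v τ = coef e p a v τ := by
  have h1 := h.add_a 1 p a (Real.pi * I - 2 * v + eps p * a) v τ hτ
  rw [h.one_eq p _ _ v hτ, h.one_eq p _ _ v hτ,
    show Real.pi * I - 2 * v + eps p * a + 2 * v - eps p * a = Real.pi * I by ring] at h1
  have h2 : thetaSer (Real.pi * I - 2 * v + eps p * a + 2 * v - eps p * (a + 2 * Real.pi * I)) τ =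
      -thetaSer (Real.pi * I) τ := by
    fin_cases p
    · rw [← thetaSer_sub_two_pi]; simp [eps]; ring_nf
    · rw [← thetaSer_add_two_pi]; simp [eps]; ring_nf
  rw [h2] at h1
  refine mul_right_cancel₀ (thetaSer_pi_ne_zero hτ) ?_
  linear_combination -h1

lemma eps_zero : eps 0 = 1 := rfl
lemma eps_one : eps 1 = -1 := rfl

/-- The `(1, 0)` entry of the duality. -/
lemma swap (h : BilinearSystem e U) (a z v : ℂ) {τ : ℂ} (hτ : τ.re < 0) :
    e 0 1 a z v τ * coef e 1 z v τ = -(coef e 1 a v τ * e 0 1 z a v τ) := by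
  have hc := h.hol_coef 1
  have hs := (h.hol 0 1).comp (fun _ z _ _ => z) (fun a _ _ _ => a) (fun _ _ v _ => v)
  have key := Hol.cancel (f := fun a z v τ => e 0 1 a z v τ * coef e 1 z v τ +
      coef e 1 a v τ * e 0 1 z a v τ)
    (g := fun a z v τ => thetaSer (z + 2 * v + a) τ)
    (((h.hol 0 1).mul (hc.comp (fun _ z _ _ => z) (fun a _ _ _ => a) (fun _ _ v _ => v))).add
      (hc.mul hs)) (hol_thetaSer fun a z v _ => z + 2 * v + a)
    (nonZero_thetaSer _ ⟨Real.pi * I, 0, 0, by simp⟩) (fun a z v τ hτ => by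
      have h1 := h.one_zero a z v τ hτ
      rw [h.one_eq 1 _ _ v hτ, h.one_eq 1 _ _ v hτ, eps_one] at h1
      rw [show a + 2 * v - -1 * z = z + 2 * v + a by ring,
        show z + 2 * v - -1 * a = z + 2 * v + a by ring] at h1
      linear_combination h1) a z v τ hτ
  linear_combination key

end BilinearSystem

namespace BilinearSystem

variable {e : Fin 2 → Fin 2 → ℂ → ℂ → ℂ → ℂ → ℂ} {U : ℂ → ℂ → ℂ}

lemma thetaSer_zero_left (τ : ℂ) : thetaSer 0 τ = 0 := by
  have := thetaSer_neg 0 τ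
  rw [neg_zero] at this
  linear_combination this / 2

lemma thetaSer_add_two_tau (w τ : ℂ) :
    thetaSer (w + 2 * τ) τ = exp (-2 * τ - 2 * w) * thetaSer w τ := by
  rw [show w + 2 * τ = w + τ + τ by ring, thetaSer_add_tau, thetaSer_add_tau]
  have : exp (-τ / 2 - (w + τ)) * exp (-τ / 2 - w) = exp (-2 * τ - 2 * w) := by
    rw [← exp_add]; ring_nf
  linear_combination thetaSer w τ * this

lemma one_one' (h : BilinearSystem e U) (a z v : ℂ) {τ : ℂ} (hτ : τ.re < 0) :
    e 0 1 a z v τ * (coef e 0 z v τ * thetaSer (a + 2 * v - z) τ) +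
      coef e 1 a v τ * thetaSer (z + 2 * v + a) τ * e 0 0 z a v τ =
      U v τ * (thetaSer (2 * v + 2 * a) τ * thetaSer (2 * z) τ) := by
  rw [← h.one_one a z v τ hτ, h.one_eq 0 z a v hτ, h.one_eq 1 a z v hτ, eps_zero, eps_one, one_mul,
    show z + 2 * v - -1 * a = z + 2 * v + a by ring]

lemma two_zero_add_tau (h : BilinearSystem e U) (a z v : ℂ) {τ : ℂ} (hτ : τ.re < 0) :
    e 0 0 a (z + τ) v τ = -exp (-(3 / 2) * τ - 3 * z - (2 * v - a)) * e 0 0 a z v τ := by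
  rw [h.two_add_tau 0 _ _ _ _ hτ, eps_zero, one_mul]

lemma two_one_add_tau (h : BilinearSystem e U) (a z v : ℂ) {τ : ℂ} (hτ : τ.re < 0) :
    e 0 1 a (z + τ) v τ = -exp (-(3 / 2) * τ - 3 * z - (2 * v + a)) * e 0 1 a z v τ := by
  rw [h.two_add_tau 1 _ _ _ _ hτ, eps_one, show 2 * v - -1 * a = 2 * v + a by ring]

/-- The factor `coef e 1` is `τ`-periodic in `a`. -/
lemma coef_one_add_tau (h : BilinearSystem e U) (a v : ℂ) {τ : ℂ} (hτ : τ.re < 0) :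
    coef e 1 (a + τ) v τ = coef e 1 a v τ := by
  have hc := h.hol_coef 1
  have hcz := hc.comp (fun _ z _ _ => z) (fun a _ _ _ => a) (fun _ _ v _ => v)
  have t1 := hol_thetaSer fun a _ v _ => 2 * v + 2 * a
  have t2 := hol_thetaSer fun _ z _ _ => 2 * z
  have n1 := nonZero_thetaSer (fun a _ v _ => 2 * v + 2 * a) ⟨Real.pi * I / 2, 0, 0, by ring⟩
  have n2 := nonZero_thetaSer (fun _ z _ _ => 2 * z) ⟨0, Real.pi * I / 2, 0, by ring⟩
  have n3 : NonZero fun _ z v τ => coef e 1 z v τ := by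
    obtain ⟨a, z, v, τ, hτ, h0⟩ := h.coef_ne 1
    exact ⟨z, a, v, τ, hτ, h0⟩
  refine Hol.eq_of_mul_eq (f := fun a _ v τ => coef e 1 (a + τ) v τ)
    (hc.comp (fun a _ _ τ => a + τ) (fun _ z _ _ => z) (fun _ _ v _ => v)) hc
    (k := fun a z v τ => U v τ * (thetaSer (2 * v + 2 * a) τ * thetaSer (2 * z) τ) *
      coef e 1 z v τ)
    ((h.holU.mul (t1.mul t2)).mul hcz)
    ((h.U_ne.mul h.holU (t1.mul t2) (n1.mul t1 t2 n2)).mul (h.holU.mul (t1.mul t2)) hcz n3)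
    (fun a z v τ hτ => ?_) a 0 v hτ
  -- The behaviour of `e 0 1` under `a ↦ a + τ` is not given directly. The swap relation replaces it
  -- by `e 0 1` with `a` and `z` exchanged, whose shift is known. Comparing the (1,1) relation at
  -- `a` and `a + τ` then leaves only the two values of `coef e 1`.
  have o := h.one_one' a z v hτ
  have o' := h.one_one' (a + τ) z v hτ
  have s := h.swap a z v hτ
  have s' := h.swap (a + τ) z v hτ
  rw [h.two_one_add_tau _ _ _ hτ] at s'
  rw [h.two_zero_add_tau _ _ _ hτ, show a + τ + 2 * v - z = a + 2 * v - z + τ by ring,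
    show z + 2 * v + (a + τ) = z + 2 * v + a + τ by ring,
    show 2 * v + 2 * (a + τ) = 2 * v + 2 * a + 2 * τ by ring, thetaSer_add_tau, thetaSer_add_tau,
    thetaSer_add_two_tau] at o'
  have e1 : exp (-(3 / 2) * τ - 3 * a - (2 * v + z)) * exp (-τ / 2 - (a + 2 * v - z)) =
      exp (-2 * τ - 2 * (2 * v + 2 * a)) := by rw [← exp_add]; ring_nf
  have e2 : exp (-τ / 2 - (z + 2 * v + a)) * exp (-(3 / 2) * τ - 3 * a - (2 * v - z)) =
      exp (-2 * τ - 2 * (2 * v + 2 * a)) := by rw [← exp_add]; ring_nf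
  refine mul_left_cancel₀ (exp_ne_zero (-2 * τ - 2 * (2 * v + 2 * a))) ?_
  linear_combination (-exp (-2 * τ - 2 * (2 * v + 2 * a)) * coef e 1 (a + τ) v τ *
      coef e 1 z v τ) * o + coef e 1 a v τ * coef e 1 z v τ * o' +
    coef e 0 z v τ * thetaSer (a + 2 * v - z) τ * (exp (-2 * τ - 2 * (2 * v + 2 * a)) *
      coef e 1 (a + τ) v τ * s + coef e 1 a v τ * exp (-τ / 2 - (a + 2 * v - z)) * s' +
      coef e 1 a v τ * coef e 1 (a + τ) v τ * e 0 1 z a v τ * e1) -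
    coef e 1 (a + τ) v τ * coef e 1 a v τ * coef e 1 z v τ * thetaSer (z + 2 * v + a) τ *
      e 0 0 z a v τ * e2

/-- Both periods in `a` are now available, and an entire elliptic function is constant. -/
lemma coef_one_const (h : BilinearSystem e U) (a a' v : ℂ) {τ : ℂ} (hτ : τ.re < 0) :
    coef e 1 a v τ = coef e 1 a' v τ :=
  doublyPeriodic_const (h := fun a => coef e 1 a v τ)
    (Hol.differentiable_a (h.hol_coef 1) 0 v hτ) (fun a => h.coef_add_a 1 a v hτ) hτ
    (fun a => h.coef_one_add_tau a v hτ) a a'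

/-- The off-diagonal restriction is antisymmetric under the exchange of `a` and `z`. -/
lemma antisymm (h : BilinearSystem e U) (a z v : ℂ) {τ : ℂ} (hτ : τ.re < 0) :
    e 0 1 a z v τ = -e 0 1 z a v τ := by
  have hs := (h.hol 0 1).comp (fun _ z _ _ => z) (fun a _ _ _ => a) (fun _ _ v _ => v)
  have key := Hol.eq_of_mul_eq (h.hol 0 1) (hs.const_mul (-1)) (h.hol_coef 1) (h.coef_ne 1)
    (fun a z v τ hτ => by
      have := h.swap a z v hτ
      rw [h.coef_one_const z a v hτ] at this
      linear_combination this) a z v hτ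
  rw [key]; ring

/-- Antisymmetry converts the shift law in `z` into one in `a`. Their combination moves along the
lines on which `a + z` is constant. -/
lemma two_one_shift (h : BilinearSystem e U) (a z v : ℂ) {τ : ℂ} (hτ : τ.re < 0) :
    e 0 1 (a + τ) (z - τ) v τ = exp (-2 * τ + 2 * z - 2 * a) * e 0 1 a z v τ := by
  have h1 := h.two_one_add_tau (a + τ) (z - τ) v hτ
  rw [sub_add_cancel, h.antisymm _ z v hτ, h.two_one_add_tau z a v hτ, h.antisymm z a v hτ] at h1
  have e1 : exp (-2 * τ + 2 * z - 2 * a) * exp (-(3 / 2) * τ - 3 * (z - τ) - (2 * v + (a + τ))) =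
      exp (-(3 / 2) * τ - 3 * a - (2 * v + z)) := by rw [← exp_add]; ring_nf
  refine mul_left_cancel₀ (exp_ne_zero (-(3 / 2) * τ - 3 * (z - τ) - (2 * v + (a + τ)))) ?_
  linear_combination h1 - e 0 1 a z v τ * e1

/-- On the locus `a + z + 2v = 0` the second summand of the (1,1) relation contains `thetaSer 0 =
0`, which isolates `coef e 0`. -/
lemma one_one_diag (h : BilinearSystem e U) (c v : ℂ) {τ : ℂ} (hτ : τ.re < 0) :
    e 0 1 (-c - 2 * v) c v τ * coef e 0 c v τ = -U v τ * thetaSer (-2 * c - 2 * v) τ := by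
  have key := Hol.eq_of_mul_eq
    (f := fun c _ v τ => e 0 1 (-c - 2 * v) c v τ * coef e 0 c v τ)
    (g := fun c _ v τ => -1 * (U v τ * thetaSer (-2 * c - 2 * v) τ))
    (k := fun c _ _ τ => thetaSer (-2 * c) τ)
    (((h.hol 0 1).comp (fun c _ v _ => -c - 2 * v) (fun c _ _ _ => c) (fun _ _ v _ => v)).mul
      (h.hol_coef 0))
    ((h.holU.mul (hol_thetaSer fun c _ v _ => -2 * c - 2 * v)).const_mul (-1))
    (hol_thetaSer fun c _ _ _ => -2 * c)
    (nonZero_thetaSer _ ⟨-(Real.pi * I) / 2, 0, 0, by ring⟩)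
    (fun c _ v τ hτ => by
      have o := h.one_one' (-c - 2 * v) c v hτ
      have n := thetaSer_neg (2 * c) τ
      rw [show -c - 2 * v + 2 * v - c = -2 * c by ring,
        show c + 2 * v + (-c - 2 * v) = 0 by ring, thetaSer_zero_left,
        show 2 * v + 2 * (-c - 2 * v) = -2 * c - 2 * v by ring] at o
      rw [show -(2 * c) = -2 * c by ring] at n
      linear_combination o + U v τ * thetaSer (-2 * c - 2 * v) τ * n) c 0 v hτ
  rw [key]; ring

/-- The locus of `one_one_diag` is preserved by moving `z` by `τ` and `a` by `-τ`. The factor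
acquired by `e 0 1` in `two_one_shift` agrees with that of the right-hand side, so `coef e 0` is
unchanged. -/
lemma coef_zero_add_tau (h : BilinearSystem e U) (c v : ℂ) {τ : ℂ} (hτ : τ.re < 0) :
    coef e 0 (c + τ) v τ = coef e 0 c v τ := by
  have hc := h.hol_coef 0
  have t1 := hol_thetaSer fun a _ v _ => -2 * a - 2 * v
  refine Hol.eq_of_mul_eq (f := fun a _ v τ => coef e 0 (a + τ) v τ)
    (hc.comp (fun a _ _ τ => a + τ) (fun _ z _ _ => z) (fun _ _ v _ => v)) hc
    (k := fun a _ v τ => U v τ * thetaSer (-2 * a - 2 * v) τ) (h.holU.mul t1)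
    (h.U_ne.mul h.holU t1 (nonZero_thetaSer _ ⟨-(Real.pi * I) / 2, 0, 0, by ring⟩))
    (fun c _ v τ hτ => ?_) c 0 v hτ
  have d := h.one_one_diag c v hτ
  have d' := h.one_one_diag (c + τ) v hτ
  have s := h.two_one_shift (-(c + τ) - 2 * v) (c + τ) v hτ
  rw [show -(c + τ) - 2 * v + τ = -c - 2 * v by ring, add_sub_cancel_right] at s
  have t := thetaSer_add_two_tau (-2 * (c + τ) - 2 * v) τ
  rw [show -2 * (c + τ) - 2 * v + 2 * τ = -2 * c - 2 * v by ring] at t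
  have e1 : exp (-2 * τ + 2 * (c + τ) - 2 * (-(c + τ) - 2 * v)) =
      exp (-2 * τ - 2 * (-2 * (c + τ) - 2 * v)) := by ring_nf
  rw [e1] at s
  linear_combination coef e 0 (c + τ) v τ * d - coef e 0 c v τ * coef e 0 (c + τ) v τ * s -
    coef e 0 c v τ * exp (-2 * τ - 2 * (-2 * (c + τ) - 2 * v)) * d' - coef e 0 c v τ * U v τ * t

lemma coef_zero_const (h : BilinearSystem e U) (a a' v : ℂ) {τ : ℂ} (hτ : τ.re < 0) :
    coef e 0 a v τ = coef e 0 a' v τ :=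
  doublyPeriodic_const (h := fun a => coef e 0 a v τ)
    (Hol.differentiable_a (h.hol_coef 0) 0 v hτ) (fun a => h.coef_add_a 0 a v hτ) hτ
    (fun a => h.coef_zero_add_tau a v hτ) a a'

/-- Weighting the (1,1) relation and its mirror under `a ↔ z` cancels the antisymmetric `e 0 1`. The
rest reproduces the (0,1) relation with `coef e 0` and `coef e 1` interchanged. -/
lemma coef_one_eq_zero (h : BilinearSystem e U) (a v : ℂ) {τ : ℂ} (hτ : τ.re < 0) :
    coef e 1 a v τ = coef e 0 a v τ := by
  have t1 := hol_thetaSer fun a z v _ => 2 * v + a - z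
  have t2 := hol_thetaSer fun _ z v _ => 2 * v + 2 * z
  have t3 := hol_thetaSer fun a _ _ _ => 2 * a
  have t4 := hol_thetaSer fun a z v _ => 2 * v + z - a
  have t5 := hol_thetaSer fun a _ v _ => 2 * v + 2 * a
  have t6 := hol_thetaSer fun _ z _ _ => 2 * z
  have hb := ((t1.mul t2).mul t3).add ((t4.mul t5).mul t6)
  -- On the diagonal `z = a` the two summands coincide, so their sum is twice a nonzero product.
  have nb : NonZero fun a z v τ =>
      thetaSer (2 * v + a - z) τ * thetaSer (2 * v + 2 * z) τ * thetaSer (2 * a) τ +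
        thetaSer (2 * v + z - a) τ * thetaSer (2 * v + 2 * a) τ * thetaSer (2 * z) τ := by
    have t7 := hol_thetaSer fun _ _ v _ => 2 * v
    have n7 := nonZero_thetaSer (fun _ _ v _ => 2 * v) ⟨0, 0, Real.pi * I / 2, by ring⟩
    have n5 := nonZero_thetaSer (fun a _ v _ => 2 * v + 2 * a) ⟨Real.pi * I / 2, 0, 0, by ring⟩
    have n3 := nonZero_thetaSer (fun a _ _ _ => 2 * a) ⟨Real.pi * I / 2, 0, 0, by ring⟩
    obtain ⟨a, z, v, τ, hτ, h0⟩ := (n7.mul t7 t5 n5).mul (t7.mul t5) t3 n3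
    refine ⟨a, a, v, τ, hτ, ?_⟩
    beta_reduce
    rw [add_sub_cancel_right, ← two_mul]
    exact mul_ne_zero two_ne_zero h0
  refine Hol.eq_of_mul_eq (h.hol_coef 1) (h.hol_coef 0) (h.holU.mul hb)
    (h.U_ne.mul h.holU hb nb) (fun a z v τ hτ => ?_) a 0 v hτ
  have o := h.one_one' a z v hτ
  have o' := h.one_one' z a v hτ
  have w := h.zero_one a z v τ hτ
  rw [h.one_eq 0 _ _ _ hτ, h.one_eq 0 _ _ _ hτ, eps_zero, one_mul, one_mul,
    h.coef_zero_const z a v hτ] at w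
  rw [h.coef_zero_const z a v hτ] at o
  rw [h.coef_one_const z a v hτ, h.antisymm z a v hτ] at o'
  rw [show z + 2 * v + a = z + a + 2 * v by ring] at o
  rw [show a + 2 * v + z = z + a + 2 * v by ring] at o'
  rw [show a + 2 * v - z = 2 * v + a - z by ring] at o w
  rw [show z + 2 * v - a = 2 * v + z - a by ring] at o' w
  linear_combination -coef e 1 a v τ * w + coef e 0 a v τ * thetaSer (2 * v + z - a) τ * o +
    coef e 0 a v τ * thetaSer (2 * v + a - z) τ * o'

end BilinearSystem

/-- Translation by `π i` fixes `ϑ₀` and negates `ϑ₁`, so the values at `0` and `π i` separate the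
two coefficients. -/
lemma thetaMix_zero_sum (f₁ f₂ : ℂ → ℂ → ℂ) (ν τ : ℂ) :
    thetaMix f₁ f₂ ν 0 τ + thetaMix f₁ f₂ ν (Real.pi * I) τ = f₁ ν τ * (2 * thetaZero 0 τ) := by
  have h0 := thetaZero_add_pi 0 τ
  have h1 := thetaOne_add_pi 0 τ
  rw [zero_add] at h0 h1
  rw [thetaMix, thetaMix, h0, h1]; ring

lemma thetaMix_zero_diff (f₁ f₂ : ℂ → ℂ → ℂ) (ν τ : ℂ) :
    thetaMix f₁ f₂ ν 0 τ - thetaMix f₁ f₂ ν (Real.pi * I) τ = f₂ ν τ * (2 * thetaOne 0 τ) := by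
  have h0 := thetaZero_add_pi 0 τ
  have h1 := thetaOne_add_pi 0 τ
  rw [zero_add] at h0 h1
  rw [thetaMix, thetaMix, h0, h1]; ring

lemma thetaMix_neg (f₁ f₂ : ℂ → ℂ → ℂ) (ν w τ : ℂ) :
    thetaMix f₁ f₂ ν (-w) τ = thetaMix f₁ f₂ ν w τ := by
  rw [thetaMix, thetaZero_neg, thetaOne_neg, thetaMix]

lemma Hol.holomorphicVQ {f : ℂ → ℂ → ℂ} (hf : Hol fun _ _ v τ => f v τ) : HolomorphicVQ f :=
  DifferentiableOn.comp (g := fun y : Cover × ℂ => f y.1.2.2 y.2)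
    (f := fun y : ℂ × ℂ => (((0, 0, y.1), y.2) : Cover × ℂ)) hf
    (Differentiable.differentiableOn (by fun_prop)) fun _ hy => hy

lemma HolomorphicVQ.hol {f : ℂ → ℂ → ℂ} (hf : HolomorphicVQ f) : Hol fun _ _ v τ => f v τ :=
  fun _ hy => (hf.comp (by fun_prop) (by fun_prop) hy).differentiableWithinAt

lemma hol_thetaMix {f₁ f₂ : ℂ → ℂ → ℂ} (h₁ : HolomorphicVQ f₁) (h₂ : HolomorphicVQ f₂)
    (w : ℂ → ℂ → ℂ → ℂ → ℂ)
    (hw : Differentiable ℂ fun y : Cover × ℂ => w y.1.1 y.1.2.1 y.1.2.2 y.2 := by fun_prop) :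
    Hol fun a z v τ => thetaMix f₁ f₂ v (w a z v τ) τ := fun _ hy =>
  (differentiableAt_thetaMix h₁ h₂ (by fun_prop) hw.differentiableAt (by fun_prop)
    hy).differentiableWithinAt

/-- Even degree-two theta functions are combinations of `thetaZero` and `thetaOne`. -/
lemma eq_thetaMix {k : ℂ → ℂ} (hk : Differentiable ℂ k) {τ : ℂ} (hτ : τ.re < 0)
    (hp : ∀ y, k (y + 2 * Real.pi * I) = k y) (hq : ∀ y, k (y + τ) = exp (-τ - 2 * y) * k y)
    (y : ℂ) : k y = (k 0 + k (Real.pi * I)) / (2 * thetaZero 0 τ) * thetaZero y τ +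
      (k 0 - k (Real.pi * I)) / (2 * thetaOne 0 τ) * thetaOne y τ := by
  have hd : ∀ w : ℂ → ℂ, Differentiable ℂ w → (Differentiable ℂ fun y => thetaZero (w y) τ) ∧
      Differentiable ℂ fun y => thetaOne (w y) τ := fun w hw =>
    ⟨fun _ => differentiableAt_thetaZero hw.differentiableAt (by fun_prop) hτ,
      fun _ => differentiableAt_thetaOne hw.differentiableAt (by fun_prop) hτ⟩
  obtain ⟨d0, d1⟩ := hd (fun u => u / 2) (by fun_prop)
  have hp' : ∀ y, k (y + Real.pi * I + Real.pi * I) = k y := fun y => by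
    rw [← hp y]; ring_nf
  have hq' : ∀ y, k (y + τ + Real.pi * I) = exp (-τ - 2 * y) * k (y + Real.pi * I) := fun y => by
    rw [show y + τ + Real.pi * I = y + Real.pi * I + τ by ring, hq,
      show -τ - 2 * (y + Real.pi * I) = -τ - 2 * y - 2 * Real.pi * I by ring, exp_sub,
      exp_two_pi_mul_I, div_one]
  have half : ∀ u : ℂ, (u + 2 * Real.pi * I) / 2 = u / 2 + Real.pi * I := fun u => by ring
  have halfτ : ∀ u : ℂ, (u + 2 * τ) / 2 = u / 2 + τ := fun u => by ring
  have ex : ∀ u : ℂ, exp (-τ - 2 * (u / 2)) = exp (-τ) * exp (-u) := fun u => by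
    rw [← exp_add]; ring_nf
  have ex' : ∀ u : ℂ, exp (-(u / 2 + τ)) * (exp (-τ) * exp (-u)) =
      exp (-2 * τ) * exp (-u) * exp (-(u / 2)) := fun u => by
    simp only [← exp_add]; ring_nf
  have exn : ∀ u : ℂ, exp (-(u + Real.pi * I)) = -exp (-u) := fun u => by
    rw [neg_add, exp_add, exp_neg (Real.pi * I), exp_pi_mul_I]; norm_num
  -- The parts of `k` that are invariant and anti-invariant under `y ↦ y + π i` become, in the
  -- variable `2y`, theta functions of degree one for `2τ`. Each is therefore determined up to a
  -- scalar.
  have kp := theta_one_unique (h₁ := fun u => k (u / 2) + k (u / 2 + Real.pi * I))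
    (h₂ := fun u => thetaZero (u / 2) τ) (C := exp (-τ)) (τ := 2 * τ) (by fun_prop) d0
    (fun u => by rw [half, hp', add_comm]) (fun u => by rw [half, thetaZero_add_pi])
    (exp_ne_zero _) (fun u => by rw [halfτ, hq, hq', ex]; ring)
    (fun u => by rw [halfτ, thetaZero_add_tau, ex]) (2 * y) 0
  have km := theta_one_unique
    (h₁ := fun u => exp (-(u / 2)) * (k (u / 2) - k (u / 2 + Real.pi * I)))
    (h₂ := fun u => exp (-(u / 2)) * thetaOne (u / 2) τ) (C := exp (-2 * τ)) (τ := 2 * τ)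
    (by fun_prop) (by fun_prop)
    (fun u => by rw [half, hp', exn]; ring) (fun u => by rw [half, thetaOne_add_pi, exn]; ring)
    (exp_ne_zero _)
    (fun u => by
      rw [halfτ, hq, hq', ex]
      linear_combination (k (u / 2) - k (u / 2 + Real.pi * I)) * ex' u)
    (fun u => by rw [halfτ, thetaOne_add_tau, ex]; linear_combination thetaOne (u / 2) τ * ex' u)
    (2 * y) 0
  beta_reduce at kp km
  rw [mul_div_cancel_left₀ _ two_ne_zero, zero_div, zero_add] at kp km
  rw [neg_zero, exp_zero] at km
  have km' : (k y - k (y + Real.pi * I)) * thetaOne 0 τ =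
      thetaOne y τ * (k 0 - k (Real.pi * I)) := by
    refine mul_left_cancel₀ (exp_ne_zero (-y)) ?_
    linear_combination km
  have n0 := thetaZero_zero_ne_zero hτ
  have n1 := thetaOne_zero_ne_zero hτ
  field_simp
  linear_combination thetaOne 0 τ * kp + thetaZero 0 τ * km'

namespace BilinearSystem

variable {e : Fin 2 → Fin 2 → ℂ → ℂ → ℂ → ℂ → ℂ} {U : ℂ → ℂ → ℂ}

/-- The factor of the off-diagonal restriction that depends only on `a * z`. -/
noncomputable def symPart (e : Fin 2 → Fin 2 → ℂ → ℂ → ℂ → ℂ → ℂ) (y v τ : ℂ) : ℂ :=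
  e 0 1 ((y - v) / 2 - Real.pi * I / 2) ((y - v) / 2 + Real.pi * I / 2) v τ /
    thetaSer (Real.pi * I) τ

lemma hol_symPart (h : BilinearSystem e U) : Hol fun y _ v τ => symPart e y v τ :=
  ((h.hol 0 1).comp (fun y _ v _ => (y - v) / 2 - Real.pi * I / 2)
    (fun y _ v _ => (y - v) / 2 + Real.pi * I / 2) (fun _ _ v _ => v)).div
    (hol_thetaSer fun _ _ _ _ => Real.pi * I) fun _ _ _ _ hτ => thetaSer_pi_ne_zero hτ

/-- With `a + z` fixed, `e 0 1` is an odd function of `(z - a)/2` with the degree-four multiplier of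
`thetaSer (2 w)`. Such functions form a line, so the dependence on `z - a` is a single factor;
evaluation at `w = π i / 2` gives the remaining one. -/
lemma two_one_eq (h : BilinearSystem e U) (a z v : ℂ) {τ : ℂ} (hτ : τ.re < 0) :
    e 0 1 a z v τ = thetaSer (z - a) τ * symPart e (z + a + v) v τ := by
  have hP : Differentiable ℂ fun w : ℂ => e 0 1 ((z + a) / 2 - w) ((z + a) / 2 + w) v τ := by
    intro w
    have h1 : DifferentiableAt ℂ (fun y : Cover × ℂ => e 0 1 y.1.1 y.1.2.1 y.1.2.2 y.2)
      ((((z + a) / 2 - w, (z + a) / 2 + w, v), τ) : Cover × ℂ) :=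
      (h.hol 0 1).differentiableAt (isOpen_fullCover.mem_nhds hτ)
    exact DifferentiableAt.comp (f := fun w : ℂ => ((((z + a) / 2 - w, (z + a) / 2 + w, v), τ) :
      Cover × ℂ)) w h1 (by fun_prop)
  have key := theta_four_odd_unique
    (h₁ := fun w => e 0 1 ((z + a) / 2 - w) ((z + a) / 2 + w) v τ)
    (h₂ := fun w => thetaSer (2 * w) τ) hP (differentiable_thetaSer (by fun_prop) hτ)
    (fun w => by
      have h1 := h.add_a 0 1 ((z + a) / 2 - (w + 2 * Real.pi * I))
        ((z + a) / 2 + (w + 2 * Real.pi * I)) v τ hτ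
      have h2 := h.add_z 0 1 ((z + a) / 2 - w) ((z + a) / 2 + w) v τ hτ
      rw [show (z + a) / 2 - (w + 2 * Real.pi * I) + 2 * Real.pi * I = (z + a) / 2 - w by ring,
        ← add_assoc, h2] at h1
      rw [← add_assoc]
      exact (neg_injective h1).symm)
    (fun w => by
      rw [show 2 * (w + 2 * Real.pi * I) = 2 * w + 2 * Real.pi * I + 2 * Real.pi * I by ring,
        thetaSer_add_two_pi, thetaSer_add_two_pi, neg_neg])
    (fun w => by rw [h.antisymm _ _ v hτ]; ring_nf)
    (fun w => by rw [mul_neg, thetaSer_neg]) (τ := τ)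
    (fun w => by
      have h1 := h.two_one_shift ((z + a) / 2 - (w + τ)) ((z + a) / 2 + (w + τ)) v hτ
      rw [show (z + a) / 2 - (w + τ) + τ = (z + a) / 2 - w by ring,
        show (z + a) / 2 + (w + τ) - τ = (z + a) / 2 + w by ring] at h1
      rw [h1, ← mul_assoc, ← exp_add, ← exp_add]
      rw [show -2 * τ + -4 * w + (-2 * τ + 2 * ((z + a) / 2 + (w + τ)) -
        2 * ((z + a) / 2 - (w + τ))) = 0 by ring, exp_zero, one_mul])
    (fun w => by
      rw [mul_add, thetaSer_add_two_tau, ← exp_add]; ring_nf)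
    ((z - a) / 2) (Real.pi * I / 2)
  beta_reduce at key
  rw [show (z + a) / 2 - (z - a) / 2 = a by ring, show (z + a) / 2 + (z - a) / 2 = z by ring,
    show 2 * (Real.pi * I / 2) = Real.pi * I by ring, show 2 * ((z - a) / 2) = z - a by ring] at key
  rw [symPart, add_sub_cancel_right, ← mul_div_assoc, eq_div_iff (thetaSer_pi_ne_zero hτ), key]

/-- Moving `y` by a full period exchanges the two evaluation points up to a period in `z`. The sign
from that period cancels the one from antisymmetry. -/
lemma symPart_add_pi (h : BilinearSystem e U) (y v : ℂ) {τ : ℂ} (hτ : τ.re < 0) :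
    symPart e (y + 2 * Real.pi * I) v τ = symPart e y v τ := by
  have h1 := h.add_z 0 1 ((y - v) / 2 + Real.pi * I / 2) ((y - v) / 2 - Real.pi * I / 2) v τ hτ
  have h2 := h.antisymm ((y - v) / 2 + Real.pi * I / 2) ((y - v) / 2 - Real.pi * I / 2) v hτ
  rw [h2, neg_neg] at h1
  rw [symPart, symPart, ← h1]
  ring_nf

/-- The shift law of `e 0 1` has degree three in `z`, and removing the factor `thetaSer (z - a)` of
degree one leaves degree two. -/
lemma symPart_add_tau (h : BilinearSystem e U) (y v : ℂ) {τ : ℂ} (hτ : τ.re < 0) :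
    symPart e (y + τ) v τ = exp (-τ - 2 * y) * symPart e y v τ := by
  have h1 := h.two_one_add_tau ((y - v) / 2 - Real.pi * I / 2) ((y - v) / 2 + Real.pi * I / 2) v hτ
  rw [h.two_one_eq _ _ v hτ, h.two_one_eq _ _ v hτ,
    show (y - v) / 2 + Real.pi * I / 2 + τ - ((y - v) / 2 - Real.pi * I / 2) = Real.pi * I + τ by
      ring,
    show (y - v) / 2 + Real.pi * I / 2 - ((y - v) / 2 - Real.pi * I / 2) = Real.pi * I by ring,
    show (y - v) / 2 + Real.pi * I / 2 + τ + ((y - v) / 2 - Real.pi * I / 2) + v = y + τ by ring,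
    show (y - v) / 2 + Real.pi * I / 2 + ((y - v) / 2 - Real.pi * I / 2) + v = y by ring,
    thetaSer_add_tau] at h1
  have e1 : exp (-τ / 2 - Real.pi * I) * exp (-τ - 2 * y) =
    exp (-(3 / 2) * τ - 3 * ((y - v) / 2 + Real.pi * I / 2) -
      (2 * v + ((y - v) / 2 - Real.pi * I / 2))) := by rw [← exp_add]; ring_nf
  refine mul_left_cancel₀ (mul_ne_zero (thetaSer_pi_ne_zero hτ)
    (exp_ne_zero (-τ / 2 - Real.pi * I))) ?_
  linear_combination -h1 - thetaSer (Real.pi * I) τ * symPart e y v τ * e1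

/-- The solutions of the bilinear system. -/
lemma solve (h : BilinearSystem e U) : ∃ f₀ f₁ f₂ : ℂ → ℂ → ℂ,
    (HolomorphicVQ f₀ ∧ HolomorphicVQ f₁ ∧ HolomorphicVQ f₂) ∧ ∀ v τ : ℂ, τ.re < 0 →
      (∀ p a z, e 0 p a z v τ =
        thetaMix f₁ f₂ v (z - eps p * a + v) τ * thetaSer (z + eps p * a) τ) ∧
      (∀ p a z, e 1 p a z v τ = f₀ v τ * thetaSer (z + 2 * v - eps p * a) τ) ∧
      U v τ = f₀ v τ * thetaMix f₁ f₂ v v τ := by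
  have hs := h.hol_symPart
  have s0 : HolomorphicVQ fun v τ => symPart e 0 v τ := Hol.holomorphicVQ
    (hs.comp (fun _ _ _ _ => 0) (fun _ z _ _ => z) (fun _ _ v _ => v))
  have s1 : HolomorphicVQ fun v τ => symPart e (Real.pi * I) v τ := Hol.holomorphicVQ
    (hs.comp (fun _ _ _ _ => Real.pi * I) (fun _ z _ _ => z) (fun _ _ v _ => v))
  have t0 : Hol fun _ _ _ τ => thetaZero 0 τ := fun _ hy =>
    (differentiableAt_thetaZero (by fun_prop) (by fun_prop) hy).differentiableWithinAt
  have t1 : Hol fun _ _ _ τ => thetaOne 0 τ := fun _ hy =>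
    (differentiableAt_thetaOne (by fun_prop) (by fun_prop) hy).differentiableWithinAt
  set f₀ : ℂ → ℂ → ℂ := fun v τ => coef e 0 0 v τ with hf₀
  set f₁ : ℂ → ℂ → ℂ := fun v τ =>
    (symPart e 0 v τ + symPart e (Real.pi * I) v τ) / (2 * thetaZero 0 τ) with hf₁
  set f₂ : ℂ → ℂ → ℂ := fun v τ =>
    (symPart e 0 v τ - symPart e (Real.pi * I) v τ) / (2 * thetaOne 0 τ) with hf₂
  have h0 : HolomorphicVQ f₀ := Hol.holomorphicVQ
    ((h.hol_coef 0).comp (fun _ _ _ _ => 0) (fun _ z _ _ => z) (fun _ _ v _ => v))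
  have h1 : HolomorphicVQ f₁ := Hol.holomorphicVQ ((s0.hol.add s1.hol).div (t0.const_mul 2)
    fun _ _ _ _ hτ => mul_ne_zero two_ne_zero (thetaZero_zero_ne_zero hτ))
  have h2 : HolomorphicVQ f₂ := Hol.holomorphicVQ ((s0.hol.sub s1.hol).div (t1.const_mul 2)
    fun _ _ _ _ hτ => mul_ne_zero two_ne_zero (thetaOne_zero_ne_zero hτ))
  have hsym : ∀ y v {τ : ℂ}, τ.re < 0 → symPart e y v τ = thetaMix f₁ f₂ v y τ :=
    fun y v τ hτ => eq_thetaMix (k := fun y => symPart e y v τ)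
      (Hol.differentiable_a hs 0 v hτ) hτ (fun y => h.symPart_add_pi y v hτ)
      (fun y => h.symPart_add_tau y v hτ) y
  have hone : ∀ p a z v {τ : ℂ}, τ.re < 0 →
      e 1 p a z v τ = f₀ v τ * thetaSer (z + 2 * v - eps p * a) τ := by
    intro p a z v τ hτ
    rw [h.one_eq p a z v hτ, hf₀]
    beta_reduce
    fin_cases p
    · simp only [Fin.zero_eta]
      rw [h.coef_zero_const a 0 v hτ]
    · simp only [Fin.mk_one]
      rw [h.coef_one_eq_zero a v hτ, h.coef_zero_const a 0 v hτ]
  have htwo : ∀ a z v {τ : ℂ}, τ.re < 0 →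
      e 0 1 a z v τ = thetaSer (z - a) τ * thetaMix f₁ f₂ v (z + a + v) τ := fun a z v τ hτ => by
    rw [h.two_one_eq a z v hτ, hsym _ _ hτ]
  have hU : ∀ v {τ : ℂ}, τ.re < 0 → U v τ = f₀ v τ * thetaMix f₁ f₂ v v τ := by
    intro v τ hτ
    -- At this point both theta factors of the relation have argument `±π i`, hence are nonzero, and
    -- `e 0 1` contributes `thetaMix` at `-v`, which is its value at `v`.
    have d := h.one_one_diag (Real.pi * I / 2 - v) v hτ
    have n := thetaSer_neg (Real.pi * I) τ
    rw [htwo _ _ _ hτ, h.coef_zero_const _ 0 v hτ,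
      show Real.pi * I / 2 - v - (-(Real.pi * I / 2 - v) - 2 * v) = Real.pi * I by ring,
      show Real.pi * I / 2 - v + (-(Real.pi * I / 2 - v) - 2 * v) + v = -v by ring, thetaMix_neg,
      show -2 * (Real.pi * I / 2 - v) - 2 * v = -(Real.pi * I) by ring, n] at d
    refine mul_left_cancel₀ (thetaSer_pi_ne_zero hτ) ?_
    rw [hf₀]
    linear_combination -d
  have hfn : NonZero fun _ _ v τ => f₀ v τ := by
    obtain ⟨a, z, v, τ, hτ, hne⟩ := h.U_ne
    beta_reduce at hne
    rw [hU v hτ] at hne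
    exact ⟨a, z, v, τ, hτ, left_ne_zero_of_mul hne⟩
  -- The (1,1) relation determines `e 0 0` once the rest is known. Comparison with
  -- `thetaMix_plucker` gives its form after division by `f₀` times a theta factor, neither of which
  -- vanishes identically.
  have hzero : ∀ a z v {τ : ℂ}, τ.re < 0 →
      e 0 0 z a v τ = thetaMix f₁ f₂ v (v + a - z) τ * thetaSer (z + a) τ := by
    intro a z v τ hτ
    have tk := hol_thetaSer fun a z v _ => z + a + 2 * v
    refine Hol.eq_of_mul_eq (f := fun a z v τ => e 0 0 z a v τ)
      (g := fun a z v τ => thetaMix f₁ f₂ v (v + a - z) τ * thetaSer (z + a) τ)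
      (k := fun a z v τ => f₀ v τ * thetaSer (z + a + 2 * v) τ)
      ((h.hol 0 0).comp (fun _ z _ _ => z) (fun a _ _ _ => a) (fun _ _ v _ => v))
      ((hol_thetaMix h1 h2 fun a z v _ => v + a - z).mul (hol_thetaSer fun a z _ _ => z + a))
      (h0.hol.mul tk) (hfn.mul h0.hol tk (nonZero_thetaSer _ ⟨Real.pi * I, 0, 0, by simp⟩))
      (fun a z v τ hτ => ?_) a z v hτ
    have o := h.one_one a z v τ hτ
    have pl := thetaMix_plucker f₁ f₂ v a z v hτ
    rw [htwo _ _ _ hτ, hone _ _ _ _ hτ, hone _ _ _ _ hτ, hU v hτ, eps_zero, eps_one,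
      show a + 2 * v - 1 * z = 2 * v + a - z by ring,
      show z + 2 * v - -1 * a = z + a + 2 * v by ring] at o
    linear_combination o - f₀ v τ * pl
  refine ⟨f₀, f₁, f₂, ⟨h0, h1, h2⟩, fun v τ hτ => ⟨fun p a z => ?_, fun p a z => hone p a z v hτ,
    hU v hτ⟩⟩
  fin_cases p
  · simp only [Fin.zero_eta, eps_zero]
    rw [hzero z a v hτ]
    ring_nf
  · simp only [Fin.mk_one, eps_one]
    rw [htwo a z v hτ]
    ring_nf

end BilinearSystem

/-! ### From the conditions to the bilinear system. -/

section Forward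

variable {E : Fin 2 → Fin 2 → MultiFun} {Υ : ℂ → ℂ → ℂ}

/-- Property A supplies holomorphy jointly with `q`, whereas the single-valuedness condition
concerns each `q` separately. The prefactor is invertible and can be divided out. -/
lemma PropertyA.hol (hA : PropertyA E) (μ p : Fin 2) : Hol fun a z v τ => E μ p (a, z, v) τ := by
  obtain ⟨α, β, r, h, -⟩ := hA μ
  obtain ⟨-, -, hd⟩ := h p
  have h1 : DifferentiableOn ℂ (fun y : Cover × ℂ => exp (r * y.2) * exp (α * y.1.1) *
      exp (β * y.1.2.1) * exp (3 / 2 * y.1.1 + 1 / 2 * (2 * y.1.2.2 - eps p * y.1.1))) fullCover :=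
    Differentiable.differentiableOn (by fun_prop)
  refine (h1.mul hd).congr fun y _ => ?_
  simp only [Pi.mul_apply, sqrtL, O]
  have e1 : exp (r * y.2) * exp (α * y.1.1) * exp (β * y.1.2.1) *
      exp (3 / 2 * y.1.1 + 1 / 2 * (2 * y.1.2.2 - eps p * y.1.1)) *
      (exp (-r * y.2) * exp (-α * y.1.1) * exp (-β * y.1.2.1) * (exp (-(3 / 2) * y.1.1) *
        exp (-1 / 2 * (2 * y.1.2.2 - eps p * y.1.1)))) = 1 := by
    simp only [← exp_add]
    rw [← exp_zero]
    ring_nf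
  linear_combination -E μ p (y.1.1, y.1.2.1, y.1.2.2) y.2 * e1

lemma SingleValuedHolomorphic.add_a (hS : SingleValuedHolomorphic E) (μ p : Fin 2) (a z v : ℂ)
    {τ : ℂ} (hτ : τ.re < 0) : E μ p (a + 2 * Real.pi * I, z, v) τ = -E μ p (a, z, v) τ := by
  have h := ((hS μ p τ hτ).1 (a, z, v)).1
  simp only [O] at h
  have e1 : exp (-1 / 2 * (2 * v - eps p * (a + 2 * Real.pi * I))) =
      -exp (-1 / 2 * (2 * v - eps p * a)) := by
    rw [show -1 / 2 * (2 * v - eps p * (a + 2 * Real.pi * I)) =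
      -1 / 2 * (2 * v - eps p * a) + eps p * (Real.pi * I) by ring, exp_add]
    fin_cases p
    · simp [eps, exp_pi_mul_I]
    · simp [eps, exp_neg, exp_pi_mul_I]
  rw [e1] at h
  refine mul_left_cancel₀ (mul_ne_zero (exp_ne_zero (-z / 2))
    (exp_ne_zero (-1 / 2 * (2 * v - eps p * a)))) ?_
  linear_combination -h

lemma SingleValuedHolomorphic.add_z (hS : SingleValuedHolomorphic E) (μ p : Fin 2) (a z v : ℂ)
    {τ : ℂ} (hτ : τ.re < 0) : E μ p (a, z + 2 * Real.pi * I, v) τ = -E μ p (a, z, v) τ := by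
  have h := ((hS μ p τ hτ).1 (a, z, v)).2.1
  simp only [O] at h
  rw [BilinearSystem.exp_neg_half_add] at h
  refine mul_left_cancel₀ (mul_ne_zero (exp_ne_zero (-z / 2))
    (exp_ne_zero (-1 / 2 * (2 * v - eps p * a)))) ?_
  linear_combination -h

lemma SingleValuedHolomorphic.add_v (hS : SingleValuedHolomorphic E) (μ p : Fin 2) (a z v : ℂ)
    {τ : ℂ} (hτ : τ.re < 0) : E μ p (a, z, v + 2 * Real.pi * I) τ = E μ p (a, z, v) τ := by
  have h := ((hS μ p τ hτ).1 (a, z, v)).2.2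
  simp only [O] at h
  rw [show -1 / 2 * (2 * (v + 2 * Real.pi * I) - eps p * a) =
      -1 / 2 * (2 * v - eps p * a) - 2 * Real.pi * I by ring, exp_sub, exp_two_pi_mul_I,
    div_one] at h
  exact mul_left_cancel₀ (mul_ne_zero (exp_ne_zero (-z / 2))
    (exp_ne_zero (-1 / 2 * (2 * v - eps p * a)))) h

lemma nonZero_of_tendsto {f : ℂ → ℂ → ℂ → ℂ → ℂ} {r : ℝ} {c a z v l : ℂ}
    (h : Tendsto (fun τ => exp (-r * τ) * f a (z + c * τ) v τ) qToZero (𝓝 l)) (hl : l ≠ 0) :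
    NonZero f := by
  obtain ⟨τ, h1, h2⟩ := ((h.eventually_ne hl).and (eventually_re_lt 0)).exists
  exact ⟨a, _, v, τ, h2, right_ne_zero_of_mul h1⟩

lemma KLimitOneOne.nonZero (k1 : KLimitOneOne E) (p : Fin 2) :
    NonZero fun a z v τ => E 1 p (a, z, v) τ := by
  obtain ⟨r, hr⟩ := k1 (1 / 4) (by norm_num) (by norm_num)
  exact nonZero_of_tendsto (c := -(1 / 4 : ℝ)) (hr p (0, 0, 0))
    (mul_ne_zero (exp_ne_zero _) (exp_ne_zero _))

/-- The limits at slope `1/4` are multiples of `𝒪(-1/2)` and `𝒪(1/2)`, whose determinant is a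
nonzero multiple of `a - a⁻¹`. At `log a = 1` it does not vanish. -/
lemma nonZero_det (k2 : KLimitTwo E) (k1 : KLimitOneOne E) :
    NonZero fun a z v τ => (matE E (a, z, v) τ).det := by
  obtain ⟨r, hr⟩ := k1 (1 / 4) (by norm_num) (by norm_num)
  obtain ⟨r', hr'⟩ := k2 (1 / 4) (by norm_num) (by norm_num)
  have h := ((hr' 0 (1, 0, 0)).mul (hr 1 (1, 0, 0))).sub
    ((hr 0 (1, 0, 0)).mul (hr' 1 (1, 0, 0)))
  refine nonZero_of_tendsto (r := r + r') (c := -(1 / 4 : ℝ)) (a := 1) (z := 0) (v := 0)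
    (h.congr fun τ => ?_) ?_
  · simp only [matE, Matrix.det_fin_two, Matrix.of_apply, Matrix.cons_val', Matrix.cons_val_zero,
      Matrix.cons_val_one, Matrix.cons_val_fin_one, shiftZ]
    push_cast
    rw [show -((r : ℂ) + r') * τ = -r * τ + -r' * τ by ring, exp_add]
    ring
  · simp only [O, eps, Matrix.cons_val_zero, Matrix.cons_val_one, Matrix.cons_val_fin_one,
      ← exp_add]
    rw [sub_ne_zero]
    intro h1
    have h2 := congrArg norm h1
    rw [norm_exp, norm_exp, Real.exp_eq_exp] at h2
    norm_num at h2

lemma mul_eq_stab (hB : BilinearDuality E Υ) (a z v : ℂ) {τ : ℂ} (hτ : τ.re < 0)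
    (i j : Fin 2) (hd : thetaSer (-v + a) τ * thetaSer (v + z) τ ≠ 0) :
    (matE E (a, z, v) τ * (matEDual E (a, z, v) τ).transpose) i j =
      Υ v τ * stabEll (a, z, v) τ i j := by
  have h := hB (a, z, v) τ hτ ((theta_den_ne_zero_iff (a, z, v) hτ).mpr hd)
  rw [← h, Matrix.smul_apply, smul_eq_mul]

lemma hol_denominators : (Hol fun a z v τ => thetaSer (-v + a) τ * thetaSer (v + z) τ) ∧
    NonZero fun a z v τ => thetaSer (-v + a) τ * thetaSer (v + z) τ := by
  have hg1 := hol_thetaSer fun a _ v _ => -v + a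
  have hg2 := hol_thetaSer fun _ z v _ => v + z
  exact ⟨hg1.mul hg2,
    (nonZero_thetaSer (fun a _ v _ => -v + a) ⟨Real.pi * I, 0, 0, by simp⟩).mul hg1 hg2
    (nonZero_thetaSer (fun _ z v _ => v + z) ⟨0, Real.pi * I, 0, by simp⟩)⟩

lemma PropertyA.hol_swap (hA : PropertyA E) (μ p : Fin 2) :
    Hol fun a z v τ => E μ p (z, a, v) τ :=
  (hA.hol μ p).comp (fun _ z _ _ => z) (fun a _ _ _ => a) (fun _ _ v _ => v)

/-- If `Υ` vanished identically, the duality would force the determinant of `matE` times its mirror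
under `a ↔ z` to vanish, which is impossible because neither is identically zero. -/
lemma nonZero_upsilon (k2 : KLimitTwo E) (k1 : KLimitOneOne E) (hB : BilinearDuality E Υ)
    (hA : PropertyA E) : NonZero fun _ _ v τ => Υ v τ / thetaScale τ ^ 2 := by
  have hol := hA.hol
  obtain ⟨hg, ng⟩ := hol_denominators
  by_contra hcon
  have hU0 : ∀ v {τ : ℂ}, τ.re < 0 → Υ v τ = 0 := by
    intro v τ hτ
    by_contra h0
    exact hcon ⟨0, 0, v, τ, hτ, div_ne_zero h0 (pow_ne_zero 2 (thetaScale_ne_zero hτ))⟩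
  have hdet : ∀ a z v τ, (matE E (a, z, v) τ).det =
      E 0 0 (a, z, v) τ * E 1 1 (a, z, v) τ - E 1 0 (a, z, v) τ * E 0 1 (a, z, v) τ := by
    intro a z v τ
    simp [matE, Matrix.det_fin_two]
  have hdol : Hol fun a z v τ => (matE E (a, z, v) τ).det := by
    have h1 := ((hol 0 0).mul (hol 1 1)).sub ((hol 1 0).mul (hol 0 1))
    exact h1.congr fun y _ => hdet _ _ _ _
  have hdol' : Hol fun a z v τ => (matE E (z, a, v) τ).det :=
    hdol.comp (fun _ z _ _ => z) (fun a _ _ _ => a) (fun _ _ v _ => v)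
  have nd := nonZero_det k2 k1
  have nd' : NonZero fun a z v τ => (matE E (z, a, v) τ).det := by
    obtain ⟨a, z, v, τ, hτ, h0⟩ := nd
    exact ⟨z, a, v, τ, hτ, h0⟩
  obtain ⟨a, z, v, τ, hτ, h0⟩ := (nd.mul hdol hdol' nd').mul (hdol.mul hdol') hg ng
  beta_reduce at h0
  obtain ⟨h1, hd⟩ := mul_ne_zero_iff.mp h0
  have hz : ∀ i j, (matE E (a, z, v) τ * (matEDual E (a, z, v) τ).transpose) i j = 0 :=
    fun i j => by rw [mul_eq_stab hB a z v hτ i j hd, hU0 v hτ, zero_mul]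
  have hz' : matE E (a, z, v) τ * (matEDual E (a, z, v) τ).transpose = 0 := Matrix.ext hz
  have hdd : (matEDual E (a, z, v) τ).det = (matE E (z, a, v) τ).det := by
    simp [matE, matEDual, dualE, swapAZ, Matrix.det_fin_two]
    ring
  have h2 := congrArg Matrix.det hz'
  rw [Matrix.det_mul, Matrix.det_transpose, hdd, Matrix.det_zero] at h2
  exact h1 h2

/-- The hypotheses of the characterization yield the bilinear system. -/
lemma bilinearSystem (q2 : QDiffTwo E) (q1 : QDiffOneOne E) (hS : SingleValuedHolomorphic E)
    (k2 : KLimitTwo E) (k1 : KLimitOneOne E) (hΥ : HolomorphicVQ Υ) (hB : BilinearDuality E Υ)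
    (hA : PropertyA E) :
    BilinearSystem (fun μ p a z v τ => E μ p (a, z, v) τ) fun v τ => Υ v τ / thetaScale τ ^ 2 := by
  have hol := hA.hol
  have hols := hA.hol_swap
  -- The duality is given only off the zeros of these denominators. Multiplying by them and
  -- cancelling extends each entry to an identity of holomorphic functions.
  obtain ⟨hg, ng⟩ := hol_denominators
  have hsc : Hol fun _ _ _ τ => thetaScale τ ^ 2 := by
    have ho : IsOpen {τ : ℂ | τ.re < 0} := isOpen_lt (by fun_prop) continuous_const
    intro y hy
    have h1 : DifferentiableAt ℂ thetaScale y.2 :=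
      differentiableOn_thetaScale.differentiableAt (ho.mem_nhds hy)
    have h2 : DifferentiableAt ℂ (fun y : Cover × ℂ => thetaScale y.2) y :=
      h1.comp y differentiableAt_snd
    exact (h2.pow 2).differentiableWithinAt
  have hUol : Hol fun _ _ v τ => Υ v τ / thetaScale τ ^ 2 :=
    hΥ.hol.div hsc fun _ _ _ τ hτ => pow_ne_zero 2 (thetaScale_ne_zero hτ)
  have ent : ∀ a z v {τ : ℂ} (i j : Fin 2),
      (matE E (a, z, v) τ * (matEDual E (a, z, v) τ).transpose) i j =
      E 0 i (a, z, v) τ * E 1 (Fin.rev j) (z, a, v) τ +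
        E 1 i (a, z, v) τ * E 0 (Fin.rev j) (z, a, v) τ := by
    intro a z v τ i j
    fin_cases i <;> fin_cases j <;>
      simp [matE, matEDual, dualE, swapAZ, Matrix.mul_apply, Fin.sum_univ_two, Fin.rev]
  have r0 : Fin.rev (0 : Fin 2) = 1 := rfl
  have r1 : Fin.rev (1 : Fin 2) = 0 := rfl
  refine
    { hol := hol
      holU := hUol
      two_add_tau := fun p a z v τ hτ => ?_
      one_add_tau := fun p a z v τ hτ => ?_
      add_a := fun μ p a z v τ hτ => hS.add_a μ p a z v hτ
      add_z := fun μ p a z v τ hτ => hS.add_z μ p a z v hτ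
      one_zero := Hol.cancel (((hol 0 1).mul (hols 1 1)).add ((hol 1 1).mul (hols 0 1))) hg ng
        fun a z v τ hτ => ?_
      one_one := fun a z v τ hτ => ?_
      zero_one := fun a z v τ hτ => ?_
      one_ne := k1.nonZero
      U_ne := nonZero_upsilon k2 k1 hB hA }
  · have h := q2 p (a, z, v) τ hτ
    simp only [shiftZ, O] at h
    rw [h]
    have e1 : exp (-(3 / 2) * τ) * exp (-3 * z) * exp (-1 * (2 * v - eps p * a)) =
        exp (-(3 / 2) * τ - 3 * z - (2 * v - eps p * a)) := by
      simp only [← exp_add]; ring_nf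
    linear_combination -E 0 p (a, z, v) τ * e1
  · have h := q1 p (a, z, v) τ hτ
    simp only [shiftZ, O] at h
    rw [h]
    have e1 : exp (-(1 / 2) * τ) * exp (-z) * exp (-1 * (2 * v - eps p * a)) =
        exp (-τ / 2 - z - (2 * v - eps p * a)) := by
      simp only [← exp_add]; ring_nf
    linear_combination -E 1 p (a, z, v) τ * e1
  · by_cases hd : thetaSer (-v + a) τ * thetaSer (v + z) τ = 0
    · rw [hd, mul_zero]
    · have h := mul_eq_stab hB a z v hτ 1 0 hd
      rw [stabEll_one_zero, mul_zero, ent, r0] at h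
      rw [h, zero_mul]
  · refine Hol.eq_of_mul_eq (((hol 0 1).mul (hols 1 0)).add ((hol 1 1).mul (hols 0 0)))
      (hUol.mul ((hol_thetaSer fun a _ v _ => 2 * v + 2 * a).mul (hol_thetaSer fun _ z _ _ => 2 * z)))
      hg ng (fun a z v τ hτ => ?_) a z v hτ
    by_cases hd : thetaSer (-v + a) τ * thetaSer (v + z) τ = 0
    · rw [hd, mul_zero, mul_zero]
    · have h := mul_eq_stab hB a z v hτ 1 1 hd
      rw [stabEll_one_one _ hτ, ent, r1] at h
      rw [h]
      ring
  · refine Hol.eq_of_mul_eq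
      (f := fun a z v τ => (E 0 0 (a, z, v) τ * E 1 0 (z, a, v) τ +
        E 1 0 (a, z, v) τ * E 0 0 (z, a, v) τ) * thetaSer (z + a + 2 * v) τ)
      ((((hol 0 0).mul (hols 1 0)).add ((hol 1 0).mul (hols 0 0))).mul
        (hol_thetaSer fun a z v _ => z + a + 2 * v))
      (hUol.mul ((((hol_thetaSer fun a z v _ => 2 * v + a - z).mul
        (hol_thetaSer fun _ z v _ => 2 * v + 2 * z)).mul (hol_thetaSer fun a _ _ _ => 2 * a)).add
        (((hol_thetaSer fun a z v _ => 2 * v + z - a).mul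
        (hol_thetaSer fun a _ v _ => 2 * v + 2 * a)).mul (hol_thetaSer fun _ z _ _ => 2 * z))))
      hg ng (fun a z v τ hτ => ?_) a z v hτ
    by_cases hd : thetaSer (-v + a) τ * thetaSer (v + z) τ = 0
    · rw [hd, mul_zero, mul_zero]
    · have h := mul_eq_stab hB a z v hτ 0 1 hd
      rw [ent, r1] at h
      have h' := stabEll_zero_one_mul (a, z, v) hτ hd
      dsimp only at h'
      rw [h, mul_assoc (Υ v τ), h']
      ring

/-- The hypotheses of the characterization force the form of the explicit series. -/
lemma exists_isSeries (q2 : QDiffTwo E) (q1 : QDiffOneOne E) (hS : SingleValuedHolomorphic E)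
    (k2 : KLimitTwo E) (k1 : KLimitOneOne E) (hΥ : HolomorphicVQ Υ) (hB : BilinearDuality E Υ)
    (hA : PropertyA E) : ∃ f₀ f₁ f₂ : ℂ → ℂ → ℂ,
      (HolomorphicVQ f₀ ∧ HolomorphicVQ f₁ ∧ HolomorphicVQ f₂) ∧
      IsSeries f₀ f₁ f₂ E ∧ IsUpsilon f₀ f₁ f₂ Υ := by
  obtain ⟨f₀, f₁, f₂, hh, h⟩ := (bilinearSystem q2 q1 hS k2 k1 hΥ hB hA).solve
  refine ⟨f₀, f₁, f₂, hh, isSeries_iff.mpr fun τ hτ => ⟨fun p x => (h x.2.2 τ hτ).1 p x.1 x.2.1,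
    fun p x => (h x.2.2 τ hτ).2.1 p x.1 x.2.1⟩, fun ν τ hτ => ?_⟩
  have hU := (h ν τ hτ).2.2
  rw [div_eq_iff (pow_ne_zero 2 (thetaScale_ne_zero hτ))] at hU
  rw [hU, mul_comm]

end Forward

/-! ## Asymptotics of the coefficients -/

/-- A bounded holomorphic function on the double cover of the punctured disk extends. -/
lemma exists_isBigO_sub {F : ℂ → ℂ} (hd : ∀ τ : ℂ, τ.re < 0 → DifferentiableAt ℂ F τ)
    (hp : ∀ τ : ℂ, τ.re < 0 → F (τ + 4 * Real.pi * I) = F τ)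
    (hb : F =O[qToZero] fun _ => (1 : ℂ)) :
    ∃ l, (fun τ => F τ - l) =O[qToZero] fun τ => exp (τ / 2) := by
  have hpi : (2 * Real.pi * I : ℂ) ≠ 0 := by simp [Real.pi_ne_zero]
  have hre : ∀ z : ℂ, (2 * Real.pi * I * z).re = -(2 * Real.pi * z.im) := fun z => by
    simp [mul_re, mul_im]
  have him : ∀ τ : ℂ, (τ / (2 * Real.pi * I)).im = -τ.re / (2 * Real.pi) := fun τ => by
    have h1 := hre (τ / (2 * Real.pi * I))
    rw [mul_div_cancel₀ _ hpi] at h1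
    rw [h1]
    field_simp
  -- In the variable `τ / (2π i)` the double cover becomes periodicity under `2` in the upper
  -- half-plane. Boundedness at the cusp removes the singularity in `q^{1/2}`, and the error is of
  -- first order there.
  set G : ℂ → ℂ := fun z => if 0 < z.im then F (2 * Real.pi * I * z) else 0 with hG
  have hGper : Function.Periodic G (2 : ℝ) := by
    intro z
    have h1 : (z + ((2 : ℝ) : ℂ)).im = z.im := by simp
    simp only [hG, h1]
    split_ifs with h
    · have h2 := hp (2 * Real.pi * I * z) (by rw [hre]; nlinarith [Real.pi_pos])
      rw [← h2]
      push_cast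
      ring_nf
    · rfl
  have hGpos : ∀ z : ℂ, 0 < z.im → G z = F (2 * Real.pi * I * z) := fun z hz => if_pos hz
  have hGd : ∀ᶠ z in comap im atTop, DifferentiableAt ℂ G z := by
    filter_upwards [tendsto_comap.eventually (eventually_gt_atTop (0 : ℝ))] with z hz
    have h1 : DifferentiableAt ℂ (fun z => F (2 * Real.pi * I * z)) z :=
      DifferentiableAt.comp (f := fun z => 2 * Real.pi * I * z) z
        (hd _ (by rw [hre]; nlinarith [Real.pi_pos])) (by fun_prop)
    refine h1.congr_of_eventuallyEq ?_
    have ho : IsOpen {z : ℂ | 0 < z.im} := isOpen_lt continuous_const continuous_im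
    filter_upwards [ho.mem_nhds hz] with w hw
    exact hGpos w hw
  have ht1 : Tendsto (fun z : ℂ => 2 * Real.pi * I * z) (comap im atTop) qToZero := by
    refine tendsto_comap_iff.mpr ?_
    have h1 : re ∘ (fun z : ℂ => 2 * Real.pi * I * z) = fun z => -(2 * Real.pi * z.im) :=
      funext hre
    rw [h1]
    exact tendsto_neg_atTop_atBot.comp
      ((tendsto_comap (f := im)).const_mul_atTop (by positivity))
  have ht2 : Tendsto (fun τ : ℂ => τ / (2 * Real.pi * I)) qToZero (comap im atTop) := by
    refine tendsto_comap_iff.mpr ?_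
    have h1 : im ∘ (fun τ : ℂ => τ / (2 * Real.pi * I)) = fun τ => -τ.re / (2 * Real.pi) :=
      funext him
    rw [h1]
    exact (tendsto_neg_atBot_atTop.comp (tendsto_comap (f := re))).atTop_div_const (by positivity)
  have hGb : BoundedAtFilter (comap im atTop) G := by
    have h1 := hb.comp_tendsto ht1
    refine (h1.congr' ?_ (EventuallyEq.refl _ _)).trans (isBigO_of_le _ fun _ => by simp)
    filter_upwards [tendsto_comap.eventually (eventually_gt_atTop (0 : ℝ))] with z hz
    exact (hGpos z hz).symm
  have key := Function.Periodic.exp_decay_sub_of_bounded_at_inf two_pos hGper hGd hGb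
  refine ⟨Function.Periodic.cuspFunction 2 G 0,
    IsBigO.trans (IsBigO.congr' (key.comp_tendsto ht2) ?_ (EventuallyEq.refl _ _))
    (isBigO_of_le _ fun τ => ?_)⟩
  · filter_upwards [eventually_re_lt 0] with τ hτ
    have h0 : 0 < (τ / (2 * Real.pi * I)).im := by
      rw [him]
      exact div_pos (by linarith) (by positivity)
    simp only [Function.comp_apply]
    rw [hGpos _ h0, mul_div_cancel₀ _ hpi]
  · simp only [Function.comp_apply, him]
    rw [Real.norm_eq_abs, abs_of_pos (Real.exp_pos _), norm_exp]
    refine le_of_eq (congrArg _ ?_)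
    have : (τ / 2).re = τ.re / 2 := by simp
    rw [this]
    field_simp

lemma isBigO_sub_of_tendsto {F : ℂ → ℂ} (hd : ∀ τ : ℂ, τ.re < 0 → DifferentiableAt ℂ F τ)
    (hp : ∀ τ : ℂ, τ.re < 0 → F (τ + 4 * Real.pi * I) = F τ) {l : ℂ}
    (hl : Tendsto F qToZero (𝓝 l)) :
    (fun τ => F τ - l) =O[qToZero] fun τ => exp (τ / 2) := by
  obtain ⟨l', h⟩ := exists_isBigO_sub hd hp (hl.isBigO_one ℂ)
  have h1 := tendsto_exp_mul_qToZero (r := 1 / 2) (by norm_num)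
  have h2 := (h.trans_tendsto (h1.congr fun τ => by push_cast; ring_nf)).add_const l'
  rw [zero_add] at h2
  have : l' = l := tendsto_nhds_unique (h2.congr fun τ => by ring) hl
  rwa [← this]

lemma tendsto_add_four_pi : Tendsto (fun τ : ℂ => τ + 4 * Real.pi * I) qToZero qToZero :=
  (tendsto_add_qToZero (4 * Real.pi)).congr fun τ => by push_cast; ring

/-- The exponent of a normalized function with rational monodromy is rational. -/
lemma exists_rat_of_monodromy {f : ℂ → ℂ} {r : ℚ} {c : ℝ}
    (hp : ∀ τ : ℂ, τ.re < 0 → f (τ + 4 * Real.pi * I) = exp (r * (4 * Real.pi * I)) * f τ)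
    (hl : Tendsto (fun τ => exp (-c * τ) * f τ) qToZero (𝓝 1)) :
    ∃ n : ℤ, c = r + n / 2 := by
  have h1 := hl.comp tendsto_add_four_pi
  have h2 := hl.const_mul (exp ((r - c) * (4 * Real.pi * I)))
  have h3 : exp ((r - c) * (4 * Real.pi * I)) * 1 = 1 := by
    refine tendsto_nhds_unique (h2.congr' ?_) h1
    filter_upwards [eventually_re_lt 0] with τ hτ
    simp only [Function.comp_apply]
    rw [hp τ hτ, show -(c : ℂ) * (τ + 4 * Real.pi * I) = -c * τ + -c * (4 * Real.pi * I) by ring,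
      sub_mul, exp_sub, exp_add, neg_mul (c : ℂ) (4 * Real.pi * I), exp_neg]
    field_simp
  rw [mul_one, exp_eq_one_iff] at h3
  obtain ⟨n, hn⟩ := h3
  refine ⟨-n, ?_⟩
  have hpi : (2 * Real.pi * I : ℂ) ≠ 0 := by simp [Real.pi_ne_zero]
  have h4 : 2 * ((r : ℂ) - c) = n := by
    refine mul_right_cancel₀ hpi ?_
    rw [← hn]; ring
  have h5 : 2 * ((r : ℝ) - c) = n := by exact_mod_cast h4
  push_cast
  linarith

/-! ### Monodromy and leading exponents of the coefficients. -/

section Forward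

variable {E : Fin 2 → Fin 2 → MultiFun} {f₀ f₁ f₂ : ℂ → ℂ → ℂ}

lemma PropertyA.exists_monodromy (hA : PropertyA E) (μ : Fin 2) : ∃ r : ℚ, ∀ p x (τ : ℂ), τ.re < 0 →
    E μ p x (τ + 4 * Real.pi * I) = exp (r * (4 * Real.pi * I)) * E μ p x τ := by
  obtain ⟨α, β, r, h, -⟩ := hA μ
  refine ⟨r, fun p x τ hτ => ?_⟩
  have h1 := (h p).2.1 x τ hτ
  dsimp only at h1
  have h2 : exp (-(r : ℂ) * (τ + 4 * Real.pi * I)) * exp (r * (4 * Real.pi * I)) =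
      exp (-r * τ) := by rw [← exp_add]; ring_nf
  rw [← h2] at h1
  have h3 : sqrtL p x ≠ 0 := mul_ne_zero (exp_ne_zero _) (exp_ne_zero _)
  refine mul_left_cancel₀ (mul_ne_zero (mul_ne_zero (mul_ne_zero
    (exp_ne_zero (-(r : ℂ) * (τ + 4 * Real.pi * I))) (exp_ne_zero (-(α : ℂ) * x.1)))
    (exp_ne_zero (-(β : ℂ) * x.2.1))) h3) ?_
  linear_combination h1

lemma exp_half_pi_mul_I : exp ((1 / 8 : ℚ) * (4 * Real.pi * I)) = I := by
  rw [show ((1 / 8 : ℚ) : ℂ) * (4 * Real.pi * I) = Real.pi / 2 * I by push_cast; ring,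
    exp_pi_div_two_mul_I]

/-- Evaluate where `thetaSer` has argument `π i` and is invertible. Its own monodromy `I` accounts
for the correction by `1/8`. -/
lemma IsSeries.zero_monodromy (hE : IsSeries f₀ f₁ f₂ E) (hA : PropertyA E) :
    ∃ r : ℚ, ∀ ν (τ : ℂ), τ.re < 0 →
      f₀ ν (τ + 4 * Real.pi * I) = exp (r * (4 * Real.pi * I)) * f₀ ν τ := by
  obtain ⟨r, h⟩ := hA.exists_monodromy 1
  refine ⟨r - 1 / 8, fun ν τ hτ => ?_⟩
  have h1 := h 0 (0, Real.pi * I - 2 * ν, ν) τ hτ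
  have hτ' : (τ + 4 * Real.pi * I).re < 0 := by simpa using hτ
  rw [hE.oneOne _ _ hτ, hE.oneOne _ _ hτ', thetaSer_tau_add] at h1
  simp only [mul_zero, sub_zero, sub_add_cancel] at h1
  have h2 : exp ((r - 1 / 8 : ℚ) * (4 * Real.pi * I)) * I = exp (r * (4 * Real.pi * I)) := by
    rw [show (r : ℂ) * (4 * Real.pi * I) =
      (r - 1 / 8 : ℚ) * (4 * Real.pi * I) + (1 / 8 : ℚ) * (4 * Real.pi * I) by push_cast; ring,
      exp_add _ ((1 / 8 : ℚ) * (4 * Real.pi * I)), exp_half_pi_mul_I]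
  refine mul_right_cancel₀ (mul_ne_zero I_ne_zero (thetaSer_pi_ne_zero hτ)) ?_
  linear_combination h1 - f₀ ν τ * thetaSer (Real.pi * I) τ * h2

/-- The combination `thetaMix` has a single monodromy factor, but `ϑ₁` changes sign and `ϑ₀` does
not, so the factors of `f₁` and `f₂` are opposite. -/
lemma IsSeries.one_monodromy (hE : IsSeries f₀ f₁ f₂ E) (hA : PropertyA E) :
    ∃ r : ℚ, ∀ ν (τ : ℂ), τ.re < 0 →
      f₁ ν (τ + 4 * Real.pi * I) = exp (r * (4 * Real.pi * I)) * f₁ ν τ ∧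
      f₂ ν (τ + 4 * Real.pi * I) = -exp (r * (4 * Real.pi * I)) * f₂ ν τ := by
  obtain ⟨r, h⟩ := hA.exists_monodromy 0
  refine ⟨r - 1 / 8, fun ν τ hτ => ?_⟩
  have hτ' : (τ + 4 * Real.pi * I).re < 0 := by simpa using hτ
  have h2 : exp ((r - 1 / 8 : ℚ) * (4 * Real.pi * I)) * I = exp (r * (4 * Real.pi * I)) := by
    rw [show (r : ℂ) * (4 * Real.pi * I) =
      (r - 1 / 8 : ℚ) * (4 * Real.pi * I) + (1 / 8 : ℚ) * (4 * Real.pi * I) by push_cast; ring,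
      exp_add _ ((1 / 8 : ℚ) * (4 * Real.pi * I)), exp_half_pi_mul_I]
  have key : ∀ y, thetaMix f₁ f₂ ν y (τ + 4 * Real.pi * I) =
      exp ((r - 1 / 8 : ℚ) * (4 * Real.pi * I)) * thetaMix f₁ f₂ ν y τ := by
    intro y
    have h1 := h 0 ((Real.pi * I - y + ν) / 2, (Real.pi * I + y - ν) / 2, ν) τ hτ
    rw [hE.two _ _ hτ, hE.two _ _ hτ', thetaSer_tau_add] at h1
    simp only [BilinearSystem.eps_zero, one_mul] at h1
    rw [show (Real.pi * I + y - ν) / 2 + (Real.pi * I - y + ν) / 2 = Real.pi * I by ring,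
      show (Real.pi * I + y - ν) / 2 - (Real.pi * I - y + ν) / 2 + ν = y by ring] at h1
    refine mul_right_cancel₀ (mul_ne_zero I_ne_zero (thetaSer_pi_ne_zero hτ)) ?_
    linear_combination h1 - thetaMix f₁ f₂ ν y τ * thetaSer (Real.pi * I) τ * h2
  have s' := thetaMix_zero_sum f₁ f₂ ν (τ + 4 * Real.pi * I)
  have d' := thetaMix_zero_diff f₁ f₂ ν (τ + 4 * Real.pi * I)
  have s := thetaMix_zero_sum f₁ f₂ ν τ
  have d := thetaMix_zero_diff f₁ f₂ ν τ
  rw [key, key, thetaZero_tau_add] at s'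
  rw [key, key, thetaOne_tau_add] at d'
  constructor
  · refine mul_right_cancel₀ (mul_ne_zero two_ne_zero (thetaZero_zero_ne_zero hτ)) ?_
    linear_combination exp ((r - 1 / 8 : ℚ) * (4 * Real.pi * I)) * s - s'
  · refine mul_right_cancel₀ (mul_ne_zero two_ne_zero (thetaOne_zero_ne_zero hτ)) ?_
    linear_combination d' - exp ((r - 1 / 8 : ℚ) * (4 * Real.pi * I)) * d

lemma IsSeries.add_two_pi (hE : IsSeries f₀ f₁ f₂ E) (hS : SingleValuedHolomorphic E) (ν : ℂ) {τ : ℂ}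
    (hτ : τ.re < 0) : f₀ (ν + 2 * Real.pi * I) τ = f₀ ν τ ∧
      f₁ (ν + 2 * Real.pi * I) τ = f₁ ν τ ∧ f₂ (ν + 2 * Real.pi * I) τ = f₂ ν τ := by
  have key : ∀ y, thetaMix f₁ f₂ (ν + 2 * Real.pi * I) y τ = thetaMix f₁ f₂ ν y τ := by
    intro y
    have h1 := hS.add_v 0 0 ((Real.pi * I - y + ν) / 2) ((Real.pi * I + y - ν) / 2) ν hτ
    rw [hE.two _ _ hτ, hE.two _ _ hτ] at h1
    simp only [BilinearSystem.eps_zero, one_mul] at h1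
    rw [show (Real.pi * I + y - ν) / 2 + (Real.pi * I - y + ν) / 2 = Real.pi * I by ring,
      show (Real.pi * I + y - ν) / 2 - (Real.pi * I - y + ν) / 2 + (ν + 2 * Real.pi * I) =
        y + 2 * Real.pi * I by ring, thetaMix_add_pi,
      show (Real.pi * I + y - ν) / 2 - (Real.pi * I - y + ν) / 2 + ν = y by ring] at h1
    exact mul_right_cancel₀ (thetaSer_pi_ne_zero hτ) h1
  refine ⟨?_, ?_, ?_⟩
  · have h1 := hS.add_v 1 0 0 (Real.pi * I - 2 * ν) ν hτ
    rw [hE.oneOne _ _ hτ, hE.oneOne _ _ hτ] at h1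
    simp only [mul_zero, sub_zero, sub_add_cancel] at h1
    rw [show Real.pi * I - 2 * ν + 2 * (ν + 2 * Real.pi * I) =
      Real.pi * I + 2 * Real.pi * I + 2 * Real.pi * I by ring, thetaSer_add_two_pi,
      thetaSer_add_two_pi, neg_neg] at h1
    exact mul_right_cancel₀ (thetaSer_pi_ne_zero hτ) h1
  · have s' := thetaMix_zero_sum f₁ f₂ (ν + 2 * Real.pi * I) τ
    rw [key, key, thetaMix_zero_sum] at s'
    exact (mul_right_cancel₀ (mul_ne_zero two_ne_zero (thetaZero_zero_ne_zero hτ)) s').symm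
  · have s' := thetaMix_zero_diff f₁ f₂ (ν + 2 * Real.pi * I) τ
    rw [key, key, thetaMix_zero_diff] at s'
    exact (mul_right_cancel₀ (mul_ne_zero two_ne_zero (thetaOne_zero_ne_zero hτ)) s').symm

/-- A single slope in `(0, 1/2)` suffices: dividing the prescribed limit at `1/4` by the known limit
of `thetaSer` leaves that of `f₀`. -/
lemma IsSeries.exists_tendsto_zero (hE : IsSeries f₀ f₁ f₂ E) (k1 : KLimitOneOne E) :
    ∃ c : ℝ, ∀ ν, Tendsto (fun τ => exp (-c * τ) * f₀ ν τ) qToZero (𝓝 1) := by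
  obtain ⟨ρ, h⟩ := k1 (1 / 4) (by norm_num) (by norm_num)
  refine ⟨ρ + ((1 / 4) ^ 2 - distHalf (1 / 4)) / 2, fun ν => ?_⟩
  have h1 := h 0 (0, 0, ν)
  have h2 := tendsto_thetaSer (1 / 4) (2 * ν)
  have hf : ⌊(1 / 4 : ℝ)⌋ = 0 := Int.floor_eq_zero_iff.mpr ⟨by norm_num, by norm_num⟩
  rw [leadTerm_of_mem (by norm_num) (by norm_num), hf, zpow_zero, one_mul] at h2
  have h3 := h1.div h2 (exp_ne_zero _)
  have h4 : exp ((0 : ℂ) / 2) * O (1 / 2) 0 (0, 0, ν) / exp (2 * ν / 2) = 1 := by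
    rw [O, zero_div, exp_zero, one_mul, ← exp_sub]
    refine (congrArg exp ?_).trans exp_zero
    ring
  dsimp only at h3
  rw [h4] at h3
  refine h3.congr' ?_
  filter_upwards [eventually_re_lt 0, eventually_thetaSer_ne_zero (1 / 4) (2 * ν)
    (by rw [leadTerm_of_mem (by norm_num) (by norm_num)]; exact exp_ne_zero _)] with τ hτ hn
  simp only [Pi.div_apply]
  rw [hE.oneOne _ _ hτ]
  simp only [shiftZ, mul_zero, sub_zero, zero_add]
  rw [show -((1 / 4 : ℝ) : ℂ) * τ + 2 * ν = 2 * ν - ((1 / 4 : ℝ) : ℂ) * τ by ring,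
    ← mul_assoc, mul_div_mul_right _ _ hn, div_eq_iff (exp_ne_zero _), mul_right_comm, ← exp_add]
  push_cast
  ring_nf

/-- At slope `1/4` the series `ϑ₀` and `ϑ₁` have the same order. The limit of `thetaMix` does not
depend on `y`, so the half-sum and half-difference of its values at `y = 0` and `y = π i` give the
limits of `f₁` and `f₂`. -/
lemma IsSeries.exists_tendsto_one (hE : IsSeries f₀ f₁ f₂ E) (k2 : KLimitTwo E) :
    ∃ c : ℝ, ∀ ν, Tendsto (fun τ => exp (-c * τ) * f₁ ν τ) qToZero (𝓝 1) ∧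
      Tendsto (fun τ => exp (-c * τ) * f₂ ν τ) qToZero (𝓝 0) := by
  obtain ⟨ρ, h⟩ := k2 (1 / 4) (by norm_num) (by norm_num)
  refine ⟨ρ + ((1 / 4) ^ 2 - distHalf (1 / 4)) / 2, fun ν => ?_⟩
  set c : ℝ := ρ + ((1 / 4) ^ 2 - distHalf (1 / 4)) / 2 with hc
  have hf : ⌊(1 / 4 : ℝ)⌋ = 0 := Int.floor_eq_zero_iff.mpr ⟨by norm_num, by norm_num⟩
  have hf' : ⌊(1 / 4 + 1 / 2 : ℝ)⌋ = 0 := Int.floor_eq_zero_iff.mpr ⟨by norm_num, by norm_num⟩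
  have key : ∀ y, Tendsto (fun τ => exp (-c * τ) *
      thetaMix f₁ f₂ ν (y - (1 / 4 : ℝ) * τ) τ) qToZero (𝓝 1) := by
    intro y
    have h1 := h 0 ((ν - y) / 2, (y - ν) / 2, ν)
    have h2 := tendsto_thetaSer (1 / 4) 0
    rw [leadTerm_of_mem (by norm_num) (by norm_num), hf, zpow_zero, one_mul, zero_div,
      exp_zero] at h2
    have h3 := h1.div h2 one_ne_zero
    have h4 : exp ν * exp ((y - ν) / 2 / 2) * O (-1 / 2) 0 ((ν - y) / 2, (y - ν) / 2, ν) / 1 =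
        1 := by
      rw [O, BilinearSystem.eps_zero, div_one, ← exp_add, ← exp_add]
      refine (congrArg exp ?_).trans exp_zero
      ring
    dsimp only at h3
    rw [h4] at h3
    refine h3.congr' ?_
    filter_upwards [eventually_re_lt 0, eventually_thetaSer_ne_zero (1 / 4) 0
      (by rw [leadTerm_of_mem (by norm_num) (by norm_num)]; exact exp_ne_zero _)] with τ hτ hn
    simp only [Pi.div_apply]
    rw [hE.two _ _ hτ]
    simp only [shiftZ, BilinearSystem.eps_zero, one_mul]
    rw [show (y - ν) / 2 + -((1 / 4 : ℝ) : ℂ) * τ - (ν - y) / 2 + ν = y - ((1 / 4 : ℝ) : ℂ) * τ by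
        ring,
      show (y - ν) / 2 + -((1 / 4 : ℝ) : ℂ) * τ + (ν - y) / 2 = 0 - ((1 / 4 : ℝ) : ℂ) * τ by ring,
      ← mul_assoc, mul_div_mul_right _ _ hn, div_eq_iff (exp_ne_zero _), mul_right_comm, ← exp_add]
    rw [hc]
    push_cast
    ring_nf
  have z0 := tendsto_thetaZero (1 / 4) 0
  rw [leadZero_of_mem (n := 0) (by norm_num) (by norm_num), distHalf, hf'] at z0
  have z1 := tendsto_thetaOne (1 / 4) 0
  rw [leadOne_of_mem (n := 0) (by norm_num) (by norm_num), distHalf, hf] at z1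
  norm_num at z0 z1
  have k0 := key 0
  have kp := key (Real.pi * I)
  norm_num at k0 kp
  have e0 : ∀ τ : ℂ, thetaMix f₁ f₂ ν (Real.pi * I - 1 / 4 * τ) τ =
      f₁ ν τ * thetaZero (-(1 / 4 * τ)) τ - f₂ ν τ * thetaOne (-(1 / 4 * τ)) τ := fun τ => by
    rw [thetaMix, show Real.pi * I - 1 / 4 * τ = -(1 / 4 * τ) + Real.pi * I by ring,
      thetaZero_add_pi, thetaOne_add_pi]
    ring
  have n0 := z0.eventually_ne one_ne_zero
  have n1 := z1.eventually_ne one_ne_zero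
  have r1 := ((k0.add kp).div (z0.const_mul 2) (by norm_num))
  have r2 := ((k0.sub kp).div (z1.const_mul 2) (by norm_num))
  norm_num at r1 r2
  constructor
  · refine r1.congr' ?_
    filter_upwards [n0] with τ hn
    simp only [Pi.div_apply]
    rw [e0, thetaMix]
    generalize thetaZero (-(1 / 4 * τ)) τ = t at hn ⊢
    field_simp
    ring
  · refine r2.congr' ?_
    filter_upwards [n1] with τ hn
    simp only [Pi.div_apply]
    rw [e0, thetaMix]
    generalize thetaOne (-(1 / 4 * τ)) τ = t at hn ⊢
    field_simp
    ring

end Forward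

/-! ## The wall at slope `1/2` -/

lemma polynomial_ext_exp {P Q : Polynomial ℂ} (h : ∀ z, P.eval (exp z) = Q.eval (exp z)) : P = Q := by
  refine Polynomial.eq_of_infinite_eval_eq P Q (Set.Infinite.mono (s := {0}ᶜ) ?_
    (Set.finite_singleton (0 : ℂ)).infinite_compl)
  rw [← range_exp]
  rintro _ ⟨z, rfl⟩
  exact h z

/-- Comparison of coefficients of Laurent polynomials in `exp z`, one of them with three terms. -/
lemma laurent_match {ι : Type*} {N : ℕ} {F : ℕ → ι → ℂ} {A B C : ι → ℂ} {j κ : ℂ}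
    (h : ∀ t z, ∑ β ∈ Finset.range (N + 1), exp ((j - β) * z) * F β t =
      exp (κ * z) * (A t + B t * exp z + C t * exp (2 * z)))
    (hA : ∀ t, A t ≠ 0) (hC : ∀ t, C t ≠ 0) (h0 : ∃ t, F 0 t ≠ 0) (hN : ∃ t, F N t ≠ 0) :
    N = 2 ∧ ∀ t, F 0 t = C t ∧ F 1 t = B t ∧ F 2 t = A t := by
  classical
  set P : ι → Polynomial ℂ := fun t =>
    ∑ k ∈ Finset.range (N + 1), Polynomial.monomial k (F (N - k) t) with hP
  set Q : ι → Polynomial ℂ := fun t => Polynomial.monomial 0 (A t) + Polynomial.monomial 1 (B t) +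
    Polynomial.monomial 2 (C t) with hQ
  have cP : ∀ t k, (P t).coeff k = if k ≤ N then F (N - k) t else 0 := by
    intro t k
    simp only [hP, Polynomial.finsetSum_coeff, Polynomial.coeff_monomial, Finset.sum_ite_eq',
      Finset.mem_range, Nat.lt_succ_iff]
  have q0 : ∀ t, (Q t).coeff 0 = A t := fun t => by simp [hQ, Polynomial.coeff_monomial]
  have q1 : ∀ t, (Q t).coeff 1 = B t := fun t => by simp [hQ, Polynomial.coeff_monomial]
  have q2 : ∀ t, (Q t).coeff 2 = C t := fun t => by simp [hQ, Polynomial.coeff_monomial]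
  have q3 : ∀ t k, 2 < k → (Q t).coeff k = 0 := fun t k hk => by
    simp only [hQ, Polynomial.coeff_add, Polynomial.coeff_monomial]
    rw [if_neg (by omega), if_neg (by omega), if_neg (by omega)]
    simp
  set d : ℂ := κ + N - j with hd
  have key : ∀ t z, (P t).eval (exp z) = exp (d * z) * (Q t).eval (exp z) := by
    intro t z
    have h1 := congrArg (fun y => exp ((N - j) * z) * y) (h t z)
    beta_reduce at h1
    rw [Finset.mul_sum, ← Finset.sum_range_reflect] at h1
    simp only [hP, hQ, Polynomial.eval_finsetSum, Polynomial.eval_add, Polynomial.eval_monomial,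
      pow_zero, pow_one, mul_one]
    have e1 : exp (d * z) = exp ((N - j) * z) * exp (κ * z) := by
      rw [← exp_add, hd]; ring_nf
    have e2 : exp z ^ 2 = exp (2 * z) := by rw [← exp_nat_mul]; norm_num
    rw [e1, e2, mul_assoc, ← h1]
    refine Finset.sum_congr rfl fun k hk => ?_
    have hk' : k ≤ N := Nat.lt_succ_iff.mp (Finset.mem_range.mp hk)
    rw [show N + 1 - 1 - k = N - k by omega, ← exp_nat_mul, ← mul_assoc, ← exp_add,
      Nat.cast_sub hk', mul_comm]
    ring_nf
  obtain ⟨t₀, ht₀⟩ := h0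
  obtain ⟨t₁, ht₁⟩ := hN
  -- Replacing `z` by `z + 2π i` leaves both polynomials unchanged, which forces the relative
  -- exponent to be an integer.
  obtain ⟨D, hD⟩ : ∃ D : ℤ, d = D := by
    obtain ⟨z, hz⟩ : ∃ z, (Q t₀).eval (exp z) ≠ 0 := by
      by_contra hcon
      push Not at hcon
      have : Q t₀ = 0 := polynomial_ext_exp fun z => by rw [hcon, Polynomial.eval_zero]
      have h2 := q0 t₀
      rw [this, Polynomial.coeff_zero] at h2
      exact hA t₀ h2.symm
    have k1 := key t₀ z
    have k2 := key t₀ (z + 2 * Real.pi * I)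
    have e1 : exp (z + 2 * Real.pi * I) = exp z := by
      rw [exp_add, exp_two_pi_mul_I, mul_one]
    rw [e1, k1, mul_add, exp_add] at k2
    have k3 := mul_right_cancel₀ hz k2
    have k4 : exp (d * (2 * Real.pi * I)) = 1 :=
      mul_left_cancel₀ (exp_ne_zero (d * z)) (by rw [← k3, mul_one])
    obtain ⟨n, hn⟩ := exp_eq_one_iff.mp k4
    exact ⟨n, mul_right_cancel₀ (by simp [Real.pi_ne_zero]) hn⟩
  rw [hD] at key
  -- A negative `D` would annihilate the constant term of `Q t₀`, and a positive one that of `P t₁`;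
  -- both are nonzero.
  have hPQ : ∀ t, P t = Q t := by
    rcases lt_trichotomy D 0 with hlt | rfl | hgt
    · obtain ⟨m, hm⟩ : ∃ m : ℕ, D = -(m + 1 : ℕ) := ⟨(-D - 1).toNat, by omega⟩
      have h2 : Polynomial.X ^ (m + 1) * P t₀ = Q t₀ := polynomial_ext_exp fun z => by
        rw [Polynomial.eval_mul, Polynomial.eval_pow, Polynomial.eval_X, key, ← mul_assoc,
          ← exp_nat_mul, ← exp_add, hm]
        push_cast
        rw [show ((m : ℂ) + 1) * z + -(m + 1) * z = 0 by ring, exp_zero, one_mul]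
      have h3 := q0 t₀
      rw [← h2, pow_succ', mul_assoc, Polynomial.coeff_X_mul_zero] at h3
      exact absurd h3.symm (hA t₀)
    · exact fun t => polynomial_ext_exp fun z => by rw [key]; simp
    · obtain ⟨m, hm⟩ : ∃ m : ℕ, D = (m + 1 : ℕ) := ⟨(D - 1).toNat, by omega⟩
      have h2 : P t₁ = Polynomial.X ^ (m + 1) * Q t₁ := polynomial_ext_exp fun z => by
        rw [Polynomial.eval_mul, Polynomial.eval_pow, Polynomial.eval_X, key, ← exp_nat_mul, hm]
        push_cast
        rfl
      have h3 := cP t₁ 0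
      rw [h2, pow_succ', mul_assoc, Polynomial.coeff_X_mul_zero, if_pos (Nat.zero_le _)] at h3
      exact absurd h3.symm ht₁
  have hN2 : N = 2 := by
    have h2 := cP t₀ 2
    rw [hPQ, q2] at h2
    have h3 : 2 ≤ N := by
      by_contra hlt
      rw [if_neg hlt] at h2
      exact hC t₀ h2
    have h4 := cP t₀ N
    rw [if_pos le_rfl, Nat.sub_self, hPQ] at h4
    by_contra hne
    rw [q3 _ _ (by omega)] at h4
    exact ht₀ h4.symm
  subst hN2
  refine ⟨rfl, fun t => ?_⟩
  have c0 := cP t 0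
  have c1 := cP t 1
  have c2 := cP t 2
  rw [hPQ] at c0 c1 c2
  rw [q0] at c0
  rw [q1] at c1
  rw [q2] at c2
  norm_num at c0 c1 c2
  exact ⟨c2.symm, c1.symm, c0.symm⟩

lemma ch_mul_mem_KX {F : Vec} (hF : F ∈ KX) (i k : ℤ) : mono i 0 k F ∈ KX :=
  KX.smul_mem (⟨ch i 0 k, ch_mem_KPt i k⟩ : KPt) hF

lemma IsKCanonical.mem_KX {s : ℝ} {B : Fin 2 → Vec} (h : IsKCanonical s B) (p : Fin 2) :
    B p ∈ KX := by
  obtain ⟨b, hb⟩ := h.basis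
  rw [← hb p]
  exact (b p).2

lemma IsKCanonical.ne_zero {s : ℝ} {B : Fin 2 → Vec} (h : IsKCanonical s B) (p : Fin 2) :
    B p ≠ 0 := by
  obtain ⟨b, hb⟩ := h.basis
  have : Nontrivial KPt := ⟨⟨0, 1, fun h0 => by
    have h1 := congrFun (congrArg Subtype.val h0) (0 : Cover)
    simp at h1⟩⟩
  rw [← hb p]
  intro h0
  exact b.ne_zero p (Subtype.ext h0)

lemma lowerSpan_le_KX {B : Fin 2 → Vec} (hB : ∀ p, B p ∈ KX) {F : Vec} (hF : F ∈ lowerSpan B) :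
    F ∈ KX := by
  refine (AddSubgroup.closure_le (K := KX.toAddSubgroup)).mpr ?_ hF
  rintro _ ⟨k, -, _, ⟨i, p, rfl⟩, rfl⟩
  exact ch_mul_mem_KX (ch_mul_mem_KX (hB p) i 0) 0 (-k)

lemma ne_zero_of_mem_twists {B : Fin 2 → Vec} (hB : ∀ p, B p ≠ 0) {F : Vec} (hF : F ∈ twists B) :
    F ≠ 0 := by
  obtain ⟨i, p, rfl⟩ := hF
  intro h0
  refine hB p ?_
  funext q x
  have := congrFun (congrFun h0 q) x
  exact (mul_eq_zero.mp this).resolve_left (ch_ne_zero _ _ _ x)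

lemma mem_KX_of_mem_twists {B : Fin 2 → Vec} (hB : ∀ p, B p ∈ KX) {F : Vec} (hF : F ∈ twists B) :
    F ∈ KX := by
  obtain ⟨i, p, rfl⟩ := hF
  exact ch_mul_mem_KX (hB p) i 0

section Forward

variable {E : Fin 2 → Fin 2 → MultiFun} {f₀ f₁ f₂ : ℂ → ℂ → ℂ} {c : ℝ} {u : ℂ → ℂ}

/-- The leading term of `f₂` beyond the exponent of `f₁`. -/
lemma IsSeries.exists_second_limit (h₂ : HolomorphicVQ f₂) {r : ℚ}
    (hm : ∀ ν (τ : ℂ), τ.re < 0 →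
      f₂ ν (τ + 4 * Real.pi * I) = -exp (r * (4 * Real.pi * I)) * f₂ ν τ)
    {n : ℤ} (hc : c = r + n / 2)
    (ht : ∀ ν, Tendsto (fun τ => exp (-c * τ) * f₂ ν τ) qToZero (𝓝 0)) :
    ∃ u : ℂ → ℂ, ∀ ν, (fun τ => exp (-(c + 1 / 4) * τ) * f₂ ν τ - u ν) =O[qToZero]
      fun τ => exp (τ / 2) := by
  have key : ∀ ν, ∃ l, (fun τ => exp (-(c + 1 / 4) * τ) * f₂ ν τ - l) =O[qToZero]
      fun τ => exp (τ / 2) := by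
    intro ν
    have dif : ∀ (b τ : ℂ), τ.re < 0 → DifferentiableAt ℂ (fun τ => exp (-b * τ) * f₂ ν τ) τ := by
      intro b τ hτ
      have := h₂.comp (g := fun _ : ℂ => ν) (h := fun τ : ℂ => τ) (by fun_prop) (by fun_prop) hτ
      fun_prop
    have per : ∀ τ : ℂ, τ.re < 0 → exp (-(c + 1 / 4) * (τ + 4 * Real.pi * I)) *
        f₂ ν (τ + 4 * Real.pi * I) = exp (-(c + 1 / 4) * τ) * f₂ ν τ := by
      intro τ hτ
      have e1 : exp (-((c : ℂ) + 1 / 4) * (τ + 4 * Real.pi * I)) * exp (r * (4 * Real.pi * I)) =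
          -exp (-(c + 1 / 4) * τ) := by
        have hc' : (c : ℂ) = r + n / 2 := by rw [hc]; push_cast; rfl
        rw [← exp_add, show -((c : ℂ) + 1 / 4) * (τ + 4 * Real.pi * I) + r * (4 * Real.pi * I) =
          -(c + 1 / 4) * τ - Real.pi * I - n * (2 * Real.pi * I) by rw [hc']; ring, exp_sub,
          exp_int_mul_two_pi_mul_I, exp_sub, exp_pi_mul_I, div_one, div_neg, div_one]
      rw [hm ν τ hτ]
      linear_combination -f₂ ν τ * e1
    -- The monodromy of `f₂` confines its exponents to `c + 1/4 + ½ℤ`. Since `q^{-c} f₂` tends to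
    -- zero, so does `q^{-(c - 1/4)} f₂`, which is periodic and hence `O(q^{1/2})`. Therefore
    -- `q^{-(c + 1/4)} f₂` is bounded, and being periodic it has a limit.
    have h1 := tendsto_exp_mul_qToZero (r := 1 / 4) (by norm_num)
    have h2 : Tendsto (fun τ => exp (-(c - 1 / 4 : ℂ) * τ) * f₂ ν τ) qToZero (𝓝 0) := by
      have := h1.mul (ht ν)
      rw [mul_zero] at this
      refine this.congr fun τ => ?_
      rw [← mul_assoc, ← exp_add]
      push_cast
      ring_nf
    have h3 := isBigO_sub_of_tendsto (dif (c - 1 / 4)) (fun τ hτ => by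
      have h := per τ hτ
      have e2 : ∀ τ : ℂ, exp (-((c : ℂ) - 1 / 4) * τ) = exp (-(c + 1 / 4) * τ) * exp (τ / 2) :=
        fun τ => by rw [← exp_add]; ring_nf
      have e3 : exp ((τ + 4 * Real.pi * I) / 2) = exp (τ / 2) := by
        rw [show (τ + 4 * Real.pi * I) / 2 = τ / 2 + 2 * Real.pi * I by ring, exp_add,
          exp_two_pi_mul_I, mul_one]
      rw [e2, e2, e3]
      linear_combination exp (τ / 2) * h) h2
    refine exists_isBigO_sub (dif (c + 1 / 4)) per ?_
    have h4 := (isBigO_refl (fun τ : ℂ => exp (-τ / 2)) qToZero).mul h3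
    refine h4.congr (fun τ => ?_) fun τ => ?_
    · rw [sub_zero, ← mul_assoc, ← exp_add]; ring_nf
    · rw [← exp_add, ← exp_zero]; ring_nf
  choose u hu using key
  exact ⟨u, hu⟩

lemma tendsto_of_isBigO_sub {F : ℂ → ℂ} {l : ℂ}
    (h : (fun τ => F τ - l) =O[qToZero] fun τ => exp (τ / 2)) : Tendsto F qToZero (𝓝 l) := by
  have h1 := tendsto_exp_mul_qToZero (r := 1 / 2) (by norm_num)
  have h2 := (h.trans_tendsto (h1.congr fun τ => by push_cast; ring_nf)).add_const l
  rw [zero_add] at h2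
  exact h2.congr fun τ => by ring

/-- At slope `1/2` the series `ϑ₁` exceeds `ϑ₀` by an order `q^{-1/4}`. A term `q^{c + 1/4} u` of
`f₂` thus enters at the order of the two leading terms of `ϑ₀`, between them in powers of `z`. -/
lemma IsSeries.tendsto_two_half (hE : IsSeries f₀ f₁ f₂ E)
    (t₁ : ∀ ν, Tendsto (fun τ => exp (-c * τ) * f₁ ν τ) qToZero (𝓝 1))
    (t₂ : ∀ ν, Tendsto (fun τ => exp (-(c + 1 / 4) * τ) * f₂ ν τ) qToZero (𝓝 (u ν)))
    (p : Fin 2) (x : Cover) :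
    Tendsto (fun τ => exp ((1 / 8 - c) * τ) * E 0 p (shiftZ (-(1 / 2 : ℝ) * τ) x) τ) qToZero
      (𝓝 ((1 + exp (2 * (x.2.1 - eps p * x.1 + x.2.2)) +
        u x.2.2 * exp (x.2.1 - eps p * x.1 + x.2.2)) * exp ((x.2.1 + eps p * x.1) / 2))) := by
  have hf : ⌊(1 / 2 : ℝ)⌋ = 0 := Int.floor_eq_zero_iff.mpr ⟨by norm_num, by norm_num⟩
  have hf' : ⌊(1 / 2 + 1 / 2 : ℝ)⌋ = 1 := by norm_num
  have d0 : distHalf (1 / 2) = 0 := by rw [distHalf, hf]; norm_num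
  have d1 : distHalf (1 / 2 + 1 / 2) = 1 / 4 := by rw [distHalf, hf']; norm_num
  have z0 := tendsto_thetaZero (1 / 2) (x.2.1 - eps p * x.1 + x.2.2)
  have z1 := tendsto_thetaOne (1 / 2) (x.2.1 - eps p * x.1 + x.2.2)
  have z2 := tendsto_thetaSer (1 / 2) (x.2.1 + eps p * x.1)
  have l0 := leadZero_half 0 (x.2.1 - eps p * x.1 + x.2.2)
  rw [Int.cast_zero, zero_add] at l0
  rw [d1, l0] at z0
  rw [d0, leadOne_of_mem (n := 0) (by norm_num) (by norm_num)] at z1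
  rw [d0, leadTerm_of_mem (by norm_num) (by norm_num), hf, zpow_zero, one_mul] at z2
  have := (((t₁ x.2.2).mul z0).add ((t₂ x.2.2).mul z1)).mul z2
  convert! this.congr' ?_ using 2
  · push_cast
    simp only [mul_zero, zero_add, zero_mul, exp_zero, one_mul, mul_one]
    ring
  filter_upwards [eventually_re_lt 0] with τ hτ
  rw [hE.two _ _ hτ]
  simp only [shiftZ, thetaMix]
  rw [show x.2.1 + -((1 / 2 : ℝ) : ℂ) * τ - eps p * x.1 + x.2.2 =
      x.2.1 - eps p * x.1 + x.2.2 - ((1 / 2 : ℝ) : ℂ) * τ by ring,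
    show x.2.1 + -((1 / 2 : ℝ) : ℂ) * τ + eps p * x.1 =
      x.2.1 + eps p * x.1 - ((1 / 2 : ℝ) : ℂ) * τ by ring]
  have e0 : exp ((1 / 8 - (c : ℂ)) * τ) = exp (-c * τ) *
      exp (((1 / 2) ^ 2 - 1 / 4 : ℝ) * τ) * exp ((((1 / 2) ^ 2 - 0) / 2 : ℝ) * τ) := by
    rw [← exp_add, ← exp_add]; push_cast; ring_nf
  have e1 : exp ((1 / 8 - (c : ℂ)) * τ) = exp (-(c + 1 / 4) * τ) *
      exp (((1 / 2) ^ 2 - 0 : ℝ) * τ) * exp ((((1 / 2) ^ 2 - 0) / 2 : ℝ) * τ) := by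
    rw [← exp_add, ← exp_add]; push_cast; ring_nf
  generalize thetaZero (x.2.1 - eps p * x.1 + x.2.2 - ((1 / 2 : ℝ) : ℂ) * τ) τ = A
  generalize thetaOne (x.2.1 - eps p * x.1 + x.2.2 - ((1 / 2 : ℝ) : ℂ) * τ) τ = B
  generalize thetaSer (x.2.1 + eps p * x.1 - ((1 / 2 : ℝ) : ℂ) * τ) τ = C
  linear_combination -f₁ x.2.2 τ * A * C * e0 - f₂ x.2.2 τ * B * C * e1

end Forward

lemma eq_zero_of_sum_exp_eq_zero {N : ℕ} {F : ℕ → ℂ}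
    (h : ∀ z, ∑ β ∈ Finset.range (N + 1), exp (-β * z) * F β = 0) : F 0 = 0 := by
  have hP : (∑ β ∈ Finset.range (N + 1), Polynomial.monomial β (F β)) = 0 :=
    polynomial_ext_exp fun z => by
      rw [Polynomial.eval_zero, ← h (-z), Polynomial.eval_finsetSum]
      refine Finset.sum_congr rfl fun β _ => ?_
      rw [Polynomial.eval_monomial, ← exp_nat_mul, neg_mul_neg, mul_comm]
  have h0 := congrArg (fun P : Polynomial ℂ => P.coeff 0) hP
  simpa [Polynomial.finsetSum_coeff, Polynomial.coeff_monomial] using h0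

section Forward

variable {E : Fin 2 → Fin 2 → MultiFun} {f₀ f₁ f₂ : ℂ → ℂ → ℂ} {c : ℝ} {u : ℂ → ℂ}

/-- The limit of `ℰ([2])` at slope `1/2`, up to normalization. -/
lemma exists_eq_half_limit (hA : PropertyA E) (hlim : ∀ p x,
      Tendsto (fun τ => exp ((1 / 8 - c) * τ) * E 0 p (shiftZ (-(1 / 2 : ℝ) * τ) x) τ) qToZero
      (𝓝 ((1 + exp (2 * (x.2.1 - eps p * x.1 + x.2.2)) +
        u x.2.2 * exp (x.2.1 - eps p * x.1 + x.2.2)) * exp ((x.2.1 + eps p * x.1) / 2)))) :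
    ∃ α β : ℂ, ∃ V ∈ kClass (1 / 2) 0, V = 0 ∨ ∀ p a z v, V p (a, z, v) =
      exp (-α * a + β * z) * (exp (eps p * a - v) + u v * exp z + exp (v - eps p * a) *
        exp (2 * z)) := by
  obtain ⟨α, β, -, -, hs⟩ := hA 0
  obtain ⟨rs, V, hV, ht⟩ := hs (1 / 2)
  refine ⟨α + 3 / 2, 1 / 2 - β, V, hV, ?_⟩
  set K : Vec := fun p x => exp (-(α + 3 / 2 : ℂ) * x.1 + (1 / 2 - β) * x.2.1) *
    (exp (eps p * x.1 - x.2.2) + u x.2.2 * exp x.2.1 + exp (x.2.2 - eps p * x.1) *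
        exp (2 * x.2.1)) with hK
  set δ : ℝ := -rs - (1 / 8 - c) with hδ
  have hlim' : ∀ p x, Tendsto (fun τ => exp (-α * x.1) * exp (-β * x.2.1) * sqrtL p x *
      (exp ((1 / 8 - c) * τ) * E 0 p (shiftZ (-(1 / 2 : ℝ) * τ) x) τ)) qToZero (𝓝 (K p x)) := by
    intro p x
    have h1 := (hlim p x).const_mul (exp (-α * x.1) * exp (-β * x.2.1) * sqrtL p x)
    convert! h1 using 2
    rw [hK, sqrtL, O]
    beta_reduce
    have e1 : exp (-(α + 3 / 2 : ℂ) * x.1 + (1 / 2 - β) * x.2.1) * exp (eps p * x.1 - x.2.2) =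
        exp (-α * x.1) * exp (-β * x.2.1) * (exp (-(3 / 2) * x.1) *
        exp (-1 / 2 * (2 * x.2.2 - eps p * x.1))) * exp ((x.2.1 + eps p * x.1) / 2) := by
      simp only [← exp_add]; ring_nf
    have e2 : exp x.2.1 = exp (eps p * x.1 - x.2.2) * exp (x.2.1 - eps p * x.1 + x.2.2) := by
      simp only [← exp_add]; ring_nf
    have e3 : exp (x.2.2 - eps p * x.1) * exp (2 * x.2.1) = exp (eps p * x.1 - x.2.2) *
        exp (2 * (x.2.1 - eps p * x.1 + x.2.2)) := by
      simp only [← exp_add]; ring_nf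
    rw [e3, e2]
    linear_combination (1 + exp (2 * (x.2.1 - eps p * x.1 + x.2.2)) +
        u x.2.2 * exp (x.2.1 - eps p * x.1 + x.2.2)) * e1
  have hrel : ∀ p x, Tendsto (fun τ => exp (δ * τ) * (exp (-α * x.1) * exp (-β * x.2.1) *
      sqrtL p x * (exp ((1 / 8 - c) * τ) * E 0 p (shiftZ (-(1 / 2 : ℝ) * τ) x) τ))) qToZero
      (𝓝 (V p x)) := by
    intro p x
    refine (ht p x).congr fun τ => ?_
    have e1 : exp (-(rs : ℂ) * τ) = exp (δ * τ) * exp ((1 / 8 - c) * τ) := by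
      rw [← exp_add, hδ]; push_cast; ring_nf
    rw [e1]
    ring
  -- The two normalizing exponents could differ. A negative `δ` would make `K` zero, which its
  -- values at `z = 1` and `z = -1` exclude, as their vanishing forces `4 = 0`. A positive one makes
  -- `V` zero, a case left to be ruled out by the canonical basis.
  rcases lt_trichotomy δ 0 with h | h | h
  · exfalso
    have hz : ∀ p x, K p x = 0 := by
      intro p x
      have h1 := (tendsto_exp_mul_qToZero (r := -δ) (by linarith)).mul (hrel p x)
      rw [zero_mul] at h1
      refine tendsto_nhds_unique (hlim' p x) (h1.congr fun τ => ?_)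
      rw [← mul_assoc (exp _), ← exp_add]
      push_cast
      rw [neg_mul, neg_add_cancel, exp_zero, one_mul]
    have h1 := (mul_eq_zero.mp (hz 0 (0, 0, 0))).resolve_left (exp_ne_zero _)
    have h2 := (mul_eq_zero.mp (hz 0 (0, Real.pi * I, 0))).resolve_left (exp_ne_zero _)
    norm_num [exp_pi_mul_I, exp_two_pi_mul_I, ← mul_assoc] at h1 h2
    have h3 : (4 : ℂ) = 0 := by linear_combination h1 + h2
    norm_num at h3
  · right
    intro p a z v
    refine tendsto_nhds_unique (hrel p (a, z, v)) ((hlim' p (a, z, v)).congr fun τ => ?_)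
    rw [h]
    simp
  · left
    funext p x
    have h1 := (tendsto_exp_mul_qToZero h).mul (hlim' p x)
    rw [zero_mul] at h1
    exact tendsto_nhds_unique (hrel p x) h1

/-- The shape of the canonical basis element at the wall `1/2`. -/
lemma exists_wall_form (hA : PropertyA E) (hlim : ∀ p x,
      Tendsto (fun τ => exp ((1 / 8 - c) * τ) * E 0 p (shiftZ (-(1 / 2 : ℝ) * τ) x) τ) qToZero
      (𝓝 ((1 + exp (2 * (x.2.1 - eps p * x.1 + x.2.2)) +
        u x.2.2 * exp (x.2.1 - eps p * x.1 + x.2.2)) * exp ((x.2.1 + eps p * x.1) / 2)))) :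
    ∃ Bp Bm wc W p₀ F₁, ∃ g : ℂ → ℂ, (∀ a, g a ≠ 0) ∧ IsWallCanonical (1 / 2) Bp Bm wc W ∧
      F₁ ∈ lowerSpan Bp ∧ (∀ p a z v, F₁ p (a, z, v) = g a * u v) ∧
      ∀ p a z v, W p₀ p (a, z, v) = g a * (exp (v - eps p * a) + exp (-z) * u v +
        exp (-2 * z) * exp (eps p * a - v)) := by
  obtain ⟨α, κ, V, ⟨-, Bp, Bm, wc, W, p₀, -, hW, -, σ, i, j, hσ, rfl⟩, hV⟩ :=
    exists_eq_half_limit hA hlim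
  obtain ⟨ε, hp⟩ := hW.plus.exists
  obtain ⟨ε', hm⟩ := hW.minus.exists
  obtain ⟨N, F, σ', hσ', hF0, hFN, hmid, -, hsum⟩ := hW.form p₀
  have hσ1 : (σ : ℂ) * σ = 1 := by rcases hσ with rfl | rfl <;> norm_num
  have hσ0 : (σ : ℂ) ≠ 0 := left_ne_zero_of_mul_eq_one hσ1
  have hwc : wc (Bp p₀) ∈ twists Bm := hW.bijOn.mapsTo ⟨0, p₀, (mono_zero _).symm⟩
  have hFK : ∀ β, β ≤ N → F β ∈ KX := by
    intro β hβ
    rcases Nat.eq_zero_or_pos β with rfl | h0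
    · rw [hF0]; exact hp.mem_KX p₀
    · rcases hβ.eq_or_lt with rfl | h1
      · rw [hFN]
        exact KX.toAddSubgroup.zsmul_mem (mem_KX_of_mem_twists hm.mem_KX hwc) σ'
      · exact lowerSpan_le_KX hp.mem_KX (hmid β h0 h1).1
  have hind : ∀ β, β ≤ N → ∀ p a z v, F β p (a, z, v) = F β p (a, 0, v) := fun β hβ p a z v =>
    indep_z_of_mem_KPt ((hFK β hβ).1 p) a z 0 v
  have hWsum : ∀ p a z v, W p₀ p (a, z, v) =
      ∑ β ∈ Finset.range (N + 1), exp (-β * z) * F β p (a, 0, v) := by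
    intro p a z v
    rw [hsum, Finset.sum_apply, Finset.sum_apply]
    refine Finset.sum_congr rfl fun β hβ => ?_
    rw [mono, hind β (Nat.lt_succ_iff.mp (Finset.mem_range.mp hβ)), ch]
    push_cast
    simp
  have hN0 : F 0 ≠ 0 := by rw [hF0]; exact hp.ne_zero p₀
  have hNN : F N ≠ 0 := by
    rw [hFN]
    have := ne_zero_of_mem_twists hm.ne_zero hwc
    rcases hσ' with rfl | rfl
    · rwa [one_smul]
    · rwa [neg_smul, one_smul, neg_ne_zero]
  have point : ∀ β, β ≤ N → F β ≠ 0 → ∃ t : Fin 2 × ℂ × ℂ, F β t.1 (t.2.1, 0, t.2.2) ≠ 0 := by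
    intro β hβ h0
    by_contra hcon
    push Not at hcon
    refine h0 ?_
    funext p x
    have := hcon (p, x.1, x.2.2)
    rw [← hind β hβ p x.1 x.2.1 x.2.2] at this
    exact this
  have hVW : ∀ p a z v, (σ • mono i j 0 (W p₀)) p (a, z, v) =
      σ * (exp (i * a + j * z) * W p₀ p (a, z, v)) := by
    intro p a z v
    simp [mono, ch]
  -- If `V` were zero, so would be every `z`-coefficient of `W p₀`, including the basis element `Bp
  -- p₀`.
  rcases hV with hV | hV
  · exfalso
    obtain ⟨⟨p, a, v⟩, ht⟩ := point 0 (Nat.zero_le _) hN0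
    refine ht (eq_zero_of_sum_exp_eq_zero (N := N) (F := fun β => F β p (a, 0, v)) fun z => ?_)
    have h1 := hVW p a z v
    rw [hV] at h1
    rw [← hWsum]
    have h2 := (mul_eq_zero.mp h1.symm).resolve_left hσ0
    exact (mul_eq_zero.mp h2).resolve_left (exp_ne_zero _)
  · set g : ℂ → ℂ := fun a => σ * exp (-(α + i) * a) with hg
    have hg0 : ∀ a, g a ≠ 0 := fun a => mul_ne_zero hσ0 (exp_ne_zero _)
    have hWe : ∀ p a z v, exp (j * z) * W p₀ p (a, z, v) = g a * (exp (κ * z) *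
        (exp (eps p * a - v) + u v * exp z + exp (v - eps p * a) * exp (2 * z))) := by
      intro p a z v
      have h1 := hVW p a z v
      rw [hV] at h1
      have e1 : exp (-(α + i) * a) * exp (i * a) = exp (-α * a) := by rw [← exp_add]; ring_nf
      rw [exp_add, exp_add] at h1
      refine mul_left_cancel₀ (exp_ne_zero (i * a)) ?_
      rw [hg]
      beta_reduce
      linear_combination -σ * h1 - exp (i * a) * exp (j * z) * W p₀ p (a, z, v) * hσ1 -
        σ * exp (κ * z) * (exp (eps p * a - v) + u v * exp z + exp (v - eps p * a) *
          exp (2 * z)) * e1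
    -- The limit has exactly three powers of `z` with nonzero outer coefficients. Hence `N = 2`, and
    -- the unknown `u` is the intermediate term `F 1`.
    obtain ⟨rfl, hF⟩ := laurent_match (ι := Fin 2 × ℂ × ℂ) (N := N)
      (F := fun β t => F β t.1 (t.2.1, 0, t.2.2))
      (A := fun t => g t.2.1 * exp (eps t.1 * t.2.1 - t.2.2))
      (B := fun t => g t.2.1 * u t.2.2)
      (C := fun t => g t.2.1 * exp (t.2.2 - eps t.1 * t.2.1)) (j := j) (κ := κ)
      (fun t z => by
        have h1 := hWe t.1 t.2.1 z t.2.2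
        rw [hWsum, Finset.mul_sum] at h1
        rw [show (∑ β ∈ Finset.range (N + 1), exp (((j : ℂ) - β) * z) * F β t.1 (t.2.1, 0, t.2.2)) =
          ∑ β ∈ Finset.range (N + 1), exp (j * z) * (exp (-β * z) * F β t.1 (t.2.1, 0, t.2.2)) from
          Finset.sum_congr rfl fun β _ => by
            rw [← mul_assoc, ← exp_add]; ring_nf]
        rw [h1]
        ring)
      (fun t => mul_ne_zero (hg0 _) (exp_ne_zero _)) (fun t => mul_ne_zero (hg0 _) (exp_ne_zero _))
      (point 0 (Nat.zero_le _) hN0) (point N le_rfl hNN)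
    refine ⟨Bp, Bm, wc, W, p₀, F 1, g, hg0, hW, (hmid 1 one_pos one_lt_two).1, fun p a z v => ?_,
      fun p a z v => ?_⟩
    · rw [hind 1 one_le_two]
      exact (hF (p, a, v)).2.1
    · obtain ⟨e0, e1, e2⟩ := hF (p, a, v)
      dsimp only at e0 e1 e2
      rw [hWsum, Finset.sum_range_succ, Finset.sum_range_succ, Finset.sum_range_one, e0, e1, e2]
      push_cast
      rw [neg_zero, zero_mul, exp_zero, neg_one_mul]
      ring

end Forward

/-! ### Decay in `v` and bar invariance at the wall. -/

instance neBot_comap_re_atTop : (comap re atTop).NeBot := by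
  refine comap_neBot fun t ht => ?_
  obtain ⟨b, hb⟩ := mem_atTop_sets.mp ht
  exact ⟨(b : ℂ), hb _ (by simp)⟩

lemma coeffK_add (s : ℝ) (F G : Vec) (x : Cover) :
    coeffK s (F + G) x = coeffK s F x + coeffK s G x := by
  rw [coeffK, coeffK, coeffK, ← Matrix.mulVec_add]
  rfl

lemma coeffK_smul {s : ℝ} {F G : Vec} {x : Cover} {c : ℂ} (h : ∀ p, F p x = c * G p x) :
    coeffK s F x = c • coeffK s G x := by
  rw [coeffK, coeffK, ← Matrix.mulVec_smul]
  congr 1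
  funext p
  rw [h, Pi.smul_apply, smul_eq_mul]

lemma tendsto_exp_neg_nat_mul {k : ℕ} (hk : 0 < k) (c : ℂ) :
    Tendsto (fun ν => exp (c + -k * ν)) (comap re atTop) (𝓝 0) := by
  rw [tendsto_zero_iff_norm_tendsto_zero]
  have h : ∀ ν : ℂ, ‖exp (c + -k * ν)‖ = Real.exp (c.re + -(k * ν.re)) := fun ν => by
    rw [norm_exp]; simp
  simp only [h]
  refine Real.tendsto_exp_atBot.comp (tendsto_atBot_add_const_left _ _ ?_)
  exact tendsto_neg_atTop_atBot.comp
    ((tendsto_comap (f := re)).const_mul_atTop (Nat.cast_pos.mpr hk))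

/-- The stable coefficients of elements of `lowerSpan B` tend to zero. -/
lemma IsKCanonical.tendsto_lowerSpan {s : ℝ} {B : Fin 2 → Vec} {U : Set (ℂ × ℂ)}
    (hU : ∀ y ∈ U, ∀ p p', Tendsto (fun ν => coeffK s (B p) (y.1, y.2, ν) p') (comap re atTop)
      (𝓝 (if p = p' then 1 else 0))) {F : Vec} (hF : F ∈ lowerSpan B) {y : ℂ × ℂ} (hy : y ∈ U)
    (p' : Fin 2) :
    Tendsto (fun ν => coeffK s F (y.1, y.2, ν) p') (comap re atTop) (𝓝 0) := by
  induction hF using AddSubgroup.closure_induction with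
  | mem F hF =>
    obtain ⟨k, hk, _, ⟨i, p, rfl⟩, rfl⟩ := hF
    have h1 := (tendsto_exp_neg_nat_mul hk (i * y.1)).mul (hU y hy p p')
    rw [zero_mul] at h1
    refine h1.congr fun ν => ?_
    rw [coeffK_smul (F := mono 0 0 (-k) (mono i 0 0 (B p))) (G := B p) (c := exp (i * y.1 + -k * ν)) fun q => by
      rw [mono_mono, mono, ch]; push_cast; ring_nf]
    rfl
  | zero =>
    have : ∀ ν, coeffK s 0 (y.1, y.2, ν) p' = 0 := fun ν => by
      rw [coeffK_smul (G := 0) (c := 0) fun q => by simp]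
      simp
    simp only [this]
    exact tendsto_const_nhds
  | add F G _ _ h1 h2 =>
    have := h1.add h2
    rw [add_zero] at this
    refine this.congr fun ν => ?_
    rw [coeffK_add]
    rfl
  | neg F _ h1 =>
    have := h1.neg
    rw [neg_zero] at this
    refine this.congr fun ν => ?_
    rw [coeffK_smul (F := -F) (G := F) (c := -1) fun q => by simp]
    simp

/-- Pointwise form of semilinearity: the scalars are the values at `invV x`, so a coefficient
depending on `v` comes out with `v` inverted. -/
lemma barK_add_mul {s : ℝ} {F G H : Vec} {x : Cover} {c d : ℂ}
    (h : ∀ p, F p (invV x) = c * (G p (invV x) + d * H p (invV x))) (p : Fin 2) :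
    barK s F p x = c * (barK s G p x + d * barK s H p x) := by
  have h1 : coeffK s F (invV x) = c • (coeffK s G (invV x) + d • coeffK s H (invV x)) := by
    rw [coeffK_smul (G := G + fun p x' => d * H p x') (c := c) h, coeffK_add,
      coeffK_smul (F := fun p x' => d * H p x') (G := H) (c := d) fun _ => rfl]
  rw [barK, barK, barK, h1, Matrix.mulVec_smul, Matrix.mulVec_add, Matrix.mulVec_smul]
  simp only [Pi.smul_apply, Pi.add_apply, smul_eq_mul]
  ring

lemma BarFixed.barK_self {s : ℝ} {F : Vec} (h : BarFixed s F) {x : Cover} (hx : Generic x)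
    (p : Fin 2) : barK s F p x = F p x := by
  have h1 := h.barK_eq 0 0 hx p
  have h2 : twistO 0 0 F = F := by
    funext q y
    rw [twistO, ch_zero, O]
    simp
  rwa [h2, Int.cast_zero, add_zero] at h1

/-- An even periodic entire function that vanishes at infinity is zero. -/
lemma eq_zero_of_even_periodic {u : ℂ → ℂ} (hd : Differentiable ℂ u)
    (hp : ∀ ν, u (ν + 2 * Real.pi * I) = u ν) (he : ∀ ν, u (-ν) = u ν)
    (hl : Tendsto u (comap re atTop) (𝓝 0)) (ν : ℂ) : u ν = 0 := by
  have hev : ∀ᶠ ν in comap re atTop, ‖u ν‖ < 1 := by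
    have := (tendsto_zero_iff_norm_tendsto_zero.mp hl).eventually_lt_const one_pos
    exact this
  obtain ⟨R, hR⟩ : ∃ R : ℝ, ∀ ν : ℂ, R ≤ ν.re → ‖u ν‖ < 1 := by
    obtain ⟨t, ht, hsub⟩ := mem_comap.mp hev
    obtain ⟨R, hR⟩ := mem_atTop_sets.mp ht
    exact ⟨R, fun ν hν => hsub (hR _ hν)⟩
  have hK : IsCompact (Set.Icc (-R) R ×ℂ Set.Icc 0 (2 * Real.pi)) := isCompact_Icc.reProdIm isCompact_Icc
  obtain ⟨M, hM⟩ := hK.exists_bound_of_continuousOn hd.continuous.continuousOn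
  have hper : Function.Periodic u (2 * Real.pi * I) := hp
  -- Decay bounds `u` for large real part, evenness for large negative real part, and periodicity
  -- reduces the strip between to a compact rectangle. By Liouville `u` is constant, equal to its
  -- limit.
  have hb : ∀ ν, ‖u ν‖ ≤ max 1 M := by
    intro ν
    by_cases h1 : R ≤ ν.re
    · exact (hR ν h1).le.trans (le_max_left _ _)
    by_cases h2 : ν.re ≤ -R
    · rw [← he ν]
      exact (hR (-ν) (by rw [neg_re]; linarith)).le.trans (le_max_left _ _)
    push Not at h1 h2
    set n : ℤ := ⌊ν.im / (2 * Real.pi)⌋ with hn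
    have hpi : 0 < 2 * Real.pi := by positivity
    have h3 := hper.sub_int_mul_eq n (x := ν)
    rw [← h3]
    refine (hM _ ?_).trans (le_max_right _ _)
    have hre : (ν - n * (2 * Real.pi * I)).re = ν.re := by simp
    have him : (ν - n * (2 * Real.pi * I)).im = ν.im - n * (2 * Real.pi) := by simp
    rw [mem_reProdIm, hre, him]
    have f1 := Int.floor_le (ν.im / (2 * Real.pi))
    have f2 := Int.lt_floor_add_one (ν.im / (2 * Real.pi))
    rw [← hn] at f1 f2
    rw [le_div_iff₀ hpi] at f1
    rw [div_lt_iff₀ hpi] at f2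
    exact ⟨⟨h2.le, h1.le⟩, by linarith, by linarith⟩
  have hbd : Bornology.IsBounded (Set.range u) := by
    rw [isBounded_iff_forall_norm_le]
    exact ⟨max 1 M, by rintro _ ⟨ν, rfl⟩; exact hb ν⟩
  have hc : ∀ ν', u ν' = u ν := fun ν' => hd.apply_eq_apply_of_bounded hbd ν' ν
  exact tendsto_nhds_unique (tendsto_const_nhds.congr fun ν' => (hc ν').symm) hl

section Forward

variable {E : Fin 2 → Fin 2 → MultiFun} {c : ℝ} {u : ℂ → ℂ}

/-- Property A at slope `1/2` excludes an intermediate term. -/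
lemma half_limit_eq_zero (hA : PropertyA E) (hlim : ∀ p x,
      Tendsto (fun τ => exp ((1 / 8 - c) * τ) * E 0 p (shiftZ (-(1 / 2 : ℝ) * τ) x) τ) qToZero
      (𝓝 ((1 + exp (2 * (x.2.1 - eps p * x.1 + x.2.2)) +
        u x.2.2 * exp (x.2.1 - eps p * x.1 + x.2.2)) * exp ((x.2.1 + eps p * x.1) / 2))))
    (ν : ℂ) : u ν = 0 := by
  obtain ⟨Bp, Bm, wc, W, p₀, F₁, g, hg, hW, hlow, hF, hWf⟩ := exists_wall_form hA hlim
  obtain ⟨ε, hp, hε, hε'⟩ := (hW.plus.and (Filter.Eventually.and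
    (self_mem_nhdsWithin (s := Set.Ioi (0 : ℝ))) (eventually_nhdsWithin_of_eventually_nhds
    (eventually_lt_nhds (b := (1 / 2 : ℝ)) (by norm_num))))).exists
  have hFK : F₁ 0 ∈ KPt := (lowerSpan_le_KX hp.mem_KX hlow).1 0
  have hu : u = fun v => F₁ 0 (0, 0, v) / g 0 := by
    funext v
    rw [hF, mul_div_cancel_left₀ _ (hg 0)]
  have hd : Differentiable ℂ u := by
    rw [hu]
    have h1 := differentiable_of_mem_KPt hFK
    have h2 : Differentiable ℂ fun v : ℂ => F₁ 0 (0, 0, v) :=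
      h1.comp (f := fun v : ℂ => ((0, 0, v) : Cover)) (by fun_prop)
    exact h2.div_const _
  refine eq_zero_of_even_periodic hd (fun v => ?_) ?_ ?_ ν
  · rw [hu]
    beta_reduce
    rw [periodic_v_of_mem_KPt hFK]
  -- The outer terms and the trivial class are fixed by the bar involution, by `barFixed_half`.
  -- Invariance of their combination therefore says that the coefficient `z⁻¹ u` is unchanged by `v
  -- ↦ v⁻¹`.
  · obtain ⟨U, hUo, hUd, hU⟩ := hW.bar p₀
    have hdense := hUd.inter_of_isOpen_left isOpen_dense_generic.2 hUo
    have h0 : (fun x : Cover => u (-x.2.2)) = fun x : Cover => u x.2.2 := by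
      refine Continuous.ext_on hdense (hd.continuous.comp (by fun_prop))
        (hd.continuous.comp (by fun_prop)) fun x hx => ?_
      have h1 := hU x hx.1 0
      rw [barK_add_mul (c := g x.1) (d := exp (-x.2.1) * u (-x.2.2))
        (G := lineClass 0 0 (-1) 1 + lineClass 0 (-2) 1 (-1)) (H := lineClass 0 0 0 0)
        (fun p => by
          simp only [invV, Pi.add_apply, lineClass_eq_exp]
          rw [hWf]
          push_cast
          simp only [zero_mul, zero_add, add_zero, exp_zero, mul_one]
          have e1 : (-1 : ℂ) * -x.2.2 + 1 * (2 * -x.2.2 - eps p * x.1) = -x.2.2 - eps p * x.1 := by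
            ring
          have e2 : -2 * x.2.1 + 1 * -x.2.2 + -1 * (2 * -x.2.2 - eps p * x.1) =
              -2 * x.2.1 + (eps p * x.1 - -x.2.2) := by ring
          rw [e1, e2, exp_add (-2 * x.2.1)]
          ring), barFixed_half.2.barK_self hx.2, barFixed_half.1.barK_self hx.2] at h1
      have h2 := hWf 0 x.1 x.2.1 x.2.2
      rw [show ((x.1, x.2.1, x.2.2) : Cover) = x from rfl] at h2
      rw [h2] at h1
      have h3 := mul_left_cancel₀ (hg x.1) h1
      simp only [Pi.add_apply, lineClass_eq_exp] at h3
      push_cast at h3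
      simp only [zero_mul, zero_add, add_zero, exp_zero, mul_one] at h3
      have e1 : (-1 : ℂ) * x.2.2 + 1 * (2 * x.2.2 - eps 0 * x.1) = x.2.2 - eps 0 * x.1 := by
        ring
      have e2 : -2 * x.2.1 + 1 * x.2.2 + -1 * (2 * x.2.2 - eps 0 * x.1) =
          -2 * x.2.1 + (eps 0 * x.1 - x.2.2) := by ring
      rw [e1, e2, exp_add (-2 * x.2.1)] at h3
      refine mul_left_cancel₀ (exp_ne_zero (-x.2.1)) ?_
      linear_combination h3
    intro v
    exact congrFun h0 (0, 0, v)
  -- The term `F₁` is `g u` times the trivial class `canonOdd 0 0`, whose first stable coefficient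
  -- tends to `1`. Membership in `lowerSpan` makes the first coefficient of `F₁` tend to `0`, hence
  -- also `u`.
  · obtain ⟨U, hUo, hUd, hU⟩ := hp.asymptotic
    have hcan := isKCanonical_odd (s := 1 / 2 + ε) 0 (by linarith) (by linarith)
    rw [Int.cast_zero, add_zero] at hcan
    obtain ⟨U', hUo', hUd', hU'⟩ := hcan.asymptotic
    obtain ⟨y, hy, hy'⟩ := (hUd.inter_of_isOpen_left hUd' hUo).nonempty
    have h1 := IsKCanonical.tendsto_lowerSpan hU hlow hy 0
    have h2 := hU' y hy' 0 0
    rw [if_pos rfl] at h2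
    have h3 := h1.div (h2.const_mul (g y.1)) (mul_ne_zero (hg _) one_ne_zero)
    rw [zero_div] at h3
    refine h3.congr' ?_
    filter_upwards [h2.eventually_ne one_ne_zero] with v hv
    simp only [Pi.div_apply]
    rw [coeffK_smul (F := F₁) (G := canonOdd 0 0) (c := g y.1 * u v) fun p => by
      rw [hF]; simp [canonOdd, lineClass_eq_exp], Pi.smul_apply, smul_eq_mul,
      mul_div_mul_right _ _ hv, mul_div_cancel_left₀ _ (hg _)]

end Forward

/-! ### Assembly of the coefficients. -/

lemma singleValuedVQ_of_monodromy {f : ℂ → ℂ → ℂ} {r : ℚ} {c : ℝ} {n : ℤ}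
    (h : ∀ ν (τ : ℂ), τ.re < 0 → f (ν + 2 * Real.pi * I) τ = f ν τ)
    (hm : ∀ ν (τ : ℂ), τ.re < 0 → f ν (τ + 4 * Real.pi * I) = exp (r * (4 * Real.pi * I)) * f ν τ)
    (hc : c = r + n / 2) : SingleValuedVQ c f := by
  refine fun ν τ hτ => ⟨by rw [h ν τ hτ], ?_⟩
  have hc' : (c : ℂ) = r + n / 2 := by rw [hc]; push_cast; rfl
  rw [hm ν τ hτ, ← mul_assoc, ← exp_add,
    show -(c : ℂ) * (τ + 4 * Real.pi * I) + r * (4 * Real.pi * I) =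
      -c * τ - n * (2 * Real.pi * I) by rw [hc']; ring, exp_sub, exp_int_mul_two_pi_mul_I, div_one]

lemma SingleValuedVQ.isBigO {f : ℂ → ℂ → ℂ} {c : ℝ} (h : SingleValuedVQ c f)
    (hf : HolomorphicVQ f) (ν : ℂ)
    (hl : Tendsto (fun τ => exp (-c * τ) * f ν τ) qToZero (𝓝 1)) :
    (fun τ => exp (-c * τ) * f ν τ - 1) =O[qToZero] fun τ => exp (τ / 2) := by
  refine isBigO_sub_of_tendsto (fun τ hτ => ?_) (fun τ hτ => (h ν τ hτ).2) hl
  have := hf.comp (g := fun _ : ℂ => ν) (h := fun τ : ℂ => τ) (by fun_prop) (by fun_prop) hτ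
  fun_prop

/-- The conditions on an elliptic canonical basis determine the shape of its coefficients. -/
lemma exists_coefficients {E : Fin 2 → Fin 2 → MultiFun} {Υ : ℂ → ℂ → ℂ} (q2 : QDiffTwo E)
    (q1 : QDiffOneOne E) (hS : SingleValuedHolomorphic E) (k2 : KLimitTwo E) (k1 : KLimitOneOne E)
    (hΥ : HolomorphicVQ Υ) (hB : BilinearDuality E Υ) (hA : PropertyA E) :
    ∃ (f₀ f₁ f₂ : ℂ → ℂ → ℂ) (c₀ c₁ : ℚ),
      (HolomorphicVQ f₀ ∧ HolomorphicVQ f₁ ∧ HolomorphicVQ f₂) ∧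
      (SingleValuedVQ c₀ f₀ ∧ SingleValuedVQ c₁ f₁ ∧ SingleValuedVQ (c₁ + 3 / 4) f₂) ∧
      (∀ ν, (fun τ => exp (-(c₀ : ℝ) * τ) * f₀ ν τ - 1) =O[qToZero] fun τ => exp (τ / 2)) ∧
      (∀ ν, (fun τ => exp (-(c₁ : ℝ) * τ) * f₁ ν τ - 1) =O[qToZero] fun τ => exp (τ / 2)) ∧
      (∀ ν, (fun τ => exp (-((c₁ + 3 / 4 : ℝ) : ℂ) * τ) * f₂ ν τ) =O[qToZero]
        fun _ => (1 : ℂ)) ∧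
      IsSeries f₀ f₁ f₂ E ∧ IsUpsilon f₀ f₁ f₂ Υ := by
  obtain ⟨f₀, f₁, f₂, ⟨h₀, h₁, h₂⟩, hE, hU⟩ := exists_isSeries q2 q1 hS k2 k1 hΥ hB hA
  obtain ⟨r₀, m₀⟩ := hE.zero_monodromy hA
  obtain ⟨r₁, m₁⟩ := hE.one_monodromy hA
  obtain ⟨c₀, t₀⟩ := hE.exists_tendsto_zero k1
  obtain ⟨c₁, t₁⟩ := hE.exists_tendsto_one k2
  obtain ⟨n₀, e₀⟩ := exists_rat_of_monodromy (f := f₀ 0) (m₀ 0) (t₀ 0)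
  obtain ⟨n₁, e₁⟩ := exists_rat_of_monodromy (f := f₁ 0) (fun τ hτ => (m₁ 0 τ hτ).1) (t₁ 0).1
  obtain ⟨u, hu⟩ := IsSeries.exists_second_limit h₂ (fun ν τ hτ => (m₁ ν τ hτ).2) e₁
    fun ν => (t₁ ν).2
  have hu0 : ∀ ν, u ν = 0 := half_limit_eq_zero hA (hE.tendsto_two_half (fun ν => (t₁ ν).1)
    fun ν => tendsto_of_isBigO_sub (hu ν))
  have per := fun ν (τ : ℂ) (hτ : τ.re < 0) => hE.add_two_pi hS ν hτ
  have s₀ : SingleValuedVQ c₀ f₀ :=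
    singleValuedVQ_of_monodromy (fun ν τ hτ => (per ν τ hτ).1) m₀ e₀
  have s₁ : SingleValuedVQ c₁ f₁ := singleValuedVQ_of_monodromy (fun ν τ hτ => (per ν τ hτ).2.1)
    (fun ν τ hτ => (m₁ ν τ hτ).1) e₁
  -- The sign in the monodromy of `f₂` is that of `q^{1/4}`, and a further half power takes the
  -- exponent to `c₁ + 3/4` without changing the monodromy.
  have s₂ : SingleValuedVQ (c₁ + 3 / 4) f₂ := by
    refine singleValuedVQ_of_monodromy (r := r₁ + 1 / 4) (n := n₁ + 1)
      (fun ν τ hτ => (per ν τ hτ).2.2) (fun ν τ hτ => ?_) ?_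
    · rw [(m₁ ν τ hτ).2]
      push_cast
      rw [show ((r₁ : ℂ) + 1 / 4) * (4 * Real.pi * I) = r₁ * (4 * Real.pi * I) + Real.pi * I by ring,
        exp_add, exp_pi_mul_I, mul_neg_one]
    · rw [e₁]
      push_cast
      ring
  obtain ⟨c₀', rfl⟩ : ∃ c : ℚ, (c : ℝ) = c₀ := ⟨r₀ + n₀ / 2, by rw [e₀]; push_cast; rfl⟩
  obtain ⟨c₁', rfl⟩ : ∃ c : ℚ, (c : ℝ) = c₁ := ⟨r₁ + n₁ / 2, by rw [e₁]; push_cast; rfl⟩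
  refine ⟨f₀, f₁, f₂, c₀', c₁', ⟨h₀, h₁, h₂⟩, ⟨s₀, s₁, s₂⟩, fun ν => s₀.isBigO h₀ ν (t₀ ν),
    fun ν => s₁.isBigO h₁ ν (t₁ ν).1, fun ν => ?_, hE, hU⟩
  -- Since `u` vanishes, the error `O(q^{1/2})` is the whole of `q^{-(c₁ + 1/4)} f₂`. Dividing by
  -- `q^{1/2}` gives boundedness at exponent `c₁ + 3/4`.
  have h3 := (isBigO_refl (fun τ : ℂ => exp (-τ / 2)) qToZero).mul (hu ν)
  refine h3.congr (fun τ => ?_) fun τ => ?_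
  · rw [hu0, sub_zero, ← mul_assoc, ← exp_add]
    push_cast
    ring_nf
  · rw [← exp_add, ← exp_zero]
    ring_nf

end EllipticCanonical

theorem theorem4p1 (E : Fin 2 → Fin 2 → MultiFun) (Υ : ℂ → ℂ → ℂ) :
    (QDiffTwo E ∧ QDiffOneOne E ∧ SingleValuedHolomorphic E ∧ KLimitTwo E ∧ KLimitOneOne E ∧
      HolomorphicVQ Υ ∧ BilinearDuality E Υ ∧ PropertyA E) ↔
    ∃ (f₀ f₁ f₂ : ℂ → ℂ → ℂ) (c₀ c₁ c₂ : ℚ),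
      (HolomorphicVQ f₀ ∧ HolomorphicVQ f₁ ∧ HolomorphicVQ f₂) ∧
      (SingleValuedVQ c₀ f₀ ∧ SingleValuedVQ c₁ f₁ ∧ SingleValuedVQ c₂ f₂) ∧
      (∀ ν, (fun τ => Complex.exp (-c₀ * τ) * f₀ ν τ - 1) =O[qToZero]
        fun τ => Complex.exp (τ / 2)) ∧
      (∀ ν, (fun τ => Complex.exp (-c₁ * τ) * f₁ ν τ - 1) =O[qToZero]
        fun τ => Complex.exp (τ / 2)) ∧
      (∀ ν, (fun τ => Complex.exp (-c₂ * τ) * f₂ ν τ) =O[qToZero] fun _ => (1 : ℂ)) ∧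
      (c₁ + 3 / 4 ≤ c₂ ∧ ∃ k : ℤ, c₂ - c₁ + 1 / 4 = k / 2) ∧
      ∀ τ : ℂ, τ.re < 0 →
        (∀ p x, E 0 p x τ = f₁ x.2.2 τ * seriesTwoA p x τ + f₂ x.2.2 τ * seriesTwoB p x τ) ∧
        (∀ p x, E 1 p x τ = f₀ x.2.2 τ * seriesOneOne p x τ) ∧
        ∀ ν, Υ ν τ = Complex.exp (τ / 4) * qPochhammer τ ^ 2 *
          (f₀ ν τ * (f₁ ν τ * thetaZero ν τ + f₂ ν τ * thetaOne ν τ)) := by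
  constructor
  · rintro ⟨q2, q1, hS, k2, k1, hΥ, hB, hA⟩
    obtain ⟨f₀, f₁, f₂, c₀, c₁, hh, ⟨s₀, s₁, s₂⟩, a₀, a₁, a₂, hE, hU⟩ :=
      exists_coefficients q2 q1 hS k2 k1 hΥ hB hA
    have hc : ((c₁ + 3 / 4 : ℚ) : ℝ) = c₁ + 3 / 4 := by push_cast; rfl
    -- The smallest admissible value of `c₂` works, with `c₂ - c₁ + 1/4 = 1 = 2/2`.
    refine ⟨f₀, f₁, f₂, c₀, c₁, c₁ + 3 / 4, hh, ⟨s₀, s₁, by rw [hc]; exact s₂⟩,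
      fun ν => by simpa using a₀ ν, fun ν => by simpa using a₁ ν, fun ν => by simpa using a₂ ν,
      ⟨le_rfl, 2, by push_cast; ring⟩, fun τ hτ => ⟨(hE τ hτ).1, (hE τ hτ).2, fun ν => ?_⟩⟩
    rw [hU ν τ hτ, upsilon_eq]
  · rintro ⟨f₀, f₁, f₂, c₀, c₁, c₂, ⟨h₀, h₁, h₂⟩, ⟨s₀, s₁, s₂⟩, a₀, a₁, a₂, ⟨hc, k, hk⟩, hser⟩
    have hE : IsSeries f₀ f₁ f₂ E := fun τ hτ => ⟨(hser τ hτ).1, (hser τ hτ).2.1⟩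
    have hU : IsUpsilon f₀ f₁ f₂ Υ := fun ν τ hτ => by
      rw [(hser τ hτ).2.2 ν, upsilon_eq]
    have t₀ : ∀ ν, Tendsto (fun τ => Complex.exp (-(c₀ : ℝ) * τ) * f₀ ν τ) qToZero (𝓝 1) :=
      fun ν => tendsto_one_of_isBigO (by simpa using a₀ ν)
    have t₁ : ∀ ν, Tendsto (fun τ => Complex.exp (-(c₁ : ℝ) * τ) * f₁ ν τ) qToZero (𝓝 1) :=
      fun ν => tendsto_one_of_isBigO (by simpa using a₁ ν)
    have t₂ : ∀ ν, (fun τ => Complex.exp (-(c₂ : ℝ) * τ) * f₂ ν τ) =O[qToZero] fun _ => (1 : ℂ) :=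
      fun ν => by simpa using a₂ ν
    have hc' : (c₁ : ℝ) + 3 / 4 ≤ c₂ := by
      have := (Rat.cast_le (K := ℝ)).mpr hc
      push_cast at this
      exact this
    have hk' : ∃ k : ℤ, (c₂ : ℝ) - c₁ + 1 / 4 = k / 2 := ⟨k, by
      have := congrArg (Rat.cast : ℚ → ℝ) hk
      push_cast at this
      exact this⟩
    exact ⟨hE.qDiffTwo, hE.qDiffOneOne, hE.singleValuedHolomorphic h₀ h₁ h₂ s₀ s₁ s₂,
      hE.kLimitTwo t₁ t₂ hc', hE.kLimitOneOne t₀, hU.holomorphic h₀ h₁ h₂,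
      hE.bilinearDuality hU h₀ h₁ h₂, hE.propertyA h₀ h₁ h₂ s₀ s₁ s₂ hk' t₀ t₁ t₂ hc'⟩
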